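/- **Conventions.** $\mathbb S^1$ is the oriented circle; for $x\ne y$, $[x;y]$ and $(x;y)$ are the closed and open arcs going from $x$ to $y$ in the positive direction. A *rectangle* is a set $r=[\theta_1;\theta_2]\times[\varphi_1;\varphi_2]\subset\mathbb S^1\times\mathbb S^1$; its vertices $(\theta_1,\varphi_2),(\theta_2,\varphi_1)$ are of type $\diagup$ and $(\theta_1,\varphi_1),(\theta_2,\varphi_2)$ of type $\diagdown$. Two rectangles are *compatible* if their intersection is empty, or consists of vertices of both, or is a rectangle containing no vertex of either. A *rectangular diagram of a surface* $\Pi$ is a finite set of pairwise compatible rectangles such that every meridian $\{\theta\}\times\mathbb S^1$ and every longitude $\mathbb S^1\times\{\varphi\}$ contains at most two free vertices; a point is a *free vertex* if it is a vertex of exactly one rectangle of $\Pi$. The set of free vertices is the *boundary* $\partial\Pi$. A meridian is *occupied* if it contains a vertex of $\Pi$. Identify $\mathbb S^3$ with the join of two circles, with coordinates $(\theta,\varphi,\tau)$, $\tau\in[0,1]$, where $\theta$ is forgotten at $\tau=0$ and $\varphi$ at $\tau=1$. The circle $\tau=0$ is the *binding*, and the *page* $\mathscr P_{\theta_0}$ is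 the closure of $\{\theta=\theta_0,\ \tau>0\}$. To $r=[\theta_1;\theta_2]\times[\varphi_1;\varphi_2]$ is associated the disc $$\widehat r=\{(\theta,\varphi,\tau):(\theta,\varphi)\in r,\ \sin^2(\tfrac{\pi\tau}2)\,\beta_{\theta_1,\theta_2}(\theta)=\cos^2(\tfrac{\pi\tau}2)\,\beta_{\varphi_1,\varphi_2}(\varphi)\},\qquad \beta_{a,b}(x)=\frac{|[a;x]|\cdot|[x;b]|}{|[a;b]|},$$ where $|\cdot|$ is arc length, and to $\Pi$ the surface $\widehat\Pi=\bigcup_{r\in\Pi}\widehat r$. A *morphism* $F\to F'$ of surfaces is an isotopy class of orientation-preserving homeomorphisms of $\mathbb S^3$ taking $F$ to $F'$ (isotopy through such homeomorphisms). It is *canonical* if it has a representative that fixes the binding pointwise and preserves every page. A *non-crossing chord diagram* is a finite set of pairs of distinct points of $\mathbb S^1$ (chords) such that, for any two different chords, the first lies in one of the two open arcs cut off by the endpoints of the second. The passage $C_0\mapsto C_1$ between two such diagrams is an *admissible event* if, for some distinct $\varphi_1,\dots,\varphi_k\in\mathbb S^1$, $k\ge2$, in this circular order, one of $C_0,C_1$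 is obtained from the other by replacing (1) $\{\varphi_1,\varphi_2\},\dots,\{\varphi_{k-1},\varphi_k\}$ with $\{\varphi_2,\varphi_3\},\dots,\{\varphi_{k-2},\varphi_{k-1}\}$ ($k$ even), or (2) $\{\varphi_1,\varphi_2\},\dots,\{\varphi_{k-2},\varphi_{k-1}\}$ with $\{\varphi_2,\varphi_3\},\dots,\{\varphi_{k-1},\varphi_k\}$ ($k$ odd), or (3) $\{\varphi_1,\varphi_2\},\dots,\{\varphi_{k-1},\varphi_k\}$ with $\{\varphi_2,\varphi_3\},\dots,\{\varphi_{k-2},\varphi_{k-1}\},\{\varphi_k,\varphi_1\}$ ($k\ge4$ even). A *movie diagram* is a left continuous map $\Psi$ from $\mathbb S^1$ to the discrete set of non-crossing chord diagrams, with finitely many discontinuities, such that $\Psi(\theta_0)\mapsto\Psi(\theta_0+0)$ is an admissible event at every discontinuity $\theta_0$. For a rectangular diagram of a surface $\Pi$, the map $\Psi_\Pi$ is the left continuous map such that, if the meridian of $\theta_0$ is not occupied, $\{\varphi_1,\varphi_2\}\in\Psi_\Pi(\theta_0)$ if and only if for some $\theta_1,\theta_2$ with $\theta_0\in(\theta_1;\theta_2)$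 one of $[\theta_1;\theta_2]\times[\varphi_1;\varphi_2]$, $[\theta_1;\theta_2]\times[\varphi_2;\varphi_1]$ belongs to $\Pi$. **Vertical bubble moves.** Let $r=[\theta_1;\theta_2]\times[\varphi_1;\varphi_2]\in\Pi$ and $\theta_3,\theta_4\in(\theta_1;\theta_2)$ be such that no meridian with $\theta\in[\theta_3;\theta_4]$ is occupied and $[\theta_3;\theta_4]\times[\varphi_1;\varphi_2]$ is not contained in the interior of any rectangle of $\Pi$. Replacing $r$ with $[\theta_1;\theta_3]\times[\varphi_1;\varphi_2]$, $[\theta_3;\theta_4]\times[\varphi_2;\varphi_1]$, $[\theta_4;\theta_2]\times[\varphi_1;\varphi_2]$ is a *vertical bubble creation move*; the inverse is a reduction move. The assigned morphism is represented by any homeomorphism that takes $\widehat\Pi$ to $\widehat\Pi'$, preserves every page, and is identical on the pages $\mathscr P_\theta$ with $\theta\notin(\theta_1;\theta_2)$. **Vertical half-wrinkle moves.** Let $v_1=(\theta_0,\varphi_1)$ and $v_2=(\theta_0,\varphi_2)$ be free vertices of $\Pi$ of types $\diagdown$ and $\diagup$, respectively, let $\varepsilon>0$ be such that the meridian of $\theta_0$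 is the only occupied one in $[\theta_0-2\varepsilon;\theta_0+2\varepsilon]\subsetneq\mathbb S^1$, and let $\psi$ be an orientation-preserving self-homeomorphism of this interval. The vertical sides on the meridian of $\theta_0$ that are contained in $[\varphi_1;\varphi_2]$ are shifted to $\psi(\theta_0+\varepsilon)$; if there are any, the rectangle $[\psi(\theta_0);\psi(\theta_0+\varepsilon)]\times[\varphi_2;\varphi_1]$ is added. Those contained in $[\varphi_2;\varphi_1]$ are shifted to $\psi(\theta_0-\varepsilon)$; if there are any, the rectangle $[\psi(\theta_0-\varepsilon);\psi(\theta_0)]\times[\varphi_1;\varphi_2]$ is added. This is a *vertical half-wrinkle creation move*; the inverse is a reduction move. It is called *simple* here if $v_1,v_2$ are the only vertices of $\Pi$ on their meridian, and *boundary-preserving* if $\partial\Pi=\partial\Pi'$. The assigned morphism is represented by any homeomorphism that takes $\widehat\Pi$ to $\widehat\Pi'$ and is identical outside a (tame) open $3$-ball $B$ that misses some page and meets $\widehat\Pi$ and $\widehat\Pi'$ in (unknotted) open discs or half-discs with closures $\bigcup_{r\in\Pi\setminus\Pi'}\widehat r$ and $\bigcup_{r\in\Pi'\setminus\Pi}\widehat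 r$. To reduction moves (of both kinds) the inverse morphisms are assigned. **Proposition.** (i) For every rectangular diagram of a surface $\Pi$, the map $\Psi_\Pi$ is a movie diagram. A movie diagram $\Psi$ has the form $\Psi_\Pi$ for some rectangular diagram of a surface $\Pi$ if and only if, for every $\varphi\in\mathbb S^1$, the set of all $\theta\in\mathbb S^1$ such that $\varphi$ is an endpoint of a chord of $\Psi(\theta)$ is connected (possibly empty). (ii) For rectangular diagrams of surfaces $\Pi,\Pi'$, we have $\Psi_\Pi=\Psi_{\Pi'}$ if and only if $\Pi$ and $\Pi'$ are related by a finite sequence of vertical bubble moves and simple boundary-preserving vertical half-wrinkle moves (creations and reductions). Any such sequence induces a morphism $\widehat\Pi\to\widehat\Pi'$ (the composition of the morphisms assigned to its moves), and every morphism so induced is canonical. -/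

import Mathlib

namespace RectMovie

open Filter Topology

noncomputable section

/-! ## The circle, rectangles in the torus, rectangular diagrams of surfaces -/

/-- The oriented circle, with angular coordinate measured in full turns. For `a ≠ b`, the closed and
open arcs going from `a` to `b` in the positive direction are `Set.cIcc a b` and `Set.cIoo a b`. -/
abbrev S1 : Type := UnitAddCircle

/-- The rectangle `[θ₁;θ₂] × [φ₁;φ₂]` in the torus `S1 × S1`. It is determined by its four
coordinates and determines them. -/
structure Rect where
  θ₁ : S1
  θ₂ : S1
  φ₁ : S1
  φ₂ : S1
  hθ : θ₁ ≠ θ₂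
  hφ : φ₁ ≠ φ₂

namespace Rect

/-- The rectangle as a subset of the torus. -/
def carrier (r : Rect) : Set (S1 × S1) := Set.cIcc r.θ₁ r.θ₂ ×ˢ Set.cIcc r.φ₁ r.φ₂

/-- The interior of the rectangle. -/
def inside (r : Rect) : Set (S1 × S1) := Set.cIoo r.θ₁ r.θ₂ ×ˢ Set.cIoo r.φ₁ r.φ₂

/-- The vertices of type `╱`. -/
def slash (r : Rect) : Set (S1 × S1) := {(r.θ₁, r.φ₂), (r.θ₂, r.φ₁)}

/-- The vertices of type `╲`. -/
def backslash (r : Rect) : Set (S1 × S1) := {(r.θ₁, r.φ₁), (r.θ₂, r.φ₂)}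

/-- The four vertices. -/
def vertices (r : Rect) : Set (S1 × S1) := r.slash ∪ r.backslash

/-- Compatibility of two rectangles. -/
def Compatible (r r' : Rect) : Prop :=
  r.carrier ∩ r'.carrier = ∅ ∨
  (r.carrier ∩ r'.carrier ⊆ r.vertices ∧ r.carrier ∩ r'.carrier ⊆ r'.vertices) ∨
  ∃ q : Rect, r.carrier ∩ r'.carrier = q.carrier ∧
    Disjoint q.carrier r.vertices ∧ Disjoint q.carrier r'.vertices

end Rect

/-- The free vertices of a collection of rectangles: the points that are vertices of exactly one
of its rectangles. -/
def freeVertices (R : Set Rect) : Set (S1 × S1) := {v | ∃! r, r ∈ R ∧ v ∈ r.vertices}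

/-- A rectangular diagram of a surface. -/
structure Diagram where
  rects : Finset Rect
  compatible : ∀ r ∈ rects, ∀ r' ∈ rects, r ≠ r' → r.Compatible r'
  meridian_le : ∀ θ : S1, (freeVertices (rects : Set Rect) ∩ {v | v.1 = θ}).encard ≤ 2
  longitude_le : ∀ φ : S1, (freeVertices (rects : Set Rect) ∩ {v | v.2 = φ}).encard ≤ 2

namespace Diagram

/-- The boundary of a diagram: the set of its free vertices. -/
def boundary (P : Diagram) : Set (S1 × S1) := freeVertices (P.rects : Set Rect)

/-- `θ` is an occupied meridian of the diagram. -/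
def OccupiedMeridian (P : Diagram) (θ : S1) : Prop := ∃ r ∈ P.rects, ∃ v ∈ r.vertices, v.1 = θ

end Diagram

/-! ## Movie diagrams -/

/-- A non-crossing chord diagram: a finite set of unordered pairs of distinct points of the circle
such that, of any two different chords, the first lies in one of the two open arcs into which the
endpoints of the second divide the circle. -/
def IsNonCrossing (C : Finset (Sym2 S1)) : Prop :=
  (∀ c ∈ C, ¬ c.IsDiag) ∧
  ∀ c ∈ C, ∀ d ∈ C, c ≠ d → ∀ a b : S1, d = s(a, b) →
    (∀ x ∈ c, x ∈ Set.cIoo a b) ∨ (∀ x ∈ c, x ∈ Set.cIoo b a)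

/-- The points `p 0, …, p (k-1)` are pairwise distinct and follow on the circle in this circular
order. -/
def InCircularOrder {k : ℕ} (p : Fin k → S1) : Prop :=
  Function.Injective p ∧ ∀ i j l : Fin k, i < j → j < l → sbtw (p i) (p j) (p l)

/-- The chords `{p 0, p 1}, {p 2, p 3}, …` -/
def evenChords {k : ℕ} (p : Fin k → S1) : Set (Sym2 S1) :=
  {c | ∃ i j : Fin k, Even i.val ∧ j.val = i.val + 1 ∧ c = s(p i, p j)}

/-- The chords `{p 1, p 2}, {p 3, p 4}, …` -/
def oddChords {k : ℕ} (p : Fin k → S1) : Set (Sym2 S1) :=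
  {c | ∃ i j : Fin k, Odd i.val ∧ j.val = i.val + 1 ∧ c = s(p i, p j)}

/-- The chord joining the last of the points `p 0, …, p (k-1)` with the first. -/
def closingChord {k : ℕ} (p : Fin k → S1) : Set (Sym2 S1) :=
  {c | ∃ i j : Fin k, i.val + 1 = k ∧ j.val = 0 ∧ c = s(p i, p j)}

/-- `D` is obtained from `C` by replacing the chords in `X`, all of which belong to `C`, with the
chords in `Y`. -/
def Replaces (C D : Finset (Sym2 S1)) (X Y : Set (Sym2 S1)) : Prop :=
  X ⊆ (C : Set (Sym2 S1)) ∧ (D : Set (Sym2 S1)) = ((C : Set (Sym2 S1)) \ X) ∪ Y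

/-- `D` is obtained from `C` by one of the elementary replacements. The first alternative covers,
for even `k`, the replacement of `{φ₁,φ₂},…,{φₖ₋₁,φₖ}` with `{φ₂,φ₃},…,{φₖ₋₂,φₖ₋₁}` and, for odd
`k`, that of `{φ₁,φ₂},…,{φₖ₋₂,φₖ₋₁}` with `{φ₂,φ₃},…,{φₖ₋₁,φₖ}`. -/
def ElementaryReplacement (C D : Finset (Sym2 S1)) : Prop :=
  ∃ (k : ℕ) (p : Fin k → S1), 2 ≤ k ∧ InCircularOrder p ∧
    (Replaces C D (evenChords p) (oddChords p) ∨
      (4 ≤ k ∧ Even k ∧ Replaces C D (evenChords p) (oddChords p ∪ closingChord p)))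

/-- The passage from `C` to `D` is an admissible event. -/
def AdmissibleEvent (C D : Finset (Sym2 S1)) : Prop :=
  ElementaryReplacement C D ∨ ElementaryReplacement D C

/-- A movie diagram: a left continuous map, with finitely many discontinuities, from the circle to
the discrete space of non-crossing chord diagrams, such that the passage from the value to the right
limit at each discontinuity is an admissible event. The neighborhood filter of `C` in a discrete
space is `pure C`. -/
structure IsMovieDiagram (Ψ : S1 → Finset (Sym2 S1)) : Prop where
  nonCrossing : ∀ θ, IsNonCrossing (Ψ θ)
  left_continuous : ∀ θ : S1, Tendsto (fun t : ℝ => Ψ (θ + (t : S1))) (𝓝[<] 0) (pure (Ψ θ))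
  finite_discontinuities : {θ : S1 | ¬ Tendsto Ψ (𝓝 θ) (pure (Ψ θ))}.Finite
  event : ∀ θ : S1, ¬ Tendsto Ψ (𝓝 θ) (pure (Ψ θ)) →
    ∃ C : Finset (Sym2 S1),
      Tendsto (fun t : ℝ => Ψ (θ + (t : S1))) (𝓝[>] 0) (pure C) ∧ AdmissibleEvent (Ψ θ) C

open Classical in
/-- The movie diagram `Ψ_Π` associated with a diagram `Π`: the chords at the moment `θ` are the
pairs `{φ₁, φ₂}` for all the rectangles `[θ₁;θ₂] × [φ₁;φ₂]` of `Π` such that `θ` lies in the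
half-open arc `(θ₁;θ₂]`. At a meridian that is not occupied this is the same as `θ ∈ (θ₁;θ₂)`, see
`mem_movieOf_iff`; at an occupied meridian the value is the left limit. -/
def movieOf (P : Diagram) (θ : S1) : Finset (Sym2 S1) :=
  (P.rects.filter fun r => θ ∈ Set.cIoo r.θ₁ r.θ₂ ∨ θ = r.θ₂).image fun r => s(r.φ₁, r.φ₂)

/-- At a meridian that is not occupied, `{a, b}` is a chord of the associated movie diagram if and
only if, for some `θ₁, θ₂` with `θ ∈ (θ₁;θ₂)`, one of the rectangles `[θ₁;θ₂] × [a;b]` and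
`[θ₁;θ₂] × [b;a]` belongs to the diagram. -/
theorem mem_movieOf_iff (P : Diagram) (θ : S1) (h : ¬ P.OccupiedMeridian θ) (a b : S1) :
    s(a, b) ∈ movieOf P θ ↔
      ∃ r ∈ P.rects, θ ∈ Set.cIoo r.θ₁ r.θ₂ ∧
        ((r.φ₁ = a ∧ r.φ₂ = b) ∨ (r.φ₁ = b ∧ r.φ₂ = a)) := by
  have key : ∀ r ∈ P.rects, θ ≠ r.θ₂ := by
    intro r hr he
    exact h ⟨r, hr, (r.θ₂, r.φ₁), by simp [Rect.vertices, Rect.slash], he.symm⟩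
  simp only [movieOf, Finset.mem_image, Finset.mem_filter, Sym2.eq_iff]
  constructor
  · rintro ⟨r, ⟨hr, h1⟩, h2⟩
    exact ⟨r, hr, h1.resolve_right (key r hr), h2⟩
  · rintro ⟨r, hr, h1, h2⟩
    exact ⟨r, ⟨hr, Or.inl h1⟩, h2⟩

/-! ## The three-sphere as a join, and the surface associated with a diagram -/

/-- The unit sphere of `ℂ²`. The point with join coordinates `(θ, φ, τ)` is
`(cos (πτ/2) e^{iφ}, sin (πτ/2) e^{iθ})`. -/
abbrev S3 : Type := Metric.sphere (0 : EuclideanSpace ℂ (Fin 2)) 1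

/-- The unit complex number with argument `θ`. -/
def expi (θ : S1) : ℂ := (AddCircle.toCircle θ : ℂ)

/-- The binding of the open book, that is, the circle `τ = 0`. -/
def binding : Set S3 := {x | x.1 1 = 0}

/-- The page of the open book at the angle `θ`; it contains the binding. -/
def page (θ : S1) : Set S3 := {x | x.1 1 = (‖x.1 1‖ : ℂ) * expi θ}

/-- The length, in full turns, of the arc going from `a` to `x` in the positive direction. -/
def arcLength (a x : S1) : ℝ := (AddCircle.equivIco (1 : ℝ) 0 (x - a)).1

/-- A function on the arc `[a;b]` that vanishes at the endpoints, where its slopes are `1` and `-1`,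
is positive inside, and grows as the arc gets larger. -/
def bump (a b x : S1) : ℝ := arcLength a x * arcLength x b / arcLength a b

/-- The disc associated with the rectangle `[θ₁;θ₂] × [φ₁;φ₂]`: the points with coordinates
`(θ, φ, τ)`, where `(θ, φ)` lies in the rectangle, such that
`sin² (πτ/2) bump θ₁ θ₂ θ = cos² (πτ/2) bump φ₁ φ₂ φ`.
The interior of the disc is projected homeomorphically onto the interior of the rectangle, the
boundary of the disc consists of the four arcs that lie over the vertices of the rectangle, and, as
`bump` is monotone in the arc, the interiors of the discs of compatible rectangles are disjoint. The
two discs of compatible rectangles sharing a vertex are tangent along the arc over that vertex. -/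
def tile (r : Rect) : Set S3 :=
  {x | ∃ θ ∈ Set.cIcc r.θ₁ r.θ₂, ∃ φ ∈ Set.cIcc r.φ₁ r.φ₂,
    x.1 1 = (‖x.1 1‖ : ℂ) * expi θ ∧ x.1 0 = (‖x.1 0‖ : ℂ) * expi φ ∧
    ‖x.1 1‖ ^ 2 * bump r.θ₁ r.θ₂ θ = ‖x.1 0‖ ^ 2 * bump r.φ₁ r.φ₂ φ}

/-- The surface associated with a diagram. -/
def Diagram.surface (P : Diagram) : Set S3 := ⋃ r ∈ P.rects, tile r

/-! ## Morphisms of surfaces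

A morphism from `F` to `F'` is a class of orientation-preserving self-homeomorphisms of the
three-sphere taking `F` to `F'`, up to isotopy through such homeomorphisms. Orientation is preserved
by all the homeomorphisms met below: they are isotopic to ones that fix every point of a non-empty
open set, or preserve every page and fix the binding pointwise. -/

/-- `f` and `g`, which take `F` to `F'`, are isotopic through homeomorphisms taking `F` to `F'`:
they represent the same morphism from `F` to `F'`. -/
def Isotopic (F F' : Set S3) (f g : S3 ≃ₜ S3) : Prop :=
  ∃ H : C(unitInterval × S3, S3), (∀ x, H (0, x) = f x) ∧ (∀ x, H (1, x) = g x) ∧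
    ∀ t, ∃ h : S3 ≃ₜ S3, (∀ x, H (t, x) = h x) ∧ h '' F = F'

/-- The morphism from `F` to `F'` represented by `f` is canonical: it can be represented by a
homeomorphism that fixes the binding pointwise and preserves every page. -/
def IsCanonicalMorphism (F F' : Set S3) (f : S3 ≃ₜ S3) : Prop :=
  ∃ c : S3 ≃ₜ S3, c '' F = F' ∧ (∀ x ∈ binding, c x = x) ∧ (∀ θ, c '' page θ = page θ) ∧
    Isotopic F F' f c

/-! ## Vertical bubble moves -/

/-- The passage from `P` to `Q` is the vertical bubble creation move that replaces the rectangle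
`r = [θ₁;θ₂] × [φ₁;φ₂]` with `[θ₁;θ₃] × [φ₁;φ₂]`, `[θ₃;θ₄] × [φ₂;φ₁]` and `[θ₄;θ₂] × [φ₁;φ₂]`. -/
def IsBubbleCreation (P Q : Diagram) (r : Rect) (θ₃ θ₄ : S1) : Prop :=
  r ∈ P.rects ∧ θ₃ ∈ Set.cIoo r.θ₁ r.θ₂ ∧ θ₄ ∈ Set.cIoo r.θ₁ r.θ₂ ∧
  (∀ θ ∈ Set.cIcc θ₃ θ₄, ¬ P.OccupiedMeridian θ) ∧
  (∀ q ∈ P.rects, ¬ (Set.cIcc θ₃ θ₄ ×ˢ Set.cIcc r.φ₁ r.φ₂ ⊆ q.inside)) ∧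
  ∃ r₁ r₂ r₃ : Rect,
    (r₁.θ₁ = r.θ₁ ∧ r₁.θ₂ = θ₃ ∧ r₁.φ₁ = r.φ₁ ∧ r₁.φ₂ = r.φ₂) ∧
    (r₂.θ₁ = θ₃ ∧ r₂.θ₂ = θ₄ ∧ r₂.φ₁ = r.φ₂ ∧ r₂.φ₂ = r.φ₁) ∧
    (r₃.θ₁ = θ₄ ∧ r₃.θ₂ = r.θ₂ ∧ r₃.φ₁ = r.φ₁ ∧ r₃.φ₂ = r.φ₂) ∧
    (Q.rects : Set Rect) = ((P.rects : Set Rect) ∪ {r₁, r₂, r₃}) \ {r}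

/-- The passage from `P` to `Q` is a vertical bubble creation move. -/
def BubbleCreation (P Q : Diagram) : Prop := ∃ r θ₃ θ₄, IsBubbleCreation P Q r θ₃ θ₄

/-- `f` represents the morphism assigned to the vertical bubble creation move from `P` to `Q`: it
takes the surface of `P` to that of `Q`, preserves every page, and is identical outside the domain
`θ ∈ (θ₁;θ₂)`, in which the modification of the surface occurs. -/
def BubbleHomeo (P Q : Diagram) (f : S3 ≃ₜ S3) : Prop :=
  ∃ r θ₃ θ₄, IsBubbleCreation P Q r θ₃ θ₄ ∧ f '' P.surface = Q.surface ∧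
    (∀ θ, f '' page θ = page θ) ∧ ∀ θ, θ ∉ Set.cIoo r.θ₁ r.θ₂ → ∀ x ∈ page θ, f x = x

/-! ## Vertical half-wrinkle moves -/

/-- `r` has one of the forms `[θ₀;θ₁] × [φ';φ'']` and `[θ₁;θ₀] × [φ';φ'']` with `[φ';φ'']`
contained in `[a;b]`. -/
def HasSideIn (r : Rect) (θ₀ a b : S1) : Prop :=
  (r.θ₁ = θ₀ ∨ r.θ₂ = θ₀) ∧ Set.cIcc r.φ₁ r.φ₂ ⊆ Set.cIcc a b

/-- `q` is obtained from `r` by moving its vertical side from the meridian of `θ₀` to that of `θ`. -/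
def SideMoved (r q : Rect) (θ₀ θ : S1) : Prop :=
  q.φ₁ = r.φ₁ ∧ q.φ₂ = r.φ₂ ∧
    ((r.θ₁ = θ₀ ∧ q.θ₁ = θ ∧ q.θ₂ = r.θ₂) ∨ (r.θ₂ = θ₀ ∧ q.θ₂ = θ ∧ q.θ₁ = r.θ₁))

/-- The passage from `P` to `Q` is a vertical half-wrinkle creation move at the `╲`-vertex
`(θ₀, φ₁)` and the `╱`-vertex `(θ₀, φ₂)` of the boundary of `P`. The homeomorphism `ψ` of the
interval `[θ₀ - 2ε; θ₀ + 2ε]` is written in terms of the displacement from `θ₀`. -/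
def HalfWrinkleCreationAt (P Q : Diagram) (θ₀ φ₁ φ₂ : S1) : Prop :=
  (θ₀, φ₁) ∈ P.boundary ∧ (∃ r ∈ P.rects, (θ₀, φ₁) ∈ r.backslash) ∧
  (θ₀, φ₂) ∈ P.boundary ∧ (∃ r ∈ P.rects, (θ₀, φ₂) ∈ r.slash) ∧
  ∃ (ε : ℝ) (_ : 0 < ε) (_ : 4 * ε < 1)
    (ψ : Set.Icc (-(2 * ε)) (2 * ε) ≃o Set.Icc (-(2 * ε)) (2 * ε)) (θm θc θp : S1),
    (∀ t ∈ Set.Icc (-(2 * ε)) (2 * ε), P.OccupiedMeridian (θ₀ + (t : S1)) → t = 0) ∧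
    θm = θ₀ + ((ψ ⟨-ε, by constructor <;> linarith⟩ : ℝ) : S1) ∧
    θc = θ₀ + ((ψ ⟨0, by constructor <;> linarith⟩ : ℝ) : S1) ∧
    θp = θ₀ + ((ψ ⟨ε, by constructor <;> linarith⟩ : ℝ) : S1) ∧
    ∀ q : Rect, q ∈ Q.rects ↔
      (q ∈ P.rects ∧ ¬ HasSideIn q θ₀ φ₁ φ₂ ∧ ¬ HasSideIn q θ₀ φ₂ φ₁) ∨
      (∃ r ∈ P.rects, HasSideIn r θ₀ φ₁ φ₂ ∧ SideMoved r q θ₀ θp) ∨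
      (∃ r ∈ P.rects, HasSideIn r θ₀ φ₂ φ₁ ∧ SideMoved r q θ₀ θm) ∨
      ((∃ r ∈ P.rects, HasSideIn r θ₀ φ₁ φ₂) ∧
        q.θ₁ = θc ∧ q.θ₂ = θp ∧ q.φ₁ = φ₂ ∧ q.φ₂ = φ₁) ∨
      ((∃ r ∈ P.rects, HasSideIn r θ₀ φ₂ φ₁) ∧
        q.θ₁ = θm ∧ q.θ₂ = θc ∧ q.φ₁ = φ₁ ∧ q.φ₂ = φ₂)

/-- The passage from `P` to `Q` is a boundary-preserving vertical half-wrinkle creation move at two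
boundary vertices that are the only vertices of `P` on their meridian. -/
def HalfWrinkleCreation (P Q : Diagram) : Prop :=
  ∃ θ₀ φ₁ φ₂ : S1, HalfWrinkleCreationAt P Q θ₀ φ₁ φ₂ ∧ P.boundary = Q.boundary ∧
    ∀ r ∈ P.rects, ∀ v ∈ r.vertices, v.1 = θ₀ → v = (θ₀, φ₁) ∨ v = (θ₀, φ₂)

/-- An open hemisphere, the standard open `3`-ball in the three-sphere. -/
def stdBall : Set S3 := {x | 0 < (x.1 1).im}

/-- The flat open disc that cuts the standard ball into two halves. -/
def stdDisc : Set S3 := {x | 0 < (x.1 1).im ∧ (x.1 1).re = 0}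

/-- One half of the flat open disc; it contains the diameter that bounds it, so that it is an open
half-disc `{x² + y² < 1, y ≥ 0}`. -/
def stdHalfDisc : Set S3 := {x | 0 < (x.1 1).im ∧ (x.1 1).re = 0 ∧ 0 ≤ (x.1 0).re}

/-- `B` is an open `3`-ball in the three-sphere and `d` is an open disc or an open half-disc
embedded in it in the standard way. -/
def IsBallWithDisc (B d : Set S3) : Prop :=
  ∃ g : S3 ≃ₜ S3, g '' stdBall = B ∧ (g '' stdDisc = d ∨ g '' stdHalfDisc = d)

/-- `f` represents the morphism assigned to the half-wrinkle creation move from `P` to `Q`: it takes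
the surface of `P` to that of `Q` and is identical outside an open ball `B`, disjoint from some
page, that meets the two surfaces in open discs or half-discs whose closures are formed by the tiles
that disappear and by those that appear, respectively. -/
def HalfWrinkleHomeo (P Q : Diagram) (f : S3 ≃ₜ S3) : Prop :=
  f '' P.surface = Q.surface ∧
  ∃ B : Set S3, IsBallWithDisc B (B ∩ P.surface) ∧ IsBallWithDisc B (B ∩ Q.surface) ∧
    closure (B ∩ P.surface) = (⋃ r ∈ (P.rects : Set Rect) \ (Q.rects : Set Rect), tile r) ∧
    closure (B ∩ Q.surface) = (⋃ r ∈ (Q.rects : Set Rect) \ (P.rects : Set Rect), tile r) ∧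
    (∃ θ, Disjoint B (page θ)) ∧ ∀ x, x ∉ B → f x = x

/-! ## Sequences of moves and the morphisms that they induce -/

/-- The passage from `P` to `Q` is a creation or reduction move of one of the two kinds. -/
def VerticalMove (P Q : Diagram) : Prop :=
  BubbleCreation P Q ∨ BubbleCreation Q P ∨ HalfWrinkleCreation P Q ∨ HalfWrinkleCreation Q P

/-- `f` represents the morphism assigned to the move from `P` to `Q`; to a reduction move, the
inverse of the morphism of the respective creation move is assigned. -/
def MoveHomeo (P Q : Diagram) (f : S3 ≃ₜ S3) : Prop :=
  BubbleHomeo P Q f ∨ BubbleHomeo Q P f.symm ∨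
  (HalfWrinkleCreation P Q ∧ HalfWrinkleHomeo P Q f) ∨
  (HalfWrinkleCreation Q P ∧ HalfWrinkleHomeo Q P f.symm)

/-- Finite sequences of moves leading from one diagram to another. -/
inductive MoveSequence : Diagram → Diagram → Type
  | nil (P : Diagram) : MoveSequence P P
  | snoc {P Q R : Diagram} (s : MoveSequence P Q) (h : VerticalMove Q R) : MoveSequence P R

/-- `f` represents the morphism induced by a sequence of moves from `P` to `Q`, that is, the
composition of the morphisms assigned to the moves of the sequence. -/
def MoveSequence.Induces : {P Q : Diagram} → MoveSequence P Q → (S3 ≃ₜ S3) → Prop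
  | _, _, .nil P, f => Isotopic P.surface P.surface (Homeomorph.refl S3) f
  | P, R, .snoc (Q := Q) s _, f => ∃ g h : S3 ≃ₜ S3,
      s.Induces g ∧ MoveHomeo Q R h ∧ Isotopic P.surface R.surface (g.trans h) f

end

end RectMovie

namespace RectMovie
open Filter Topology
open Set (cIoo cIcc left_mem_cIcc right_mem_cIcc disjoint_left mem_iUnion)
local notation "ℓ" => arcLength
noncomputable section

/-! ## Arcs of the circle -/

lemma arc_nonneg (a x : S1) : 0 ≤ ℓ a x := (AddCircle.equivIco (1 : ℝ) 0 (x - a)).2.1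

lemma arc_lt_one (a x : S1) : ℓ a x < 1 := by
  have := (AddCircle.equivIco (1 : ℝ) 0 (x - a)).2.2
  simpa [arcLength] using this

lemma coe_arc (a x : S1) : ((ℓ a x : ℝ) : S1) = x - a :=
  AddCircle.coe_equivIco

lemma add_arc (a x : S1) : a + ((ℓ a x : ℝ) : S1) = x := by
  rw [coe_arc]; abel

lemma arc_add {a : S1} {t : ℝ} (h0 : 0 ≤ t) (h1 : t < 1) : ℓ a (a + (t : S1)) = t := by
  have h : t ∈ Set.Ico (0 : ℝ) (0 + 1) := ⟨h0, by simpa using h1⟩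
  simp [arcLength, AddCircle.equivIco_coe_eq h]

lemma arc_inj {o x y : S1} : ℓ o x = ℓ o y ↔ x = y := by
  refine ⟨fun h => ?_, fun h => h ▸ rfl⟩
  rw [← add_arc o x, h, add_arc]

@[simp] theorem arc_self (a : S1) : ℓ a a = 0 := by
  simpa using arc_add (a := a) (t := 0) le_rfl one_pos

lemma arc_eq_zero {a x : S1} : ℓ a x = 0 ↔ x = a := by
  rw [← arc_self a, arc_inj]

lemma arc_pos {a x : S1} : 0 < ℓ a x ↔ x ≠ a := by
  rw [lt_iff_le_and_ne, ne_comm, Ne, arc_eq_zero]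
  exact and_iff_right (arc_nonneg a x)

lemma arc_eq_ite (o a b : S1) : ℓ a b =
    if ℓ o a ≤ ℓ o b then ℓ o b - ℓ o a
    else ℓ o b - ℓ o a + 1 := by
  have h1 := arc_nonneg o a
  have h2 := arc_nonneg o b
  have h3 := arc_lt_one o a
  have h4 := arc_lt_one o b
  have key : b = a + ((ℓ o b - ℓ o a : ℝ) : S1) := by
    rw [AddCircle.coe_sub, coe_arc, coe_arc]; abel
  split_ifs with h
  · conv_lhs => rw [key]
    exact arc_add (by linarith) (by linarith)
  · have : b = a + ((ℓ o b - ℓ o a + 1 : ℝ) : S1) := by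
      rw [AddCircle.coe_add, AddCircle.coe_period, add_zero]; exact key
    conv_lhs => rw [this]
    exact arc_add (by linarith) (by linarith)

lemma btw_iff_arc {a x b : S1} (h : a ≠ b) : btw a x b ↔ ℓ a x ≤ ℓ a b := by
  induction a using QuotientAddGroup.induction_on with | _ a
  induction x using QuotientAddGroup.induction_on with | _ x
  induction b using QuotientAddGroup.induction_on with | _ b
  rw [QuotientAddGroup.btw_coe_iff']
  have e1 : ℓ (a : S1) x = toIcoMod one_pos 0 (x - a) := rfl
  have e2 : ℓ (a : S1) b = toIcoMod one_pos 0 (b - a) := rfl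
  rw [e1, e2]
  have : ¬ (b - a) ≡ 0 [PMOD (1 : ℝ)] := by
    intro hm
    apply h
    rw [← sub_eq_zero]
    have h1 := (AddCommGroup.modEq_iff_eq_mod_zmultiples).1 hm
    have : ((b - a : ℝ) : S1) = 0 := by simpa using h1
    rw [AddCircle.coe_sub, sub_eq_zero] at this
    exact sub_eq_zero.2 this.symm
  rw [← (AddCommGroup.not_modEq_iff_toIcoMod_eq_toIocMod one_pos).1 (fun h' => this h'.symm)]

lemma mem_cIcc_iff {a b x : S1} (h : a ≠ b) : x ∈ cIcc a b ↔ ℓ a x ≤ ℓ a b :=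
  btw_iff_arc h

lemma mem_cIoo_iff {a b x : S1} :
    x ∈ cIoo a b ↔ 0 < ℓ a x ∧ ℓ a x < ℓ a b := by
  by_cases h : a = b
  · subst h
    simp only [arc_self]
    constructor
    · intro hx
      exact absurd hx (by simp [cIoo, sbtw_irrefl_left_right])
    · rintro ⟨h1, h2⟩; linarith
  · have : x ∈ cIoo a b ↔ ¬ btw b x a := Set.mem_cIoo.trans sbtw_iff_not_btw
    rw [this, btw_iff_arc (Ne.symm h), not_le]
    rw [arc_eq_ite a b a, arc_eq_ite a b x, arc_self]
    have hb := arc_pos.2 (Ne.symm h)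
    have := arc_nonneg a x
    have := arc_lt_one a x
    split_ifs <;> constructor <;> intros <;> (try constructor) <;> linarith

lemma mem_cIcc_iff' (o : S1) {a b x : S1} (h : a ≠ b) : x ∈ cIcc a b ↔
    (ℓ o a ≤ ℓ o x ∧ ℓ o x ≤ ℓ o b) ∨
    (ℓ o b < ℓ o a ∧ ℓ o a ≤ ℓ o x) ∨
    (ℓ o b < ℓ o a ∧ ℓ o x ≤ ℓ o b) := by
  rw [mem_cIcc_iff h, arc_eq_ite o a b, arc_eq_ite o a x]
  have hne : ℓ o a ≠ ℓ o b := fun h' => h (arc_inj.1 h')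
  have h1 := arc_nonneg o x
  have h2 := arc_lt_one o x
  have h3 := arc_nonneg o b
  have h4 := arc_lt_one o b
  have h5 := arc_lt_one o a
  split_ifs <;> grind

lemma mem_cIoo_iff' (o : S1) {a b x : S1} : x ∈ cIoo a b ↔
    (ℓ o a < ℓ o x ∧ ℓ o x < ℓ o b) ∨
    (ℓ o b < ℓ o a ∧ ℓ o a < ℓ o x) ∨
    (ℓ o b < ℓ o a ∧ ℓ o x < ℓ o b) := by
  rw [mem_cIoo_iff, arc_eq_ite o a b, arc_eq_ite o a x]
  have h1 := arc_nonneg o x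
  have h2 := arc_lt_one o x
  have h3 := arc_nonneg o b
  have h4 := arc_lt_one o b
  have h5 := arc_lt_one o a
  split_ifs <;> grind

lemma cIoo_subset_cIcc (a b : S1) : cIoo a b ⊆ cIcc a b :=
  fun _ hx => Set.mem_cIcc.2 (Set.mem_cIoo.1 hx).btw

lemma left_not_mem_cIoo (a b : S1) : a ∉ cIoo a b :=
  fun h => sbtw_irrefl_left (Set.mem_cIoo.1 h)
lemma right_not_mem_cIoo (a b : S1) : b ∉ cIoo a b :=
  fun h => sbtw_irrefl_right (Set.mem_cIoo.1 h)

lemma mem_cIcc_iff_or {a b x : S1} (h : a ≠ b) :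
    x ∈ cIcc a b ↔ x = a ∨ x = b ∨ x ∈ cIoo a b := by
  rw [mem_cIcc_iff h, mem_cIoo_iff, ← arc_eq_zero (a := a), ← arc_inj (o := a) (x := x)]
  have := arc_pos.2 (Ne.symm h)
  have := arc_nonneg a x
  grind

lemma not_mem_cIcc_iff {a b x : S1} : x ∉ cIcc a b ↔ x ∈ cIoo b a := by
  have : x ∈ cIoo b a ↔ ¬ btw a x b := Set.mem_cIoo.trans sbtw_iff_not_btw
  exact this.symm

lemma mem_cIcc_or_swap {a b : S1} (x : S1) : x ∈ cIcc a b ∨ x ∈ cIcc b a := btw_total a x b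

lemma cIoo_nonempty {a b : S1} (h : a ≠ b) : (cIoo a b).Nonempty := by
  have := arc_pos.2 (Ne.symm h)
  have := arc_lt_one a b
  refine ⟨a + ((ℓ a b / 2 : ℝ) : S1), mem_cIoo_iff.2 ?_⟩
  rw [arc_add] <;> first | constructor <;> linarith | linarith

/-- The half-open arc `(a;b]`. -/
def hIoc (a b : S1) : Set S1 := {x | x ∈ cIoo a b ∨ x = b}
/-- The half-open arc `[a;b)`. -/
def hIco (a b : S1) : Set S1 := {x | x = a ∨ x ∈ cIoo a b}

lemma mem_hIoc_iff {a b x : S1} (h : a ≠ b) :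
    x ∈ hIoc a b ↔ 0 < ℓ a x ∧ ℓ a x ≤ ℓ a b := by
  change _ ∨ _ ↔ _
  rw [mem_cIoo_iff, ← arc_inj (o := a) (x := x)]
  have := arc_pos.2 (Ne.symm h)
  grind

lemma mem_hIco_iff {a b x : S1} (h : a ≠ b) :
    x ∈ hIco a b ↔ ℓ a x < ℓ a b := by
  change _ ∨ _ ↔ _
  rw [mem_cIoo_iff, ← arc_eq_zero]
  have := arc_pos.2 (Ne.symm h)
  have := arc_nonneg a x
  grind

lemma mem_hIoc_iff' (o : S1) {a b x : S1} (h : a ≠ b) : x ∈ hIoc a b ↔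
    (ℓ o a < ℓ o x ∧ ℓ o x ≤ ℓ o b) ∨
    (ℓ o b < ℓ o a ∧ ℓ o a < ℓ o x) ∨
    (ℓ o b < ℓ o a ∧ ℓ o x ≤ ℓ o b) := by
  change _ ∨ _ ↔ _
  rw [mem_cIoo_iff' o, ← arc_inj (o := o) (x := x)]
  have hne : ℓ o a ≠ ℓ o b := fun h' => h (arc_inj.1 h')
  grind

lemma mem_hIco_iff' (o : S1) {a b x : S1} (h : a ≠ b) : x ∈ hIco a b ↔
    (ℓ o a ≤ ℓ o x ∧ ℓ o x < ℓ o b) ∨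
    (ℓ o b < ℓ o a ∧ ℓ o a ≤ ℓ o x) ∨
    (ℓ o b < ℓ o a ∧ ℓ o x < ℓ o b) := by
  change _ ∨ _ ↔ _
  rw [mem_cIoo_iff' o, ← arc_inj (o := o) (x := x)]
  have hne : ℓ o a ≠ ℓ o b := fun h' => h (arc_inj.1 h')
  grind

lemma arc_sub {a : S1} {t : ℝ} (h0 : 0 < t) (h1 : t < 1) :
    ℓ a (a - (t : S1)) = 1 - t := by
  have : a - (t : S1) = a + ((1 - t : ℝ) : S1) := by
    rw [AddCircle.coe_sub, AddCircle.coe_period]; abel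
  rw [this]; exact arc_add (by linarith) (by linarith)

lemma cIcc_subset_cIoo {a b c d : S1} (hab : a ≠ b) (hcd : c ≠ d)
    (h : (cIcc a b ∩ cIcc c d).Nonempty) (ha : a ∉ cIcc c d) (hb : b ∉ cIcc c d) :
    cIcc c d ⊆ cIoo a b := by
  obtain ⟨y, hy, hy'⟩ := h
  intro x hx
  rw [mem_cIcc_iff' a hcd] at *
  rw [mem_cIcc_iff' a hab] at *
  rw [mem_cIoo_iff' a]
  rw [arc_self] at *
  have h1 := arc_nonneg a x
  have h3 := arc_nonneg a b
  have h5 := arc_nonneg a c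
  have h7 := arc_nonneg a d
  grind

lemma isOpen_cIoo (a b : S1) : IsOpen (cIoo a b) := by
  have : cIoo a b = (fun t : ℝ => a + (t : S1)) '' Set.Ioo 0 (ℓ a b) := by
    ext x
    rw [mem_cIoo_iff]
    constructor
    · intro h; exact ⟨ℓ a x, h, add_arc a x⟩
    · rintro ⟨t, ht, rfl⟩
      rw [arc_add ht.1.le (ht.2.trans (arc_lt_one _ _))]; exact ht
  rw [this]
  have h1 : IsOpenMap (fun t : ℝ => (t : S1)) := QuotientAddGroup.isOpenMap_coe
  have h2 : IsOpenMap (fun t : ℝ => a + (t : S1)) := (isOpenMap_add_left a).comp h1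
  exact h2 _ isOpen_Ioo

/-! ## Local description of compatibility -/

namespace Rect

/-- The rectangle is present immediately before the moment `θ`. -/
def L (r : Rect) (θ : S1) : Prop := θ ∈ hIoc r.θ₁ r.θ₂
/-- The rectangle is present immediately after the moment `θ`. -/
def R (r : Rect) (θ : S1) : Prop := θ ∈ hIco r.θ₁ r.θ₂
/-- The vertical arc of the rectangle. -/
def arc (r : Rect) : Set S1 := cIcc r.φ₁ r.φ₂
/-- The interior of the vertical arc of the rectangle. -/
def arcInt (r : Rect) : Set S1 := cIoo r.φ₁ r.φ₂

lemma L_right (r : Rect) : r.L r.θ₂ := .inr rfl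
lemma R_left (r : Rect) : r.R r.θ₁ := .inl rfl

lemma L_and_R (r : Rect) {θ : S1} : r.L θ ∧ r.R θ ↔ θ ∈ cIoo r.θ₁ r.θ₂ := by
  have h := r.hθ
  constructor
  · rintro ⟨h1 | h1, h2 | h2⟩
    · exact h1
    · exact h1
    · exact absurd (h2.symm.trans h1) h
    · exact h2
  · exact fun h => ⟨.inl h, .inr h⟩

lemma not_L_left (r : Rect) : ¬ r.L r.θ₁ := by
  rintro (h | h)
  · exact left_not_mem_cIoo _ _ h
  · exact r.hθ h

lemma not_R_right (r : Rect) : ¬ r.R r.θ₂ := by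
  rintro (h | h)
  · exact r.hθ h.symm
  · exact right_not_mem_cIoo _ _ h

lemma end_iff (r : Rect) {θ : S1} : r.L θ ∧ ¬ r.R θ ↔ θ = r.θ₂ := by
  constructor
  · rintro ⟨h1 | h1, h2⟩
    · exact absurd (.inr h1) h2
    · exact h1
  · rintro rfl; exact ⟨r.L_right, r.not_R_right⟩

lemma start_iff (r : Rect) {θ : S1} : ¬ r.L θ ∧ r.R θ ↔ θ = r.θ₁ := by
  constructor
  · rintro ⟨h1, h2 | h2⟩
    · exact h2
    · exact absurd (.inl h2) h1
  · rintro rfl; exact ⟨r.not_L_left, r.R_left⟩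

lemma mem_cIcc_iff_L_or_R (r : Rect) {θ : S1} : θ ∈ cIcc r.θ₁ r.θ₂ ↔ r.L θ ∨ r.R θ := by
  rw [mem_cIcc_iff_or r.hθ]
  unfold L R hIoc hIco
  simp only [Set.mem_ofPred_eq]; tauto

lemma eventually_right (r : Rect) (θ : S1) : ∀ᶠ t : ℝ in 𝓝[>] 0,
    (r.L (θ + (t : S1)) ↔ r.R θ) ∧ (r.R (θ + (t : S1)) ↔ r.R θ) := by
  have h1 := arc_nonneg θ r.θ₁
  have h2 := arc_nonneg θ r.θ₂
  have h3 := arc_lt_one θ r.θ₁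
  have h4 := arc_lt_one θ r.θ₂
  have hne : ℓ θ r.θ₁ ≠ ℓ θ r.θ₂ := fun h' => r.hθ (arc_inj.1 h')
  have e : ∀ p : ℝ, 0 ≤ p → ∀ᶠ t : ℝ in 𝓝[>] 0, 0 < t ∧ t < 1 ∧ (p = 0 ∨ t < p) := by
    intro p hp
    filter_upwards [self_mem_nhdsWithin, nhdsWithin_le_nhds (Iio_mem_nhds one_pos),
      (show ∀ᶠ t : ℝ in 𝓝[>] 0, p = 0 ∨ t < p by
        rcases hp.eq_or_lt with h | h
        · exact Eventually.of_forall fun _ => .inl h.symm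
        · filter_upwards [nhdsWithin_le_nhds (Iio_mem_nhds h)] with t ht using .inr ht)]
      with t h1 h2 h3 using ⟨h1, h2, h3⟩
  filter_upwards [e _ h1, e _ h2] with t ht1 ht2
  unfold L R
  rw [mem_hIoc_iff' θ r.hθ, mem_hIco_iff' θ r.hθ, mem_hIco_iff' θ r.hθ,
    arc_add ht1.1.le ht1.2.1, arc_self]
  grind

lemma eventually_left (r : Rect) (θ : S1) : ∀ᶠ t : ℝ in 𝓝[>] 0,
    (r.L (θ - (t : S1)) ↔ r.L θ) ∧ (r.R (θ - (t : S1)) ↔ r.L θ) := by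
  have h1 := arc_nonneg θ r.θ₁
  have h2 := arc_nonneg θ r.θ₂
  have h3 := arc_lt_one θ r.θ₁
  have h4 := arc_lt_one θ r.θ₂
  have hne : ℓ θ r.θ₁ ≠ ℓ θ r.θ₂ := fun h' => r.hθ (arc_inj.1 h')
  have e : ∀ p : ℝ, p < 1 → ∀ᶠ t : ℝ in 𝓝[>] 0, 0 < t ∧ t < 1 ∧ p < 1 - t := by
    intro p hp
    filter_upwards [self_mem_nhdsWithin, nhdsWithin_le_nhds (Iio_mem_nhds one_pos),
      nhdsWithin_le_nhds (Iio_mem_nhds (sub_pos.2 hp))] with t h1 h2 h3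
    exact ⟨h1, h2, by linarith [Set.mem_Iio.1 h3]⟩
  filter_upwards [e _ h3, e _ h4] with t ht1 ht2
  unfold L R
  rw [mem_hIoc_iff' θ r.hθ, mem_hIco_iff' θ r.hθ, mem_hIoc_iff' θ r.hθ,
    arc_sub ht1.1 ht1.2.1, arc_self]
  grind

/-- The vertical arc of `r` lies in the interior of that of `q`. -/
def Inner (r q : Rect) : Prop := r.arc ⊆ q.arcInt
def Apart (r q : Rect) : Prop := Disjoint r.arc q.arc
/-- The vertical arcs meet only in common end points. -/
def Touch (r q : Rect) : Prop :=
  ∀ φ ∈ r.arc, φ ∈ q.arc → (φ = r.φ₁ ∨ φ = r.φ₂) ∧ (φ = q.φ₁ ∨ φ = q.φ₂)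
/-- Disjoint or nested vertical arcs. -/
def Laminar (r q : Rect) : Prop := r.Apart q ∨ r.Inner q ∨ q.Inner r

lemma Apart.symm {r q : Rect} (h : r.Apart q) : q.Apart r := Disjoint.symm h
lemma Touch.symm {r q : Rect} (h : r.Touch q) : q.Touch r := fun φ h1 h2 => (h φ h2 h1).symm
lemma Laminar.symm {r q : Rect} (h : r.Laminar q) : q.Laminar r := by
  rcases h with h | h | h
  · exact .inl h.symm
  · exact .inr (.inr h)
  · exact .inr (.inl h)

lemma φ₁_mem_arc (r : Rect) : r.φ₁ ∈ r.arc := left_mem_cIcc _ _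
lemma φ₂_mem_arc (r : Rect) : r.φ₂ ∈ r.arc := right_mem_cIcc _ _
lemma φ₁_not_mem_arcInt (r : Rect) : r.φ₁ ∉ r.arcInt := left_not_mem_cIoo _ _
lemma φ₂_not_mem_arcInt (r : Rect) : r.φ₂ ∉ r.arcInt := right_not_mem_cIoo _ _

lemma Inner.not_apart {r q : Rect} (h : r.Inner q) : ¬ r.Apart q := fun h' =>
  disjoint_left.1 h' r.φ₁_mem_arc (cIoo_subset_cIcc _ _ (h r.φ₁_mem_arc))

lemma Inner.not_touch {r q : Rect} (h : r.Inner q) : ¬ r.Touch q := fun h' => by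
  have h1 := h r.φ₁_mem_arc
  rcases (h' _ r.φ₁_mem_arc (cIoo_subset_cIcc _ _ h1)).2 with h2 | h2 <;> rw [h2] at h1
  · exact q.φ₁_not_mem_arcInt h1
  · exact q.φ₂_not_mem_arcInt h1

lemma Inner.not_inner {r q : Rect} (h : r.Inner q) : ¬ q.Inner r := fun h' =>
  r.φ₁_not_mem_arcInt (h' (cIoo_subset_cIcc _ _ (h r.φ₁_mem_arc)))

/-- `r` and `q` cross each other, `r` being longer in the first direction. -/
def Cross (r q : Rect) : Prop := cIcc q.θ₁ q.θ₂ ⊆ cIoo r.θ₁ r.θ₂ ∧ r.Inner q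

lemma mem_carrier {r : Rect} {θ φ : S1} :
    (θ, φ) ∈ r.carrier ↔ θ ∈ cIcc r.θ₁ r.θ₂ ∧ φ ∈ r.arc := Iff.rfl

lemma mem_vertices {r : Rect} {θ φ : S1} :
    (θ, φ) ∈ r.vertices ↔ (θ = r.θ₁ ∨ θ = r.θ₂) ∧ (φ = r.φ₁ ∨ φ = r.φ₂) := by
  simp only [vertices, slash, backslash, Set.mem_union, Set.mem_insert_iff, Set.mem_singleton_iff,
    Prod.mk.injEq]
  tauto

lemma Compatible.symm {r q : Rect} (h : r.Compatible q) : q.Compatible r := by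
  rcases h with h | ⟨h1, h2⟩ | ⟨p, h1, h2, h3⟩
  · exact .inl (by rw [Set.inter_comm]; exact h)
  · exact .inr (.inl ⟨by rwa [Set.inter_comm], by rwa [Set.inter_comm]⟩)
  · exact .inr (.inr ⟨p, by rwa [Set.inter_comm], h3, h2⟩)

lemma Compatible.cross {r q : Rect} (h : r.Compatible q) {θ φ : S1} (hr : (θ, φ) ∈ r.carrier)
    (hq : (θ, φ) ∈ q.carrier) (hv : (θ, φ) ∉ r.vertices ∨ (θ, φ) ∉ q.vertices) :
    r.Cross q ∨ q.Cross r := by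
  rcases h with h | ⟨h1, h2⟩ | ⟨p, h1, h2, h3⟩
  · exact absurd (show (θ, φ) ∈ r.carrier ∩ q.carrier from ⟨hr, hq⟩) (by simp [h])
  · exact (hv.elim (fun hv => hv (h1 (Set.mem_inter hr hq))) fun hv => hv (h2 (Set.mem_inter hr hq))).elim
  · rw [← h1] at h2 h3
    have k2 : ∀ θ φ, (θ, φ) ∈ r.carrier → (θ, φ) ∈ q.carrier → (θ, φ) ∉ r.vertices :=
      fun θ φ a b => disjoint_left.1 h2 (Set.mem_inter a b)
    have k3 : ∀ θ φ, (θ, φ) ∈ r.carrier → (θ, φ) ∈ q.carrier → (θ, φ) ∉ q.vertices :=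
      fun θ φ a b => disjoint_left.1 h3 (Set.mem_inter a b)
    simp only [mem_carrier, mem_vertices] at k2 k3 hr hq
    have a1 := left_mem_cIcc r.θ₁ r.θ₂
    have a2 := right_mem_cIcc r.θ₁ r.θ₂
    have b1 := left_mem_cIcc q.θ₁ q.θ₂
    have b2 := right_mem_cIcc q.θ₁ q.θ₂
    have c1 := r.φ₁_mem_arc
    have c2 := r.φ₂_mem_arc
    have d1 := q.φ₁_mem_arc
    have d2 := q.φ₂_mem_arc
    by_cases hA : r.θ₁ ∈ cIcc q.θ₁ q.θ₂ ∨ r.θ₂ ∈ cIcc q.θ₁ q.θ₂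
    · right
      have e : r.φ₁ ∉ q.arc ∧ r.φ₂ ∉ q.arc := by grind
      have i : q.Inner r := cIcc_subset_cIoo r.hφ q.hφ ⟨φ, hr.2, hq.2⟩ e.1 e.2
      have j1 : q.φ₁ ∈ r.arc := cIoo_subset_cIcc _ _ (i d1)
      have e' : q.θ₁ ∉ cIcc r.θ₁ r.θ₂ ∧ q.θ₂ ∉ cIcc r.θ₁ r.θ₂ := by grind
      exact ⟨cIcc_subset_cIoo q.hθ r.hθ ⟨θ, hq.1, hr.1⟩ e'.1 e'.2, i⟩
    · left
      push Not at hA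
      have i := cIcc_subset_cIoo r.hθ q.hθ ⟨θ, hr.1, hq.1⟩ hA.1 hA.2
      have j1 := cIoo_subset_cIcc _ _ (i b1)
      have e' : q.φ₁ ∉ r.arc ∧ q.φ₂ ∉ r.arc := by grind
      exact ⟨i, cIcc_subset_cIoo q.hφ r.hφ ⟨φ, hq.2, hr.2⟩ e'.1 e'.2⟩

/-- Conditions on a pair of rectangles at a moment `θ`. -/
structure LocalAt (r q : Rect) (θ : S1) : Prop where
  before : r.L θ → q.L θ → r.Laminar q
  after : r.R θ → q.R θ → r.Laminar q
  left_thru : θ = r.θ₁ ∨ θ = r.θ₂ → q.L θ → q.R θ → ¬ r.Inner q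
  right_thru : θ = q.θ₁ ∨ θ = q.θ₂ → r.L θ → r.R θ → ¬ q.Inner r
  both_end : θ = r.θ₂ → θ = q.θ₂ → r.Apart q
  both_start : θ = r.θ₁ → θ = q.θ₁ → r.Apart q
  end_start : θ = r.θ₂ → θ = q.θ₁ → r.Touch q
  start_end : θ = r.θ₁ → θ = q.θ₂ → r.Touch q

lemma LocalAt.symm {r q : Rect} {θ : S1} (h : r.LocalAt q θ) : q.LocalAt r θ where
  before h1 h2 := (h.before h2 h1).symm
  after h1 h2 := (h.after h2 h1).symm
  left_thru := h.right_thru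
  right_thru := h.left_thru
  both_end h1 h2 := (h.both_end h2 h1).symm
  both_start h1 h2 := (h.both_start h2 h1).symm
  end_start h1 h2 := (h.start_end h2 h1).symm
  start_end h1 h2 := (h.end_start h2 h1).symm

lemma Compatible.laminar {r q : Rect} (h : r.Compatible q) {θ : S1}
    (h1 : θ ∈ cIoo r.θ₁ r.θ₂) (h2 : θ ∈ cIoo q.θ₁ q.θ₂) (h' : ¬ r.Apart q) :
    r.Cross q ∨ q.Cross r := by
  obtain ⟨φ, a, b⟩ := Set.not_disjoint_iff.1 h'
  refine h.cross (θ := θ) (φ := φ) ⟨cIoo_subset_cIcc _ _ h1, a⟩ ⟨cIoo_subset_cIcc _ _ h2, b⟩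
    (.inl fun hv => ?_)
  rcases (mem_vertices.1 hv).1 with e | e <;> rw [e] at h1
  · exact left_not_mem_cIoo _ _ h1
  · exact right_not_mem_cIoo _ _ h1

lemma Cross.left_thru {r q : Rect} (h : r.Cross q) {θ : S1} (hq : θ ∈ cIcc q.θ₁ q.θ₂) :
    θ ≠ r.θ₁ ∧ θ ≠ r.θ₂ := by
  have := h.1 hq
  constructor <;> rintro rfl
  · exact left_not_mem_cIoo _ _ this
  · exact right_not_mem_cIoo _ _ this

lemma Compatible.localAt {r q : Rect} (h : r.Compatible q) (θ : S1) : r.LocalAt q θ := by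
  have hL : r.L θ → q.L θ → r.Apart q ∨ r.Cross q ∨ q.Cross r := by
    intro h1 h2
    by_cases ha : r.Apart q
    · exact .inl ha
    obtain ⟨t, e1, e2⟩ := ((r.eventually_left θ).and (q.eventually_left θ)).exists
    exact .inr (h.laminar (r.L_and_R.1 ⟨e1.1.2 h1, e1.2.2 h1⟩)
      (q.L_and_R.1 ⟨e2.1.2 h2, e2.2.2 h2⟩) ha)
  have hR : r.R θ → q.R θ → r.Apart q ∨ r.Cross q ∨ q.Cross r := by
    intro h1 h2
    by_cases ha : r.Apart q
    · exact .inl ha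
    obtain ⟨t, e1, e2⟩ := ((r.eventually_right θ).and (q.eventually_right θ)).exists
    exact .inr (h.laminar (r.L_and_R.1 ⟨e1.1.2 h1, e1.2.2 h1⟩)
      (q.L_and_R.1 ⟨e2.1.2 h2, e2.2.2 h2⟩) ha)
  have no : (θ = r.θ₁ ∨ θ = r.θ₂) → (θ = q.θ₁ ∨ θ = q.θ₂) → ¬ (r.Cross q ∨ q.Cross r) := by
    intro h1 h2 h3
    have m1 : θ ∈ cIcc r.θ₁ r.θ₂ := by
      rcases h1 with e | e <;> rw [e]
      · exact left_mem_cIcc _ _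
      · exact right_mem_cIcc _ _
    have m2 : θ ∈ cIcc q.θ₁ q.θ₂ := by
      rcases h2 with e | e <;> rw [e]
      · exact left_mem_cIcc _ _
      · exact right_mem_cIcc _ _
    rcases h3 with h3 | h3
    · exact h1.elim (h3.left_thru m2).1 (h3.left_thru m2).2
    · exact h2.elim (h3.left_thru m1).1 (h3.left_thru m1).2
  have thru : ∀ r q : Rect, r.Compatible q → (θ = r.θ₁ ∨ θ = r.θ₂) → q.L θ → q.R θ → ¬ r.Inner q := by
    intro r q h h1 h2 h3 h4
    have m1 : θ ∈ cIcc r.θ₁ r.θ₂ := by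
      rcases h1 with e | e <;> rw [e]
      · exact left_mem_cIcc _ _
      · exact right_mem_cIcc _ _
    have i := h4 r.φ₁_mem_arc
    have m2 := cIoo_subset_cIcc _ _ (q.L_and_R.1 ⟨h2, h3⟩)
    rcases h.cross (θ := θ) (φ := r.φ₁) ⟨m1, r.φ₁_mem_arc⟩ ⟨m2, cIoo_subset_cIcc _ _ i⟩
      (.inr fun hv => by
        rcases (mem_vertices.1 hv).2 with e | e <;> rw [e] at i
        · exact q.φ₁_not_mem_arcInt i
        · exact q.φ₂_not_mem_arcInt i) with h5 | h5
    · exact h1.elim (h5.left_thru m2).1 (h5.left_thru m2).2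
    · exact h4.not_inner h5.2
  have touch : θ ∈ cIcc r.θ₁ r.θ₂ → θ ∈ cIcc q.θ₁ q.θ₂ → ¬ (r.Cross q ∨ q.Cross r) →
      r.Touch q := by
    intro m1 m2 hn φ h1 h2
    by_contra hv
    refine hn (h.cross (θ := θ) (φ := φ) ⟨m1, h1⟩ ⟨m2, h2⟩ ?_)
    rw [← not_and_or]
    exact fun h3 => hv ⟨(mem_vertices.1 h3.1).2, (mem_vertices.1 h3.2).2⟩
  refine ⟨fun h1 h2 => ?_, fun h1 h2 => ?_, thru r q h, thru q r h.symm, ?_, ?_, ?_, ?_⟩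
  · rcases hL h1 h2 with h | h | h
    · exact .inl h
    · exact .inr (.inl h.2)
    · exact .inr (.inr h.2)
  · rcases hR h1 h2 with h | h | h
    · exact .inl h
    · exact .inr (.inl h.2)
    · exact .inr (.inr h.2)
  · intro e1 e2
    exact (hL (e1 ▸ r.L_right) (e2 ▸ q.L_right)).resolve_right (no (.inr e1) (.inr e2))
  · intro e1 e2
    exact (hR (e1 ▸ r.R_left) (e2 ▸ q.R_left)).resolve_right (no (.inl e1) (.inl e2))
  · intro e1 e2
    exact touch (e1 ▸ right_mem_cIcc _ _) (e2 ▸ left_mem_cIcc _ _)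
      (no (.inr e1) (.inl e2))
  · intro e1 e2
    exact touch (e1 ▸ left_mem_cIcc _ _) (e2 ▸ right_mem_cIcc _ _)
      (no (.inl e1) (.inr e2))

lemma Cross.compatible {r q : Rect} (h : r.Cross q) : r.Compatible q := by
  refine .inr (.inr ⟨⟨q.θ₁, q.θ₂, r.φ₁, r.φ₂, q.hθ, r.hφ⟩, ?_, ?_, ?_⟩)
  · ext ⟨θ, φ⟩
    constructor
    · rintro ⟨h1, h2⟩; exact ⟨h2.1, h1.2⟩
    · rintro ⟨h1, h2⟩
      exact ⟨⟨cIoo_subset_cIcc _ _ (h.1 h1), h2⟩, ⟨h1, cIoo_subset_cIcc _ _ (h.2 h2)⟩⟩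
  · refine disjoint_left.2 ?_
    rintro ⟨θ, φ⟩ ⟨h1, h2⟩ h3
    have := (mem_vertices.1 h3).1
    have := h.left_thru h1
    tauto
  · refine disjoint_left.2 ?_
    rintro ⟨θ, φ⟩ ⟨h1, h2⟩ h3
    have h4 := h.2 h2
    rcases (mem_vertices.1 h3).2 with e | e <;> rw [e] at h4
    · exact q.φ₁_not_mem_arcInt h4
    · exact q.φ₂_not_mem_arcInt h4

lemma compatible_of_inner {r q : Rect} (h : ∀ θ, r.LocalAt q θ) (hi : r.Inner q) :
    r.Compatible q := by
  by_cases hd : (cIcc r.θ₁ r.θ₂ ∩ cIcc q.θ₁ q.θ₂).Nonempty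
  · have key : ∀ θ, (θ = r.θ₁ ∨ θ = r.θ₂) → θ ∉ cIcc q.θ₁ q.θ₂ := by
      intro θ hθ hm
      rcases q.mem_cIcc_iff_L_or_R.1 hm with hL | hR
      · by_cases hR : q.R θ
        · exact (h θ).left_thru hθ hL hR hi
        · have e := q.end_iff.1 ⟨hL, hR⟩
          rcases hθ with e' | e'
          · exact hi.not_touch ((h θ).start_end e' e)
          · exact hi.not_apart ((h θ).both_end e' e)
      · by_cases hL : q.L θ
        · exact (h θ).left_thru hθ hL hR hi
        · have e := q.start_iff.1 ⟨hL, hR⟩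
          rcases hθ with e' | e'
          · exact hi.not_apart ((h θ).both_start e' e)
          · exact hi.not_touch ((h θ).end_start e' e)
    exact Cross.compatible
      ⟨cIcc_subset_cIoo r.hθ q.hθ hd (key _ (.inl rfl)) (key _ (.inr rfl)), hi⟩
  · left
    rw [Set.not_nonempty_iff_eq_empty] at hd
    rw [carrier, carrier, Set.prod_inter_prod, hd, Set.empty_prod]

lemma compatible_of_localAt {r q : Rect} (h : ∀ θ, r.LocalAt q θ) : r.Compatible q := by
  by_cases h1 : r.Inner q
  · exact compatible_of_inner h h1
  by_cases h2 : q.Inner r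
  · exact (compatible_of_inner (fun θ => (h θ).symm) h2).symm
  by_cases h3 : r.Apart q
  · left
    have h3 : cIcc r.φ₁ r.φ₂ ∩ cIcc q.φ₁ q.φ₂ = ∅ := Set.disjoint_iff_inter_eq_empty.1 h3
    rw [carrier, carrier, Set.prod_inter_prod, h3, Set.prod_empty]
  have hl : ¬ r.Laminar q := by unfold Laminar; tauto
  have key : ∀ θ φ, (θ, φ) ∈ r.carrier → (θ, φ) ∈ q.carrier →
      (θ, φ) ∈ r.vertices ∧ (θ, φ) ∈ q.vertices := by
    rintro θ φ ⟨a1, a2⟩ ⟨b1, b2⟩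
    rw [r.mem_cIcc_iff_L_or_R] at a1
    rw [q.mem_cIcc_iff_L_or_R] at b1
    rw [mem_vertices, mem_vertices]
    have k1 := (h θ).before
    have k2 := (h θ).after
    rcases a1 with a1 | a1 <;> rcases b1 with b1 | b1
    · exact absurd (k1 a1 b1) hl
    · have e1 := r.end_iff.1 ⟨a1, fun a => hl (k2 a b1)⟩
      have e2 := q.start_iff.1 ⟨fun b => hl (k1 a1 b), b1⟩
      have := (h θ).end_start e1 e2 φ a2 b2
      tauto
    · have e1 := r.start_iff.1 ⟨fun a => hl (k1 a b1), a1⟩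
      have e2 := q.end_iff.1 ⟨b1, fun b => hl (k2 a1 b)⟩
      have := (h θ).start_end e1 e2 φ a2 b2
      tauto
    · exact absurd (k2 a1 b1) hl
  exact .inr (.inl ⟨fun v hv => (key v.1 v.2 hv.1 hv.2).1, fun v hv => (key v.1 v.2 hv.1 hv.2).2⟩)

end Rect

/-! ## Families of compatible rectangles and their free vertices -/

namespace Rect

/-- `φ` is the level of a horizontal side of the rectangle. -/
def HasEnd (r : Rect) (φ : S1) : Prop := φ = r.φ₁ ∨ φ = r.φ₂

lemma mem_chord {r : Rect} {φ : S1} : φ ∈ s(r.φ₁, r.φ₂) ↔ r.HasEnd φ := Sym2.mem_iff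

lemma HasEnd.mem_arc {r : Rect} {φ : S1} (h : r.HasEnd φ) : φ ∈ r.arc := by
  rcases h with h | h <;> rw [h]
  · exact r.φ₁_mem_arc
  · exact r.φ₂_mem_arc

lemma HasEnd.not_mem_arcInt {r : Rect} {φ : S1} (h : r.HasEnd φ) : φ ∉ r.arcInt := by
  rcases h with h | h <;> rw [h]
  · exact r.φ₁_not_mem_arcInt
  · exact r.φ₂_not_mem_arcInt

lemma Laminar.not_hasEnd {r q : Rect} (h : r.Laminar q) {φ : S1} (h1 : r.HasEnd φ)
    (h2 : q.HasEnd φ) : False := by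
  rcases h with h | h | h
  · exact disjoint_left.1 h h1.mem_arc h2.mem_arc
  · exact h2.not_mem_arcInt (h h1.mem_arc)
  · exact h1.not_mem_arcInt (h h2.mem_arc)

end Rect

/-- Pairwise compatible rectangles. -/
def PairwiseCompatible (F : Set Rect) : Prop := ∀ r ∈ F, ∀ q ∈ F, r ≠ q → r.Compatible q

lemma Diagram.pairwiseCompatible (P : Diagram) : PairwiseCompatible (P.rects : Set Rect) :=
  P.compatible

def endsBefore (F : Set Rect) (θ φ : S1) : Prop := ∃ r ∈ F, r.L θ ∧ r.HasEnd φ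
def endsAfter (F : Set Rect) (θ φ : S1) : Prop := ∃ r ∈ F, r.R θ ∧ r.HasEnd φ

lemma PairwiseCompatible.eq_of_L {F : Set Rect} (hF : PairwiseCompatible F) {r q : Rect}
    (hr : r ∈ F) (hq : q ∈ F) {θ φ : S1} (h1 : r.L θ) (h2 : q.L θ) (e1 : r.HasEnd φ)
    (e2 : q.HasEnd φ) : r = q := by
  by_contra hne
  exact (((hF r hr q hq hne).localAt θ).before h1 h2).not_hasEnd e1 e2

lemma PairwiseCompatible.eq_of_R {F : Set Rect} (hF : PairwiseCompatible F) {r q : Rect}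
    (hr : r ∈ F) (hq : q ∈ F) {θ φ : S1} (h1 : r.R θ) (h2 : q.R θ) (e1 : r.HasEnd φ)
    (e2 : q.HasEnd φ) : r = q := by
  by_contra hne
  exact (((hF r hr q hq hne).localAt θ).after h1 h2).not_hasEnd e1 e2

lemma Rect.mem_vertices_iff_LR {r : Rect} {θ φ : S1} :
    (θ, φ) ∈ r.vertices ↔ ((r.L θ ∧ ¬ r.R θ) ∨ (¬ r.L θ ∧ r.R θ)) ∧ r.HasEnd φ := by
  rw [Rect.mem_vertices, r.end_iff, r.start_iff, or_comm (a := θ = r.θ₁)]; rfl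

lemma PairwiseCompatible.mem_freeVertices {F : Set Rect} (hF : PairwiseCompatible F) {θ φ : S1} :
    (θ, φ) ∈ freeVertices F ↔ ¬ (endsBefore F θ φ ↔ endsAfter F θ φ) := by
  have uL := fun (r : Rect) (hr : r ∈ F) (q : Rect) (hq : q ∈ F) =>
    hF.eq_of_L hr hq (θ := θ) (φ := φ)
  have uR := fun (r : Rect) (hr : r ∈ F) (q : Rect) (hq : q ∈ F) =>
    hF.eq_of_R hr hq (θ := θ) (φ := φ)
  have hfree : (θ, φ) ∈ freeVertices F ↔ ∃! r, r ∈ F ∧ (θ, φ) ∈ r.vertices := Iff.rfl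
  rw [hfree]
  simp only [Rect.mem_vertices_iff_LR]
  constructor
  · rintro ⟨r, ⟨hr, hv, he⟩, hu⟩ hiff
    rcases hv with ⟨h1, h2⟩ | ⟨h1, h2⟩
    · obtain ⟨q, hq, h3, h4⟩ := hiff.1 ⟨r, hr, h1, he⟩
      by_cases h5 : q.L θ
      · exact h2 (uL r hr q hq h1 h5 he h4 ▸ h3)
      · exact h2 (hu q ⟨hq, .inr ⟨h5, h3⟩, h4⟩ ▸ h3)
    · obtain ⟨q, hq, h3, h4⟩ := hiff.2 ⟨r, hr, h2, he⟩
      by_cases h5 : q.R θ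
      · exact h1 (uR r hr q hq h2 h5 he h4 ▸ h3)
      · exact h1 (hu q ⟨hq, .inl ⟨h3, h5⟩, h4⟩ ▸ h3)
  · intro h
    by_cases hb : endsBefore F θ φ
    · have ha : ¬ endsAfter F θ φ := by tauto
      obtain ⟨r, hr, h1, h2⟩ := hb
      refine ⟨r, ⟨hr, .inl ⟨h1, fun h3 => ha ⟨r, hr, h3, h2⟩⟩, h2⟩, ?_⟩
      rintro q ⟨hq, h3, h4⟩
      rcases h3 with h3 | h3
      · exact uL q hq r hr h3.1 h1 h4 h2
      · exact absurd ⟨q, hq, h3.2, h4⟩ ha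
    · have ha : endsAfter F θ φ := by tauto
      obtain ⟨r, hr, h1, h2⟩ := ha
      refine ⟨r, ⟨hr, .inr ⟨fun h3 => hb ⟨r, hr, h3, h2⟩, h1⟩, h2⟩, ?_⟩
      rintro q ⟨hq, h3, h4⟩
      rcases h3 with h3 | h3
      · exact absurd ⟨q, hq, h3.1, h4⟩ hb
      · exact uR q hq r hr h3.2 h1 h4 h2

/-! ## The movie of a diagram -/

lemma mem_movieOf {P : Diagram} {θ : S1} {c : Sym2 S1} :
    c ∈ movieOf P θ ↔ ∃ r ∈ P.rects, r.L θ ∧ s(r.φ₁, r.φ₂) = c := by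
  classical
  simp only [movieOf, Finset.mem_image, Finset.mem_filter, and_assoc]
  rfl

open Classical in
/-- The right limit of the movie of a diagram. -/
def movieAfter (P : Diagram) (θ : S1) : Finset (Sym2 S1) :=
  (P.rects.filter fun r => r.R θ).image fun r => s(r.φ₁, r.φ₂)

lemma mem_movieAfter {P : Diagram} {θ : S1} {c : Sym2 S1} :
    c ∈ movieAfter P θ ↔ ∃ r ∈ P.rects, r.R θ ∧ s(r.φ₁, r.φ₂) = c := by
  classical
  simp only [movieAfter, Finset.mem_image, Finset.mem_filter, and_assoc]

lemma endsBefore_iff {P : Diagram} {θ φ : S1} :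
    endsBefore (P.rects : Set Rect) θ φ ↔ ∃ c ∈ movieOf P θ, φ ∈ c := by
  constructor
  · rintro ⟨r, hr, h1, h2⟩
    exact ⟨_, mem_movieOf.2 ⟨r, hr, h1, rfl⟩, Rect.mem_chord.2 h2⟩
  · rintro ⟨c, hc, h⟩
    obtain ⟨r, hr, h1, rfl⟩ := mem_movieOf.1 hc
    exact ⟨r, hr, h1, Rect.mem_chord.1 h⟩

lemma endsAfter_iff {P : Diagram} {θ φ : S1} :
    endsAfter (P.rects : Set Rect) θ φ ↔ ∃ c ∈ movieAfter P θ, φ ∈ c := by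
  constructor
  · rintro ⟨r, hr, h1, h2⟩
    exact ⟨_, mem_movieAfter.2 ⟨r, hr, h1, rfl⟩, Rect.mem_chord.2 h2⟩
  · rintro ⟨c, hc, h⟩
    obtain ⟨r, hr, h1, rfl⟩ := mem_movieAfter.1 hc
    exact ⟨r, hr, h1, Rect.mem_chord.1 h⟩

lemma eventually_rects_right (F : Finset Rect) (θ : S1) : ∀ᶠ t : ℝ in 𝓝[>] 0, ∀ r ∈ F,
    (r.L (θ + (t : S1)) ↔ r.R θ) ∧ (r.R (θ + (t : S1)) ↔ r.R θ) :=
  (eventually_all_finset F).2 fun r _ => r.eventually_right θ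

lemma eventually_rects_left (F : Finset Rect) (θ : S1) : ∀ᶠ t : ℝ in 𝓝[>] 0, ∀ r ∈ F,
    (r.L (θ - (t : S1)) ↔ r.L θ) ∧ (r.R (θ - (t : S1)) ↔ r.L θ) :=
  (eventually_all_finset F).2 fun r _ => r.eventually_left θ

lemma movieOf_right (P : Diagram) (θ : S1) :
    ∀ᶠ t : ℝ in 𝓝[>] 0, movieOf P (θ + (t : S1)) = movieAfter P θ := by
  filter_upwards [eventually_rects_right P.rects θ] with t ht
  ext c
  rw [mem_movieOf, mem_movieAfter]
  exact exists_congr fun r => and_congr_right fun hr => by rw [(ht r hr).1]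

lemma movieOf_left (P : Diagram) (θ : S1) :
    ∀ᶠ t : ℝ in 𝓝[>] 0, movieOf P (θ - (t : S1)) = movieOf P θ := by
  filter_upwards [eventually_rects_left P.rects θ] with t ht
  ext c
  rw [mem_movieOf, mem_movieOf]
  exact exists_congr fun r => and_congr_right fun hr => by rw [(ht r hr).1]

lemma movieAfter_eq {P Q : Diagram} (h : movieOf P = movieOf Q) : movieAfter P = movieAfter Q := by
  funext θ
  obtain ⟨t, h1, h2⟩ := ((movieOf_right P θ).and (movieOf_right Q θ)).exists
  rw [← h1, ← h2, h]

lemma eventually_nhds_circle {p : S1 → Prop} {θ : S1} : (∀ᶠ x in 𝓝 θ, p x) ↔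
    p θ ∧ (∀ᶠ t : ℝ in 𝓝[>] 0, p (θ + (t : S1))) ∧ ∀ᶠ t : ℝ in 𝓝[>] 0, p (θ - (t : S1)) := by
  have h1 : IsOpenMap (fun t : ℝ => (t : S1)) := QuotientAddGroup.isOpenMap_coe
  have h2 : IsOpenMap (fun t : ℝ => θ + (t : S1)) := (isOpenMap_add_left θ).comp h1
  have h3 : Continuous (fun t : ℝ => θ + (t : S1)) :=
    continuous_const.add (AddCircle.continuous_mk' 1)
  have h4 : map (fun t : ℝ => θ + (t : S1)) (𝓝 0) = 𝓝 θ := by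
    have := h2.map_nhds_eq h3.continuousAt (x := 0)
    simpa using this
  have h5 : (∀ᶠ t : ℝ in 𝓝[>] 0, p (θ - (t : S1))) ↔ ∀ᶠ t : ℝ in 𝓝[<] 0, p (θ + (t : S1)) := by
    have : map (fun t : ℝ => -t) (𝓝[>] 0) = 𝓝[<] 0 := by
      simp
    rw [← this, eventually_map]
    simp [sub_eq_add_neg]
  rw [h5, ← h4, eventually_map, ← nhdsLT_sup_nhdsGE, ← Set.Ioi_insert, nhdsWithin_insert]
  simp only [eventually_sup, eventually_pure, AddCircle.coe_zero, add_zero]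
  tauto

lemma Diagram.isNonCrossing_of {P : Diagram} {S : Finset (Sym2 S1)} {p : Rect → Prop}
    (hS : ∀ c ∈ S, ∃ r ∈ P.rects, p r ∧ s(r.φ₁, r.φ₂) = c)
    (hp : ∀ r ∈ P.rects, ∀ q ∈ P.rects, r ≠ q → p r → p q → r.Laminar q) : IsNonCrossing S := by
  constructor
  · intro c hc
    obtain ⟨r, _, _, rfl⟩ := hS c hc
    exact fun h => r.hφ (Sym2.mk_isDiag_iff.1 h)
  · intro c hc d hd hne a b hab
    obtain ⟨r, hr, h1, rfl⟩ := hS c hc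
    obtain ⟨q, hq, h2, rfl⟩ := hS d hd
    have hl := hp r hr q hq (fun h => hne (by rw [h])) h1 h2
    have key : (∀ x ∈ s(r.φ₁, r.φ₂), x ∈ cIoo q.φ₁ q.φ₂) ∨
        (∀ x ∈ s(r.φ₁, r.φ₂), x ∈ cIoo q.φ₂ q.φ₁) := by
      rcases hl with h | h | h
      · right
        intro x hx
        exact not_mem_cIcc_iff.1 (disjoint_left.1 h (Rect.mem_chord.1 hx).mem_arc)
      · left
        intro x hx
        exact h (Rect.mem_chord.1 hx).mem_arc
      · right
        intro x hx
        exact not_mem_cIcc_iff.1 fun h' => (Rect.mem_chord.1 hx).not_mem_arcInt (h h')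
    rcases Sym2.eq_iff.1 hab with ⟨rfl, rfl⟩ | ⟨rfl, rfl⟩
    · exact key
    · exact key.symm

lemma isNonCrossing_movieOf (P : Diagram) (θ : S1) : IsNonCrossing (movieOf P θ) :=
  Diagram.isNonCrossing_of (p := fun r => r.L θ) (fun _ hc => mem_movieOf.1 hc)
    fun r hr q hq hne h1 h2 => ((P.compatible r hr q hq hne).localAt θ).before h1 h2

lemma Diagram.occupiedMeridian_iff {P : Diagram} {θ : S1} :
    P.OccupiedMeridian θ ↔ ∃ r ∈ P.rects, θ = r.θ₁ ∨ θ = r.θ₂ := by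
  constructor
  · rintro ⟨r, hr, ⟨θ', φ⟩, hv, rfl⟩
    exact ⟨r, hr, (Rect.mem_vertices.1 hv).1⟩
  · rintro ⟨r, hr, h⟩
    exact ⟨r, hr, (θ, r.φ₁), Rect.mem_vertices.2 ⟨h, .inl rfl⟩, rfl⟩

lemma Diagram.finite_occupied (P : Diagram) : {θ | P.OccupiedMeridian θ}.Finite := by
  classical
  refine (P.rects.image Rect.θ₁ ∪ P.rects.image Rect.θ₂).finite_toSet.subset ?_
  intro θ h
  obtain ⟨r, hr, h⟩ := Diagram.occupiedMeridian_iff.1 h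
  rw [Finset.mem_coe, Finset.mem_union, Finset.mem_image, Finset.mem_image]
  rcases h with h | h
  · exact .inl ⟨r, hr, h.symm⟩
  · exact .inr ⟨r, hr, h.symm⟩

lemma Diagram.L_iff_R {P : Diagram} {θ : S1} (h : ¬ P.OccupiedMeridian θ) {r : Rect}
    (hr : r ∈ P.rects) : r.L θ ↔ r.R θ := by
  rw [Diagram.occupiedMeridian_iff] at h
  push Not at h
  have h1 := fun h' => (h r hr).2 (r.end_iff.1 h')
  have h2 := fun h' => (h r hr).1 (r.start_iff.1 h')
  exact ⟨fun a => by_contra fun b => h1 ⟨a, b⟩, fun a => by_contra fun b => h2 ⟨b, a⟩⟩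

lemma movieAfter_eq_movieOf {P : Diagram} {θ : S1} (h : ¬ P.OccupiedMeridian θ) :
    movieAfter P θ = movieOf P θ := by
  ext c
  rw [mem_movieAfter, mem_movieOf]
  exact exists_congr fun r => and_congr_right fun hr => by rw [P.L_iff_R h hr]

lemma tendsto_movieOf {P : Diagram} {θ : S1} (h : movieAfter P θ = movieOf P θ) :
    Tendsto (movieOf P) (𝓝 θ) (pure (movieOf P θ)) := by
  rw [tendsto_pure, eventually_nhds_circle]
  exact ⟨rfl, by simpa [h] using movieOf_right P θ, movieOf_left P θ⟩

lemma eventually_small {b : ℝ} (hb : 0 < b) : ∀ᶠ t : ℝ in 𝓝[>] 0, 0 < t ∧ t < b := by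
  filter_upwards [self_mem_nhdsWithin, nhdsWithin_le_nhds (Iio_mem_nhds hb)] with t h1 h2
    using ⟨h1, h2⟩

/-! ## One-sided locally constant predicates on the circle -/

/-- `p` is locally constant from the left with right limit `q`. -/
structure IsTame (p q : S1 → Prop) : Prop where
  right : ∀ θ : S1, ∀ᶠ t : ℝ in 𝓝[>] 0, (p (θ + (t : S1)) ↔ q θ) ∧ (q (θ + (t : S1)) ↔ q θ)
  left : ∀ θ : S1, ∀ᶠ t : ℝ in 𝓝[>] 0, (p (θ - (t : S1)) ↔ p θ) ∧ (q (θ - (t : S1)) ↔ p θ)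

namespace IsTame
variable {p q : S1 → Prop}

lemma not (h : IsTame p q) : IsTame (fun θ => ¬ p θ) fun θ => ¬ q θ where
  right θ := by filter_upwards [h.right θ] with t ht using by simp only [ht.1, ht.2, and_self]
  left θ := by filter_upwards [h.left θ] with t ht using by simp only [ht.1, ht.2, and_self]

lemma exists_switch_aux (h : IsTame p q) (o : S1) {a b : ℝ} (hab : a < b)
    (ha : q (o + (a : S1))) (hb : ¬ p (o + (b : S1))) :
    ∃ x ∈ Set.Ioo a b, ¬ (p (o + (x : S1)) ↔ q (o + (x : S1))) := by
  by_contra! hno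
  have hc : Continuous (fun t : ℝ => o + (t : S1)) :=
    continuous_const.add (AddCircle.continuous_mk' 1)
  have op : ∀ p q : S1 → Prop, IsTame p q →
      (∀ x ∈ Set.Ioo a b, (p (o + (x : S1)) ↔ q (o + (x : S1)))) →
      IsOpen {x ∈ Set.Ioo a b | p (o + (x : S1))} := by
    intro p q h hno
    rw [isOpen_iff_mem_nhds]
    rintro x ⟨hx, hp⟩
    have : ∀ᶠ z in 𝓝 (o + (x : S1)), p z := by
      rw [eventually_nhds_circle]
      refine ⟨hp, ?_, ?_⟩
      · filter_upwards [h.right (o + (x : S1))] with t ht using ht.1.2 ((hno x hx).1 hp)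
      · filter_upwards [h.left (o + (x : S1))] with t ht using ht.1.2 hp
    filter_upwards [Ioo_mem_nhds hx.1 hx.2, hc.continuousAt.eventually this] with y h1 h2
      using ⟨h1, h2⟩
  have o1 := op p q h hno
  have o2 := op _ _ h.not fun x hx => not_congr (hno x hx)
  have hsub := isPreconnected_Ioo.subset_left_of_subset_union o1 o2
    (disjoint_left.2 fun x h1 h2 => h2.2 h1.2)
    (fun x hx => by
      by_cases hp : p (o + (x : S1))
      · exact .inl ⟨hx, hp⟩
      · exact .inr ⟨hx, hp⟩)
    (by
      obtain ⟨t, ht, h0, h1⟩ := ((h.right (o + (a : S1))).and (eventually_small (sub_pos.2 hab))).exists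
      have hm : a + t ∈ Set.Ioo a b := ⟨by linarith, by linarith⟩
      refine ⟨a + t, hm, hm, ?_⟩
      have := ht.1.2 ha
      rwa [add_assoc, ← AddCircle.coe_add] at this)
  obtain ⟨t, ht, h0, h1⟩ := ((h.left (o + (b : S1))).and (eventually_small (sub_pos.2 hab))).exists
  have hm : b - t ∈ Set.Ioo a b := ⟨by linarith, by linarith⟩
  have := (hsub hm).2
  rw [AddCircle.coe_sub, ← add_sub_assoc] at this
  exact hb (ht.1.1 this)

lemma exists_switch (h : IsTame p q) (o : S1) {a b : ℝ} (hab : a < b)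
    (hne : ¬ (p (o + (a : S1)) ↔ p (o + (b : S1)))) :
    ∃ x ∈ Set.Ico a b, ¬ (p (o + (x : S1)) ↔ q (o + (x : S1))) := by
  by_cases hs : p (o + (a : S1)) ↔ q (o + (a : S1))
  · by_cases ha : q (o + (a : S1))
    · obtain ⟨x, hx, h1⟩ := h.exists_switch_aux o hab ha (by tauto)
      exact ⟨x, Set.Ioo_subset_Ico_self hx, h1⟩
    · obtain ⟨x, hx, h1⟩ := h.not.exists_switch_aux o hab ha (by tauto)
      exact ⟨x, Set.Ioo_subset_Ico_self hx, by tauto⟩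
  · exact ⟨a, ⟨le_rfl, hab⟩, hs⟩

lemma isPreconnected (h : IsTame p q) (h2 : {θ | ¬ (p θ ↔ q θ)}.encard ≤ 2) :
    IsPreconnected {θ | p θ} := by
  by_cases hall : ∃ o, ¬ p o
  · obtain ⟨o, ho⟩ := hall
    have hset : {θ | p θ} =
        (fun t : ℝ => o + (t : S1)) '' {t : ℝ | t ∈ Set.Ioo 0 1 ∧ p (o + (t : S1))} := by
      ext θ
      constructor
      · intro hθ
        have hne : θ ≠ o := by rintro rfl; exact ho hθ
        refine ⟨ℓ o θ, ⟨⟨arc_pos.2 hne, arc_lt_one _ _⟩, ?_⟩, add_arc o θ⟩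
        rwa [add_arc]
      · rintro ⟨t, ht, rfl⟩; exact ht.2
    rw [hset]
    refine IsPreconnected.image ?_ _
      (continuous_const.add (AddCircle.continuous_mk' 1)).continuousOn
    refine (Set.ordConnected_def.2 ?_).isPreconnected
    rintro a ⟨ha, pa⟩ c ⟨hc, pc⟩ b hb
    refine ⟨⟨ha.1.trans_le hb.1, hb.2.trans_lt hc.2⟩, ?_⟩
    by_contra pb
    have hab : a < b := lt_of_le_of_ne hb.1 (by rintro rfl; exact pb pa)
    have hbc : b < c := lt_of_le_of_ne hb.2 (by rintro rfl; exact pb pc)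
    obtain ⟨x, hx, sx⟩ := h.exists_switch o (a := 0) ha.1 (by simpa using fun hh => ho (hh.2 pa))
    obtain ⟨y, hy, sy⟩ := h.exists_switch o hab (by tauto)
    obtain ⟨z, hz, sz⟩ := h.exists_switch o hbc (by tauto)
    have hinj : ∀ u ∈ Set.Ico (0 : ℝ) 1, ∀ v ∈ Set.Ico (0 : ℝ) 1, u < v →
        o + (u : S1) ≠ o + (v : S1) := by
      intro u hu v hv huv he
      have := congrArg (ℓ o) he
      rw [arc_add hu.1 hu.2, arc_add hv.1 hv.2] at this
      linarith
    have hx' : x ∈ Set.Ico (0 : ℝ) 1 := ⟨hx.1, hx.2.trans ha.2⟩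
    have hy' : y ∈ Set.Ico (0 : ℝ) 1 := ⟨ha.1.le.trans hy.1, hy.2.trans (hbc.trans hc.2)⟩
    have hz' : z ∈ Set.Ico (0 : ℝ) 1 := ⟨(ha.1.trans hab).le.trans hz.1, hz.2.trans hc.2⟩
    have h3 : ({o + (x : S1), o + (y : S1), o + (z : S1)} : Set S1).encard ≤ 2 := by
      refine (Set.encard_le_encard ?_).trans h2
      rintro w (rfl | rfl | rfl)
      · exact sx
      · exact sy
      · exact sz
    rw [Set.encard_insert_of_notMem, Set.encard_pair] at h3
    · norm_num at h3
    · exact hinj _ hy' _ hz' (hy.2.trans_le hz.1)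
    · rintro (h | h)
      · exact hinj _ hx' _ hy' (hx.2.trans_le hy.1) h
      · exact hinj _ hx' _ hz' (hx.2.trans_le (hab.le.trans hz.1)) h
  · push Not at hall
    have : {θ | p θ} = Set.univ := Set.eq_univ_of_forall hall
    rw [this]
    exact isPreconnected_univ

end IsTame

lemma isTame_ends (F : Finset Rect) (φ : S1) : IsTame
    (fun θ => endsBefore (F : Set Rect) θ φ) fun θ => endsAfter (F : Set Rect) θ φ where
  right θ := by
    filter_upwards [eventually_rects_right F θ] with t ht
    exact ⟨exists_congr fun r => and_congr_right fun hr => by rw [(ht r hr).1],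
      exists_congr fun r => and_congr_right fun hr => by rw [(ht r hr).2]⟩
  left θ := by
    filter_upwards [eventually_rects_left F θ] with t ht
    exact ⟨exists_congr fun r => and_congr_right fun hr => by rw [(ht r hr).1],
      exists_congr fun r => and_congr_right fun hr => by rw [(ht r hr).2]⟩

lemma isPreconnected_ends (P : Diagram) (φ : S1) :
    IsPreconnected {θ : S1 | ∃ c ∈ movieOf P θ, φ ∈ c} := by
  have h := (isTame_ends P.rects φ).isPreconnected (by
    refine le_trans ?_ (P.longitude_le φ)
    rw [← Function.Injective.encard_image (f := fun θ : S1 => (θ, φ)) (fun a b h => (Prod.ext_iff.1 h).1)]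
    refine Set.encard_le_encard ?_
    rintro _ ⟨θ, h, rfl⟩
    exact ⟨P.pairwiseCompatible.mem_freeVertices.2 h, rfl⟩)
  simpa only [endsBefore_iff] using h

/-! ## Chains of arcs -/

lemma inCircularOrder_of_strictMono {k : ℕ} {o : S1} {p : Fin k → S1}
    (h : StrictMono fun i => ℓ o (p i)) : InCircularOrder p := by
  refine ⟨fun i j hij => h.injective (by simp [hij]), fun i j l hij hjl => ?_⟩
  have := (mem_cIoo_iff' o (a := p i) (b := p l) (x := p j)).2 (.inl ⟨h hij, h hjl⟩)
  exact Set.mem_cIoo.1 this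

lemma exists_enumeration (V : Finset S1) (o : S1) : ∃ (k : ℕ) (p : Fin k → S1),
    (StrictMono fun i => ℓ o (p i)) ∧ ∀ x, x ∈ V ↔ ∃ i, p i = x := by
  classical
  have hc : (V.image (ℓ o)).card = V.card :=
    Finset.card_image_of_injective _ fun x y h => arc_inj.1 h
  let e := (V.image (ℓ o)).orderEmbOfFin hc
  have he : ∀ i, ∃ x ∈ V, ℓ o x = e i := fun i => by
    exact Finset.mem_image.1 ((V.image (ℓ o)).orderEmbOfFin_mem hc i)
  choose p hp1 hp2 using he
  refine ⟨_, p, fun i j hij => ?_, fun x => ⟨fun hx => ?_, ?_⟩⟩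
  · simp only [hp2]; exact e.strictMono hij
  · have : ℓ o x ∈ Set.range e := by
      rw [Finset.range_orderEmbOfFin]; exact Finset.mem_coe.2 (Finset.mem_image_of_mem _ hx)
    obtain ⟨i, hi⟩ := this
    exact ⟨i, arc_inj.1 ((hp2 i).trans hi)⟩
  · rintro ⟨i, rfl⟩; exact hp1 i

/-! ## Two-colored families of arcs meeting in end points -/

/-- The vertical sides on one meridian: those of one color are pairwise disjoint, and those of
different colors meet only in end points. -/
structure SideFamily (W : Finset Rect) (col : Rect → Prop) : Prop where
  apart : ∀ r ∈ W, ∀ q ∈ W, r ≠ q → (col r ↔ col q) → r.Apart q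
  touch : ∀ r ∈ W, ∀ q ∈ W, r ≠ q → r.Touch q

namespace SideFamily
variable {W : Finset Rect} {col : Rect → Prop}

lemma eq_of_mem_arcInt (h : SideFamily W col) {r q : Rect} (hr : r ∈ W) (hq : q ∈ W) {φ : S1}
    (h1 : r.HasEnd φ) (h2 : φ ∈ q.arcInt) : False := by
  by_cases he : r = q
  · subst he; exact h1.not_mem_arcInt h2
  · exact Rect.HasEnd.not_mem_arcInt (h.touch r hr q hq he φ h1.mem_arc (cIoo_subset_cIcc _ _ h2)).2 h2

lemma eq_of_mem_both (h : SideFamily W col) {r q : Rect} (hr : r ∈ W) (hq : q ∈ W) {φ : S1}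
    (h1 : φ ∈ r.arc) (h2 : φ ∈ q.arcInt) : r = q := by
  by_contra he
  exact Rect.HasEnd.not_mem_arcInt (h.touch r hr q hq he φ h1 (cIoo_subset_cIcc _ _ h2)).2 h2

lemma eq_of_φ₁ (h : SideFamily W col) {r q : Rect} (hr : r ∈ W) (hq : q ∈ W) (e : r.φ₁ = q.φ₁) :
    r = q := by
  have a1 := arc_pos.2 (Ne.symm r.hφ)
  have a2 := arc_pos.2 (Ne.symm q.hφ)
  rw [← e] at a2
  have b1 := arc_lt_one r.φ₁ r.φ₂
  set m := min (ℓ r.φ₁ r.φ₂) (ℓ r.φ₁ q.φ₂) / 2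
  have hm : 0 < m := by positivity
  have l1 : m < ℓ r.φ₁ r.φ₂ := by
    have := min_le_left (ℓ r.φ₁ r.φ₂) (ℓ r.φ₁ q.φ₂)
    simp only [m]; linarith
  have l2 : m < ℓ r.φ₁ q.φ₂ := by
    have := min_le_right (ℓ r.φ₁ r.φ₂) (ℓ r.φ₁ q.φ₂)
    simp only [m]; linarith
  have p := arc_add (a := r.φ₁) hm.le (l1.trans b1)
  refine h.eq_of_mem_both hr hq (φ := r.φ₁ + (m : S1)) ?_ ?_
  · exact cIoo_subset_cIcc _ _ (mem_cIoo_iff.2 (by rw [p]; exact ⟨hm, l1⟩))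
  · unfold Rect.arcInt; rw [← e]
    exact mem_cIoo_iff.2 (by rw [p]; exact ⟨hm, l2⟩)

lemma eq_of_φ₂ (h : SideFamily W col) {r q : Rect} (hr : r ∈ W) (hq : q ∈ W) (e : r.φ₂ = q.φ₂) :
    r = q := by
  have a1 := arc_pos.2 r.hφ
  have a2 := arc_pos.2 q.hφ
  rw [← e] at a2
  have b1 := arc_lt_one r.φ₂ r.φ₁
  have b2 := arc_lt_one r.φ₂ q.φ₁
  set m := max (ℓ r.φ₂ r.φ₁) (ℓ r.φ₂ q.φ₁)
  have hm : m < 1 := max_lt b1 b2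
  have l1 : ℓ r.φ₂ r.φ₁ ≤ m := le_max_left _ _
  have l2 : ℓ r.φ₂ q.φ₁ ≤ m := le_max_right _ _
  have p := arc_add (a := r.φ₂) (t := (m + 1) / 2) (by linarith) (by linarith)
  refine h.eq_of_mem_both hr hq (φ := r.φ₂ + (((m + 1) / 2 : ℝ) : S1)) ?_ ?_
  · refine cIoo_subset_cIcc _ _ ((mem_cIoo_iff' r.φ₂).2 (.inr (.inl ?_)))
    rw [p, arc_self]; exact ⟨a1, by linarith⟩
  · unfold Rect.arcInt; rw [← e]
    refine (mem_cIoo_iff' r.φ₂).2 (.inr (.inl ?_))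
    rw [p, arc_self]; exact ⟨a2, by linarith⟩

lemma col_ne (h : SideFamily W col) {r q : Rect} (hr : r ∈ W) (hq : q ∈ W) (hne : r ≠ q) {φ : S1}
    (h1 : r.HasEnd φ) (h2 : q.HasEnd φ) : col q ↔ ¬ col r := by
  have : ¬ (col r ↔ col q) := fun hc =>
    disjoint_left.1 (h.apart r hr q hq hne hc) h1.mem_arc h2.mem_arc
  tauto

lemma touch_symm_ne {r q : Rect} (h : r.φ₂ = q.φ₁) : r ≠ q := by
  rintro rfl; exact r.hφ h.symm

/-- The chords of the sides of one color. -/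
def chords (W : Finset Rect) (col : Rect → Prop) : Set (Sym2 S1) :=
  {c | ∃ r ∈ W, col r ∧ s(r.φ₁, r.φ₂) = c}

lemma exists_chain (h : SideFamily W col) (hne : W.Nonempty)
    (hfree : {φ : S1 | ∃! r, r ∈ W ∧ r.HasEnd φ}.encard ≤ 2) :
    ∃ (k : ℕ) (p : Fin k → S1) (σ : Prop), 2 ≤ k ∧ InCircularOrder p ∧
      chords W (fun r => (col r ↔ σ)) = evenChords p ∧
      (chords W (fun r => ¬ (col r ↔ σ)) = oddChords p ∨
        (Even k ∧ chords W (fun r => ¬ (col r ↔ σ)) = oddChords p ∪ closingChord p)) := by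
  classical
  set V : Finset S1 := W.image Rect.φ₁ ∪ W.image Rect.φ₂ with hV
  have hVm : ∀ φ, φ ∈ V ↔ ∃ r ∈ W, r.HasEnd φ := by
    intro φ
    simp only [hV, Finset.mem_union, Finset.mem_image, Rect.HasEnd]
    constructor
    · rintro (⟨r, hr, e⟩ | ⟨r, hr, e⟩)
      · exact ⟨r, hr, .inl e.symm⟩
      · exact ⟨r, hr, .inr e.symm⟩
    · rintro ⟨r, hr, e | e⟩
      · exact .inl ⟨r, hr, e.symm⟩
      · exact .inr ⟨r, hr, e.symm⟩
  obtain ⟨r₀, hr₀⟩ := hne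
  obtain ⟨o, ho⟩ : ∃ o : S1, (∀ r ∈ W, o ∉ r.arc) ∨ (o ∈ V ∧ ∀ x, ∃ r ∈ W, x ∈ r.arc) := by
    by_cases hg : ∃ o, ∀ r ∈ W, o ∉ r.arc
    · obtain ⟨o, ho⟩ := hg; exact ⟨o, .inl ho⟩
    · push Not at hg
      exact ⟨r₀.φ₁, .inr ⟨(hVm _).2 ⟨r₀, hr₀, .inl rfl⟩, hg⟩⟩
  obtain ⟨k, p, hp, hpV⟩ := exists_enumeration V o
  have hinj : Function.Injective p := fun i j hij => hp.injective (by simp [hij])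
  have pe : ∀ {m n : ℕ} {hm : m < k} {hn : n < k}, m = n → p ⟨m, hm⟩ = p ⟨n, hn⟩ := fun e =>
    congrArg p (Fin.ext e)
  have hlt : ∀ i j, ℓ o (p i) < ℓ o (p j) ↔ i < j := fun i j => hp.lt_iff_lt
  have idx : ∀ r ∈ W, ∃ i j, p i = r.φ₁ ∧ p j = r.φ₂ := fun r hr => by
    obtain ⟨i, hi⟩ := (hpV _).1 ((hVm _).2 ⟨r, hr, .inl rfl⟩)
    obtain ⟨j, hj⟩ := (hpV _).1 ((hVm _).2 ⟨r, hr, .inr rfl⟩)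
    exact ⟨i, j, hi, hj⟩
  have noint : ∀ r ∈ W, ∀ i, p i ∉ r.arcInt := fun r hr i hi => by
    obtain ⟨q, hq, e⟩ := (hVm _).1 ((hpV _).2 ⟨i, rfl⟩)
    exact h.eq_of_mem_arcInt hq hr e hi
  -- the two possible positions of a side
  have pos : ∀ r ∈ W, ∀ i j, p i = r.φ₁ → p j = r.φ₂ → (i < j → j.val = i.val + 1) ∧
      (j < i → i.val + 1 = k ∧ j.val = 0 ∧ o ∈ r.arc) := by
    intro r hr i j hi hj
    constructor
    · intro hij
      by_contra hne
      have hlt1 : i.val + 1 < j.val := by have : i.val < j.val := hij; omega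
      have hb : i.val + 1 < k := hlt1.trans j.2
      refine noint r hr ⟨i.val + 1, hb⟩ ((mem_cIoo_iff' o).2 (.inl ?_))
      rw [← hi, ← hj, hlt, hlt]
      exact ⟨Fin.lt_def.2 (Nat.lt_succ_self _), Fin.lt_def.2 hlt1⟩
    · intro hji
      have hji' := (hlt j i).2 hji
      have h0 : ∀ z, (i < z ∨ z < j) → False := by
        intro z hz
        refine noint r hr z ((mem_cIoo_iff' o).2 ?_)
        rw [← hi, ← hj]
        simp only [hlt]
        tauto
      refine ⟨?_, ?_, ?_⟩
      · by_contra hne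
        have : i.val + 1 < k := by have := i.2; omega
        exact h0 ⟨i.val + 1, this⟩ (.inl (Fin.lt_def.2 (Nat.lt_succ_self _)))
      · by_contra hne
        have h1 : 0 < j.val := Nat.pos_of_ne_zero hne
        exact h0 ⟨0, by omega⟩ (.inr (Fin.lt_def.2 h1))
      · refine (mem_cIcc_iff' o r.hφ).2 (.inr (.inr ?_))
        rw [← hi, ← hj, arc_self]
        exact ⟨hji', arc_nonneg _ _⟩
  have ijne : ∀ r ∈ W, ∀ i j, p i = r.φ₁ → p j = r.φ₂ → i ≠ j := by
    rintro r hr i j hi hj rfl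
    exact r.hφ (hi.symm.trans hj)
  have hk2 : 2 ≤ k := by
    obtain ⟨i, j, hi, hj⟩ := idx r₀ hr₀
    have := ijne r₀ hr₀ i j hi hj
    have : i.val ≠ j.val := fun e => this (Fin.ext e)
    omega
  -- presence of the consecutive sides
  have pres : ∀ (i : ℕ) (hi : i + 1 < k),
      ∃ r ∈ W, r.φ₁ = p ⟨i, by omega⟩ ∧ r.φ₂ = p ⟨i + 1, hi⟩ := by
    intro i hi
    rcases ho with ho | ⟨hoV, hcov⟩
    · by_contra hnot
      have fwd : ∀ r ∈ W, ∀ a b, p a = r.φ₁ → p b = r.φ₂ → b.val = a.val + 1 := by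
        intro r hr a b ha hb
        rcases lt_or_gt_of_ne (ijne r hr a b ha hb) with hl | hl
        · exact (pos r hr a b ha hb).1 hl
        · exact absurd ((pos r hr a b ha hb).2 hl).2.2 (ho r hr)
      have free1 : ∀ a : Fin k, (∀ r ∈ W, r.φ₁ ≠ p a) → ∃! r, r ∈ W ∧ r.HasEnd (p a) := by
        intro a ha
        obtain ⟨r, hr, e⟩ := (hVm _).1 ((hpV _).2 ⟨a, rfl⟩)
        exact ⟨r, ⟨hr, e⟩, fun q ⟨hq, e'⟩ => h.eq_of_φ₂ hq hr
          ((e'.resolve_left (ha q hq).symm).symm.trans (e.resolve_left (ha r hr).symm))⟩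
      have free2 : ∀ a : Fin k, (∀ r ∈ W, r.φ₂ ≠ p a) → ∃! r, r ∈ W ∧ r.HasEnd (p a) := by
        intro a ha
        obtain ⟨r, hr, e⟩ := (hVm _).1 ((hpV _).2 ⟨a, rfl⟩)
        exact ⟨r, ⟨hr, e⟩, fun q ⟨hq, e'⟩ => h.eq_of_φ₁ hq hr
          ((e'.resolve_right (ha q hq).symm).symm.trans (e.resolve_right (ha r hr).symm))⟩
      have n0 : ∀ r ∈ W, r.φ₂ ≠ p ⟨0, by omega⟩ := by
        intro r hr e
        obtain ⟨a, b, ha, hb⟩ := idx r hr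
        have h1 := fwd r hr a b ha hb
        have h2 : b.val = 0 := congrArg Fin.val (hinj (hb.trans e))
        omega
      have n1 : ∀ r ∈ W, r.φ₁ ≠ p ⟨i, by omega⟩ := by
        intro r hr e
        obtain ⟨a, b, ha, hb⟩ := idx r hr
        have h1 := fwd r hr a b ha hb
        have h2 : a.val = i := congrArg Fin.val (hinj (ha.trans e))
        exact hnot ⟨r, hr, e, hb.symm.trans (pe (by omega))⟩
      have n2 : ∀ r ∈ W, r.φ₂ ≠ p ⟨i + 1, hi⟩ := by
        intro r hr e
        obtain ⟨a, b, ha, hb⟩ := idx r hr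
        have h1 := fwd r hr a b ha hb
        have h2 : b.val = i + 1 := congrArg Fin.val (hinj (hb.trans e))
        exact n1 r hr (ha.symm.trans (pe (by omega)))
      have hi0 : i ≠ 0 := by
        rintro rfl
        obtain ⟨r, hr, e | e⟩ := (hVm _).1 ((hpV _).2 ⟨⟨0, by omega⟩, rfl⟩)
        · exact n1 r hr e.symm
        · exact n0 r hr e.symm
      have h3 : ({p ⟨0, by omega⟩, p ⟨i, by omega⟩, p ⟨i + 1, hi⟩} : Set S1).encard ≤ 2 := by
        refine (Set.encard_le_encard ?_).trans hfree
        rintro w (rfl | rfl | rfl)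
        · exact free2 _ n0
        · exact free1 _ n1
        · exact free2 _ n2
      rw [Set.encard_insert_of_notMem, Set.encard_pair] at h3
      · norm_num at h3
      · exact fun e => by simpa using hinj e
      · rintro (e | e) <;> have := Fin.val_eq_of_eq (hinj e) <;> simp at this; omega
    · have hl : ℓ o (p ⟨i, by omega⟩) < ℓ o (p ⟨i + 1, hi⟩) :=
        (hlt _ _).2 (Fin.lt_def.2 (Nat.lt_succ_self _))
      set u := ℓ o (p ⟨i, by omega⟩) with hu
      set v := ℓ o (p ⟨i + 1, hi⟩) with hv
      have hu0 : 0 ≤ u := arc_nonneg _ _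
      have hv1 : v < 1 := arc_lt_one _ _
      have hm := arc_add (a := o) (t := (u + v) / 2) (by linarith) (by linarith)
      obtain ⟨r, hr, hx⟩ := hcov (o + (((u + v) / 2 : ℝ) : S1))
      obtain ⟨a, b, ha, hb⟩ := idx r hr
      rw [Rect.arc, mem_cIcc_iff' o r.hφ, hm, ← ha, ← hb] at hx
      have hup : ∀ a : Fin k, (u + v) / 2 ≤ ℓ o (p a) → i + 1 ≤ a.val := by
        intro a h1
        have : u < ℓ o (p a) := by linarith
        have := (hlt _ _).1 this
        exact Fin.lt_def.1 this
      have hdn : ∀ a : Fin k, ℓ o (p a) ≤ (u + v) / 2 → a.val ≤ i := by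
        intro a h1
        have : ℓ o (p a) < v := by linarith
        have := Fin.lt_def.1 ((hlt _ _).1 this)
        simp only at this; omega
      rcases lt_or_gt_of_ne (ijne r hr a b ha hb) with hl' | hl'
      · have h1 := (pos r hr a b ha hb).1 hl'
        have h2 := (hlt a b).2 hl'
        have hx1 : ℓ o (p a) ≤ (u + v) / 2 ∧ (u + v) / 2 ≤ ℓ o (p b) := by grind
        have h3 := hup b hx1.2
        have h4 := hdn a hx1.1
        exact ⟨r, hr, ha.symm.trans (pe (by omega)), hb.symm.trans (pe (by omega))⟩
      · have h1 := (pos r hr a b ha hb).2 hl'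
        have h2 := (hlt b a).2 hl'
        exfalso
        rcases hx with hx | hx | hx
        · linarith
        · have := hdn a hx.2; omega
        · have := hup b hx.2; omega
  have pres' : ∀ i : ℕ, ∃ r : Rect, ∀ hi : i + 1 < k,
      r ∈ W ∧ r.φ₁ = p ⟨i, by omega⟩ ∧ r.φ₂ = p ⟨i + 1, hi⟩ := fun i => by
    by_cases hi : i + 1 < k
    · obtain ⟨r, hr⟩ := pres i hi; exact ⟨r, fun _ => hr⟩
    · exact ⟨r₀, fun h' => absurd h' hi⟩
  choose side hsides using pres'
  have hside : ∀ i, i + 1 < k → side i ∈ W := fun i hi => (hsides i hi).1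
  have h1side : ∀ i (hi : i + 1 < k), (side i).φ₁ = p ⟨i, by omega⟩ := fun i hi => (hsides i hi).2.1
  have h2side : ∀ i (hi : i + 1 < k), (side i).φ₂ = p ⟨i + 1, hi⟩ := fun i hi => (hsides i hi).2.2
  have alt : ∀ i (hi : i + 1 < k), col (side i) ↔ (col (side 0) ↔ Even i) := by
    intro i
    induction i with
    | zero => intro _; simp
    | succ n ih =>
      intro hi
      have hn := ih (by omega)
      have e : (side n).φ₂ = (side (n + 1)).φ₁ := by
        rw [h2side n (by omega), h1side (n + 1) hi]
      have := h.col_ne (hside n (by omega)) (hside (n + 1) hi) (touch_symm_ne e) (.inr rfl)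
        (.inl e)
      rw [this, hn, Nat.even_add_one]
      tauto
  have fwdside : ∀ r ∈ W, ∀ a b, p a = r.φ₁ → p b = r.φ₂ → b.val = a.val + 1 →
      r = side a.val := by
    intro r hr a b ha hb hab
    have hi : a.val + 1 < k := hab ▸ b.2
    exact h.eq_of_φ₁ hr (hside _ hi) (by rw [h1side _ hi, ← ha])
  have hev : ∀ (r : Rect), r ∈ W → (∃ i, ∃ hi : i + 1 < k, r = side i) ∨
      (r.φ₁ = p ⟨k - 1, by omega⟩ ∧ r.φ₂ = p ⟨0, by omega⟩) := by
    intro r hr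
    obtain ⟨a, b, ha, hb⟩ := idx r hr
    rcases lt_or_gt_of_ne (ijne r hr a b ha hb) with hl | hl
    · have h1 := (pos r hr a b ha hb).1 hl
      exact .inl ⟨a.val, h1 ▸ b.2, fwdside r hr a b ha hb h1⟩
    · have h1 := (pos r hr a b ha hb).2 hl
      exact .inr ⟨ha.symm.trans (pe (by omega)), hb.symm.trans (pe (by omega))⟩
  have altσ : ∀ i (hi : i + 1 < k), ((col (side i) ↔ col (side 0)) ↔ Even i) := by
    intro i hi
    rw [alt i hi]; tauto
  have ch : ∀ (D : Rect → Prop) (E : ℕ → Prop), (∀ i, i + 1 < k → (D (side i) ↔ E i)) →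
      chords W D = {c | ∃ i j : Fin k, E i.val ∧ j.val = i.val + 1 ∧ c = s(p i, p j)} ∪
        {c | ∃ r ∈ W, D r ∧ (r.φ₁ = p ⟨k - 1, by omega⟩ ∧ r.φ₂ = p ⟨0, by omega⟩) ∧
          s(r.φ₁, r.φ₂) = c} := by
    intro D E hD
    ext c
    constructor
    · rintro ⟨r, hr, hc, rfl⟩
      rcases hev r hr with ⟨i, hi, rfl⟩ | h'
      · exact .inl ⟨⟨i, by omega⟩, ⟨i + 1, hi⟩, (hD i hi).1 hc, rfl, by rw [h1side _ hi, h2side _ hi]⟩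
      · exact .inr ⟨r, hr, hc, h', rfl⟩
    · rintro (⟨i, j, h1, h2, rfl⟩ | ⟨r, hr, hc, -, rfl⟩)
      · have hi : i.val + 1 < k := h2 ▸ j.2
        refine ⟨side i, hside _ hi, (hD _ hi).2 h1, ?_⟩
        rw [h1side _ hi, h2side _ hi]
        exact congrArg (fun z => s(p i, p z)) (Fin.ext h2.symm)
      · exact ⟨r, hr, hc, rfl⟩
  have cq : ∀ q ∈ W, q.φ₁ = p ⟨k - 1, by omega⟩ ∧ q.φ₂ = p ⟨0, by omega⟩ →
      Even k ∧ ¬ (col q ↔ col (side 0)) := by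
    intro q hq ⟨hq1, hq2⟩
    have c1 : col q ↔ ¬ col (side 0) := by
      have e : q.φ₂ = (side 0).φ₁ := by rw [hq2, h1side 0 (by omega)]
      exact h.col_ne (hside 0 (by omega)) hq (touch_symm_ne e).symm (.inl rfl) (.inr e.symm)
    have c2 : col q ↔ ¬ col (side (k - 2)) := by
      have e : (side (k - 2)).φ₂ = q.φ₁ := by
        rw [h2side (k - 2) (by omega), hq1]; exact pe (by omega)
      exact h.col_ne (hside (k - 2) (by omega)) hq (touch_symm_ne e) (.inr rfl) (.inl e)
    have h4 : Even (k - 2) := (altσ (k - 2) (by omega)).1 (not_iff_not.1 (c2.symm.trans c1))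
    refine ⟨?_, by tauto⟩
    rw [show k = k - 2 + 2 by omega]; exact h4.add even_two
  have odd := ch (fun r => ¬ (col r ↔ col (side 0))) Odd fun i hi => by
    rw [altσ i hi, Nat.not_even_iff_odd]
  refine ⟨k, p, col (side 0), hk2, inCircularOrder_of_strictMono hp, ?_, ?_⟩
  · rw [ch _ Even altσ]
    refine (Set.union_eq_left (s := evenChords p)).2 ?_
    rintro c ⟨q, hq, hc, h', -⟩
    exact ((cq q hq h').2 hc).elim
  by_cases hclose : ∃ r ∈ W, r.φ₁ = p ⟨k - 1, by omega⟩ ∧ r.φ₂ = p ⟨0, by omega⟩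
  · obtain ⟨q, hq, h'⟩ := hclose
    refine .inr ⟨(cq q hq h').1, odd.trans (congrArg (oddChords p ∪ ·) (Set.ext fun c => ⟨?_, ?_⟩))⟩
    · rintro ⟨r, -, -, h', rfl⟩
      exact ⟨⟨k - 1, by omega⟩, ⟨0, by omega⟩, by simp; omega, rfl, by rw [h'.1, h'.2]⟩
    · rintro ⟨i, j, h1, h2, rfl⟩
      exact ⟨q, hq, (cq q hq h').2, h', by rw [h'.1, h'.2, pe (show k - 1 = i.1 by omega), pe h2.symm]⟩
  · refine .inl (odd.trans ((Set.union_eq_left (s := oddChords p)).2 ?_))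
    rintro c ⟨q, hq, -, h', -⟩
    exact (hclose ⟨q, hq, h'⟩).elim

end SideFamily

/-! ## The movie of a diagram is a movie diagram -/

open Classical in
/-- The rectangles of a diagram having a vertical side on the given meridian. -/
def sidesAt (P : Diagram) (θ : S1) : Finset Rect := P.rects.filter fun r => θ = r.θ₁ ∨ θ = r.θ₂

lemma mem_sidesAt {P : Diagram} {θ : S1} {r : Rect} :
    r ∈ sidesAt P θ ↔ r ∈ P.rects ∧ (θ = r.θ₁ ∨ θ = r.θ₂) := by
  classical
  simp [sidesAt]

lemma sideFamily_sidesAt (P : Diagram) (θ : S1) :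
    SideFamily (sidesAt P θ) fun r => θ = r.θ₂ where
  apart r hr q hq hne hc := by
    obtain ⟨hr, h1⟩ := mem_sidesAt.1 hr
    obtain ⟨hq, h2⟩ := mem_sidesAt.1 hq
    have h := (P.compatible r hr q hq hne).localAt θ
    by_cases e : θ = r.θ₂
    · exact h.both_end e (hc.1 e)
    · exact h.both_start (h1.resolve_right e) (h2.resolve_right fun e' => e (hc.2 e'))
  touch r hr q hq hne := by
    obtain ⟨hr, h1⟩ := mem_sidesAt.1 hr
    obtain ⟨hq, h2⟩ := mem_sidesAt.1 hq
    have h := (P.compatible r hr q hq hne).localAt θ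
    have ha : r.Apart q → r.Touch q := fun ha φ a b => absurd b (disjoint_left.1 ha a)
    rcases h1 with h1 | h1 <;> rcases h2 with h2 | h2
    · exact ha (h.both_start h1 h2)
    · exact h.start_end h1 h2
    · exact h.end_start h1 h2
    · exact ha (h.both_end h1 h2)

lemma mem_vertices_iff_sidesAt {P : Diagram} {θ φ : S1} {r : Rect} :
    (r ∈ P.rects ∧ (θ, φ) ∈ r.vertices) ↔ r ∈ sidesAt P θ ∧ r.HasEnd φ := by
  rw [mem_sidesAt, Rect.mem_vertices, and_assoc]; rfl

lemma replaces_after (P : Diagram) (θ : S1) :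
    Replaces (movieOf P θ) (movieAfter P θ) (SideFamily.chords (sidesAt P θ) fun r => θ = r.θ₂)
      (SideFamily.chords (sidesAt P θ) fun r => ¬ θ = r.θ₂) := by
  constructor
  · rintro c ⟨r, hr, e, rfl⟩
    exact mem_movieOf.2 ⟨r, (mem_sidesAt.1 hr).1, e ▸ r.L_right, rfl⟩
  · ext c
    simp only [Finset.mem_coe, Set.mem_union, Set.mem_sdiff, SideFamily.chords, Set.mem_ofPred_eq]
    rw [mem_movieAfter, mem_movieOf]
    constructor
    · rintro ⟨r, hr, h1, rfl⟩
      by_cases hL : r.L θ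
      · refine .inl ⟨⟨r, hr, hL, rfl⟩, ?_⟩
        rintro ⟨q, hq, e, he⟩
        have : q = r := P.pairwiseCompatible.eq_of_L (mem_sidesAt.1 hq).1 hr (θ := θ)
          (e ▸ q.L_right) hL (.inl rfl) (Rect.mem_chord.1 (he ▸ Sym2.mem_mk_left _ _))
        subst this
        rw [e] at h1; exact q.not_R_right h1
      · have e := r.start_iff.1 ⟨hL, h1⟩
        exact .inr ⟨r, mem_sidesAt.2 ⟨hr, .inl e⟩, fun e' => r.hθ (e.symm.trans e'), rfl⟩
    · rintro (⟨⟨r, hr, hL, rfl⟩, h2⟩ | ⟨r, hr, e, rfl⟩)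
      · by_cases hR : r.R θ
        · exact ⟨r, hr, hR, rfl⟩
        · have e := r.end_iff.1 ⟨hL, hR⟩
          exact absurd ⟨r, mem_sidesAt.2 ⟨hr, .inr e⟩, e, rfl⟩ h2
      · obtain ⟨hr, h1⟩ := mem_sidesAt.1 hr
        exact ⟨r, hr, (h1.resolve_right e) ▸ r.R_left, rfl⟩

lemma replaces_before (P : Diagram) (θ : S1) :
    Replaces (movieAfter P θ) (movieOf P θ) (SideFamily.chords (sidesAt P θ) fun r => ¬ θ = r.θ₂)
      (SideFamily.chords (sidesAt P θ) fun r => θ = r.θ₂) := by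
  constructor
  · rintro c ⟨r, hr, e, rfl⟩
    obtain ⟨hr, h1⟩ := mem_sidesAt.1 hr
    exact mem_movieAfter.2 ⟨r, hr, (h1.resolve_right e) ▸ r.R_left, rfl⟩
  · ext c
    simp only [Finset.mem_coe, Set.mem_union, Set.mem_sdiff, SideFamily.chords, Set.mem_ofPred_eq]
    rw [mem_movieAfter, mem_movieOf]
    constructor
    · rintro ⟨r, hr, h1, rfl⟩
      by_cases hR : r.R θ
      · refine .inl ⟨⟨r, hr, hR, rfl⟩, ?_⟩
        rintro ⟨q, hq, e, he⟩
        have e1 := (mem_sidesAt.1 hq).2.resolve_right e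
        have : q = r := P.pairwiseCompatible.eq_of_R (mem_sidesAt.1 hq).1 hr (θ := θ)
          (e1 ▸ q.R_left) hR (.inl rfl) (Rect.mem_chord.1 (he ▸ Sym2.mem_mk_left _ _))
        subst this
        rw [e1] at h1; exact q.not_L_left h1
      · have e := r.end_iff.1 ⟨h1, hR⟩
        exact .inr ⟨r, mem_sidesAt.2 ⟨hr, .inr e⟩, e, rfl⟩
    · rintro (⟨⟨r, hr, hR, rfl⟩, h2⟩ | ⟨r, hr, e, rfl⟩)
      · by_cases hL : r.L θ
        · exact ⟨r, hr, hL, rfl⟩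
        · have e := r.start_iff.1 ⟨hL, hR⟩
          exact absurd ⟨r, mem_sidesAt.2 ⟨hr, .inl e⟩, fun e' => r.hθ (e.symm.trans e'), rfl⟩ h2
      · exact ⟨r, (mem_sidesAt.1 hr).1, e ▸ r.L_right, rfl⟩

lemma closingChord_two {p : Fin 2 → S1} : closingChord p = evenChords p := by
  ext c
  constructor
  · rintro ⟨i, j, h1, h2, rfl⟩
    exact ⟨j, i, by simp [h2], by omega, Sym2.eq_swap⟩
  · rintro ⟨i, j, h1, h2, rfl⟩
    exact ⟨j, i, by omega, by omega, Sym2.eq_swap⟩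

lemma oddChords_two {p : Fin 2 → S1} : oddChords p = ∅ := by
  ext c
  simp only [Set.mem_empty_iff_false, iff_false]
  rintro ⟨i, j, h1, h2, rfl⟩
  have : i.val = 0 := by omega
  rw [this] at h1
  exact absurd h1 (by decide)

lemma Replaces.eq_of_closed_two {C D : Finset (Sym2 S1)} {p : Fin 2 → S1}
    (h : Replaces C D (evenChords p) (oddChords p ∪ closingChord p)) : C = D := by
  have := h.2
  rw [oddChords_two, closingChord_two, Set.empty_union, Set.sdiff_union_of_subset h.1] at this
  exact (Finset.coe_injective this).symm

lemma admissibleEvent_movieOf (P : Diagram) (θ : S1) (hne : movieAfter P θ ≠ movieOf P θ) :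
    AdmissibleEvent (movieOf P θ) (movieAfter P θ) := by
  have hocc : P.OccupiedMeridian θ := by
    by_contra h; exact hne (movieAfter_eq_movieOf h)
  obtain ⟨r, hr, h1⟩ := Diagram.occupiedMeridian_iff.1 hocc
  obtain ⟨k, p, σ, hk, hp, hA, hB⟩ := (sideFamily_sidesAt P θ).exists_chain
    ⟨r, mem_sidesAt.2 ⟨hr, h1⟩⟩ (by
      refine le_trans ?_ (P.meridian_le θ)
      rw [← Function.Injective.encard_image (f := fun φ : S1 => (θ, φ))
        (fun a b h => (Prod.ext_iff.1 h).2)]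
      refine Set.encard_le_encard ?_
      rintro _ ⟨φ, h, rfl⟩
      refine ⟨?_, rfl⟩
      change ∃! r, r ∈ P.rects ∧ (θ, φ) ∈ r.vertices
      simpa only [mem_vertices_iff_sidesAt, Set.mem_ofPred_eq] using h)
  have repl : ∀ {C D : Finset (Sym2 S1)} {S : Set (Sym2 S1)}, C ≠ D → Replaces C D (evenChords p) S →
      (S = oddChords p ∨ (Even k ∧ S = oddChords p ∪ closingChord p)) → ElementaryReplacement C D := by
    rintro C D S hCD h (rfl | ⟨hev, rfl⟩)
    · exact ⟨k, p, hk, hp, .inl h⟩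
    · refine ⟨k, p, hk, hp, .inr ⟨?_, hev, h⟩⟩
      by_contra hk4
      have : k = 2 := by obtain ⟨m, hm⟩ := hev; omega
      subst this
      exact hCD h.eq_of_closed_two
  by_cases hσ : σ
  · simp only [hσ, iff_true] at hA hB
    exact .inl (repl hne.symm (hA ▸ replaces_after P θ) hB)
  · simp only [hσ, iff_false, not_not] at hA hB
    exact .inr (repl hne (hA ▸ replaces_before P θ) hB)

lemma map_neg_nhdsGT_zero : map (fun t : ℝ => -t) (𝓝[>] 0) = 𝓝[<] 0 := by simp

lemma isMovieDiagram_movieOf (P : Diagram) : IsMovieDiagram (movieOf P) where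
  nonCrossing := isNonCrossing_movieOf P
  left_continuous θ := by
    rw [tendsto_pure, ← map_neg_nhdsGT_zero, eventually_map]
    filter_upwards [movieOf_left P θ] with t ht
    rw [AddCircle.coe_neg, ← sub_eq_add_neg]; exact ht
  finite_discontinuities := by
    refine P.finite_occupied.subset fun θ h => ?_
    by_contra hn
    exact h (tendsto_movieOf (movieAfter_eq_movieOf hn))
  event θ h := by
    refine ⟨movieAfter P θ, tendsto_pure.2 (movieOf_right P θ), admissibleEvent_movieOf P θ ?_⟩
    exact fun h' => h (tendsto_movieOf h')

/-! ## Diagrams from moving families of arcs -/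

namespace IsTame
variable {p q : S1 → Prop}

lemma exists_end (h : IsTame p q) {θ : S1} (hθ : p θ) (hn : ∃ x, ¬ p x) :
    ∃ t : ℝ, 0 ≤ t ∧ t < 1 ∧ p (θ + (t : S1)) ∧ ¬ q (θ + (t : S1)) ∧
      ∀ s : ℝ, 0 ≤ s → s < t → q (θ + (s : S1)) ∧ p (θ + (s : S1)) := by
  obtain ⟨x, hx⟩ := hn
  set S : Set ℝ := {t | 0 ≤ t ∧ ¬ q (θ + (t : S1))} with hS
  have hbdd : BddBelow S := ⟨0, fun t ht => ht.1⟩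
  have hx0 : 0 < ℓ θ x := arc_pos.2 (by rintro rfl; exact hx hθ)
  have hmem : ∃ t ∈ S, t < 1 := by
    obtain ⟨t, ht, h0, h1⟩ := ((h.left x).and (eventually_small hx0)).exists
    refine ⟨ℓ θ x - t, ⟨by linarith, ?_⟩, by linarith [arc_lt_one θ x]⟩
    rw [AddCircle.coe_sub, ← add_sub_assoc, add_arc, ht.2]; exact hx
  obtain ⟨t₁, ht₁, ht₁'⟩ := hmem
  set t := sInf S with ht
  have h0 : 0 ≤ t := le_csInf ⟨t₁, ht₁⟩ fun s hs => hs.1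
  have hlt : ∀ s : ℝ, 0 ≤ s → s < t → q (θ + (s : S1)) := fun s hs hst => by
    by_contra hq
    exact absurd (csInf_le hbdd (show s ∈ S from ⟨hs, hq⟩)) (not_le.2 hst)
  have hnq : ¬ q (θ + (t : S1)) := by
    intro hq
    obtain ⟨δ, hδ, hall⟩ := mem_nhdsGT_iff_exists_Ioo_subset.1 (h.right (θ + (t : S1)))
    have : t + δ ≤ t := le_csInf ⟨t₁, ht₁⟩ fun s hs => by
      by_contra hlt'
      push Not at hlt'
      have h1 : t ≤ s := csInf_le hbdd hs
      rcases h1.eq_or_lt with e | h2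
      · exact hs.2 (e ▸ hq)
      · have h3 := (hall (show s - t ∈ Set.Ioo 0 δ from ⟨by linarith, by linarith⟩)).2
        rw [add_assoc, ← AddCircle.coe_add, add_sub_cancel] at h3
        exact hs.2 (h3.2 hq)
    have : 0 < δ := hδ
    linarith
  have hp : ∀ s : ℝ, 0 ≤ s → s ≤ t → p (θ + (s : S1)) := by
    intro s hs hst
    rcases hs.eq_or_lt with e | hs'
    · rw [← e]; simpa using hθ
    · obtain ⟨u, hu, hu0, hu1⟩ := ((h.left (θ + (s : S1))).and (eventually_small hs')).exists
      have := hlt (s - u) (by linarith) (by linarith)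
      rw [AddCircle.coe_sub, ← add_sub_assoc] at this
      exact hu.2.1 this
  exact ⟨t, h0, (csInf_le hbdd ht₁).trans_lt ht₁', hp t h0 le_rfl, hnq,
    fun s hs hst => ⟨hlt s hs hst, hp s hs hst.le⟩⟩

lemma neg (h : IsTame p q) : IsTame (fun θ => q (-θ)) fun θ => p (-θ) where
  right θ := by
    filter_upwards [h.left (-θ)] with t ht
    rw [neg_add, ← sub_eq_add_neg]; exact ⟨ht.2, ht.1⟩
  left θ := by
    filter_upwards [h.right (-θ)] with t ht
    rw [neg_sub, sub_eq_add_neg, add_comm]; exact ⟨ht.2, ht.1⟩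

lemma exists_start (h : IsTame p q) {θ : S1} (hθ : q θ) (hn : ∃ x, ¬ q x) :
    ∃ t : ℝ, 0 ≤ t ∧ t < 1 ∧ q (θ - (t : S1)) ∧ ¬ p (θ - (t : S1)) ∧
      ∀ s : ℝ, 0 ≤ s → s < t → q (θ - (s : S1)) ∧ p (θ - (s : S1)) := by
  obtain ⟨x, hx⟩ := hn
  obtain ⟨t, h0, h1, h2, h3, h4⟩ := h.neg.exists_end (θ := -θ) (by simpa using hθ)
    ⟨-x, by simpa using hx⟩
  have e : ∀ s : ℝ, -(-θ + (s : S1)) = θ - (s : S1) := fun s => by abel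
  rw [e] at h2 h3
  refine ⟨t, h0, h1, h2, h3, fun s hs hst => ?_⟩
  have := h4 s hs hst
  rw [e] at this
  exact this.symm

lemma exists_not_right (h : IsTame p q) (hn : ∃ x, ¬ p x) : ∃ x, ¬ q x := by
  obtain ⟨x, hx⟩ := hn
  obtain ⟨t, ht⟩ := (h.left x).exists
  exact ⟨_, fun hq => hx (ht.2.1 hq)⟩

lemma exists_interval (h : IsTame p q) {θ : S1} (hθ : p θ) (hn : ∃ x, ¬ p x) :
    ∃ x y : S1, x ≠ y ∧ θ ∈ hIoc x y ∧ ¬ p x ∧ q x ∧ p y ∧ ¬ q y ∧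
      ∀ z ∈ cIoo x y, p z ∧ q z := by
  obtain ⟨t, t0, t1, pt, qt, ht⟩ := h.exists_end hθ hn
  obtain ⟨δ, hδ, hall⟩ := mem_nhdsGT_iff_exists_Ioo_subset.1 (h.left θ)
  have hδ' : 0 < δ := hδ
  have hl : ∀ u : ℝ, 0 < u → u < δ → p (θ - (u : S1)) ∧ q (θ - (u : S1)) := fun u h0 h1 =>
    ⟨(hall ⟨h0, h1⟩).1.2 hθ, (hall ⟨h0, h1⟩).2.2 hθ⟩
  obtain ⟨s', s0', s1', qs, ps, hs'⟩ := h.exists_start (hl (δ / 2) (by linarith) (by linarith)).2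
    (h.exists_not_right hn)
  have e : ∀ s : ℝ, θ - ((δ / 2 : ℝ) : S1) - (s : S1) = θ - ((δ / 2 + s : ℝ) : S1) := fun s => by
    rw [AddCircle.coe_add]; abel
  rw [e] at qs ps
  obtain ⟨s, hs⟩ : ∃ s, s = δ / 2 + s' := ⟨_, rfl⟩
  rw [← hs] at qs ps
  have hb : ∀ u : ℝ, 0 < u → u < s → p (θ - (u : S1)) ∧ q (θ - (u : S1)) := by
    intro u h0 h1
    by_cases hu : u < δ
    · exact hl u h0 hu
    · have := hs' (u - δ / 2) (by linarith) (by linarith)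
      rw [e, add_sub_cancel] at this
      exact this.symm
  have hst : s + t < 1 := by
    by_contra hge
    push Not at hge
    have e1 : θ - ((1 - t : ℝ) : S1) = θ + (t : S1) := by
      rw [AddCircle.coe_sub, AddCircle.coe_period]; abel
    rcases (show 1 - t ≤ s by linarith).eq_or_lt with h1 | h1
    · rw [← h1, e1] at ps; exact ps pt
    · have := (hb (1 - t) (by linarith) h1).2
      rw [e1] at this; exact qt this
  have hs0 : 0 < s := by linarith
  have hℓ : ∀ u : ℝ, 0 ≤ u → u < 1 →
      ℓ (θ - (s : S1)) (θ - (s : S1) + (u : S1)) = u := fun u => arc_add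
  have hy : θ + (t : S1) = θ - (s : S1) + ((s + t : ℝ) : S1) := by
    rw [AddCircle.coe_add]; abel
  have hθ' : θ = θ - (s : S1) + (s : S1) := by abel
  have hne : θ - (s : S1) ≠ θ + (t : S1) := by
    rw [hy]; intro h1
    have := hℓ (s + t) (by linarith) hst
    rw [← h1, arc_self] at this; linarith
  refine ⟨θ - (s : S1), θ + (t : S1), hne, ?_, ps, qs, pt, qt, fun z hz => ?_⟩
  · rw [mem_hIoc_iff hne, hy, hℓ _ (by linarith) hst]
    have := hℓ s hs0.le (by linarith)
    rw [← hθ'] at this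
    rw [this]; constructor <;> linarith
  · rw [mem_cIoo_iff, hy, hℓ _ (by linarith) hst] at hz
    have hz' := add_arc (θ - (s : S1)) z
    set u := ℓ (θ - (s : S1)) z
    by_cases h1 : u < s
    · have := hb (s - u) (by linarith) (by linarith)
      rwa [show θ - ((s - u : ℝ) : S1) = z by rw [← hz', AddCircle.coe_sub]; abel] at this
    · have := ht (u - s) (by linarith) (by linarith)
      rw [show θ + ((u - s : ℝ) : S1) = z by rw [← hz', AddCircle.coe_sub]; abel] at this
      exact this.symm

lemma finite_switch (h : IsTame p q) : {θ | ¬ (p θ ↔ q θ)}.Finite := by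
  have key : ∀ θ, ∃ U ∈ 𝓝 θ, (U ∩ {θ | ¬ (p θ ↔ q θ)}).Finite := by
    intro θ
    have : ∀ᶠ z in 𝓝 θ, z ∈ {θ | ¬ (p θ ↔ q θ)} → z = θ := by
      rw [eventually_nhds_circle]
      refine ⟨fun _ => rfl, ?_, ?_⟩
      · filter_upwards [h.right θ] with t ht h1
        exact absurd (ht.1.trans ht.2.symm) h1
      · filter_upwards [h.left θ] with t ht h1
        exact absurd (ht.1.trans ht.2.symm) h1
    exact ⟨_, this, (Set.finite_singleton θ).subset fun z hz => hz.1 hz.2⟩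
  choose U hU hf using key
  obtain ⟨t, ht⟩ := isCompact_univ.elim_nhds_subcover U fun θ _ => hU θ
  refine (t.finite_toSet.biUnion fun θ _ => hf θ).subset fun z hz => ?_
  obtain ⟨θ, h1, h2⟩ := Set.mem_iUnion₂.1 (ht.2 (Set.mem_univ z))
  exact Set.mem_iUnion₂.2 ⟨θ, h1, h2, hz⟩

end IsTame

/-- `ML a b θ` and `MR a b θ` say that the arc `[a;b]` is selected immediately before and,
respectively, immediately after the moment `θ`. -/
structure ArcFamily (ML MR : S1 → S1 → S1 → Prop) : Prop where
  tame : ∀ a b, IsTame (ML a b) (MR a b)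
  finite : {c : S1 × S1 | ∃ θ, ML c.1 c.2 θ}.Finite
  ne : ∀ a b θ, ML a b θ → a ≠ b
  never : ∀ a b, ∃ θ, ¬ ML a b θ

/-- The arc of `r` is selected exactly during the time interval of `r`, maximal with this property. -/
structure IsSpell (ML MR : S1 → S1 → S1 → Prop) (r : Rect) : Prop where
  start : ¬ ML r.φ₁ r.φ₂ r.θ₁
  finish : ¬ MR r.φ₁ r.φ₂ r.θ₂
  left : ∀ θ, r.L θ → ML r.φ₁ r.φ₂ θ
  right : ∀ θ, r.R θ → MR r.φ₁ r.φ₂ θ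

lemma Rect.ext' {r q : Rect} (h1 : r.θ₁ = q.θ₁) (h2 : r.θ₂ = q.θ₂) (h3 : r.φ₁ = q.φ₁)
    (h4 : r.φ₂ = q.φ₂) : r = q := by
  cases r; cases q; simp_all

lemma IsSpell.eq_of_L {ML MR : S1 → S1 → S1 → Prop} {r q : Rect} (hr : IsSpell ML MR r)
    (hq : IsSpell ML MR q) (h1 : r.φ₁ = q.φ₁) (h2 : r.φ₂ = q.φ₂) {θ : S1} (hL : r.L θ)
    (hL' : q.L θ) : r = q := by
  have hs := hr.start
  have hf := hr.finish
  rw [h1, h2] at hs hf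
  have e1 : ¬ q.L r.θ₁ := fun h => hs (hq.left _ h)
  have e2 : ¬ q.R r.θ₂ := fun h => hf (hq.right _ h)
  have hs' := hq.start
  have hf' := hq.finish
  rw [← h1, ← h2] at hs' hf'
  have e3 : ¬ r.L q.θ₁ := fun h => hs' (hr.left _ h)
  have e4 : ¬ r.R q.θ₂ := fun h => hf' (hr.right _ h)
  simp only [Rect.L, Rect.R] at hL hL' e1 e2 e3 e4
  have hrθ := r.hθ
  have hqθ := q.hθ
  rw [ne_eq, ← arc_inj (o := θ)] at hrθ hqθ
  rw [mem_hIoc_iff' θ r.hθ] at hL e3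
  rw [mem_hIoc_iff' θ q.hθ] at hL' e1
  rw [mem_hIco_iff' θ r.hθ] at e4
  rw [mem_hIco_iff' θ q.hθ] at e2
  rw [arc_self] at hL hL'
  have p1 := arc_nonneg θ r.θ₁
  have p2 := arc_nonneg θ r.θ₂
  have p3 := arc_nonneg θ q.θ₁
  have p4 := arc_nonneg θ q.θ₂
  refine Rect.ext' (arc_inj (o := θ).1 ?_) (arc_inj (o := θ).1 ?_) h1 h2 <;> grind

lemma IsTame.mem_hIco_of_right {p q : S1 → Prop} (h : IsTame p q) {θ : S1} (hθ : q θ)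
    (hn : ∃ x, ¬ p x) :
    ∃ x y : S1, x ≠ y ∧ θ ∈ hIco x y ∧ ¬ p x ∧ q x ∧ p y ∧ ¬ q y ∧
      ∀ z ∈ cIoo x y, p z ∧ q z := by
  obtain ⟨δ, hδ, hall⟩ := mem_nhdsGT_iff_exists_Ioo_subset.1 (h.right θ)
  have hδ' : 0 < δ := hδ
  obtain ⟨t, t0, t1⟩ := (eventually_small (lt_min hδ' one_pos)).exists
  have t1' := t1.trans_le (min_le_right _ _)
  obtain ⟨x, y, hxy, hm, hx, qx, py, qy, hz⟩ :=
    h.exists_interval ((hall ⟨t0, t1.trans_le (min_le_left _ _)⟩).1.2 hθ) hn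
  refine ⟨x, y, hxy, ?_, hx, qx, py, qy, hz⟩
  rw [mem_hIoc_iff' θ hxy, arc_add t0.le t1'] at hm
  rw [mem_hIco_iff' θ hxy, arc_self]
  have p1 := arc_nonneg θ x
  have p2 := arc_nonneg θ y
  have k : ℓ θ x < t → ℓ θ x = 0 := by
    intro hlt
    by_contra h0
    have hx' := (hall ⟨lt_of_le_of_ne p1 (Ne.symm h0),
      hlt.trans (t1.trans_le (min_le_left _ _))⟩).1.2 hθ
    rw [add_arc] at hx'
    exact hx hx'
  grind

lemma ArcFamily.exists_rects {ML MR : S1 → S1 → S1 → Prop} (h : ArcFamily ML MR) :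
    ∃ F : Finset Rect, (∀ r ∈ F, IsSpell ML MR r) ∧
      (∀ a b θ, ML a b θ ↔ ∃ r ∈ F, r.φ₁ = a ∧ r.φ₂ = b ∧ r.L θ) ∧
      ∀ a b θ, MR a b θ ↔ ∃ r ∈ F, r.φ₁ = a ∧ r.φ₂ = b ∧ r.R θ := by
  set S : Set S1 := ⋃ c ∈ {c : S1 × S1 | ∃ θ, ML c.1 c.2 θ}, {θ | ¬ (ML c.1 c.2 θ ↔ MR c.1 c.2 θ)}
  have hS : S.Finite := h.finite.biUnion fun c _ => (h.tame c.1 c.2).finite_switch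
  have hF : {r : Rect | IsSpell ML MR r}.Finite := by
    refine Set.Finite.of_finite_image
      (f := fun r : Rect => ((r.θ₁, r.θ₂), (r.φ₁, r.φ₂))) ?_ fun r _ q _ e => ?_
    · refine ((hS.prod hS).prod h.finite).subset ?_
      rintro _ ⟨r, hr, rfl⟩
      have hm : (r.φ₁, r.φ₂) ∈ {c : S1 × S1 | ∃ θ, ML c.1 c.2 θ} := ⟨_, hr.left _ r.L_right⟩
      exact ⟨⟨Set.mem_iUnion₂.2 ⟨_, hm, fun e => hr.start (e.2 (hr.right _ r.R_left))⟩,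
        Set.mem_iUnion₂.2 ⟨_, hm, fun e => hr.finish (e.1 (hr.left _ r.L_right))⟩⟩, hm⟩
    · simp only [Prod.mk.injEq] at e
      exact Rect.ext' e.1.1 e.1.2 e.2.1 e.2.2
  have mk : ∀ a b x y : S1, a ≠ b → ∀ hxy : x ≠ y, ¬ ML a b x → MR a b x → ML a b y →
      ¬ MR a b y → (∀ z ∈ cIoo x y, ML a b z ∧ MR a b z) →
      ∃ r : Rect, IsSpell ML MR r ∧ r.φ₁ = a ∧ r.φ₂ = b ∧ r.θ₁ = x ∧ r.θ₂ = y := by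
    intro a b x y hab hxy h1 h2 h3 h4 h5
    refine ⟨⟨x, y, a, b, hxy, hab⟩, ⟨h1, h4, ?_, ?_⟩, rfl, rfl, rfl, rfl⟩
    · rintro z (hz | rfl)
      · exact (h5 z hz).1
      · exact h3
    · rintro z (rfl | hz)
      · exact h2
      · exact (h5 z hz).2
  refine ⟨hF.toFinset, fun r hr => hF.mem_toFinset.1 hr, fun a b θ => ⟨fun hm => ?_, ?_⟩,
    fun a b θ => ⟨fun hm => ?_, ?_⟩⟩
  · obtain ⟨x, y, hxy, hm', h1, h2, h3, h4, h5⟩ := (h.tame a b).exists_interval hm (h.never a b)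
    obtain ⟨r, hr, e1, e2, e3, e4⟩ := mk a b x y (h.ne a b θ hm) hxy h1 h2 h3 h4 h5
    exact ⟨r, hF.mem_toFinset.2 hr, e1, e2, by rw [Rect.L, e3, e4]; exact hm'⟩
  · rintro ⟨r, hr, rfl, rfl, hL⟩
    exact (hF.mem_toFinset.1 hr).left _ hL
  · obtain ⟨x, y, hxy, hm', h1, h2, h3, h4, h5⟩ := (h.tame a b).mem_hIco_of_right hm (h.never a b)
    obtain ⟨r, hr, e1, e2, e3, e4⟩ := mk a b x y (h.ne a b y h3) hxy h1 h2 h3 h4 h5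
    exact ⟨r, hF.mem_toFinset.2 hr, e1, e2, by rw [Rect.R, e3, e4]; exact hm'⟩
  · rintro ⟨r, hr, rfl, rfl, hL⟩
    exact (hF.mem_toFinset.1 hr).right _ hL

/-- Local conditions on a family of arcs, under which its spells are pairwise compatible. Only the
vertical arcs of the rectangles `r` and `q` matter. -/
structure ArcFamily.Fits (ML MR : S1 → S1 → S1 → Prop) : Prop where
  before : ∀ (r q : Rect) θ, ML r.φ₁ r.φ₂ θ → ML q.φ₁ q.φ₂ θ →
    ¬ (r.φ₁ = q.φ₁ ∧ r.φ₂ = q.φ₂) → r.Laminar q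
  after : ∀ (r q : Rect) θ, MR r.φ₁ r.φ₂ θ → MR q.φ₁ q.φ₂ θ →
    ¬ (r.φ₁ = q.φ₁ ∧ r.φ₂ = q.φ₂) → r.Laminar q
  thru : ∀ (r q : Rect) θ, ¬ (ML r.φ₁ r.φ₂ θ ↔ MR r.φ₁ r.φ₂ θ) → ML q.φ₁ q.φ₂ θ →
    MR q.φ₁ q.φ₂ θ → ¬ r.Inner q
  both_end : ∀ (r q : Rect) θ, ML r.φ₁ r.φ₂ θ → ¬ MR r.φ₁ r.φ₂ θ → ML q.φ₁ q.φ₂ θ →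
    ¬ MR q.φ₁ q.φ₂ θ → ¬ r.Inner q
  both_start : ∀ (r q : Rect) θ, MR r.φ₁ r.φ₂ θ → ¬ ML r.φ₁ r.φ₂ θ → MR q.φ₁ q.φ₂ θ →
    ¬ ML q.φ₁ q.φ₂ θ → ¬ r.Inner q
  end_start : ∀ (r q : Rect) θ, ML r.φ₁ r.φ₂ θ → ¬ MR r.φ₁ r.φ₂ θ → MR q.φ₁ q.φ₂ θ →
    ¬ ML q.φ₁ q.φ₂ θ → r.Touch q

lemma ArcFamily.Fits.localAt {ML MR : S1 → S1 → S1 → Prop} (h : ArcFamily.Fits ML MR)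
    {r q : Rect} (hr : IsSpell ML MR r) (hq : IsSpell ML MR q) (hne : r ≠ q) (θ : S1) :
    r.LocalAt q θ := by
  have hbe : r.L θ → q.L θ → r.Laminar q := fun h1 h2 =>
    h.before r q θ (hr.left _ h1) (hq.left _ h2) fun e => hne (hr.eq_of_L hq e.1 e.2 h1 h2)
  have haf : r.R θ → q.R θ → r.Laminar q := fun h1 h2 =>
    h.after r q θ (hr.right _ h1) (hq.right _ h2) fun e => by
      obtain ⟨t, e1, e2⟩ := ((r.eventually_right θ).and (q.eventually_right θ)).exists
      exact hne (hr.eq_of_L hq e.1 e.2 (e1.1.2 h1) (e2.1.2 h2))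
  refine ⟨hbe, haf, ?_, ?_, ?_, ?_, ?_, ?_⟩
  · rintro (rfl | rfl) h1 h2
    · exact h.thru r q _ (fun e => hr.start (e.2 (hr.right _ r.R_left))) (hq.left _ h1) (hq.right _ h2)
    · exact h.thru r q _ (fun e => hr.finish (e.1 (hr.left _ r.L_right))) (hq.left _ h1)
        (hq.right _ h2)
  · rintro (rfl | rfl) h1 h2
    · exact h.thru q r _ (fun e => hq.start (e.2 (hq.right _ q.R_left))) (hr.left _ h1) (hr.right _ h2)
    · exact h.thru q r _ (fun e => hq.finish (e.1 (hq.left _ q.L_right))) (hr.left _ h1)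
        (hr.right _ h2)
  · rintro rfl e
    have a1 := hr.left _ r.L_right
    have a2 := hq.left _ q.L_right
    have b2 := hq.finish
    rw [← e] at a2 b2
    exact ((hbe r.L_right (e ▸ q.L_right)).resolve_right (by
      rintro (hi | hi)
      · exact h.both_end r q _ a1 hr.finish a2 b2 hi
      · exact h.both_end q r _ a2 b2 a1 hr.finish hi))
  · rintro rfl e
    have a1 := hr.right _ r.R_left
    have a2 := hq.right _ q.R_left
    have b2 := hq.start
    rw [← e] at a2 b2
    exact ((haf r.R_left (e ▸ q.R_left)).resolve_right (by
      rintro (hi | hi)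
      · exact h.both_start r q _ a1 hr.start a2 b2 hi
      · exact h.both_start q r _ a2 b2 a1 hr.start hi))
  · rintro rfl e
    exact h.end_start r q _ (hr.left _ r.L_right) hr.finish (e ▸ hq.right _ q.R_left)
      (e ▸ hq.start)
  · rintro rfl e
    exact (h.end_start q r _ (e ▸ hq.left _ q.L_right) (e ▸ hq.finish) (hr.right _ r.R_left)
      hr.start).symm

/-- The arc `[a;b]` is present in the diagram immediately before the moment `θ`. -/
def Diagram.ActL (P : Diagram) (a b θ : S1) : Prop := ∃ r ∈ P.rects, r.φ₁ = a ∧ r.φ₂ = b ∧ r.L θ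
/-- The arc `[a;b]` is present in the diagram immediately after the moment `θ`. -/
def Diagram.ActR (P : Diagram) (a b θ : S1) : Prop := ∃ r ∈ P.rects, r.φ₁ = a ∧ r.φ₂ = b ∧ r.R θ

lemma Diagram.mem_movieOf_iff_act {P : Diagram} {a b θ : S1} :
    s(a, b) ∈ movieOf P θ ↔ P.ActL a b θ ∨ P.ActL b a θ := by
  rw [mem_movieOf]
  simp only [Sym2.eq_iff, Diagram.ActL]
  constructor
  · rintro ⟨r, hr, h1, h2 | h2⟩
    · exact .inl ⟨r, hr, h2.1, h2.2, h1⟩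
    · exact .inr ⟨r, hr, h2.1, h2.2, h1⟩
  · rintro (⟨r, hr, h1, h2, h3⟩ | ⟨r, hr, h1, h2, h3⟩)
    · exact ⟨r, hr, h3, .inl ⟨h1, h2⟩⟩
    · exact ⟨r, hr, h3, .inr ⟨h1, h2⟩⟩

lemma ArcFamily.exists_diagram {ML MR : S1 → S1 → S1 → Prop} (h : ArcFamily ML MR)
    (hfit : ArcFamily.Fits ML MR) {Ψ Φ : S1 → Finset (Sym2 S1)}
    (hΨ : ∀ a b θ, s(a, b) ∈ Ψ θ ↔ ML a b θ ∨ ML b a θ)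
    (hΦ : ∀ a b θ, s(a, b) ∈ Φ θ ↔ MR a b θ ∨ MR b a θ)
    (hm : ∀ θ, {φ | ¬ ((∃ c ∈ Ψ θ, φ ∈ c) ↔ ∃ c ∈ Φ θ, φ ∈ c)}.encard ≤ 2)
    (hl : ∀ φ, {θ | ¬ ((∃ c ∈ Ψ θ, φ ∈ c) ↔ ∃ c ∈ Φ θ, φ ∈ c)}.encard ≤ 2) :
    ∃ P : Diagram, movieOf P = Ψ ∧ (∀ a b θ, P.ActL a b θ ↔ ML a b θ) ∧
      ∀ a b θ, P.ActR a b θ ↔ MR a b θ := by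
  obtain ⟨F, hF, hL, hR⟩ := h.exists_rects
  have hc : PairwiseCompatible (F : Set Rect) := fun r hr q hq hne =>
    Rect.compatible_of_localAt fun θ => hfit.localAt (hF r hr) (hF q hq) hne θ
  have hb : ∀ θ φ, endsBefore (F : Set Rect) θ φ ↔ ∃ c ∈ Ψ θ, φ ∈ c := by
    intro θ φ
    constructor
    · rintro ⟨r, hr, h1, h2⟩
      exact ⟨s(r.φ₁, r.φ₂), (hΨ _ _ _).2 (.inl ((hL _ _ _).2 ⟨r, hr, rfl, rfl, h1⟩)),
        Rect.mem_chord.2 h2⟩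
    · rintro ⟨c, hc, hφ⟩
      induction c with | _ a b => ?_
      rcases (hΨ _ _ _).1 hc with h1 | h1 <;> obtain ⟨r, hr, rfl, rfl, h2⟩ := (hL _ _ _).1 h1
      · exact ⟨r, hr, h2, Rect.mem_chord.1 hφ⟩
      · exact ⟨r, hr, h2, (Sym2.mem_iff.1 hφ).symm⟩
  have ha : ∀ θ φ, endsAfter (F : Set Rect) θ φ ↔ ∃ c ∈ Φ θ, φ ∈ c := by
    intro θ φ
    constructor
    · rintro ⟨r, hr, h1, h2⟩
      exact ⟨s(r.φ₁, r.φ₂), (hΦ _ _ _).2 (.inl ((hR _ _ _).2 ⟨r, hr, rfl, rfl, h1⟩)),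
        Rect.mem_chord.2 h2⟩
    · rintro ⟨c, hc, hφ⟩
      induction c with | _ a b => ?_
      rcases (hΦ _ _ _).1 hc with h1 | h1 <;> obtain ⟨r, hr, rfl, rfl, h2⟩ := (hR _ _ _).1 h1
      · exact ⟨r, hr, h2, Rect.mem_chord.1 hφ⟩
      · exact ⟨r, hr, h2, (Sym2.mem_iff.1 hφ).symm⟩
  have hfree : ∀ θ φ, (θ, φ) ∈ freeVertices (F : Set Rect) ↔
      ¬ ((∃ c ∈ Ψ θ, φ ∈ c) ↔ ∃ c ∈ Φ θ, φ ∈ c) := fun θ φ => by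
    rw [hc.mem_freeVertices, hb, ha]
  let P : Diagram := ⟨F, hc, fun θ => by
      refine le_trans ?_ (hm θ)
      rw [← Function.Injective.encard_image (f := fun φ : S1 => (θ, φ))
        (fun a b h => (Prod.ext_iff.1 h).2)]
      refine Set.encard_le_encard ?_
      rintro ⟨θ', φ⟩ ⟨h1, rfl⟩
      exact ⟨φ, (hfree _ _).1 h1, rfl⟩, fun φ => by
      refine le_trans ?_ (hl φ)
      rw [← Function.Injective.encard_image (f := fun θ : S1 => (θ, φ))
        (fun a b h => (Prod.ext_iff.1 h).1)]
      refine Set.encard_le_encard ?_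
      rintro ⟨θ, φ'⟩ ⟨h1, rfl⟩
      exact ⟨θ, (hfree _ _).1 h1, rfl⟩⟩
  refine ⟨P, ?_, fun a b θ => (hL a b θ).symm, fun a b θ => (hR a b θ).symm⟩
  funext θ
  ext c
  induction c with | _ a b => ?_
  rw [Diagram.mem_movieOf_iff_act, hΨ]
  exact or_congr (hL a b θ).symm (hL b a θ).symm

/-! ## The moves preserve the movie -/

lemma movieOf_eq_of_rects {P Q : Diagram}
    (h : ∀ θ, (∀ r ∈ P.rects, r.L θ → ∃ q ∈ Q.rects, q.L θ ∧ s(q.φ₁, q.φ₂) = s(r.φ₁, r.φ₂)) ∧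
      ∀ r ∈ Q.rects, r.L θ → ∃ q ∈ P.rects, q.L θ ∧ s(q.φ₁, q.φ₂) = s(r.φ₁, r.φ₂)) :
    movieOf P = movieOf Q := by
  funext θ
  ext c
  rw [mem_movieOf, mem_movieOf]
  constructor
  · rintro ⟨r, hr, h1, rfl⟩; exact (h θ).1 r hr h1
  · rintro ⟨r, hr, h1, rfl⟩; exact (h θ).2 r hr h1

lemma Diagram.not_occupied_iff {P : Diagram} {θ : S1} :
    ¬ P.OccupiedMeridian θ ↔ ∀ r ∈ P.rects, θ ≠ r.θ₁ ∧ θ ≠ r.θ₂ := by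
  rw [P.occupiedMeridian_iff]; push Not; rfl

lemma Rect.eq_iff {q s : Rect} : q = s ↔ q.θ₁ = s.θ₁ ∧ q.θ₂ = s.θ₂ ∧ q.φ₁ = s.φ₁ ∧ q.φ₂ = s.φ₂ := by
  cases q; cases s; simp

/-- `q` is one of the three rectangles into which the splitting of `r` along `[x;y]` turns `r`. -/
def IsPart (r : Rect) (x y : S1) (q : Rect) : Prop :=
  (q.θ₁ = x ∧ q.θ₂ = y ∧ q.φ₁ = r.φ₂ ∧ q.φ₂ = r.φ₁) ∨
  (q.θ₁ = r.θ₁ ∧ q.θ₂ = x ∧ q.φ₁ = r.φ₁ ∧ q.φ₂ = r.φ₂) ∨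
  (q.θ₁ = y ∧ q.θ₂ = r.θ₂ ∧ q.φ₁ = r.φ₁ ∧ q.φ₂ = r.φ₂)

/-- `Q` is obtained from `P` by replacing `r = [θ₁;θ₂] × [φ₁;φ₂]` with `[θ₁;x] × [φ₁;φ₂]`,
`[x;y] × [φ₂;φ₁]` and `[y;θ₂] × [φ₁;φ₂]`, of which the first or the last may be degenerate. -/
structure IsSplit (P Q : Diagram) (r : Rect) (x y : S1) : Prop where
  mem : r ∈ P.rects
  lt : ℓ r.θ₁ x < ℓ r.θ₁ y
  le : ℓ r.θ₁ y ≤ ℓ r.θ₁ r.θ₂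
  ne : x = r.θ₁ → y = r.θ₂ → False
  rects : ∀ q, q ∈ Q.rects ↔ (q ∈ P.rects ∧ q ≠ r) ∨ IsPart r x y q
  free : ∀ q ∈ P.rects, q ≠ r → q.θ₁ ∉ cIcc x y ∧ q.θ₂ ∉ cIcc x y

lemma IsBubbleCreation.order {P Q : Diagram} {r : Rect} {θ₃ θ₄ : S1}
    (h : IsBubbleCreation P Q r θ₃ θ₄) : 0 < ℓ r.θ₁ θ₃ ∧
      ℓ r.θ₁ θ₃ < ℓ r.θ₁ θ₄ ∧ ℓ r.θ₁ θ₄ < ℓ r.θ₁ r.θ₂ := by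
  obtain ⟨hr, h3, h4, hocc, -, r₁, r₂, r₃, e1, e2, e3, hQ⟩ := h
  have h1 : r.θ₁ ∉ cIcc θ₃ θ₄ := fun hm =>
    hocc _ hm (P.occupiedMeridian_iff.2 ⟨r, hr, .inl rfl⟩)
  have hne : θ₃ ≠ θ₄ := by have := r₂.hθ; rwa [e2.1, e2.2.1] at this
  rw [mem_cIoo_iff] at h3 h4
  rw [mem_cIcc_iff' r.θ₁ hne, arc_self] at h1
  have hne' : ℓ r.θ₁ θ₃ ≠ ℓ r.θ₁ θ₄ := fun h' => hne (arc_inj.1 h')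
  grind

lemma IsBubbleCreation.isSplit {P Q : Diagram} {r : Rect} {x y : S1}
    (h : IsBubbleCreation P Q r x y) : IsSplit P Q r x y := by
  obtain ⟨o1, o2, o3⟩ := h.order
  obtain ⟨hr, -, -, hocc, -, r₁, r₂, r₃, e1, e2, e3, hQ⟩ := h
  refine ⟨hr, o2, o3.le, fun e => ?_, fun q => ?_, fun q hq _ => ⟨fun hm => ?_, fun hm => ?_⟩⟩
  · rw [e, arc_self] at o1; exact o1.false.elim
  · have h1 := Set.ext_iff.1 hQ q
    simp only [Set.mem_sdiff, Set.mem_union, Finset.mem_coe, Set.mem_insert_iff, Set.mem_singleton_iff] at h1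
    rw [h1, Rect.eq_iff (s := r₁), Rect.eq_iff (s := r₂), Rect.eq_iff (s := r₃), e1.1, e1.2.1, e1.2.2.1, e1.2.2.2, e2.1, e2.2.1,
      e2.2.2.1, e2.2.2.2, e3.1, e3.2.1, e3.2.2.1, e3.2.2.2, IsPart]
    have hx : x ≠ r.θ₂ := by rintro rfl; linarith
    have hy : y ≠ r.θ₁ := by rintro rfl; rw [arc_self] at o2; linarith
    have := r.hφ
    grind
  · exact hocc _ hm (P.occupiedMeridian_iff.2 ⟨q, hq, .inl rfl⟩)
  · exact hocc _ hm (P.occupiedMeridian_iff.2 ⟨q, hq, .inr rfl⟩)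

lemma IsSplit.movieOf_eq {P Q : Diagram} {r : Rect} {x y : S1} (h : IsSplit P Q r x y) :
    movieOf P = movieOf Q := by
  have h1 := h.lt
  have h2 := h.le
  have h3 := arc_nonneg r.θ₁ x
  have h0 := arc_self r.θ₁
  have ne := h.ne
  have hxy : x ≠ y := by rintro rfl; exact h1.false
  refine movieOf_eq_of_rects fun θ => ⟨fun q hq hqL => ?_, fun q hq hqL => ?_⟩
  · by_cases e : q = r
    · subst e
      by_cases c1 : q.θ₁ ≠ x ∧ ℓ q.θ₁ θ ≤ ℓ q.θ₁ x
      · refine ⟨⟨q.θ₁, x, q.φ₁, q.φ₂, c1.1, q.hφ⟩,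
          (h.rects _).2 (.inr (.inr (.inl ⟨rfl, rfl, rfl, rfl⟩))), ?_, rfl⟩
        rw [Rect.L, mem_hIoc_iff' q.θ₁ q.hθ] at hqL
        rw [Rect.L, mem_hIoc_iff' q.θ₁ c1.1]
        grind
      by_cases c2 : y ≠ q.θ₂ ∧ ℓ q.θ₁ y < ℓ q.θ₁ θ
      · refine ⟨⟨y, q.θ₂, q.φ₁, q.φ₂, c2.1, q.hφ⟩,
          (h.rects _).2 (.inr (.inr (.inr ⟨rfl, rfl, rfl, rfl⟩))), ?_, rfl⟩
        rw [Rect.L, mem_hIoc_iff' q.θ₁ q.hθ] at hqL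
        rw [Rect.L, mem_hIoc_iff' q.θ₁ c2.1]
        grind
      · refine ⟨⟨x, y, q.φ₂, q.φ₁, hxy, q.hφ.symm⟩,
          (h.rects _).2 (.inr (.inl ⟨rfl, rfl, rfl, rfl⟩)), ?_, Sym2.eq_swap⟩
        rw [Rect.L, mem_hIoc_iff' q.θ₁ q.hθ] at hqL
        rw [Rect.L, mem_hIoc_iff' q.θ₁ hxy]
        grind
    · exact ⟨q, (h.rects _).2 (.inl ⟨hq, e⟩), hqL, rfl⟩
  · rcases (h.rects q).1 hq with h' | h'
    · exact ⟨q, h'.1, hqL, rfl⟩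
    · have := q.hθ
      refine ⟨r, h.mem, ?_, ?_⟩
      · rw [Rect.L, mem_hIoc_iff' r.θ₁ q.hθ] at hqL
        rw [Rect.L, mem_hIoc_iff' r.θ₁ r.hθ]
        have := arc_nonneg r.θ₁ θ
        unfold IsPart at h'
        grind
      · rcases h' with ⟨-, -, e, e'⟩ | ⟨-, -, e, e'⟩ | ⟨-, -, e, e'⟩ <;> rw [e, e']
        exact Sym2.eq_swap

lemma not_cIcc_subset_swap {a b : S1} (h : a ≠ b) : ¬ cIcc a b ⊆ cIcc b a := by
  intro hs
  obtain ⟨x, hx⟩ := cIoo_nonempty h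
  exact not_mem_cIcc_iff.2 hx (hs (cIoo_subset_cIcc _ _ hx))

lemma eq_of_add_coe_eq {θ : S1} {s t : ℝ} (h : θ + (s : S1) = θ + (t : S1)) (h1 : |s - t| < 1) :
    s = t := by
  have h2 := (AddCircle.coe_eq_coe_iff_of_mem_Ico (p := (1:ℝ)) (a := min s t) (x := s) (y := t)
    (by rw [Set.mem_Ico]; rw [abs_lt] at h1; rcases min_cases s t with h | h <;> constructor <;> linarith)
    (by rw [Set.mem_Ico]; rw [abs_lt] at h1; rcases min_cases s t with h | h <;> constructor <;> linarith)).1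
    (add_left_cancel h)
  exact h2

lemma arc_add_coe {θ : S1} {t : ℝ} (h : |t| < 1 / 2) :
    ℓ θ (θ + (t : S1)) = if 0 ≤ t then t else 1 + t := by
  rw [abs_lt] at h
  split_ifs with h0
  · exact arc_add h0 (by linarith)
  · have := arc_sub (a := θ) (t := -t) (by linarith) (by linarith)
    rw [AddCircle.coe_neg, sub_neg_eq_add] at this
    rw [this]; ring

lemma HalfWrinkleCreation.exists_isSplit {P Q : Diagram} (h : HalfWrinkleCreation P Q) :
    ∃ r x y, IsSplit P Q r x y := by
  obtain ⟨θ₀, φ₁, φ₂, ⟨hb1, ⟨r, hr, hv1⟩, hb2, -, ε, hε, hε1, ψ, θm, θc, θp, hocc, hm, hc, hp, hQ⟩,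
    hbd, honly⟩ := h
  have lt1 := ψ.strictMono (a := ⟨-ε, by constructor <;> linarith⟩)
    (b := ⟨0, by constructor <;> linarith⟩) (Subtype.mk_lt_mk.2 (by linarith))
  have lt2 := ψ.strictMono (a := ⟨0, by constructor <;> linarith⟩)
    (b := ⟨ε, by constructor <;> linarith⟩) (Subtype.mk_lt_mk.2 (by linarith))
  have bm := (ψ ⟨-ε, by constructor <;> linarith⟩).2.1
  have bp := (ψ ⟨ε, by constructor <;> linarith⟩).2.2
  rw [← Subtype.coe_lt_coe] at lt1 lt2
  generalize (ψ ⟨-ε, by constructor <;> linarith⟩ : ℝ) = ψm at *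
  generalize (ψ ⟨0, by constructor <;> linarith⟩ : ℝ) = ψc at *
  generalize (ψ ⟨ε, by constructor <;> linarith⟩ : ℝ) = ψp at *
  have hfree : ∀ q ∈ P.rects, (θ₀, φ₁) ∈ q.vertices → q = r := by
    obtain ⟨r', -, hu⟩ := hb1
    intro q hq hqv
    rw [hu q ⟨hq, hqv⟩, hu r ⟨hr, .inr hv1⟩]
  have hends : ∀ q ∈ P.rects, (q.θ₁ = θ₀ ∨ q.θ₂ = θ₀) →
      (q.φ₁ = φ₁ ∧ q.φ₂ = φ₂) ∨ (q.φ₁ = φ₂ ∧ q.φ₂ = φ₁) := by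
    intro q hq hs
    have hs' : θ₀ = q.θ₁ ∨ θ₀ = q.θ₂ := hs.imp Eq.symm Eq.symm
    have a1 := honly q hq (θ₀, q.φ₁) (Rect.mem_vertices.2 ⟨hs', .inl rfl⟩) rfl
    have a2 := honly q hq (θ₀, q.φ₂) (Rect.mem_vertices.2 ⟨hs', .inr rfl⟩) rfl
    have := q.hφ
    simp only [Prod.mk.injEq, true_and] at a1 a2
    grind
  have huniq : ∀ q ∈ P.rects, (q.θ₁ = θ₀ ∨ q.θ₂ = θ₀) → q = r := fun q hq hs => by
    refine hfree q hq (Rect.mem_vertices.2 ⟨hs.imp Eq.symm Eq.symm, ?_⟩)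
    have := hends q hq hs
    grind
  have hocc' : ∀ q ∈ P.rects, ∀ t : ℝ, -(2 * ε) ≤ t → t ≤ 2 * ε →
      (θ₀ + (t : S1) = q.θ₁ ∨ θ₀ + (t : S1) = q.θ₂) → t = 0 := fun q hq t h1 h2 hs =>
    hocc t ⟨h1, h2⟩ (P.occupiedMeridian_iff.2 ⟨q, hq, hs⟩)
  have free : ∀ s t : ℝ, -(2 * ε) ≤ s → s < t → t ≤ 2 * ε → ∀ q ∈ P.rects, q ≠ r → ∀ z,
      (z = q.θ₁ ∨ z = q.θ₂) → z ∉ cIcc (θ₀ + (s : S1)) (θ₀ + (t : S1)) := by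
    intro s t h1 h2 h3 q hq hne z hz hm
    have e : ℓ (θ₀ + (s : S1)) (θ₀ + (t : S1)) = t - s := by
      rw [show θ₀ + (t : S1) = θ₀ + (s : S1) + ((t - s : ℝ) : S1) by rw [AddCircle.coe_sub]; abel]
      exact arc_add (by linarith) (by linarith)
    rw [mem_cIcc_iff (fun e' => by rw [e', arc_self] at e; linarith), e] at hm
    have h4 := arc_nonneg (θ₀ + (s : S1)) z
    have e2 : θ₀ + ((s + ℓ (θ₀ + (s : S1)) z : ℝ) : S1) = z := by
      rw [AddCircle.coe_add, ← add_assoc, add_arc]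
    have e3 := hocc' q hq (s + ℓ (θ₀ + (s : S1)) z) (by linarith) (by linarith) (by rwa [e2])
    rw [e3, AddCircle.coe_zero, add_zero] at e2
    exact hne (huniq q hq (hz.imp (e2.trans · |>.symm) (e2.trans · |>.symm)))
  have inj : ∀ s : ℝ, -(2 * ε) ≤ s → s ≤ 2 * ε → θ₀ + (s : S1) = θ₀ → s = 0 := fun s h1 h2 e =>
    eq_of_add_coe_eq (θ := θ₀) (t := 0) (by simpa using e) (by rw [abs_lt]; constructor <;> linarith)
  have hcp : θc ≠ θp := fun e => lt2.ne (eq_of_add_coe_eq (hc ▸ hp ▸ e)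
    (by rw [abs_lt]; constructor <;> linarith))
  have hmc : θm ≠ θc := fun e => lt1.ne (eq_of_add_coe_eq (hm ▸ hc ▸ e)
    (by rw [abs_lt]; constructor <;> linarith))
  have hside : r.θ₁ = θ₀ ∨ r.θ₂ = θ₀ :=
    (Rect.mem_vertices.1 (.inr hv1 : (θ₀, φ₁) ∈ r.vertices)).1.imp Eq.symm Eq.symm
  have s1 : ∀ q ∈ P.rects, HasSideIn q θ₀ r.φ₁ r.φ₂ ↔ q = r := fun q hq =>
    ⟨fun hs => huniq q hq hs.1, by rintro rfl; exact ⟨hside, le_rfl⟩⟩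
  have s2 : ∀ q ∈ P.rects, ¬ HasSideIn q θ₀ r.φ₂ r.φ₁ := fun q hq hs => by
    obtain rfl := huniq q hq hs.1
    exact not_cIcc_subset_swap q.hφ hs.2
  have hbc : (θ₀, φ₁) ∈ Q.boundary := hbd ▸ hb1
  have hn := r.hθ
  have hφ12 : (r.θ₁ = θ₀ ∧ r.φ₁ = φ₁ ∧ r.φ₂ = φ₂) ∨ (r.θ₂ = θ₀ ∧ r.φ₂ = φ₁ ∧ r.φ₁ = φ₂) := by
    have hn := r.hφ
    have := hends r hr hside
    rcases hv1 with hv | hv <;> simp only [Set.mem_singleton_iff, Prod.mk.injEq] at hv <;> grind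
  rcases hφ12 with ⟨e0, rfl, rfl⟩ | ⟨e0, rfl, rfl⟩
  · have hψ2 : ∀ t : ℝ, -(2 * ε) ≤ t → t ≤ 2 * ε → θ₀ + (t : S1) ≠ r.θ₂ := fun t h1 h2 he => by
      rw [hocc' r hr t h1 h2 (.inr he), AddCircle.coe_zero, add_zero, ← e0] at he
      exact r.hθ he
    have hQ' : ∀ q, q ∈ Q.rects ↔ (q ∈ P.rects ∧ q ≠ r) ∨ SideMoved r q θ₀ θp ∨
        q.θ₁ = θc ∧ q.θ₂ = θp ∧ q.φ₁ = r.φ₂ ∧ q.φ₂ = r.φ₁ := fun q => by rw [hQ]; grind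
    unfold SideMoved at hQ'
    have hp2 : θp ≠ r.θ₂ := hp ▸ hψ2 ψp (by linarith) bp
    have hp0 : θp ≠ θ₀ := fun he => by
      obtain ⟨v, -, hu⟩ := hbc
      have a2 := hu ⟨θc, θp, r.φ₂, r.φ₁, hcp, r.hφ.symm⟩
        ⟨(hQ' _).2 (by simp), Rect.mem_vertices.2 ⟨.inr he.symm, .inr rfl⟩⟩
      have a3 := hu ⟨θp, r.θ₂, r.φ₁, r.φ₂, hp2, r.hφ⟩
        ⟨(hQ' _).2 (by simp [e0]), Rect.mem_vertices.2 ⟨.inl he.symm, .inl rfl⟩⟩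
      exact r.hφ (congrArg Rect.φ₁ (a3.trans a2.symm))
    have hc0 : ψc = 0 := by
      obtain ⟨v, ⟨hv, hv'⟩, -⟩ := hbc
      refine inj ψc (by linarith) (by linarith) (hc ▸ ?_)
      have := hfree v
      have := (Rect.mem_vertices.1 hv').1
      grind
    have hx : θc = r.θ₁ := by rw [hc, hc0, AddCircle.coe_zero, add_zero, e0]
    have hy : ℓ r.θ₁ θp = ψp := by rw [e0, hp]; exact arc_add (by linarith) (by linarith)
    refine ⟨r, θc, θp, hr, ?_, ?_, fun _ => hp2, fun q => ?_, fun q hq hne => ?_⟩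
    · rw [hx, arc_self, hy, ← hc0]; exact lt2
    · by_contra hlt
      have := arc_nonneg r.θ₁ r.θ₂
      exact hψ2 (ℓ r.θ₁ r.θ₂) (by linarith) (by linarith) (by rw [← e0, add_arc])
    · have := q.hθ
      rw [hQ', IsPart]
      grind
    · rw [hc, hp]
      exact ⟨free _ _ (by linarith) lt2 bp q hq hne _ (.inl rfl),
        free _ _ (by linarith) lt2 bp q hq hne _ (.inr rfl)⟩
  · have hψ2 : ∀ t : ℝ, -(2 * ε) ≤ t → t ≤ 2 * ε → θ₀ + (t : S1) ≠ r.θ₁ := fun t h1 h2 he => by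
      rw [hocc' r hr t h1 h2 (.inl he), AddCircle.coe_zero, add_zero, ← e0] at he
      exact r.hθ he.symm
    have hQ' : ∀ q, q ∈ Q.rects ↔ (q ∈ P.rects ∧ q ≠ r) ∨ SideMoved r q θ₀ θm ∨
        q.θ₁ = θm ∧ q.θ₂ = θc ∧ q.φ₁ = r.φ₂ ∧ q.φ₂ = r.φ₁ := fun q => by rw [hQ]; grind
    unfold SideMoved at hQ'
    have hm2 : θm ≠ r.θ₁ := hm ▸ hψ2 ψm bm (by linarith)
    have hm0 : θm ≠ θ₀ := fun he => by
      obtain ⟨v, -, hu⟩ := hbc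
      have a2 := hu ⟨θm, θc, r.φ₂, r.φ₁, hmc, r.hφ.symm⟩
        ⟨(hQ' _).2 (by simp), Rect.mem_vertices.2 ⟨.inl he.symm, .inl rfl⟩⟩
      have a3 := hu ⟨r.θ₁, θm, r.φ₁, r.φ₂, hm2.symm, r.hφ⟩
        ⟨(hQ' _).2 (by simp [e0]), Rect.mem_vertices.2 ⟨.inr he.symm, .inr rfl⟩⟩
      exact r.hφ (congrArg Rect.φ₁ (a3.trans a2.symm))
    have hc0 : ψc = 0 := by
      obtain ⟨v, ⟨hv, hv'⟩, -⟩ := hbc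
      refine inj ψc (by linarith) (by linarith) (hc ▸ ?_)
      have := hfree v
      have := (Rect.mem_vertices.1 hv').1
      grind
    have hy : θc = r.θ₂ := by rw [hc, hc0, AddCircle.coe_zero, add_zero, e0]
    have h1 := arc_lt_one r.θ₁ r.θ₂
    have hpos : 0 ≤ ℓ r.θ₁ r.θ₂ + ψm := by
      by_contra hlt
      exact hψ2 (-ℓ r.θ₁ r.θ₂) (by linarith) (by linarith [arc_nonneg r.θ₁ r.θ₂])
        (by rw [AddCircle.coe_neg, coe_arc, e0]; abel)
    have hx : ℓ r.θ₁ θm = ℓ r.θ₁ r.θ₂ + ψm := by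
      rw [hm, ← arc_add (a := r.θ₁) hpos (by linarith), AddCircle.coe_add, ← add_assoc, add_arc, e0]
    refine ⟨r, θm, θc, hr, ?_, by rw [hy], fun e _ => hm2 e, fun q => ?_, fun q hq hne => ?_⟩
    · rw [hy, hx]; linarith
    · have := q.hθ
      rw [hQ', IsPart]
      grind
    · rw [hc, hm]
      exact ⟨free _ _ bm lt1 (by linarith) q hq hne _ (.inl rfl),
        free _ _ bm lt1 (by linarith) q hq hne _ (.inr rfl)⟩

lemma VerticalMove.movieOf_eq {P Q : Diagram} (h : VerticalMove P Q) : movieOf P = movieOf Q := by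
  rcases h with ⟨r, x, y, h⟩ | ⟨r, x, y, h⟩ | h | h
  · exact h.isSplit.movieOf_eq
  · exact h.isSplit.movieOf_eq.symm
  · obtain ⟨r, x, y, h⟩ := h.exists_isSplit
    exact h.movieOf_eq
  · obtain ⟨r, x, y, h⟩ := h.exists_isSplit
    exact h.movieOf_eq.symm

lemma MoveSequence.movieOf_eq {P Q : Diagram} (s : MoveSequence P Q) : movieOf P = movieOf Q := by
  induction s with
  | nil => rfl
  | snoc s h ih => exact ih.trans h.movieOf_eq

/-! ## Chords and arcs of an event -/

lemma Rect.laminar_of_nonCrossing {C : Finset (Sym2 S1)} (hC : IsNonCrossing C) {r q : Rect}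
    (hr : s(r.φ₁, r.φ₂) ∈ C) (hq : s(q.φ₁, q.φ₂) ∈ C) (hne : s(r.φ₁, r.φ₂) ≠ s(q.φ₁, q.φ₂))
    {x : S1} (h1 : x ∉ r.arcInt) (h2 : x ∉ q.arcInt) : r.Laminar q := by
  have k1 := hC.2 _ hr _ hq hne _ _ rfl
  have k2 := hC.2 _ hq _ hr hne.symm _ _ rfl
  simp only [Rect.mem_chord, Rect.HasEnd, forall_eq_or_imp, forall_eq] at k1 k2
  by_cases ha : r.Apart q
  · exact .inl ha
  obtain ⟨φ, a1, a2⟩ := Set.not_disjoint_iff.1 ha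
  rcases k1 with k1 | k1
  · rcases k2 with k2 | k2
    · exfalso
      have m1 : x ∈ cIcc r.φ₂ r.φ₁ := by by_contra h; exact h1 (not_mem_cIcc_iff.1 h)
      have m2 : x ∈ cIcc q.φ₂ q.φ₁ := by by_contra h; exact h2 (not_mem_cIcc_iff.1 h)
      have := cIcc_subset_cIoo r.hφ.symm q.hφ.symm ⟨x, m1, m2⟩ (not_mem_cIcc_iff.2 k1.2)
        (not_mem_cIcc_iff.2 k1.1)
      exact not_mem_cIcc_iff.2 k2.2 (cIoo_subset_cIcc _ _ (this (left_mem_cIcc _ _)))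
    · exact .inr (.inl (cIcc_subset_cIoo q.hφ r.hφ ⟨φ, a2, a1⟩ (not_mem_cIcc_iff.2 k2.1)
        (not_mem_cIcc_iff.2 k2.2)))
  · exact .inr (.inr (cIcc_subset_cIoo r.hφ q.hφ ⟨φ, a1, a2⟩ (not_mem_cIcc_iff.2 k1.1)
        (not_mem_cIcc_iff.2 k1.2)))

lemma IsNonCrossing.eq_of_common {C : Finset (Sym2 S1)} (hC : IsNonCrossing C) {c d : Sym2 S1}
    (hc : c ∈ C) (hd : d ∈ C) {x : S1} (h1 : x ∈ c) (h2 : x ∈ d) : c = d := by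
  by_contra hne
  induction d with | _ a b => ?_
  rcases hC.2 _ hc _ hd hne a b rfl with h | h <;> have := h x h1 <;>
    rcases Sym2.mem_iff.1 h2 with rfl | rfl
  · exact left_not_mem_cIoo _ _ this
  · exact right_not_mem_cIoo _ _ this
  · exact right_not_mem_cIoo _ _ this
  · exact left_not_mem_cIoo _ _ this

/-- The points `V` support the passage from `C` to `D`. The arc selected for a chord is, if possible,
the one that does not contain `V`. -/
structure EventAt (C D : Finset (Sym2 S1)) (V : Set S1) : Prop where
  nonempty : V.Nonempty
  thru : ∀ a b : S1, s(a, b) ∈ C → s(a, b) ∈ D → V ⊆ cIoo a b ∨ V ⊆ cIoo b a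
  touch : ∀ r q : Rect, ¬ (s(r.φ₁, r.φ₂) ∈ C ↔ s(r.φ₁, r.φ₂) ∈ D) →
    ¬ (s(q.φ₁, q.φ₂) ∈ C ↔ s(q.φ₁, q.φ₂) ∈ D) →
    (¬ V ⊆ cIcc r.φ₁ r.φ₂ ∨ V ⊆ cIcc r.φ₂ r.φ₁) →
    (¬ V ⊆ cIcc q.φ₁ q.φ₂ ∨ V ⊆ cIcc q.φ₂ q.φ₁) →
    s(r.φ₁, r.φ₂) = s(q.φ₁, q.φ₂) ∨ r.Touch q
  ends : ∀ c, ¬ (c ∈ C ↔ c ∈ D) → ∀ x ∈ c, x ∈ V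
  two : {φ | ¬ ((∃ c ∈ C, φ ∈ c) ↔ ∃ c ∈ D, φ ∈ c)}.encard ≤ 2

lemma EventAt.symm {C D : Finset (Sym2 S1)} {V : Set S1} (h : EventAt C D V) : EventAt D C V where
  nonempty := h.nonempty
  thru a b h1 h2 := h.thru a b h2 h1
  touch r q h1 h2 := h.touch r q (fun e => h1 e.symm) fun e => h2 e.symm
  ends c hc := h.ends c fun e => hc e.symm
  two := by
    convert h.two using 4
    exact not_congr iff_comm

lemma Rect.touch_of_ends {r q : Rect} (hne : ¬ (r.φ₁ = q.φ₁ ∧ r.φ₂ = q.φ₂))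
    (h1 : q.φ₁ ∉ r.arcInt) (h2 : q.φ₂ ∉ r.arcInt) (h3 : r.φ₁ ∉ q.arcInt) (h4 : r.φ₂ ∉ q.arcInt) :
    r.Touch q := by
  intro φ m1 m2
  unfold arcInt at h1 h2 h3 h4
  unfold arc at m1 m2
  rw [mem_cIoo_iff' φ] at h1 h2 h3 h4
  rw [mem_cIcc_iff' φ r.hφ, arc_self] at m1
  rw [mem_cIcc_iff' φ q.hφ, arc_self] at m2
  have e1 := r.hφ
  have e2 := q.hφ
  rw [ne_eq, ← arc_inj (o := φ)] at e1 e2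
  rw [← arc_inj (o := φ) (x := r.φ₁), ← arc_inj (o := φ) (x := r.φ₂)] at hne
  rw [← arc_inj (o := φ) (y := r.φ₁), ← arc_inj (o := φ) (y := r.φ₂),
    ← arc_inj (o := φ) (y := q.φ₁), ← arc_inj (o := φ) (y := q.φ₂), arc_self]
  have p1 := arc_nonneg φ r.φ₁
  have p2 := arc_nonneg φ r.φ₂
  have p3 := arc_nonneg φ q.φ₁
  have p4 := arc_nonneg φ q.φ₂
  generalize ℓ φ r.φ₁ = a at *
  generalize ℓ φ r.φ₂ = b at *
  generalize ℓ φ q.φ₁ = c at *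
  generalize ℓ φ q.φ₂ = d at *
  clear r q
  grind

namespace InCircularOrder
variable {k : ℕ} {p : Fin k → S1}

lemma mem_of_succ (h : InCircularOrder p) {i i' : Fin k} (hi : i'.val = i.val + 1) (j : Fin k) :
    p j ∈ cIcc (p i') (p i) := by
  rcases lt_trichotomy j.val i.val with h1 | h1 | h1
  · have : sbtw (p j) (p i) (p i') := h.2 j i i' h1 (by rw [Fin.lt_def]; omega)
    exact cIoo_subset_cIcc _ _ (Set.mem_cIoo.2 this.cyclic_left.cyclic_left)
  · rw [Fin.ext h1]; exact right_mem_cIcc _ _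
  · by_cases e : j = i'
    · rw [e]; exact left_mem_cIcc _ _
    · have : sbtw (p i) (p i') (p j) := h.2 i i' j (by rw [Fin.lt_def]; omega)
        (by rw [Fin.lt_def]; have := fun h' => e (Fin.ext h'); omega)
      exact cIoo_subset_cIcc _ _ (Set.mem_cIoo.2 this.cyclic_left)

lemma mem_of_closing (h : InCircularOrder p) {i i' : Fin k} (hi : i.val + 1 = k) (hi' : i'.val = 0)
    (j : Fin k) : p j ∈ cIcc (p i') (p i) := by
  by_cases e : j = i
  · rw [e]; exact right_mem_cIcc _ _
  by_cases e' : j = i'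
  · rw [e']; exact left_mem_cIcc _ _
  have := fun h' => e (Fin.ext h')
  have := fun h' => e' (Fin.ext h')
  refine cIoo_subset_cIcc _ _ (Set.mem_cIoo.2 (h.2 i' j i ?_ ?_)) <;> rw [Fin.lt_def] <;> omega

end InCircularOrder

lemma ElementaryReplacement.exists_eventAt {C D : Finset (Sym2 S1)} (h : ElementaryReplacement C D)
    (hC : IsNonCrossing C) (hD : IsNonCrossing D) : ∃ V, EventAt C D V := by
  obtain ⟨k, p, hk, hp, h⟩ := h
  obtain ⟨Y, hY1, hY2, hXC, hDe⟩ : ∃ Y : Set (Sym2 S1), oddChords p ⊆ Y ∧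
      (∀ c ∈ Y, c ∈ oddChords p ∨ (4 ≤ k ∧ Even k ∧ c ∈ closingChord p)) ∧
      Replaces C D (evenChords p) Y := by
    rcases h with h | ⟨h4, he, h⟩
    · exact ⟨_, le_rfl, fun c hc => .inl hc, h⟩
    · exact ⟨_, Set.subset_union_left, fun c hc => hc.imp id fun hc => ⟨h4, he, hc⟩, h⟩
  have hD' : ∀ c, c ∈ D ↔ (c ∈ C ∧ c ∉ evenChords p) ∨ c ∈ Y := fun c => by
    rw [← Finset.mem_coe, hDe]; rfl
  have hX : ∀ i i' : Fin k, Even i.val → i'.val = i.val + 1 → s(p i, p i') ∈ C :=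
    fun i i' h1 h2 => hXC ⟨i, i', h1, h2, rfl⟩
  have hYD : ∀ c ∈ Y, c ∈ D := fun c hc => (hD' c).2 (.inr hc)
  have hO : ∀ i i' : Fin k, Odd i.val → i'.val = i.val + 1 → s(p i, p i') ∈ D :=
    fun i i' h1 h2 => hYD _ (hY1 ⟨i, i', h1, h2, rfl⟩)
  have hinj := hp.1
  have hdisj : ∀ c ∈ Y, c ∉ evenChords p := by
    rintro c hc ⟨i, j, hi, hj, rfl⟩
    rcases hY2 _ hc with ⟨i', j', hi', hj', e⟩ | ⟨h4, -, i', j', hi', hj', e⟩ <;>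
      rw [Sym2.eq_iff, hinj.eq_iff, hinj.eq_iff, hinj.eq_iff, hinj.eq_iff] at e
    · rcases e with ⟨rfl, rfl⟩ | ⟨rfl, rfl⟩
      · exact Nat.not_even_iff_odd.2 hi' hi
      · omega
    · rcases e with ⟨rfl, rfl⟩ | ⟨rfl, rfl⟩ <;> omega
  have hshare : ∀ c ∈ Y, ∃ x ∈ evenChords p, ∃ y, y ∈ c ∧ y ∈ x := by
    intro c hc
    rcases hY2 _ hc with ⟨i', j', hi', hj', rfl⟩ | ⟨h4, he, i', j', hi', hj', rfl⟩
    · obtain ⟨m, hm⟩ := hi'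
      exact ⟨_, ⟨⟨i'.val - 1, by omega⟩, i', ⟨m, by simp only; omega⟩, by simp only; omega, rfl⟩,
        p i', by simp, by simp⟩
    · obtain ⟨m, hm⟩ := he
      exact ⟨_, ⟨⟨i'.val - 1, by omega⟩, i', ⟨m - 1, by simp only; omega⟩, by simp only; omega, rfl⟩,
        p i', by simp, by simp⟩
  have hYC : ∀ c ∈ Y, c ∉ C := by
    intro c hc hcC
    obtain ⟨x, hx, y, h1, h2⟩ := hshare c hc
    rw [hC.eq_of_common hcC (hXC hx) h1 h2] at hc
    exact hdisj x hc hx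
  have hXD : ∀ c ∈ evenChords p, c ∉ D := by
    intro c hc hcD
    rcases (hD' c).1 hcD with h | h
    · exact h.2 hc
    · exact hdisj c h hc
  have hchg : ∀ c, ¬ (c ∈ C ↔ c ∈ D) → c ∈ evenChords p ∨ c ∈ Y := by
    intro c hc
    by_contra hn
    push Not at hn
    exact hc ⟨fun h => (hD' c).2 (.inl ⟨h, hn.1⟩), fun h => (((hD' c).1 h).resolve_right hn.2).1⟩
  have hform : ∀ c, ¬ (c ∈ C ↔ c ∈ D) → ∃ i j : Fin k, c = s(p i, p j) ∧ i ≠ j ∧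
      ∀ l, p l ∈ cIcc (p j) (p i) := by
    intro c hc
    rcases hchg c hc with ⟨i, j, -, hj, rfl⟩ | hcY
    · exact ⟨i, j, rfl, by rintro rfl; omega, hp.mem_of_succ hj⟩
    · rcases hY2 c hcY with ⟨i, j, -, hj, rfl⟩ | ⟨h4, -, i, j, hi, hj, rfl⟩
      · exact ⟨i, j, rfl, by rintro rfl; omega, hp.mem_of_succ hj⟩
      · exact ⟨i, j, rfl, by rintro rfl; omega, hp.mem_of_closing hi hj⟩
  refine ⟨Set.range p, ⟨p ⟨0, by omega⟩, _, rfl⟩, ?_, ?_, ?_, ?_⟩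
  · intro a b h1 h2
    have hnX : s(a, b) ∉ evenChords p := fun h => hXD _ h h2
    have hnY : s(a, b) ∉ Y := fun h => hYC _ h h1
    have step : ∀ i i' : Fin k, i'.val = i.val + 1 →
        (p i ∈ cIoo a b ∧ p i' ∈ cIoo a b) ∨ (p i ∈ cIoo b a ∧ p i' ∈ cIoo b a) := by
      intro i i' hi
      rcases Nat.even_or_odd i.val with he | ho
      · have := hC.2 _ (hX i i' he hi) _ h1 (fun e => hnX (e ▸ ⟨i, i', he, hi, rfl⟩)) a b rfl
        simpa only [Sym2.mem_iff, forall_eq_or_imp, forall_eq] using this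
      · have := hD.2 _ (hO i i' ho hi) _ h2 (fun e => hnY (e ▸ hY1 ⟨i, i', ho, hi, rfl⟩)) a b rfl
        simpa only [Sym2.mem_iff, forall_eq_or_imp, forall_eq] using this
    have all : ∀ a b : S1, (∀ i i' : Fin k, i'.val = i.val + 1 →
        (p i ∈ cIoo a b ∧ p i' ∈ cIoo a b) ∨ (p i ∈ cIoo b a ∧ p i' ∈ cIoo b a)) →
        p ⟨0, by omega⟩ ∈ cIoo a b → Set.range p ⊆ cIoo a b := by
      intro a b step h0
      have : ∀ n (hn : n < k), p ⟨n, hn⟩ ∈ cIoo a b := by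
        intro n
        induction n with
        | zero => exact fun _ => h0
        | succ n ih =>
          intro hn
          rcases step ⟨n, by omega⟩ ⟨n + 1, hn⟩ rfl with h | h
          · exact h.2
          · exact absurd (cIoo_subset_cIcc _ _ (ih (by omega))) (not_mem_cIcc_iff.2 h.1)
      rintro _ ⟨i, rfl⟩; exact this i.1 i.2
    exact (step ⟨0, by omega⟩ ⟨1, by omega⟩ rfl).imp (fun h => all a b step h.1)
      fun h => all b a (fun i i' hi => (step i i' hi).symm) h.1
  · intro r q h1 h2 c1 c2
    obtain ⟨i, j, e1, hij, hV1⟩ := hform _ h1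
    obtain ⟨i', j', e2, hij', hV2⟩ := hform _ h2
    by_cases hk2 : k = 2
    · subst hk2
      left
      rw [e1, e2, Sym2.eq_iff, hinj.eq_iff, hinj.eq_iff, hinj.eq_iff, hinj.eq_iff]
      omega
    have orient : ∀ (r : Rect) (i j : Fin k), s(r.φ₁, r.φ₂) = s(p i, p j) → i ≠ j →
        (∀ l, p l ∈ cIcc (p j) (p i)) →
        (¬ Set.range p ⊆ cIcc r.φ₁ r.φ₂ ∨ Set.range p ⊆ cIcc r.φ₂ r.φ₁) →
        r.φ₁ = p i ∧ r.φ₂ = p j := by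
      intro r i j e hij hV c
      rcases Sym2.eq_iff.1 e with h | ⟨f1, f2⟩
      · exact h
      exfalso
      rw [f1, f2] at c
      have c := c.resolve_left fun h => h (by rintro _ ⟨l, rfl⟩; exact hV l)
      have third : ∃ l, l ≠ i ∧ l ≠ j := by
        by_contra! hn
        have : Fintype.card (Fin k) ≤ 2 := by
          rw [← Finset.card_univ]
          refine (Finset.card_le_card (t := {i, j}) fun l _ => ?_).trans Finset.card_le_two
          by_cases e : l = i
          · simp [e]
          · simp [hn l e]
        rw [Fintype.card_fin] at this
        omega
      obtain ⟨l, l1, l2⟩ := third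
      rcases (mem_cIcc_iff_or (hinj.ne hij)).1 (c ⟨l, rfl⟩) with h | h | h
      · exact l1 (hinj h)
      · exact l2 (hinj h)
      · exact not_mem_cIcc_iff.2 h (hV l)
    obtain ⟨a1, a2⟩ := orient r i j e1 hij hV1 c1
    obtain ⟨b1, b2⟩ := orient q i' j' e2 hij' hV2 c2
    by_cases hs : s(r.φ₁, r.φ₂) = s(q.φ₁, q.φ₂)
    · exact .inl hs
    have n1 : ∀ l, p l ∉ r.arcInt := fun l h => by
      rw [Rect.arcInt, a1, a2] at h; exact not_mem_cIcc_iff.2 h (hV1 l)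
    have n2 : ∀ l, p l ∉ q.arcInt := fun l h => by
      rw [Rect.arcInt, b1, b2] at h; exact not_mem_cIcc_iff.2 h (hV2 l)
    exact .inr (Rect.touch_of_ends (fun e => hs (by rw [e.1, e.2])) (b1 ▸ n1 _) (b2 ▸ n1 _)
      (a1 ▸ n2 _) (a2 ▸ n2 _))
  · intro c hc x hx
    obtain ⟨i, j, rfl, -⟩ := hform c hc
    rcases Sym2.mem_iff.1 hx with rfl | rfl <;> exact ⟨_, rfl⟩
  · refine (Set.encard_le_encard (t := {p ⟨0, by omega⟩, p ⟨k - 1, by omega⟩}) ?_).trans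
      ((Set.encard_insert_le _ _).trans (by rw [Set.encard_singleton]; norm_num))
    intro φ hφ
    have hφ' : ¬ ((∃ c ∈ C, φ ∈ c) ↔ ∃ c ∈ D, φ ∈ c) := hφ
    by_cases hc : ∃ c ∈ C, φ ∈ c
    · have hd : ∀ d ∈ D, φ ∉ d := fun d h1 h2 => hφ' ⟨fun _ => ⟨d, h1, h2⟩, fun _ => hc⟩
      obtain ⟨c, hc, hm⟩ := hc
      have hcX : c ∈ evenChords p := by
        by_contra hn
        exact hd c ((hD' c).2 (.inl ⟨hc, hn⟩)) hm
      obtain ⟨i, j, hi, hj, rfl⟩ := hcX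
      rcases Sym2.mem_iff.1 hm with rfl | rfl
      · by_cases h0 : i.val = 0
        · left; congr 1; exact Fin.ext h0
        · obtain ⟨m, hm'⟩ := hi
          exact absurd (by simp) (hd _ (hO ⟨i.val - 1, by omega⟩ i ⟨m - 1, by simp only; omega⟩
            (by simp only; omega)))
      · by_cases h0 : j.val + 1 = k
        · right; congr 1; exact Fin.ext (by simp only; omega)
        · obtain ⟨m, hm'⟩ := hi
          exact absurd (by simp) (hd _ (hO j ⟨j.val + 1, by omega⟩ ⟨m, by omega⟩ rfl))
    · have hd : ∃ d ∈ D, φ ∈ d := by by_contra hn; exact hφ' ⟨fun h => absurd h hc, fun h => absurd h hn⟩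
      have hc' : ∀ c ∈ C, φ ∉ c := fun c h1 h2 => hc ⟨c, h1, h2⟩
      obtain ⟨d, hd, hm⟩ := hd
      rcases (hD' d).1 hd with h | h
      · exact absurd hm (hc' d h.1)
      · rcases hY2 d h with ⟨i, j, hi, hj, rfl⟩ | ⟨h4, -, i, j, hi, hj, rfl⟩
        · obtain ⟨m, hm'⟩ := hi
          rcases Sym2.mem_iff.1 hm with rfl | rfl
          · exact absurd (by simp) (hc' _ (hX ⟨i.val - 1, by omega⟩ i ⟨m, by simp only; omega⟩
              (by simp only; omega)))
          · by_cases h0 : j.val + 1 = k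
            · right; congr 1; exact Fin.ext (by simp only; omega)
            · exact absurd (by simp) (hc' _ (hX j ⟨j.val + 1, by omega⟩ ⟨m + 1, by omega⟩ rfl))
        · rcases Sym2.mem_iff.1 hm with rfl | rfl
          · right; congr 1; exact Fin.ext (by simp only; omega)
          · left; congr 1; exact Fin.ext hj

lemma AdmissibleEvent.exists_eventAt {C D : Finset (Sym2 S1)} (h : AdmissibleEvent C D)
    (hC : IsNonCrossing C) (hD : IsNonCrossing D) : ∃ V, EventAt C D V := by
  rcases h with h | h
  · exact h.exists_eventAt hC hD
  · obtain ⟨V, hV⟩ := h.exists_eventAt hD hC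
    exact ⟨V, hV.symm⟩

/-- `Φ` is the right limit of the movie `Ψ`. -/
structure MovieLimits (Ψ Φ : S1 → Finset (Sym2 S1)) : Prop where
  right : ∀ θ : S1, ∀ᶠ t : ℝ in 𝓝[>] 0, Ψ (θ + (t : S1)) = Φ θ ∧ Φ (θ + (t : S1)) = Φ θ
  left : ∀ θ : S1, ∀ᶠ t : ℝ in 𝓝[>] 0, Ψ (θ - (t : S1)) = Ψ θ ∧ Φ (θ - (t : S1)) = Ψ θ
  nc : ∀ θ, IsNonCrossing (Ψ θ)
  event : ∀ θ, Ψ θ ≠ Φ θ → ∃ V, EventAt (Ψ θ) (Φ θ) V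

namespace MovieLimits
variable {Ψ Φ : S1 → Finset (Sym2 S1)}

lemma nc' (h : MovieLimits Ψ Φ) (θ : S1) : IsNonCrossing (Φ θ) := by
  obtain ⟨t, ht⟩ := (h.right θ).exists
  exact ht.1 ▸ h.nc _

lemma tame (h : MovieLimits Ψ Φ) (p : Finset (Sym2 S1) → Prop) :
    IsTame (fun θ => p (Ψ θ)) fun θ => p (Φ θ) where
  right θ := by filter_upwards [h.right θ] with t ht using by rw [ht.1, ht.2]; simp
  left θ := by filter_upwards [h.left θ] with t ht using by rw [ht.1, ht.2]; simp

lemma finite (h : MovieLimits Ψ Φ) : {c | ∃ θ, c ∈ Ψ θ}.Finite := by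
  have key : ∀ θ, ∀ᶠ z in 𝓝 θ, Ψ z = Ψ θ ∨ Ψ z = Φ θ := by
    intro θ
    rw [eventually_nhds_circle]
    refine ⟨.inl rfl, ?_, ?_⟩
    · filter_upwards [h.right θ] with t ht using .inr ht.1
    · filter_upwards [h.left θ] with t ht using .inl ht.1
  obtain ⟨s, hs⟩ := isCompact_univ.elim_nhds_subcover _ fun θ _ => key θ
  refine (s.finite_toSet.biUnion fun θ _ =>
    ((Ψ θ).finite_toSet.union (Φ θ).finite_toSet)).subset ?_
  rintro c ⟨θ, hc⟩
  obtain ⟨z, h1, h2⟩ := Set.mem_iUnion₂.1 (hs.2 (Set.mem_univ θ))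
  refine Set.mem_iUnion₂.2 ⟨z, h1, ?_⟩
  have h2' : Ψ θ = Ψ z ∨ Ψ θ = Φ z := h2
  rcases h2' with h2 | h2
  · exact .inl (h2 ▸ hc)
  · exact .inr (h2 ▸ hc)

lemma finite_ends (h : MovieLimits Ψ Φ) : (⋃ c ∈ {c | ∃ θ, c ∈ Ψ θ}, {x : S1 | x ∈ c}).Finite :=
  h.finite.biUnion fun c _ => by
    induction c with | _ a b => ?_
    simp only [Sym2.mem_iff]
    exact Set.toFinite {a, b}

lemma finite_arcs (h : MovieLimits Ψ Φ) : {c : S1 × S1 | ∃ θ, s(c.1, c.2) ∈ Ψ θ}.Finite := by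
  refine (h.finite_ends.prod h.finite_ends).subset ?_
  rintro ⟨a, b⟩ ⟨θ, hm⟩
  exact ⟨Set.mem_iUnion₂.2 ⟨s(a, b), ⟨θ, hm⟩, Sym2.mem_mk_left _ _⟩,
    Set.mem_iUnion₂.2 ⟨s(a, b), ⟨θ, hm⟩, Sym2.mem_mk_right _ _⟩⟩

lemma mem_after (h : MovieLimits Ψ Φ) {c : Sym2 S1} {θ : S1} (hc : c ∈ Φ θ) : ∃ z, c ∈ Ψ z := by
  obtain ⟨t, ht⟩ := (h.right θ).exists
  exact ⟨_, ht.1 ▸ hc⟩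

lemma finite_events (h : MovieLimits Ψ Φ) : {θ | Ψ θ ≠ Φ θ}.Finite := by
  refine (h.finite.biUnion fun c _ => (h.tame fun C => c ∈ C).finite_switch).subset ?_
  intro θ (hθ : Ψ θ ≠ Φ θ)
  by_contra hn
  refine hθ (Finset.ext fun c => ?_)
  by_contra hc
  refine hn (Set.mem_iUnion₂.2 ⟨c, ?_, hc⟩)
  by_cases h1 : c ∈ Ψ θ
  · exact ⟨θ, h1⟩
  · exact h.mem_after (θ := θ) (by tauto)

end MovieLimits

lemma eventually_not_mem_of_finite {E : Set S1} (hE : E.Finite) (θ : S1) :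
    (∀ᶠ t : ℝ in 𝓝[>] 0, θ + (t : S1) ∉ E) ∧ ∀ᶠ t : ℝ in 𝓝[>] 0, θ - (t : S1) ∉ E := by
  have h1 : ∀ e ∈ E, ∀ᶠ t : ℝ in 𝓝[>] 0, θ + (t : S1) ≠ e := by
    intro e _
    have hb : 0 < if ℓ θ e = 0 then 1 else ℓ θ e := by
      split_ifs with h
      · exact one_pos
      · exact lt_of_le_of_ne (arc_nonneg _ _) (Ne.symm h)
    filter_upwards [eventually_small hb, eventually_small one_pos] with t ht ht1 he
    have := arc_add (a := θ) ht1.1.le ht1.2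
    rw [he] at this
    split_ifs at ht <;> linarith [ht.1, ht.2]
  have h2 : ∀ e ∈ E, ∀ᶠ t : ℝ in 𝓝[>] 0, θ - (t : S1) ≠ e := by
    intro e _
    filter_upwards [eventually_small (sub_pos.2 (arc_lt_one θ e)), eventually_small one_pos]
      with t ht ht1 he
    have := arc_sub (a := θ) ht1.1 ht1.2
    rw [he] at this
    linarith [ht.2]
  constructor
  · filter_upwards [(eventually_all_finite hE).2 h1] with t ht hm using ht _ hm rfl
  · filter_upwards [(eventually_all_finite hE).2 h2] with t ht hm using ht _ hm rfl

lemma IsMovieDiagram.exists_limits {Ψ : S1 → Finset (Sym2 S1)} (h : IsMovieDiagram Ψ) :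
    ∃ Φ, MovieLimits Ψ Φ := by
  have key : ∀ θ : S1, ∃ C, (∀ᶠ t : ℝ in 𝓝[>] 0, Ψ (θ + (t : S1)) = C) ∧
      (C = Ψ θ ∨ AdmissibleEvent (Ψ θ) C) ∧ (Tendsto Ψ (𝓝 θ) (pure (Ψ θ)) → C = Ψ θ) := by
    intro θ
    by_cases hc : Tendsto Ψ (𝓝 θ) (pure (Ψ θ))
    · exact ⟨Ψ θ, (eventually_nhds_circle.1 (tendsto_pure.1 hc)).2.1, .inl rfl, fun _ => rfl⟩
    · obtain ⟨C, h1, h2⟩ := h.event θ hc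
      exact ⟨C, tendsto_pure.1 h1, .inr h2, fun h => absurd h hc⟩
  choose Φ h1 h2 h3 using key
  have hcont := h.finite_discontinuities
  have hleft : ∀ θ : S1, ∀ᶠ t : ℝ in 𝓝[>] 0, Ψ (θ - (t : S1)) = Ψ θ := by
    intro θ
    have := tendsto_pure.1 (h.left_continuous θ)
    rw [← map_neg_nhdsGT_zero, eventually_map] at this
    filter_upwards [this] with t ht
    rwa [AddCircle.coe_neg, ← sub_eq_add_neg] at ht
  refine ⟨Φ, fun θ => ?_, fun θ => ?_, h.nonCrossing, fun θ hne => ?_⟩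
  · filter_upwards [h1 θ, (eventually_not_mem_of_finite hcont θ).1] with t ht ht'
    exact ⟨ht, (h3 _ (not_not.1 ht')).trans ht⟩
  · filter_upwards [hleft θ, (eventually_not_mem_of_finite hcont θ).2] with t ht ht'
    exact ⟨ht, (h3 _ (not_not.1 ht')).trans ht⟩
  · refine ((h2 θ).resolve_left hne.symm).exists_eventAt (h.nonCrossing θ) ?_
    obtain ⟨t, ht⟩ := (h1 θ).exists
    exact ht ▸ h.nonCrossing _

lemma IsTame.encard_switch_le {p q : S1 → Prop} (h : IsTame p q) (hc : IsPreconnected {θ | p θ}) :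
    {θ | ¬ (p θ ↔ q θ)}.encard ≤ 2 := by
  have sep : ∀ z z' : S1, ¬ p z → ¬ p z' → ∀ u ∈ cIoo z z', ∀ v ∈ cIoo z' z, p u → p v →
      False := by
    intro z z' hz hz' u hu v hv pu pv
    have hne : z ≠ z' := by
      rintro rfl
      exact sbtw_irrefl_left_right (Set.mem_cIoo.1 hu)
    have := hc.subset_left_of_subset_union (isOpen_cIoo z z') (isOpen_cIoo z' z)
      (disjoint_left.2 fun x h1 h2 => not_mem_cIcc_iff.2 h2 (cIoo_subset_cIcc _ _ h1))
      (fun x (hx : p x) => by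
        by_cases hm : x ∈ cIcc z z'
        · rcases (mem_cIcc_iff_or hne).1 hm with rfl | rfl | hm
          · exact absurd hx hz
          · exact absurd hx hz'
          · exact .inl hm
        · exact .inr (not_mem_cIcc_iff.1 hm)) ⟨u, pu, hu⟩
    exact not_mem_cIcc_iff.2 hv (cIoo_subset_cIcc _ _ (this pv))
  have near : ∀ x y : S1, x ≠ y → ∀ᶠ t : ℝ in 𝓝[>] 0, x + (t : S1) ∈ cIoo x y := by
    intro x y hxy
    filter_upwards [eventually_small (arc_pos.2 hxy.symm), eventually_small one_pos] with t h1 h2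
    rw [mem_cIoo_iff, arc_add h2.1.le h2.2]; exact h1
  have ends : ∀ y y', p y → ¬ q y → p y' → ¬ q y' → y = y' := by
    intro y y' h1 h2 h3 h4
    by_contra hne
    obtain ⟨t, ht, ht'⟩ := ((near y y' hne).and (h.right y)).exists
    obtain ⟨s, hs, hs'⟩ := ((near y' y (Ne.symm hne)).and (h.right y')).exists
    refine sep (y + (t : S1)) (y' + (s : S1)) (fun h => h2 (ht'.1.1 h)) (fun h => h4 (hs'.1.1 h))
      y' ?_ y ?_ h3 h1 <;> rw [mem_cIoo_iff' y] at ht hs ⊢ <;> grind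
  have starts : ∀ x x', ¬ p x → q x → ¬ p x' → q x' → x = x' := by
    intro x x' h1 h2 h3 h4
    by_contra hne
    obtain ⟨t, ht, ht'⟩ := ((near x x' hne).and (h.right x)).exists
    obtain ⟨s, hs, hs'⟩ := ((near x' x (Ne.symm hne)).and (h.right x')).exists
    exact sep x x' h1 h3 _ ht _ hs (ht'.1.2 h2) (hs'.1.2 h4)
  have e : {θ | ¬ (p θ ↔ q θ)} ⊆ {θ | p θ ∧ ¬ q θ} ∪ {θ | ¬ p θ ∧ q θ} := by
    intro θ (hθ : ¬ _)
    by_cases h1 : p θ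
    · exact .inl ⟨h1, fun h2 => hθ ⟨fun _ => h2, fun _ => h1⟩⟩
    · exact .inr ⟨h1, by tauto⟩
  refine (Set.encard_le_encard e).trans ((Set.encard_union_le _ _).trans ?_)
  have b1 : {θ | p θ ∧ ¬ q θ}.encard ≤ 1 :=
    Set.encard_le_one_iff.2 fun a b ha hb => ends a b ha.1 ha.2 hb.1 hb.2
  have b2 : {θ | ¬ p θ ∧ q θ}.encard ≤ 1 :=
    Set.encard_le_one_iff.2 fun a b ha hb => starts a b ha.1 ha.2 hb.1 hb.2
  calc _ ≤ (1 + 1 : ℕ∞) := add_le_add b1 b2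
    _ = 2 := by norm_num

/-! ## Selecting an arc for each chord of a movie -/

/-- The arc `[a;b]` is selected: either it misses `o`, and it is not flipped, or it is obtained by
flipping. An arc that contains `V` is flipped if the length of the opposite arc satisfies `T`. -/
def Selects (o : S1) (V : Set S1) (T : ℝ → Prop) (a b : S1) : Prop :=
  (o ∈ cIoo b a ∧ ¬ (V ⊆ cIcc a b ∧ T (ℓ b a))) ∨
    (o ∈ cIoo a b ∧ V ⊆ cIcc b a ∧ T (ℓ a b))

lemma not_mem_cIoo_of_mem_cIcc {a b x : S1} (h : x ∈ cIcc a b) : x ∉ cIoo b a :=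
  fun h' => not_mem_cIcc_iff.2 h' h

lemma not_mem_cIoo_of_mem_cIoo {a b x : S1} (h : x ∈ cIoo a b) : x ∉ cIoo b a :=
  not_mem_cIoo_of_mem_cIcc (cIoo_subset_cIcc _ _ h)

lemma arc_lt_of_subset {a b c d : S1} (hab : a ≠ b)
    (h : cIcc a b ⊆ cIoo c d) : ℓ a b < ℓ c d := by
  have h1 := mem_cIoo_iff.1 (h (left_mem_cIcc a b))
  have h2 := mem_cIoo_iff.1 (h (right_mem_cIcc a b))
  have h3 : c ∉ cIcc a b := fun hm => left_not_mem_cIoo _ _ (h hm)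
  rw [mem_cIcc_iff' c hab, arc_self] at h3
  rw [arc_eq_ite c a b]
  have := arc_nonneg c b
  split_ifs <;> grind

lemma cIcc_subset_swap {a b c d : S1} (h : cIcc a b ⊆ cIoo c d) :
    cIcc d c ⊆ cIoo b a := fun x hx => by
  rw [← not_mem_cIcc_iff]; exact fun hm => not_mem_cIoo_of_mem_cIcc hx (h hm)

section selects
variable {o : S1} {V : Set S1} {T T' : ℝ → Prop}

/-- The reversed rectangle; only its vertical arc matters. -/
def Rect.swap (r : Rect) : Rect := ⟨r.θ₁, r.θ₂, r.φ₂, r.φ₁, r.hθ, r.hφ.symm⟩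

lemma Selects.laminar (hT : ∀ x y, x ≤ y → T y → T x) (hV : V.Nonempty) {C : Finset (Sym2 S1)}
    (hC : IsNonCrossing C) {r q : Rect} (hr : s(r.φ₁, r.φ₂) ∈ C) (hq : s(q.φ₁, q.φ₂) ∈ C)
    (h1 : Selects o V T r.φ₁ r.φ₂) (h2 : Selects o V T q.φ₁ q.φ₂)
    (hne : ¬ (r.φ₁ = q.φ₁ ∧ r.φ₂ = q.φ₂)) : r.Laminar q := by
  by_cases hs : s(r.φ₁, r.φ₂) = s(q.φ₁, q.φ₂)
  · exfalso
    rcases Sym2.eq_iff.1 hs with h | ⟨e1, e2⟩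
    · exact hne h
    · rw [e1, e2] at h1
      rcases h1 with h1 | h1 <;> rcases h2 with h2 | h2
      · exact not_mem_cIoo_of_mem_cIoo h1.1 h2.1
      · exact h1.2 h2.2
      · exact h2.2 h1.2
      · exact not_mem_cIoo_of_mem_cIoo h1.1 h2.1
  have main : ∀ r q : Rect, s(r.φ₁, r.φ₂) ∈ C → s(q.φ₁, q.φ₂) ∈ C →
      s(r.φ₁, r.φ₂) ≠ s(q.φ₁, q.φ₂) →
      (o ∈ cIoo r.φ₁ r.φ₂ ∧ V ⊆ cIcc r.φ₂ r.φ₁ ∧ T (ℓ r.φ₁ r.φ₂)) →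
      (o ∈ cIoo q.φ₂ q.φ₁ ∧ ¬ (V ⊆ cIcc q.φ₁ q.φ₂ ∧ T (ℓ q.φ₂ q.φ₁))) →
      r.Laminar q := by
    rintro r q hr hq hs ⟨a1, a2, a3⟩ ⟨b1, b2⟩
    by_cases hVq : V ⊆ cIcc q.φ₁ q.φ₂
    · have hnT : ¬ T (ℓ q.φ₂ q.φ₁) := fun h => b2 ⟨hVq, h⟩
      obtain ⟨x, hx⟩ := hV
      have hl : r.Laminar q.swap := Rect.laminar_of_nonCrossing hC hr
        (by rw [Sym2.eq_swap]; exact hq) (by rw [ne_eq, Sym2.eq_swap (a := q.swap.φ₁)]; exact hs)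
        (not_mem_cIoo_of_mem_cIcc (a2 hx)) (not_mem_cIoo_of_mem_cIcc (hVq hx))
      rcases hl with h | h | h
      · exact absurd (cIoo_subset_cIcc _ _ b1)
          (disjoint_left.1 h (cIoo_subset_cIcc _ _ a1))
      · exact .inl (disjoint_left.2 fun y h1 h2 => not_mem_cIoo_of_mem_cIcc h2 (h h1))
      · exact absurd (hT _ _ (arc_lt_of_subset q.hφ.symm h).le a3) hnT
    · obtain ⟨x, hx, hxq⟩ := Set.not_subset.1 hVq
      exact Rect.laminar_of_nonCrossing hC hr hq hs (not_mem_cIoo_of_mem_cIcc (a2 hx))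
        fun h => hxq (cIoo_subset_cIcc _ _ h)
  rcases h1 with h1 | h1 <;> rcases h2 with h2 | h2
  · exact Rect.laminar_of_nonCrossing hC hr hq hs (not_mem_cIoo_of_mem_cIoo h1.1)
      (not_mem_cIoo_of_mem_cIoo h2.1)
  · exact (main q r hq hr (Ne.symm hs) h2 h1).symm
  · exact main r q hr hq hs h1 h2
  · obtain ⟨x, hx⟩ := hV
    exact Rect.laminar_of_nonCrossing hC hr hq hs (not_mem_cIoo_of_mem_cIcc (h1.2.1 hx))
      (not_mem_cIoo_of_mem_cIcc (h2.2.1 hx))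

lemma Selects.changed {a b : S1} (h : ¬ (Selects o V T a b ↔ Selects o V T' a b)) :
    (o ∈ cIoo b a ∧ V ⊆ cIcc a b ∧ ¬ (T (ℓ b a) ↔ T' (ℓ b a))) ∨
    (o ∈ cIoo a b ∧ V ⊆ cIcc b a ∧ ¬ (T (ℓ a b) ↔ T' (ℓ a b))) := by
  by_cases h1 : o ∈ cIoo b a
  · have h2 := not_mem_cIoo_of_mem_cIoo h1
    left
    simp only [Selects, h1, h2, true_and, false_and, or_false] at h ⊢
    exact ⟨by by_contra hn; exact h (by simp [hn]), by tauto⟩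
  · right
    simp only [Selects, h1, false_and, false_or] at h
    by_cases h2 : o ∈ cIoo a b
    · simp only [h2, true_and] at h ⊢
      exact ⟨by by_contra hn; exact h (by simp [hn]), by tauto⟩
    · simp [h2] at h

lemma Selects.thru (hT : ∀ x y, x ≤ y → T y → T x) (hT' : ∀ x y, x ≤ y → T' y → T' x)
    (hV : V.Nonempty) {r q : Rect}
    (hr : ¬ (Selects o V T r.φ₁ r.φ₂ ↔ Selects o V T' r.φ₁ r.φ₂))
    (h1 : Selects o V T q.φ₁ q.φ₂) (h2 : Selects o V T' q.φ₁ q.φ₂) : ¬ r.Inner q := by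
  intro hi
  have hi' : cIcc r.φ₁ r.φ₂ ⊆ cIoo q.φ₁ q.φ₂ := hi
  have hr := Selects.changed hr
  rcases h1 with h1 | h1
  · have h2 := (h2.resolve_right fun h => not_mem_cIoo_of_mem_cIoo h.1 h1.1).2
    rcases hr with ⟨a1, a2, a3⟩ | ⟨a1, a2, a3⟩
    · have hVq : V ⊆ cIcc q.φ₁ q.φ₂ := a2.trans (hi'.trans (cIoo_subset_cIcc _ _))
      have n1 := fun h => h1.2 ⟨hVq, h⟩
      have n2 := fun h => h2 ⟨hVq, h⟩
      have hl := (arc_lt_of_subset q.hφ.symm (cIcc_subset_swap hi')).le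
      exact a3 ⟨fun h => absurd (hT _ _ hl h) n1, fun h => absurd (hT' _ _ hl h) n2⟩
    · exact not_mem_cIoo_of_mem_cIoo h1.1 (hi (cIoo_subset_cIcc _ _ a1))
  · have h2 := (h2.resolve_left fun h => not_mem_cIoo_of_mem_cIoo h1.1 h.1).2
    rcases hr with ⟨a1, a2, a3⟩ | ⟨a1, a2, a3⟩
    · obtain ⟨x, hx⟩ := hV
      exact not_mem_cIoo_of_mem_cIcc (h1.2.1 hx) (hi (a2 hx))
    · have hl := (arc_lt_of_subset r.hφ hi').le
      exact a3 ⟨fun _ => hT' _ _ hl h2.2, fun _ => hT _ _ hl h1.2.2⟩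

lemma Selects.same_of_changed (hsub : ∀ x y, ¬ (T x ↔ T' x) → ¬ (T y ↔ T' y) → x = y)
    (hV : V.Nonempty) {C : Finset (Sym2 S1)} (hC : IsNonCrossing C) {r q : Rect}
    (hr : s(r.φ₁, r.φ₂) ∈ C) (hq : s(q.φ₁, q.φ₂) ∈ C)
    (h1 : ¬ (Selects o V T r.φ₁ r.φ₂ ↔ Selects o V T' r.φ₁ r.φ₂))
    (h2 : ¬ (Selects o V T q.φ₁ q.φ₂ ↔ Selects o V T' q.φ₁ q.φ₂)) :
    s(r.φ₁, r.φ₂) = s(q.φ₁, q.φ₂) := by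
  have h1 := Selects.changed h1
  have h2 := Selects.changed h2
  have main : ∀ r q : Rect, s(r.φ₁, r.φ₂) ∈ C → s(q.φ₁, q.φ₂) ∈ C →
      (o ∈ cIoo r.φ₁ r.φ₂ ∧ V ⊆ cIcc r.φ₂ r.φ₁ ∧
        ¬ (T (ℓ r.φ₁ r.φ₂) ↔ T' (ℓ r.φ₁ r.φ₂))) →
      (o ∈ cIoo q.φ₁ q.φ₂ ∧ V ⊆ cIcc q.φ₂ q.φ₁ ∧
        ¬ (T (ℓ q.φ₁ q.φ₂) ↔ T' (ℓ q.φ₁ q.φ₂))) →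
      s(r.φ₁, r.φ₂) = s(q.φ₁, q.φ₂) := by
    rintro r q hr hq ⟨a1, a2, a3⟩ ⟨b1, b2, b3⟩
    by_contra hne
    obtain ⟨x, hx⟩ := hV
    have e := hsub _ _ a3 b3
    rcases Rect.laminar_of_nonCrossing hC hr hq hne (not_mem_cIoo_of_mem_cIcc (a2 hx))
      (not_mem_cIoo_of_mem_cIcc (b2 hx)) with h | h | h
    · exact disjoint_left.1 h (cIoo_subset_cIcc _ _ a1) (cIoo_subset_cIcc _ _ b1)
    · exact (arc_lt_of_subset r.hφ h).ne e
    · exact (arc_lt_of_subset q.hφ h).ne e.symm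
  have hr' : s(r.swap.φ₁, r.swap.φ₂) ∈ C := by rw [Sym2.eq_swap]; exact hr
  have hq' : s(q.swap.φ₁, q.swap.φ₂) ∈ C := by rw [Sym2.eq_swap]; exact hq
  have er : s(r.swap.φ₁, r.swap.φ₂) = s(r.φ₁, r.φ₂) := Sym2.eq_swap
  have eq : s(q.swap.φ₁, q.swap.φ₂) = s(q.φ₁, q.φ₂) := Sym2.eq_swap
  rcases h1 with h1 | h1 <;> rcases h2 with h2 | h2
  · rw [← er, ← eq]; exact main r.swap q.swap hr' hq' h1 h2
  · rw [← er]; exact main r.swap q hr' hq h1 h2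
  · rw [← eq]; exact main r q.swap hr hq' h1 h2
  · exact main r q hr hq h1 h2

end selects

/-- The local picture of a selection: either the rule of selection is the same on both sides of the
moment and an event happens, or there is no event and the rule changes for one length only. -/
structure LocalRule (o : S1) (C D : Finset (Sym2 S1)) (V : Set S1) (T T' : ℝ → Prop) : Prop where
  nonempty : V.Nonempty
  anti : ∀ x y, x ≤ y → T y → T x
  anti' : ∀ x y, x ≤ y → T' y → T' x
  alt : (EventAt C D V ∧ ∀ x < 1, T x ∧ T' x) ∨
    (C = D ∧ ∀ x y, ¬ (T x ↔ T' x) → ¬ (T y ↔ T' y) → x = y)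

lemma ArcFamily.fits_of_localRule {o : S1} {Ψ Φ : S1 → Finset (Sym2 S1)} (hΨ : MovieLimits Ψ Φ)
    {ML MR : S1 → S1 → S1 → Prop}
    (h : ∀ θ, ∃ V T T', LocalRule o (Ψ θ) (Φ θ) V T T' ∧
      (∀ a b, ML a b θ ↔ s(a, b) ∈ Ψ θ ∧ Selects o V T a b) ∧
      ∀ a b, MR a b θ ↔ s(a, b) ∈ Φ θ ∧ Selects o V T' a b) : ArcFamily.Fits ML MR := by
  have hch : ∀ (V : Set S1) (T : ℝ → Prop), (∀ x < (1:ℝ), T x) → ∀ a b, Selects o V T a b →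
      (¬ V ⊆ cIcc a b ∨ V ⊆ cIcc b a) := by
    rintro V T hT a b (h | h)
    · exact .inl fun hV => h.2 ⟨hV, hT _ (arc_lt_one _ _)⟩
    · exact .inr h.2.1
  have pair : ∀ (r q : Rect) θ, ¬ (ML r.φ₁ r.φ₂ θ ↔ MR r.φ₁ r.φ₂ θ) →
      ¬ (ML q.φ₁ q.φ₂ θ ↔ MR q.φ₁ q.φ₂ θ) → s(r.φ₁, r.φ₂) = s(q.φ₁, q.φ₂) ∨ r.Touch q := by
    intro r q θ hr hq
    obtain ⟨V, T, T', hl, h1, h2⟩ := h θ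
    rw [h1, h2] at hr hq
    rcases hl.alt with ⟨hev, hT⟩ | ⟨e, hT⟩
    · have hTT : ∀ a b, Selects o V T a b ↔ Selects o V T' a b := fun a b => by
        simp only [Selects, (hT _ (arc_lt_one _ _)).1, (hT _ (arc_lt_one _ _)).2]
      rw [hTT] at hr hq
      refine hev.touch r q (fun e => hr (by rw [e])) (fun e => hq (by rw [e])) ?_ ?_
      · exact hch V T' (fun x hx => (hT x hx).2) _ _ (by by_contra hn; exact hr (by simp [hn]))
      · exact hch V T' (fun x hx => (hT x hx).2) _ _ (by by_contra hn; exact hq (by simp [hn]))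
    · rw [← e] at hr hq
      have cr : s(r.φ₁, r.φ₂) ∈ Ψ θ := by by_contra hn; exact hr (by simp [hn])
      have cq : s(q.φ₁, q.φ₂) ∈ Ψ θ := by by_contra hn; exact hq (by simp [hn])
      exact .inl (Selects.same_of_changed hT hl.nonempty (hΨ.nc θ) cr cq
        (fun e => hr (by rw [e])) fun e => hq (by rw [e]))
  have noin : ∀ r q : Rect, (s(r.φ₁, r.φ₂) = s(q.φ₁, q.φ₂) ∨ r.Touch q) → ¬ r.Inner q := by
    rintro r q (h | h) hi
    · have : r.φ₁ ∈ s(q.φ₁, q.φ₂) := h ▸ Sym2.mem_mk_left _ _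
      exact (Rect.mem_chord.1 this).not_mem_arcInt (hi r.φ₁_mem_arc)
    · exact hi.not_touch h
  refine ⟨?_, ?_, ?_, ?_, ?_, ?_⟩
  · intro r q θ a1 a2 hne
    obtain ⟨V, T, T', hl, h1, h2⟩ := h θ
    rw [h1] at a1 a2
    exact Selects.laminar hl.anti hl.nonempty (hΨ.nc θ) a1.1 a2.1 a1.2 a2.2 hne
  · intro r q θ a1 a2 hne
    obtain ⟨V, T, T', hl, h1, h2⟩ := h θ
    rw [h2] at a1 a2
    exact Selects.laminar hl.anti' hl.nonempty (hΨ.nc' θ) a1.1 a2.1 a1.2 a2.2 hne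
  · intro r q θ hr a1 a2 hi
    obtain ⟨V, T, T', hl, h1, h2⟩ := h θ
    rw [h1, h2] at hr
    rw [h1] at a1
    rw [h2] at a2
    rcases hl.alt with ⟨hev, hT⟩ | ⟨e, hT⟩
    · have hTT : ∀ a b, Selects o V T a b ↔ Selects o V T' a b := fun a b => by
        simp only [Selects, (hT _ (arc_lt_one _ _)).1, (hT _ (arc_lt_one _ _)).2]
      rw [hTT] at hr
      have m := hev.ends _ (fun e => hr (by rw [e])) r.φ₁ (Sym2.mem_mk_left _ _)
      have mi := hi r.φ₁_mem_arc
      rcases hev.thru _ _ a1.1 a2.1 with hv | hv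
      · rcases hch V T (fun x hx => (hT x hx).1) _ _ a1.2 with hc | hc
        · exact hc (hv.trans (cIoo_subset_cIcc _ _))
        · exact not_mem_cIoo_of_mem_cIcc (hc m) mi
      · exact not_mem_cIoo_of_mem_cIoo (hv m) mi
    · rw [← e] at hr
      exact Selects.thru hl.anti hl.anti' hl.nonempty (fun e => hr (by rw [e])) a1.2 a2.2 hi
  · intro r q θ a1 a2 b1 b2
    exact noin r q (pair r q θ (fun e => a2 (e.1 a1)) fun e => b2 (e.1 b1))
  · intro r q θ a1 a2 b1 b2
    exact noin r q (pair r q θ (fun e => a2 (e.2 a1)) fun e => b2 (e.2 b1))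
  · intro r q θ a1 a2 b1 b2
    rcases pair r q θ (fun e => a2 (e.1 a1)) (fun e => b2 (e.2 b1)) with hs | ht
    · rcases Sym2.eq_iff.1 hs with ⟨e1, e2⟩ | ⟨e1, e2⟩
      · rw [e1, e2] at a1; exact absurd a1 b2
      · refine Rect.touch_of_ends (fun e => r.hφ (e.1.trans e2.symm)) ?_ ?_ ?_ ?_
        · rw [← e2]; exact r.φ₂_not_mem_arcInt
        · rw [← e1]; exact r.φ₁_not_mem_arcInt
        · rw [e1]; exact q.φ₂_not_mem_arcInt
        · rw [e2]; exact q.φ₁_not_mem_arcInt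
    · exact ht

/-! ## Every movie with connected lifetimes comes from a diagram -/

namespace IsTame
variable {p q p' q' : S1 → Prop}

lemma and (h : IsTame p q) (h' : IsTame p' q') : IsTame (fun θ => p θ ∧ p' θ) fun θ => q θ ∧ q' θ where
  right θ := by
    filter_upwards [h.right θ, h'.right θ] with t h1 h2 using by simp only [h1.1, h1.2, h2.1, h2.2, and_self]
  left θ := by
    filter_upwards [h.left θ, h'.left θ] with t h1 h2 using by simp only [h1.1, h1.2, h2.1, h2.2, and_self]

lemma or (h : IsTame p q) (h' : IsTame p' q') : IsTame (fun θ => p θ ∨ p' θ) fun θ => q θ ∨ q' θ where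
  right θ := by
    filter_upwards [h.right θ, h'.right θ] with t h1 h2 using by simp only [h1.1, h1.2, h2.1, h2.2, and_self]
  left θ := by
    filter_upwards [h.left θ, h'.left θ] with t h1 h2 using by simp only [h1.1, h1.2, h2.1, h2.2, and_self]

lemma const (P : Prop) : IsTame (fun _ => P) fun _ => P where
  right _ := by simp
  left _ := by simp

lemma exists_mem {ι : Type*} (X : Finset ι) {p q : ι → S1 → Prop} (h : ∀ i ∈ X, IsTame (p i) (q i)) :
    IsTame (fun θ => ∃ i ∈ X, p i θ) fun θ => ∃ i ∈ X, q i θ where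
  right θ := by
    filter_upwards [(eventually_all_finset X).2 fun i hi => (h i hi).right θ] with t ht
    exact ⟨exists_congr fun i => and_congr_right fun hi => (ht i hi).1,
      exists_congr fun i => and_congr_right fun hi => (ht i hi).2⟩
  left θ := by
    filter_upwards [(eventually_all_finset X).2 fun i hi => (h i hi).left θ] with t ht
    exact ⟨exists_congr fun i => and_congr_right fun hi => (ht i hi).1,
      exists_congr fun i => and_congr_right fun hi => (ht i hi).2⟩

lemma interval {x y : S1} (h : x ≠ y) : IsTame (fun θ => θ ∈ hIoc x y) fun θ => θ ∈ hIco x y where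
  right θ := (⟨x, y, x, y, h, h⟩ : Rect).eventually_right θ
  left θ := (⟨x, y, x, y, h, h⟩ : Rect).eventually_left θ

end IsTame

section window
variable {s θ : S1} {w : ℝ}

lemma window_ne (h0 : 0 < w) (h1 : w < 1 / 2) : s - (w : S1) ≠ s + (w : S1) := by
  intro h
  have : s + ((-w : ℝ) : S1) = s + (w : S1) := by rw [AddCircle.coe_neg, ← sub_eq_add_neg, h]
  have := eq_of_add_coe_eq this (by rw [abs_lt]; constructor <;> linarith)
  linarith

lemma window_arc (h1 : w < 1 / 2) {t : ℝ} (h2 : -w ≤ t) (h3 : t ≤ w) :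
    ℓ (s - (w : S1)) (s + (t : S1)) = w + t := by
  have := arc_add (a := s - (w : S1)) (t := w + t) (by linarith) (by linarith)
  rwa [AddCircle.coe_add, ← add_assoc, sub_add_cancel] at this

lemma window_eq (θ : S1) : θ = s + ((ℓ (s - (w : S1)) θ - w : ℝ) : S1) := by
  have := add_arc (s - (w : S1)) θ
  rw [AddCircle.coe_sub]
  nth_rewrite 1 [← this]
  abel

lemma mem_window_left (h0 : 0 < w) (h1 : w < 1 / 2) :
    θ ∈ hIoc (s - (w : S1)) (s + (w : S1)) ↔ ∃ t : ℝ, -w < t ∧ t ≤ w ∧ θ = s + (t : S1) := by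
  rw [mem_hIoc_iff (window_ne h0 h1), window_arc h1 (by linarith) le_rfl]
  constructor
  · intro h
    exact ⟨_, by linarith [h.1], by linarith [h.2], window_eq θ⟩
  · rintro ⟨t, h2, h3, rfl⟩
    rw [window_arc h1 h2.le h3]; constructor <;> linarith

lemma mem_window_right (h0 : 0 < w) (h1 : w < 1 / 2) :
    θ ∈ hIco (s - (w : S1)) (s + (w : S1)) ↔ ∃ t : ℝ, -w ≤ t ∧ t < w ∧ θ = s + (t : S1) := by
  rw [mem_hIco_iff (window_ne h0 h1), window_arc h1 (by linarith) le_rfl]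
  constructor
  · intro h
    exact ⟨_, by linarith [arc_nonneg (s - (w : S1)) θ], by linarith, window_eq θ⟩
  · rintro ⟨t, h2, h3, rfl⟩
    rw [window_arc h1 h2 h3.le]; linarith

end window

/-- The arc `[a;b]` is flipped immediately before `θ`: this happens near the stops `s` whose points
`poly s` lie in it. -/
def FlipL (X : Finset S1) (poly : S1 → Set S1) (ε : ℝ) (a b θ : S1) : Prop :=
  ∃ s ∈ X, poly s ⊆ cIcc a b ∧ θ ∈ hIoc (s - ((ε * (1 - ℓ b a) : ℝ) : S1))
    (s + ((ε * (1 - ℓ b a) : ℝ) : S1))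

def FlipR (X : Finset S1) (poly : S1 → Set S1) (ε : ℝ) (a b θ : S1) : Prop :=
  ∃ s ∈ X, poly s ⊆ cIcc a b ∧ θ ∈ hIco (s - ((ε * (1 - ℓ b a) : ℝ) : S1))
    (s + ((ε * (1 - ℓ b a) : ℝ) : S1))

/-- The data from which a diagram realizing a movie is built: a finite set of stops, to each of which
some points are assigned, and a small number. -/
structure Stops (Ψ Φ : S1 → Finset (Sym2 S1)) (o : S1) (X : Finset S1) (poly : S1 → Set S1)
    (ε : ℝ) : Prop where
  lim : MovieLimits Ψ Φ
  base : ∀ θ, ∀ c ∈ Ψ θ, o ∉ c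
  pos : 0 < ε
  lt : ε < 1 / 2
  sep : ∀ s ∈ X, ∀ s' ∈ X, ∀ t t' : ℝ, |t| ≤ ε → |t'| ≤ ε → s + (t : S1) = s' + (t' : S1) →
    s = s' ∧ t = t'
  nonempty : ∀ s ∈ X, (poly s).Nonempty
  event : ∀ θ, Ψ θ ≠ Φ θ → θ ∈ X ∧ EventAt (Ψ θ) (Φ θ) (poly θ)
  always : ∀ a b, (∀ θ, s(a, b) ∈ Ψ θ) → o ∈ cIoo a b → ∃ s ∈ X, poly s ⊆ cIcc b a

namespace Stops
variable {Ψ Φ : S1 → Finset (Sym2 S1)} {o : S1} {X : Finset S1} {poly : S1 → Set S1} {ε : ℝ}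

lemma width (h : Stops Ψ Φ o X poly ε) (a b : S1) :
    0 < ε * (1 - ℓ a b) ∧ ε * (1 - ℓ a b) ≤ ε ∧ ε * (1 - ℓ a b) < 1 / 2 := by
  have h1 := arc_lt_one a b
  have h2 := arc_nonneg a b
  have h3 := h.pos
  have h4 := h.lt
  have h5 : ε * (1 - ℓ a b) ≤ ε := by nlinarith
  exact ⟨mul_pos h3 (by linarith), h5, by linarith⟩

lemma flipL_iff (h : Stops Ψ Φ o X poly ε) {s : S1} (hs : s ∈ X) {t : ℝ} (ht : |t| ≤ ε) (a b : S1) :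
    FlipL X poly ε a b (s + (t : S1)) ↔ poly s ⊆ cIcc a b ∧
      (-(ε * (1 - ℓ b a)) < t ∧ t ≤ ε * (1 - ℓ b a)) := by
  obtain ⟨w0, w1, w2⟩ := h.width b a
  unfold FlipL
  simp only [mem_window_left w0 w2]
  constructor
  · rintro ⟨s', hs', h1, t', h2, h3, h4⟩
    obtain ⟨rfl, rfl⟩ := h.sep s hs s' hs' t t' ht (abs_le.2 ⟨by linarith, by linarith⟩) h4
    exact ⟨h1, h2, h3⟩
  · rintro ⟨h1, h2, h3⟩
    exact ⟨s, hs, h1, t, h2, h3, rfl⟩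

lemma flipR_iff (h : Stops Ψ Φ o X poly ε) {s : S1} (hs : s ∈ X) {t : ℝ} (ht : |t| ≤ ε) (a b : S1) :
    FlipR X poly ε a b (s + (t : S1)) ↔ poly s ⊆ cIcc a b ∧
      (-(ε * (1 - ℓ b a)) ≤ t ∧ t < ε * (1 - ℓ b a)) := by
  obtain ⟨w0, w1, w2⟩ := h.width b a
  unfold FlipR
  simp only [mem_window_right w0 w2]
  constructor
  · rintro ⟨s', hs', h1, t', h2, h3, h4⟩
    obtain ⟨rfl, rfl⟩ := h.sep s hs s' hs' t t' ht (abs_le.2 ⟨by linarith, by linarith⟩) h4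
    exact ⟨h1, h2, h3⟩
  · rintro ⟨h1, h2, h3⟩
    exact ⟨s, hs, h1, t, h2, h3, rfl⟩

lemma not_flip (h : Stops Ψ Φ o X poly ε) {θ : S1}
    (hθ : ∀ s ∈ X, ∀ t : ℝ, |t| ≤ ε → θ ≠ s + (t : S1)) (a b : S1) :
    ¬ FlipL X poly ε a b θ ∧ ¬ FlipR X poly ε a b θ := by
  obtain ⟨w0, w1, w2⟩ := h.width b a
  constructor
  · rintro ⟨s, hs, h1, h2⟩
    obtain ⟨t, h3, h4, h5⟩ := (mem_window_left w0 w2).1 h2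
    exact hθ s hs t (abs_le.2 ⟨by linarith, by linarith⟩) h5
  · rintro ⟨s, hs, h1, h2⟩
    obtain ⟨t, h3, h4, h5⟩ := (mem_window_right w0 w2).1 h2
    exact hθ s hs t (abs_le.2 ⟨by linarith, by linarith⟩) h5

lemma localRule (h : Stops Ψ Φ o X poly ε) (θ : S1) : ∃ V T T', LocalRule o (Ψ θ) (Φ θ) V T T' ∧
    (∀ a b, FlipL X poly ε a b θ ↔ V ⊆ cIcc a b ∧ T (ℓ b a)) ∧
    ∀ a b, FlipR X poly ε a b θ ↔ V ⊆ cIcc a b ∧ T' (ℓ b a) := by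
  have hX : ∀ θ, Ψ θ ≠ Φ θ → θ ∈ X := fun θ hθ => (h.event θ hθ).1
  have hε := h.pos
  by_cases hθ : ∃ s ∈ X, ∃ t : ℝ, |t| ≤ ε ∧ θ = s + (t : S1)
  · obtain ⟨s, hs, t, ht, rfl⟩ := hθ
    refine ⟨poly s, fun x => -(ε * (1 - x)) < t ∧ t ≤ ε * (1 - x),
      fun x => -(ε * (1 - x)) ≤ t ∧ t < ε * (1 - x), ⟨h.nonempty s hs, ?_, ?_, ?_⟩,
      h.flipL_iff hs ht, h.flipR_iff hs ht⟩
    · rintro x y hxy ⟨h1, h2⟩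
      have : ε * (1 - y) ≤ ε * (1 - x) := by nlinarith
      exact ⟨by linarith, by linarith⟩
    · rintro x y hxy ⟨h1, h2⟩
      have : ε * (1 - y) ≤ ε * (1 - x) := by nlinarith
      exact ⟨by linarith, by linarith⟩
    · by_cases hev : Ψ (s + (t : S1)) = Φ (s + (t : S1))
      · right
        refine ⟨hev, fun x y hx hy => ?_⟩
        have key : ∀ x, ¬ ((-(ε * (1 - x)) < t ∧ t ≤ ε * (1 - x)) ↔
            (-(ε * (1 - x)) ≤ t ∧ t < ε * (1 - x))) → ε * (1 - x) = |t| := by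
          intro x hx
          rcases lt_trichotomy |t| (ε * (1 - x)) with h1 | h1 | h1
          · rw [abs_lt] at h1
            exact absurd ⟨fun _ => ⟨h1.1.le, h1.2⟩, fun _ => ⟨h1.1, h1.2.le⟩⟩ hx
          · exact h1.symm
          · refine absurd ⟨fun h2 => ?_, fun h2 => ?_⟩ hx <;>
              exact absurd (abs_le.2 ⟨by linarith [h2.1], by linarith [h2.2]⟩) (not_le.2 h1)
        have e : ε * (1 - x) = ε * (1 - y) := (key x hx).trans (key y hy).symm
        have := mul_left_cancel₀ hε.ne' e
        linarith
      · left
        have e := hX _ hev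
        obtain ⟨e1, rfl⟩ := h.sep s hs _ e t 0 ht (by simpa using hε.le) (by simp)
        refine ⟨?_, fun x hx => ?_⟩
        · have := (h.event _ hev).2
          rwa [← e1] at this ⊢
        · have : 0 < ε * (1 - x) := mul_pos hε (by linarith)
          exact ⟨⟨by linarith, by linarith⟩, by linarith, by linarith⟩
  · push Not at hθ
    refine ⟨{o}, fun _ => False, fun _ => False, ⟨Set.singleton_nonempty o, by simp, by simp,
      .inr ⟨?_, by simp⟩⟩, fun a b => ?_, fun a b => ?_⟩
    · by_contra hne
      exact hθ θ (hX θ hne) 0 (by simpa using hε.le) (by simp)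
    · simpa using (h.not_flip hθ a b).1
    · simpa using (h.not_flip hθ a b).2

lemma base_ne (h : Stops Ψ Φ o X poly ε) {a b θ : S1} (hc : s(a, b) ∈ Ψ θ) :
    a ≠ b ∧ o ≠ a ∧ o ≠ b := by
  refine ⟨fun e => (h.lim.nc θ).1 _ hc (by simpa using e), fun e => ?_, fun e => ?_⟩
  · exact h.base θ _ hc (e ▸ Sym2.mem_mk_left _ _)
  · exact h.base θ _ hc (e ▸ Sym2.mem_mk_right _ _)

lemma exists_diagram (h : Stops Ψ Φ o X poly ε)
    (hT : ∀ φ, IsPreconnected {θ | ∃ c ∈ Ψ θ, φ ∈ c}) :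
    ∃ P : Diagram, movieOf P = Ψ ∧
      ∀ a b θ, P.ActL a b θ ↔ s(a, b) ∈ Ψ θ ∧
        ((o ∈ cIoo b a ∧ ¬ FlipL X poly ε a b θ) ∨ (o ∈ cIoo a b ∧ FlipL X poly ε b a θ)) := by
  set ML : S1 → S1 → S1 → Prop := fun a b θ => s(a, b) ∈ Ψ θ ∧
        ((o ∈ cIoo b a ∧ ¬ FlipL X poly ε a b θ) ∨ (o ∈ cIoo a b ∧ FlipL X poly ε b a θ))
    with hML
  set MR : S1 → S1 → S1 → Prop := fun a b θ => s(a, b) ∈ Φ θ ∧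
        ((o ∈ cIoo b a ∧ ¬ FlipR X poly ε a b θ) ∨ (o ∈ cIoo a b ∧ FlipR X poly ε b a θ))
    with hMR
  have loc : ∀ θ, ∃ V T T', LocalRule o (Ψ θ) (Φ θ) V T T' ∧
      (∀ a b, ML a b θ ↔ s(a, b) ∈ Ψ θ ∧ Selects o V T a b) ∧
      ∀ a b, MR a b θ ↔ s(a, b) ∈ Φ θ ∧ Selects o V T' a b := by
    intro θ
    obtain ⟨V, T, T', h1, h2, h3⟩ := h.localRule θ
    refine ⟨V, T, T', h1, fun a b => ?_, fun a b => ?_⟩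
    · rw [hML]; simp only [h2, Selects]
    · rw [hMR]; simp only [h3, Selects]
  have flip_tame : ∀ a b, IsTame (FlipL X poly ε a b) (FlipR X poly ε a b) := fun a b =>
    IsTame.exists_mem X fun s _ => (IsTame.const _).and
      (IsTame.interval (window_ne (h.width b a).1 (h.width b a).2.2))
  have hfam : ArcFamily ML MR := by
    refine ⟨fun a b => ?_, ?_, fun a b θ hm => (h.base_ne hm.1).1, fun a b => ?_⟩
    · exact (h.lim.tame fun C => s(a, b) ∈ C).and
        (((IsTame.const _).and (flip_tame a b).not).or ((IsTame.const _).and (flip_tame b a)))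
    · exact h.lim.finite_arcs.subset fun c ⟨θ, hm⟩ => ⟨θ, hm.1⟩
    · by_contra! hall
      by_cases ho : o ∈ cIoo a b
      · have hfl : ∀ θ, FlipL X poly ε b a θ := fun θ => by
          rcases (hall θ).2 with h1 | h1
          · exact absurd ho (not_mem_cIoo_of_mem_cIoo h1.1)
          · exact h1.2
        obtain ⟨s, hs, -⟩ := h.always a b (fun θ => (hall θ).1) ho
        have := (h.flipL_iff hs (abs_of_pos h.pos).le b a).1 (hfl _)
        have h1 := arc_pos.2 (h.base_ne (hall o).1).1.symm
        have := this.2.2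
        nlinarith [h.pos]
      · have hfl : ∀ θ, o ∈ cIoo b a ∧ ¬ FlipL X poly ε a b θ := fun θ => by
          rcases (hall θ).2 with h1 | h1
          · exact h1
          · exact absurd h1.1 ho
        obtain ⟨s, hs, hp⟩ := h.always b a (fun θ => Sym2.eq_swap ▸ (hall θ).1) (hfl o).1
        refine (hfl (s + ((0 : ℝ) : S1))).2 ((h.flipL_iff hs (by simpa using h.pos.le) a b).2 ⟨hp, ?_⟩)
        have := (h.width b a).1
        constructor <;> linarith
  have side : ∀ a b : S1, a ≠ b → o ≠ a → o ≠ b → (o ∈ cIoo a b ∧ o ∉ cIoo b a) ∨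
      (o ∉ cIoo a b ∧ o ∈ cIoo b a) := by
    intro a b h1 h2 h3
    by_cases hm : o ∈ cIcc a b
    · rcases (mem_cIcc_iff_or h1).1 hm with h | h | h
      · exact absurd h h2
      · exact absurd h h3
      · exact .inl ⟨h, not_mem_cIoo_of_mem_cIoo h⟩
    · have := not_mem_cIcc_iff.1 hm
      exact .inr ⟨not_mem_cIoo_of_mem_cIoo this, this⟩
  refine (hfam.exists_diagram (Ψ := Ψ) (Φ := Φ) (ArcFamily.fits_of_localRule h.lim loc) ?_ ?_ ?_ ?_).imp
    fun _ hP => ⟨hP.1, hP.2.1⟩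
  · intro a b θ
    constructor
    · intro hc
      obtain ⟨h1, h2, h3⟩ := h.base_ne hc
      have hc' : s(b, a) ∈ Ψ θ := Sym2.eq_swap ▸ hc
      rcases side a b h1 h2 h3 with h4 | h4 <;> simp only [hML, hc, hc', h4, true_and, false_and,
        or_false, false_or] <;> tauto
    · rintro (h1 | h1)
      · exact h1.1
      · exact Sym2.eq_swap ▸ h1.1
  · intro a b θ
    constructor
    · intro hc
      obtain ⟨z, hz⟩ := h.lim.mem_after hc
      obtain ⟨h1, h2, h3⟩ := h.base_ne hz
      have hc' : s(b, a) ∈ Φ θ := Sym2.eq_swap ▸ hc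
      rcases side a b h1 h2 h3 with h4 | h4 <;> simp only [hMR, hc, hc', h4, true_and, false_and,
        or_false, false_or] <;> tauto
    · rintro (h1 | h1)
      · exact h1.1
      · exact Sym2.eq_swap ▸ h1.1
  · intro θ
    by_cases he : Ψ θ = Φ θ
    · simp [he]
    · exact (h.event θ he).2.two
  · intro φ
    exact (h.lim.tame fun C => ∃ c ∈ C, φ ∈ c).encard_switch_le (hT φ)

end Stops

lemma eventually_sep {s s' : S1} (hne : s ≠ s') : ∀ᶠ ε : ℝ in 𝓝[>] 0, ∀ t t' : ℝ, |t| ≤ ε →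
    |t'| ≤ ε → s + (t : S1) ≠ s' + (t' : S1) := by
  have h1 := arc_pos.2 hne.symm
  have h2 := arc_lt_one s s'
  filter_upwards [eventually_small (half_pos h1), eventually_small (half_pos (sub_pos.2 h2)),
    eventually_small (show (0:ℝ) < 1 / 8 by norm_num)] with ε e1 e2 e3 t t' ht ht' he
  rw [abs_le] at ht ht'
  have e : s' = s + ((t - t' : ℝ) : S1) := by
    rw [AddCircle.coe_sub, ← add_sub_assoc, he, add_sub_cancel_right]
  have hl := arc_add_coe (θ := s) (t := t - t') (by rw [abs_lt]; constructor <;> linarith)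
  rw [← e] at hl
  split_ifs at hl <;> linarith

lemma MovieLimits.exists_diagram {Ψ Φ : S1 → Finset (Sym2 S1)} (h : MovieLimits Ψ Φ)
    (hT : ∀ φ, IsPreconnected {θ | ∃ c ∈ Ψ θ, φ ∈ c}) {o : S1} (ho : ∀ θ, ∀ c ∈ Ψ θ, o ∉ c)
    (Y : Finset (S1 × S1 × S1)) (hY : ∀ y ∈ Y, Ψ y.1 = Φ y.1)
    (hinj : ∀ y ∈ Y, ∀ y' ∈ Y, y.1 = y'.1 → y = y')
    (hal : ∀ a b, (∀ θ, s(a, b) ∈ Ψ θ) → o ∈ cIoo a b → ∃ s, (s, a, b) ∈ Y) :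
    ∃ P : Diagram, movieOf P = Ψ ∧
      ∀ y ∈ Y, s(y.2.1, y.2.2) ∈ Ψ y.1 → o ∈ cIoo y.2.1 y.2.2 → P.ActL y.2.1 y.2.2 y.1 := by
  classical
  have hev : ∀ θ, ∃ V, Ψ θ ≠ Φ θ → EventAt (Ψ θ) (Φ θ) V := fun θ => by
    by_cases he : Ψ θ = Φ θ
    · exact ⟨∅, fun h => absurd he h⟩
    · obtain ⟨V, hV⟩ := h.event θ he; exact ⟨V, fun _ => hV⟩
  choose W hW using hev
  set X : Finset S1 := h.finite_events.toFinset ∪ Y.image Prod.fst with hX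
  set poly : S1 → Set S1 := fun s => if Ψ s = Φ s then {x | ∃ y ∈ Y, y.1 = s ∧ (x = y.2.1 ∨ x = y.2.2)}
    else W s with hpoly
  have hpY : ∀ y ∈ Y, poly y.1 = {y.2.1, y.2.2} := by
    intro y hy
    rw [hpoly]; simp only [hY y hy, if_true]
    ext x
    constructor
    · rintro ⟨y', hy', e, hx⟩
      rwa [hinj y' hy' y hy e] at hx
    · exact fun hx => ⟨y, hy, rfl, hx⟩
  have h1 : ∀ᶠ ε : ℝ in 𝓝[>] 0, ∀ s ∈ X, ∀ s' ∈ X, s ≠ s' → ∀ t t' : ℝ, |t| ≤ ε →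
      |t'| ≤ ε → s + (t : S1) ≠ s' + (t' : S1) := by
    refine (eventually_all_finset X).2 fun s _ => (eventually_all_finset X).2 fun s' _ => ?_
    by_cases e : s = s'
    · simp [e]
    · simpa [e] using eventually_sep e
  obtain ⟨ε, e1, e3, e4⟩ := (h1.and
    (eventually_small (show (0:ℝ) < 1 / 2 by norm_num))).exists
  have hS : Stops Ψ Φ o X poly ε := by
    refine ⟨h, ho, e3, e4, ?_, ?_, ?_, ?_⟩
    · intro s hs s' hs' t t' ht ht' he
      by_cases hne : s = s'
      · subst hne
        refine ⟨rfl, eq_of_add_coe_eq he ?_⟩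
        rw [abs_le] at ht ht'; rw [abs_lt]; constructor <;> linarith
      · exact absurd he (e1 s hs s' hs' hne t t' ht ht')
    · intro s hs
      by_cases he : Ψ s = Φ s
      · rcases Finset.mem_union.1 hs with hs | hs
        · exact absurd he (h.finite_events.mem_toFinset.1 hs)
        · obtain ⟨y, hy, rfl⟩ := Finset.mem_image.1 hs
          rw [hpY y hy]; exact ⟨_, .inl rfl⟩
      · rw [hpoly]; simp only [he, if_false]; exact (hW s he).nonempty
    · intro θ hθ
      refine ⟨Finset.mem_union_left _ (h.finite_events.mem_toFinset.2 hθ), ?_⟩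
      rw [hpoly]; simp only [hθ, if_false]; exact hW θ hθ
    · intro a b hall hab
      obtain ⟨s, hs⟩ := hal a b hall hab
      refine ⟨s, Finset.mem_union_right _ (Finset.mem_image_of_mem Prod.fst hs), ?_⟩
      rw [hpY _ hs]
      rintro x (rfl | rfl)
      · exact right_mem_cIcc _ _
      · exact left_mem_cIcc _ _
  obtain ⟨P, hP, hL⟩ := hS.exists_diagram hT
  refine ⟨P, hP, ?_⟩
  · intro y hy hc hoy
    refine (hL _ _ _).2 ⟨hc, .inr ⟨hoy, ?_⟩⟩
    have hs : y.1 ∈ X := Finset.mem_union_right _ (Finset.mem_image_of_mem Prod.fst hy)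
    have := (hS.flipL_iff hs (t := 0) (by simpa using e3.le) y.2.2 y.2.1).2 ⟨?_, ?_⟩
    · simpa using this
    · rw [hpY y hy]
      rintro x (rfl | rfl)
      · exact right_mem_cIcc _ _
      · exact left_mem_cIcc _ _
    · have := (hS.width y.2.1 y.2.2).1
      constructor <;> linarith

lemma exists_injOn_of_infinite {ι α : Type*} [Nonempty α] (K : Finset ι) (S : ι → Set α)
    (h : ∀ i ∈ K, (S i).Infinite) : ∃ f : ι → α, (∀ i ∈ K, f i ∈ S i) ∧ Set.InjOn f K := by
  classical
  induction K using Finset.induction_on with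
  | empty => exact ⟨fun _ => Classical.arbitrary α, by simp, by simp⟩
  | insert a K ha ih =>
    obtain ⟨f, h1, h2⟩ := ih fun i hi => h i (Finset.mem_insert_of_mem hi)
    obtain ⟨x, hx, hx'⟩ := (h a (Finset.mem_insert_self _ _)).exists_notMem_finset (K.image f)
    refine ⟨Function.update f a x, fun i hi => ?_, ?_⟩
    · by_cases e : i = a
      · subst e; simpa using hx
      · rw [Function.update_of_ne e]; exact h1 i ((Finset.mem_insert.1 hi).resolve_left e)
    · rw [Finset.coe_insert, Set.injOn_insert (by simpa using ha)]
      have he : ∀ i ∈ K, Function.update f a x i = f i := fun i hi =>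
        Function.update_of_ne (by rintro rfl; exact ha hi) _ _
      refine ⟨fun i hi j hj e => h2 hi hj (by rwa [he i hi, he j hj] at e), ?_⟩
      rintro ⟨i, hi, e⟩
      rw [he i hi, Function.update_self] at e
      exact hx' (Finset.mem_image.2 ⟨i, hi, e⟩)

lemma MovieLimits.exists_base {Ψ Φ : S1 → Finset (Sym2 S1)} (h : MovieLimits Ψ Φ) :
    ∃ o : S1, ∀ θ, ∀ c ∈ Ψ θ, o ∉ c := by
  obtain ⟨t, ht⟩ := (eventually_not_mem_of_finite h.finite_ends 0).1.exists
  exact ⟨_, fun θ c hc hm => ht (Set.mem_iUnion₂.2 ⟨c, ⟨θ, hc⟩, hm⟩)⟩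

lemma infinite_cIoo {x y : S1} (h : x ≠ y) : (cIoo x y).Infinite := by
  have hl := arc_pos.2 h.symm
  refine ((Set.Ioo_infinite hl).image (f := fun t : ℝ => x + (t : S1)) ?_).mono ?_
  · intro s hs t ht e
    have := congrArg (ℓ x) e
    have := arc_lt_one x y
    simp only at *
    rwa [arc_add hs.1.le (by linarith [hs.2]), arc_add ht.1.le (by linarith [ht.2])] at *
  · rintro _ ⟨t, ht, rfl⟩
    rw [mem_cIoo_iff, arc_add ht.1.le (by linarith [ht.2, arc_lt_one x y])]
    exact ht

lemma IsMovieDiagram.exists_diagram {Ψ : S1 → Finset (Sym2 S1)} (hΨ : IsMovieDiagram Ψ)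
    (hT : ∀ φ, IsPreconnected {θ | ∃ c ∈ Ψ θ, φ ∈ c}) : ∃ P : Diagram, Ψ = movieOf P := by
  classical
  obtain ⟨Φ, h⟩ := hΨ.exists_limits
  obtain ⟨o, ho⟩ := h.exists_base
  obtain ⟨f, hf, hinj⟩ := exists_injOn_of_infinite h.finite_arcs.toFinset
    (fun _ => {θ : S1 | Ψ θ = Φ θ}) (fun _ _ => by
      intro hfin
      refine (infinite_cIoo (x := (0 : S1)) (y := ((1 / 2 : ℝ) : S1)) ?_) ((hfin.union h.finite_events).subset ?_)
      · intro e
        have := eq_of_add_coe_eq (θ := 0) (s := 0) (t := 1 / 2) (by simpa using e) (by norm_num [abs_lt])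
        norm_num at this
      · intro θ _
        exact em _)
  set Y := h.finite_arcs.toFinset.image fun c => (f c, c.1, c.2) with hYdef
  have h1 : ∀ y ∈ Y, Ψ y.1 = Φ y.1 := by
    intro y hy
    obtain ⟨c, hc, rfl⟩ := Finset.mem_image.1 hy
    exact hf c hc
  have h2 : ∀ y ∈ Y, ∀ y' ∈ Y, y.1 = y'.1 → y = y' := by
    intro y hy y' hy' e
    obtain ⟨c, hc, rfl⟩ := Finset.mem_image.1 hy
    obtain ⟨c', hc', rfl⟩ := Finset.mem_image.1 hy'
    rw [hinj hc hc' e]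
  obtain ⟨P, hP, _⟩ := h.exists_diagram hT ho Y h1 h2 (fun a b hall _ =>
    ⟨f (a, b), Finset.mem_image.2 ⟨(a, b), h.finite_arcs.mem_toFinset.2 ⟨0, hall 0⟩, rfl⟩⟩)
  exact ⟨P, hP.symm⟩

lemma isMovieDiagram_eq_movieOf_iff {Ψ : S1 → Finset (Sym2 S1)} (hΨ : IsMovieDiagram Ψ) :
    (∃ P : Diagram, Ψ = movieOf P) ↔ ∀ φ, IsPreconnected {θ | ∃ c ∈ Ψ θ, φ ∈ c} := by
  constructor
  · rintro ⟨P, rfl⟩ φ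
    exact RectMovie.isPreconnected_ends P φ
  · exact hΨ.exists_diagram

/-! ## Replacing an arc with the complementary one during a time interval -/

namespace Diagram
variable {P : Diagram}

lemma eq_of_LR {r q : Rect} (hr : r ∈ P.rects) (hq : q ∈ P.rects) (h1 : r.φ₁ = q.φ₁)
    (h2 : r.φ₂ = q.φ₂) {θ : S1} (hL : r.L θ) (hR : q.R θ) : r = q := by
  by_contra hne
  have hloc := (P.compatible r hr q hq hne).localAt θ
  by_cases hR' : r.R θ
  · exact hne (P.pairwiseCompatible.eq_of_R hr hq hR' hR (.inl rfl) (.inl h1))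
  · by_cases hL' : q.L θ
    · exact hne (P.pairwiseCompatible.eq_of_L hr hq hL hL' (.inl rfl) (.inl h1))
    · have := hloc.end_start (r.end_iff.1 ⟨hL, hR'⟩) (q.start_iff.1 ⟨hL', hR⟩)
      obtain ⟨x, hx⟩ := cIoo_nonempty r.hφ
      have hxr : x ∈ r.arc := cIoo_subset_cIcc _ _ hx
      have hxq : x ∈ q.arc := by rw [Rect.arc, ← h1, ← h2]; exact hxr
      rcases (this x hxr hxq).1 with rfl | rfl
      · exact left_not_mem_cIoo _ _ hx
      · exact right_not_mem_cIoo _ _ hx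

lemma actL_eq {r : Rect} (hr : r ∈ P.rects) {a b θ : S1} (h : P.ActL a b θ) (hL : r.L θ)
    {φ : S1} (h1 : φ = a ∨ φ = b) (h2 : r.HasEnd φ) : r.φ₁ = a ∧ r.φ₂ = b := by
  obtain ⟨q, hq, rfl, rfl, h3⟩ := h
  rw [P.pairwiseCompatible.eq_of_L hr hq hL h3 h2 h1]
  exact ⟨rfl, rfl⟩

lemma actR_eq {r : Rect} (hr : r ∈ P.rects) {a b θ : S1} (h : P.ActR a b θ) (hR : r.R θ)
    {φ : S1} (h1 : φ = a ∨ φ = b) (h2 : r.HasEnd φ) : r.φ₁ = a ∧ r.φ₂ = b := by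
  obtain ⟨q, hq, rfl, rfl, h3⟩ := h
  rw [P.pairwiseCompatible.eq_of_R hr hq hR h3 h2 h1]
  exact ⟨rfl, rfl⟩

lemma ActL.ne {a b θ : S1} (h : P.ActL a b θ) : a ≠ b := by
  obtain ⟨q, hq, rfl, rfl, h3⟩ := h; exact q.hφ

lemma ActR.ne {a b θ : S1} (h : P.ActR a b θ) : a ≠ b := by
  obtain ⟨q, hq, rfl, rfl, h3⟩ := h; exact q.hφ

lemma ActL.not_swap {a b θ : S1} (h : P.ActL a b θ) : ¬ P.ActL b a θ := by
  intro h'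
  have hn := h.ne
  obtain ⟨q, hq, rfl, rfl, h3⟩ := h
  exact hn (actL_eq hq h' h3 (.inr rfl) (.inl rfl)).1

lemma ActR.not_swap {a b θ : S1} (h : P.ActR a b θ) : ¬ P.ActR b a θ := by
  intro h'
  have hn := h.ne
  obtain ⟨q, hq, rfl, rfl, h3⟩ := h
  exact hn (actR_eq hq h' h3 (.inr rfl) (.inl rfl)).1

lemma mem_movieAfter_iff_act {a b θ : S1} :
    s(a, b) ∈ movieAfter P θ ↔ P.ActR a b θ ∨ P.ActR b a θ := by
  rw [mem_movieAfter]
  constructor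
  · rintro ⟨r, hr, h1, h2⟩
    rcases Sym2.eq_iff.1 h2 with ⟨rfl, rfl⟩ | ⟨rfl, rfl⟩
    · exact .inl ⟨r, hr, rfl, rfl, h1⟩
    · exact .inr ⟨r, hr, rfl, rfl, h1⟩
  · rintro (⟨r, hr, rfl, rfl, h1⟩ | ⟨r, hr, rfl, rfl, h1⟩)
    · exact ⟨r, hr, h1, rfl⟩
    · exact ⟨r, hr, h1, Sym2.eq_swap⟩

lemma isSpell {r : Rect} (hr : r ∈ P.rects) : IsSpell P.ActL P.ActR r where
  start := fun ⟨q, hq, h1, h2, h3⟩ => by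
    have := eq_of_LR hq hr h1 h2 h3 r.R_left
    subst this
    exact q.not_L_left h3
  finish := fun ⟨q, hq, h1, h2, h3⟩ => by
    have := eq_of_LR hr hq h1.symm h2.symm r.L_right h3
    subst this
    exact r.not_R_right h3
  left _ h := ⟨r, hr, rfl, rfl, h⟩
  right _ h := ⟨r, hr, rfl, rfl, h⟩

lemma mem_rects_iff {r : Rect} : r ∈ P.rects ↔ IsSpell P.ActL P.ActR r := by
  refine ⟨isSpell, fun h => ?_⟩
  obtain ⟨q, hq, h1, h2, h3⟩ := h.left _ r.L_right
  rwa [h.eq_of_L (isSpell hq) h1.symm h2.symm r.L_right h3]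

lemma tame (P : Diagram) (a b : S1) : IsTame (P.ActL a b) (P.ActR a b) := by
  have h := IsTame.exists_mem P.rects (p := fun r θ => r.φ₁ = a ∧ r.φ₂ = b ∧ r.L θ)
    (q := fun r θ => r.φ₁ = a ∧ r.φ₂ = b ∧ r.R θ) fun r _ =>
      (IsTame.const _).and ((IsTame.const _).and ⟨r.eventually_right, r.eventually_left⟩)
  exact h

lemma arcFamily (P : Diagram) : ArcFamily P.ActL P.ActR where
  tame := P.tame
  finite := by
    classical
    refine ((P.rects.image fun r => (r.φ₁, r.φ₂)).finite_toSet).subset ?_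
    rintro ⟨a, b⟩ ⟨θ, r, hr, rfl, rfl, -⟩
    exact Finset.mem_coe.2 (Finset.mem_image_of_mem _ hr)
  ne _ _ _ h := h.ne
  never a b := by
    by_contra! h
    obtain ⟨r, hr, rfl, rfl, -⟩ := h 0
    exact (isSpell hr).start (h _)

lemma _root_.RectMovie.Rect.laminar_congr {r q r' q' : Rect} (h1 : r.φ₁ = r'.φ₁)
    (h2 : r.φ₂ = r'.φ₂) (h3 : q.φ₁ = q'.φ₁) (h4 : q.φ₂ = q'.φ₂) :
    (r.Laminar q → r'.Laminar q') ∧ (r.Inner q → r'.Inner q') ∧ (r.Touch q → r'.Touch q') := by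
  unfold Rect.Laminar Rect.Inner Rect.Apart Rect.Touch Rect.arc Rect.arcInt
  rw [h1, h2, h3, h4]
  exact ⟨id, id, id⟩

lemma fits (P : Diagram) : ArcFamily.Fits P.ActL P.ActR where
  before := by
    rintro r q θ ⟨r', hr, e1, e2, h1⟩ ⟨q', hq, e3, e4, h2⟩ hne
    have hne' : r' ≠ q' := by rintro rfl; exact hne ⟨e1.symm.trans e3, e2.symm.trans e4⟩
    exact (Rect.laminar_congr e1 e2 e3 e4).1 (((P.compatible _ hr _ hq hne').localAt θ).before h1 h2)
  after := by
    rintro r q θ ⟨r', hr, e1, e2, h1⟩ ⟨q', hq, e3, e4, h2⟩ hne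
    have hne' : r' ≠ q' := by rintro rfl; exact hne ⟨e1.symm.trans e3, e2.symm.trans e4⟩
    exact (Rect.laminar_congr e1 e2 e3 e4).1 (((P.compatible _ hr _ hq hne').localAt θ).after h1 h2)
  thru := by
    rintro r q θ hsw ⟨q', hq, e3, e4, h2⟩ hR hin
    have hR' : q'.R θ := by
      obtain ⟨q'', hq'', e5, e6, h3⟩ := hR
      rwa [eq_of_LR hq hq'' (e3.trans e5.symm) (e4.trans e6.symm) h2 h3]
    have : ∃ r' ∈ P.rects, r'.φ₁ = r.φ₁ ∧ r'.φ₂ = r.φ₂ ∧ (θ = r'.θ₁ ∨ θ = r'.θ₂) := by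
      by_cases hL : P.ActL r.φ₁ r.φ₂ θ
      · obtain ⟨r', hr, e1, e2, h1⟩ := hL
        refine ⟨r', hr, e1, e2, .inr (r'.end_iff.1 ⟨h1, fun h => hsw ⟨fun _ => ⟨r', hr, e1, e2, h⟩,
          fun _ => ⟨r', hr, e1, e2, h1⟩⟩⟩)⟩
      · by_cases hR : P.ActR r.φ₁ r.φ₂ θ
        · obtain ⟨r', hr, e1, e2, h1⟩ := hR
          exact ⟨r', hr, e1, e2, .inl (r'.start_iff.1 ⟨fun h => hL ⟨r', hr, e1, e2, h⟩, h1⟩)⟩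
        · exact absurd (iff_of_false hL hR) hsw
    obtain ⟨r', hr, e1, e2, h1⟩ := this
    have hne' : r' ≠ q' := by
      rintro rfl
      rcases h1 with rfl | rfl
      · exact r'.not_L_left h2
      · exact r'.not_R_right hR'
    exact ((P.compatible _ hr _ hq hne').localAt θ).left_thru h1 h2 hR'
      ((Rect.laminar_congr e1.symm e2.symm e3.symm e4.symm).2.1 hin)
  both_end := by
    rintro r q θ ⟨r', hr, e1, e2, h1⟩ hr' ⟨q', hq, e3, e4, h2⟩ hq' hin
    have hin' := (Rect.laminar_congr e1.symm e2.symm e3.symm e4.symm).2.1 hin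
    have hne' : r' ≠ q' := by rintro rfl; exact hin'.not_inner hin'
    exact hin'.not_apart (((P.compatible _ hr _ hq hne').localAt θ).both_end
      (r'.end_iff.1 ⟨h1, fun h => hr' ⟨r', hr, e1, e2, h⟩⟩)
      (q'.end_iff.1 ⟨h2, fun h => hq' ⟨q', hq, e3, e4, h⟩⟩))
  both_start := by
    rintro r q θ ⟨r', hr, e1, e2, h1⟩ hr' ⟨q', hq, e3, e4, h2⟩ hq' hin
    have hin' := (Rect.laminar_congr e1.symm e2.symm e3.symm e4.symm).2.1 hin
    have hne' : r' ≠ q' := by rintro rfl; exact hin'.not_inner hin'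
    exact hin'.not_apart (((P.compatible _ hr _ hq hne').localAt θ).both_start
      (r'.start_iff.1 ⟨fun h => hr' ⟨r', hr, e1, e2, h⟩, h1⟩)
      (q'.start_iff.1 ⟨fun h => hq' ⟨q', hq, e3, e4, h⟩, h2⟩))
  end_start := by
    rintro r q θ ⟨r', hr, e1, e2, h1⟩ hr' ⟨q', hq, e3, e4, h2⟩ hq'
    have hne' : r' ≠ q' := by rintro rfl; exact hq' ⟨r', hr, e3, e4, h1⟩
    exact (Rect.laminar_congr e1 e2 e3 e4).2.2 (((P.compatible _ hr _ hq hne').localAt θ).end_start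
      (r'.end_iff.1 ⟨h1, fun h => hr' ⟨r', hr, e1, e2, h⟩⟩)
      (q'.start_iff.1 ⟨fun h => hq' ⟨q', hq, e3, e4, h⟩, h2⟩))

lemma not_occupied_iff_act {θ : S1} :
    ¬ P.OccupiedMeridian θ ↔ ∀ a b, P.ActL a b θ ↔ P.ActR a b θ := by
  constructor
  · intro h a b
    exact exists_congr fun r => and_congr_right fun hr => by rw [P.L_iff_R h hr]
  · rw [Diagram.not_occupied_iff]
    intro h r hr
    constructor <;> rintro rfl
    · exact (isSpell hr).start ((h _ _).2 ((isSpell hr).right _ r.R_left))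
    · exact (isSpell hr).finish ((h _ _).1 ((isSpell hr).left _ r.L_right))

lemma boundary_eq {P Q : Diagram} (h : movieOf P = movieOf Q) : P.boundary = Q.boundary := by
  ext ⟨θ, φ⟩
  rw [boundary, boundary, P.pairwiseCompatible.mem_freeVertices,
    Q.pairwiseCompatible.mem_freeVertices, endsBefore_iff, endsBefore_iff, endsAfter_iff,
    endsAfter_iff, h, movieAfter_eq h]

end Diagram

lemma left_not_mem_hIoc (x y : S1) (h : x ≠ y) : x ∉ hIoc x y := by
  rintro (h' | h')
  · exact left_not_mem_cIoo _ _ h'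
  · exact h h'

lemma right_not_mem_hIco (x y : S1) (h : x ≠ y) : y ∉ hIco x y := by
  rintro (h' | h')
  · exact h h'.symm
  · exact right_not_mem_cIoo _ _ h'

lemma right_mem_hIoc (x y : S1) : y ∈ hIoc x y := .inr rfl
lemma left_mem_hIco (x y : S1) : x ∈ hIco x y := .inl rfl

/-- `P'` is obtained from `P` by replacing the arc `[a;b]` with `[b;a]` in the time interval from
`x` to `y`. -/
structure Diagram.IsToggle (P P' : Diagram) (a b x y : S1) : Prop where
  onL : ∀ θ ∈ hIoc x y, P.ActL a b θ
  onR : ∀ θ ∈ hIco x y, P.ActR a b θ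
  left : ∀ c d θ, P'.ActL c d θ ↔
    (P.ActL c d θ ∧ ¬ (c = a ∧ d = b ∧ θ ∈ hIoc x y)) ∨ (c = b ∧ d = a ∧ θ ∈ hIoc x y)
  right : ∀ c d θ, P'.ActR c d θ ↔
    (P.ActR c d θ ∧ ¬ (c = a ∧ d = b ∧ θ ∈ hIco x y)) ∨ (c = b ∧ d = a ∧ θ ∈ hIco x y)

/-- The rectangle `r` of `P` can be replaced, in the time interval from `x` to `y`, with the
rectangle that occupies the complementary arc. -/
structure Diagram.Toggleable (P : Diagram) (r : Rect) (x y : S1) : Prop where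
  mem : r ∈ P.rects
  ne : x ≠ y
  left : ∀ θ ∈ hIoc x y, r.L θ
  right : ∀ θ ∈ hIco x y, r.R θ
  outerL : ∀ q ∈ P.rects, ∀ θ ∈ hIoc x y, q.L θ → ¬ r.Inner q
  outerR : ∀ q ∈ P.rects, ∀ θ ∈ hIco x y, q.R θ → ¬ r.Inner q
  start : ∀ q ∈ P.rects, x = q.θ₁ ∨ x = q.θ₂ → r.θ₁ = x ∧
    ((q.φ₁ = r.φ₁ ∧ q.φ₂ = r.φ₂) ∨ (q.φ₁ = r.φ₂ ∧ q.φ₂ = r.φ₁))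
  finish : ∀ q ∈ P.rects, y = q.θ₁ ∨ y = q.θ₂ → r.θ₂ = y ∧
    ((q.φ₁ = r.φ₁ ∧ q.φ₂ = r.φ₂) ∨ (q.φ₁ = r.φ₂ ∧ q.φ₂ = r.φ₁))
  inner : ∀ θ ∈ cIoo x y, ¬ P.OccupiedMeridian θ
  never : ∃ θ, θ ∉ hIoc x y ∧ ¬ P.ActL r.φ₂ r.φ₁ θ

lemma Rect.sits_swap {q r c : Rect} (h : q.Inner r ∨ q.Apart r) (h1 : c.φ₁ = r.φ₂)
    (h2 : c.φ₂ = r.φ₁) : q.Inner c ∨ q.Apart c := by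
  rcases h with h | h
  · refine .inr (disjoint_left.2 fun x hx hx' => ?_)
    rw [Rect.arc, h1, h2] at hx'
    exact not_mem_cIoo_of_mem_cIcc hx' (h hx)
  · refine .inl fun x hx => ?_
    rw [Rect.arcInt, h1, h2]
    exact not_mem_cIcc_iff.1 fun hx' => disjoint_left.1 h hx hx'

lemma Rect.not_inner_of_sits {q r : Rect} (h : q.Inner r ∨ q.Apart r) : ¬ r.Inner q := by
  rcases h with h | h
  · exact h.not_inner
  · exact fun h' => h'.not_apart h.symm

lemma Rect.touch_swap {r q : Rect} (h1 : q.φ₁ = r.φ₂) (h2 : q.φ₂ = r.φ₁) : r.Touch q := by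
  intro φ hr hq
  rw [Rect.arc, h1, h2] at hq
  rcases (mem_cIcc_iff_or r.hφ).1 hr with e | e | e
  · exact ⟨.inl e, .inr (e.trans h2.symm)⟩
  · exact ⟨.inr e, .inl (e.trans h1.symm)⟩
  · exact absurd e (not_mem_cIoo_of_mem_cIcc hq)

namespace Diagram.Toggleable
variable {P : Diagram} {r : Rect} {x y : S1}

lemma sits (h : P.Toggleable r x y) {q : Rect} {θ : S1}
    (hq : (θ ∈ hIoc x y ∧ P.ActL q.φ₁ q.φ₂ θ) ∨ (θ ∈ hIco x y ∧ P.ActR q.φ₁ q.φ₂ θ))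
    (hne : ¬ (q.φ₁ = r.φ₁ ∧ q.φ₂ = r.φ₂)) : q.Inner r ∨ q.Apart r := by
  have key : q.Laminar r ∧ ¬ r.Inner q := by
    rcases hq with ⟨hθ, hq⟩ | ⟨hθ, hq⟩
    · refine ⟨P.fits.before q r θ hq ⟨r, h.mem, rfl, rfl, h.left θ hθ⟩ hne, fun hin => ?_⟩
      obtain ⟨q', hq', e1, e2, e3⟩ := hq
      exact h.outerL q' hq' θ hθ e3 ((Rect.laminar_congr (r' := r) rfl rfl e1.symm e2.symm).2.1 hin)
    · refine ⟨P.fits.after q r θ hq ⟨r, h.mem, rfl, rfl, h.right θ hθ⟩ hne, fun hin => ?_⟩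
      obtain ⟨q', hq', e1, e2, e3⟩ := hq
      exact h.outerR q' hq' θ hθ e3 ((Rect.laminar_congr (r' := r) rfl rfl e1.symm e2.symm).2.1 hin)
  rcases key.1 with h1 | h1 | h1
  · exact .inr h1
  · exact .inl h1
  · exact absurd h1 key.2

lemma eq_of_switch (_ : P.Toggleable r x y) {θ a b : S1}
    (hθ : ∀ q ∈ P.rects, θ = q.θ₁ ∨ θ = q.θ₂ →
      (q.φ₁ = r.φ₁ ∧ q.φ₂ = r.φ₂) ∨ (q.φ₁ = r.φ₂ ∧ q.φ₂ = r.φ₁))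
    (hs : ¬ (P.ActL a b θ ↔ P.ActR a b θ)) :
    (a = r.φ₁ ∧ b = r.φ₂) ∨ (a = r.φ₂ ∧ b = r.φ₁) := by
  by_cases hL : P.ActL a b θ
  · obtain ⟨q, hq, rfl, rfl, e3⟩ := hL
    exact hθ q hq (.inr (q.end_iff.1 ⟨e3, fun h' => hs ⟨fun _ => ⟨q, hq, rfl, rfl, h'⟩,
      fun _ => ⟨q, hq, rfl, rfl, e3⟩⟩⟩))
  · by_cases hR : P.ActR a b θ
    · obtain ⟨q, hq, rfl, rfl, e3⟩ := hR
      exact hθ q hq (.inl (q.start_iff.1 ⟨fun h' => hL ⟨q, hq, rfl, rfl, h'⟩, e3⟩))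
    · exact absurd (iff_of_false hL hR) hs

lemma encard_le (P : Diagram) :
    (∀ θ, {φ | ¬ ((∃ c ∈ movieOf P θ, φ ∈ c) ↔ ∃ c ∈ movieAfter P θ, φ ∈ c)}.encard ≤ 2) ∧
    ∀ φ, {θ | ¬ ((∃ c ∈ movieOf P θ, φ ∈ c) ↔ ∃ c ∈ movieAfter P θ, φ ∈ c)}.encard ≤ 2 := by
  constructor
  · intro θ
    refine le_trans ?_ (P.meridian_le θ)
    rw [← Function.Injective.encard_image (f := fun φ : S1 => (θ, φ))
      (fun a b h => (Prod.ext_iff.1 h).2)]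
    refine Set.encard_le_encard ?_
    rintro _ ⟨φ, h, rfl⟩
    rw [Set.mem_ofPred_eq, ← endsBefore_iff, ← endsAfter_iff] at h
    exact ⟨P.pairwiseCompatible.mem_freeVertices.2 h, rfl⟩
  · intro φ
    refine le_trans ?_ (P.longitude_le φ)
    rw [← Function.Injective.encard_image (f := fun θ : S1 => (θ, φ))
      (fun a b h => (Prod.ext_iff.1 h).1)]
    refine Set.encard_le_encard ?_
    rintro _ ⟨θ, h, rfl⟩
    rw [Set.mem_ofPred_eq, ← endsBefore_iff, ← endsAfter_iff] at h
    exact ⟨P.pairwiseCompatible.mem_freeVertices.2 h, rfl⟩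

set_option maxHeartbeats 400000 in
lemma exists_toggle (h : P.Toggleable r x y) :
    ∃ P' : Diagram, movieOf P' = movieOf P ∧ P.IsToggle P' r.φ₁ r.φ₂ x y := by
  set ML : S1 → S1 → S1 → Prop := fun c d θ => (P.ActL c d θ ∧ ¬ (c = r.φ₁ ∧ d = r.φ₂ ∧ θ ∈ hIoc x y)) ∨
    (c = r.φ₂ ∧ d = r.φ₁ ∧ θ ∈ hIoc x y) with hML
  set MR : S1 → S1 → S1 → Prop := fun c d θ => (P.ActR c d θ ∧ ¬ (c = r.φ₁ ∧ d = r.φ₂ ∧ θ ∈ hIco x y)) ∨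
    (c = r.φ₂ ∧ d = r.φ₁ ∧ θ ∈ hIco x y) with hMR
  have onL : ∀ θ ∈ hIoc x y, P.ActL r.φ₁ r.φ₂ θ := fun θ hθ => ⟨r, h.mem, rfl, rfl, h.left θ hθ⟩
  have onR : ∀ θ ∈ hIco x y, P.ActR r.φ₁ r.φ₂ θ := fun θ hθ => ⟨r, h.mem, rfl, rfl, h.right θ hθ⟩
  have hr := r.hφ
  have outL : ∀ c d θ, θ ∉ hIoc x y → (ML c d θ ↔ P.ActL c d θ) := fun c d θ hθ => by
    simp only [hML, hθ, and_false, not_false_eq_true, and_true, or_false]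
  have outR : ∀ c d θ, θ ∉ hIco x y → (MR c d θ ↔ P.ActR c d θ) := fun c d θ hθ => by
    simp only [hMR, hθ, and_false, not_false_eq_true, and_true, or_false]
  have inL : ∀ c d θ, θ ∈ hIoc x y → (ML c d θ ↔ (P.ActL c d θ ∧ ¬ (c = r.φ₁ ∧ d = r.φ₂)) ∨
      (c = r.φ₂ ∧ d = r.φ₁)) := fun c d θ hθ => by simp only [hML, hθ, and_true]
  have inR : ∀ c d θ, θ ∈ hIco x y → (MR c d θ ↔ (P.ActR c d θ ∧ ¬ (c = r.φ₁ ∧ d = r.φ₂)) ∨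
      (c = r.φ₂ ∧ d = r.φ₁)) := fun c d θ hθ => by simp only [hMR, hθ, and_true]
  have notA : ∀ θ, θ ∈ hIoc x y ∨ θ ∈ hIco x y → ¬ (ML r.φ₁ r.φ₂ θ ∧ MR r.φ₁ r.φ₂ θ) := by
    rintro θ (hθ | hθ) ⟨h1, h2⟩
    · rw [inL _ _ _ hθ] at h1; exact h1.elim (fun h => h.2 ⟨rfl, rfl⟩) fun h => hr h.1
    · rw [inR _ _ _ hθ] at h2; exact h2.elim (fun h => h.2 ⟨rfl, rfl⟩) fun h => hr h.1
  have x1 := left_not_mem_hIoc x y h.ne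
  have x2 := left_mem_hIco x y
  have y1 := right_mem_hIoc x y
  have y2 := right_not_mem_hIco x y h.ne
  have sw : ∀ θ, θ ∈ hIoc x y ∨ θ ∈ hIco x y → ∃ u v : S1, ((u = r.φ₁ ∧ v = r.φ₂) ∨ (u = r.φ₂ ∧ v = r.φ₁)) ∧
      ∀ c d, (ML c d θ ∧ ¬ MR c d θ → c = u ∧ d = v) ∧ (¬ ML c d θ ∧ MR c d θ → c = v ∧ d = u) := by
    intro θ hθ
    have : θ = x ∨ θ = y ∨ θ ∈ cIoo x y := by
      rcases hθ with (h | h) | (h | h)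
      · exact .inr (.inr h)
      · exact .inr (.inl h)
      · exact .inl h
      · exact .inr (.inr h)
    rcases this with rfl | rfl | hθ
    · refine ⟨_, _, .inl ⟨rfl, rfl⟩, fun c d => ?_⟩
      have := h.eq_of_switch (θ := θ) (a := c) (b := d) fun q hq e => (h.start q hq e).2
      rw [outL _ _ _ x1, inR _ _ _ x2]
      tauto
    · refine ⟨_, _, .inr ⟨rfl, rfl⟩, fun c d => ?_⟩
      have := h.eq_of_switch (θ := θ) (a := c) (b := d) fun q hq e => (h.finish q hq e).2
      rw [inL _ _ _ y1, outR _ _ _ y2]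
      tauto
    · refine ⟨_, _, .inl ⟨rfl, rfl⟩, fun c d => ?_⟩
      have := (not_occupied_iff_act.1 (h.inner θ hθ)) c d
      rw [inL _ _ _ (.inl hθ), inR _ _ _ (.inr hθ), this]
      tauto
  have sit : ∀ (q : Rect) θ, (θ ∈ hIoc x y ∧ ML q.φ₁ q.φ₂ θ) ∨ (θ ∈ hIco x y ∧ MR q.φ₁ q.φ₂ θ) →
      ¬ (q.φ₁ = r.φ₂ ∧ q.φ₂ = r.φ₁) → q.Inner r ∨ q.Apart r := by
    intro q θ hq hne
    rcases hq with ⟨hθ, hq⟩ | ⟨hθ, hq⟩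
    · rw [inL _ _ _ hθ] at hq
      have hq := hq.resolve_right hne
      exact h.sits (.inl ⟨hθ, hq.1⟩) hq.2
    · rw [inR _ _ _ hθ] at hq
      have hq := hq.resolve_right hne
      exact h.sits (.inr ⟨hθ, hq.1⟩) hq.2
  have lam : ∀ q c : Rect, q.Inner c ∨ q.Apart c → q.Laminar c := fun q c hs =>
    hs.elim (fun h => .inr (.inl h)) .inl
  have hfam : ArcFamily ML MR := by
    refine ⟨fun c d => ?_, ?_, fun c d θ hc => ?_, fun c d => ?_⟩
    · exact ((P.tame c d).and ((IsTame.const _).and ((IsTame.const _).and (IsTame.interval h.ne))).not).or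
        ((IsTame.const _).and ((IsTame.const _).and (IsTame.interval h.ne)))
    · refine (P.arcFamily.finite.union (Set.finite_singleton (r.φ₂, r.φ₁))).subset ?_
      rintro ⟨c, d⟩ ⟨θ, hc | hc⟩
      · exact .inl ⟨θ, hc.1⟩
      · exact .inr (Prod.ext hc.1 hc.2.1)
    · rcases hc with hc | hc
      · exact hc.1.ne
      · rw [hc.1, hc.2.1]; exact hr.symm
    · by_cases e : c = r.φ₂ ∧ d = r.φ₁
      · obtain ⟨θ, h1, h2⟩ := h.never
        exact ⟨θ, by rw [outL _ _ _ h1, e.1, e.2]; exact h2⟩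
      · obtain ⟨θ, hθ⟩ := P.arcFamily.never c d
        exact ⟨θ, fun hc => hc.elim (fun h => hθ h.1) fun h => e ⟨h.1, h.2.1⟩⟩
  have pair : ∀ M A : S1 → S1 → Prop, (∀ c d, M c d ↔ (A c d ∧ ¬ (c = r.φ₁ ∧ d = r.φ₂)) ∨
      (c = r.φ₂ ∧ d = r.φ₁)) → (∀ q : Rect, A q.φ₁ q.φ₂ → ¬ (q.φ₁ = r.φ₁ ∧ q.φ₂ = r.φ₂) →
        q.Inner r ∨ q.Apart r) → ∀ p q : Rect,
      (A p.φ₁ p.φ₂ → A q.φ₁ q.φ₂ → p.Laminar q) → M p.φ₁ p.φ₂ → M q.φ₁ q.φ₂ →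
      ¬ (p.φ₁ = q.φ₁ ∧ p.φ₂ = q.φ₂) → p.Laminar q := by
    intro M A hM hs p q hA hp hq hne
    rw [hM] at hp hq
    rcases hp with hp | ep
    · rcases hq with hq | eq
      · exact hA hp.1 hq.1
      · exact lam _ _ (Rect.sits_swap (hs p hp.1 hp.2) eq.1 eq.2)
    · exact (lam _ _ (Rect.sits_swap (hq.elim (fun hq => hs q hq.1 hq.2) fun eq =>
        absurd ⟨ep.1.trans eq.1.symm, ep.2.trans eq.2.symm⟩ hne) ep.1 ep.2)).symm
  have hfit : ArcFamily.Fits ML MR := by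
    refine ⟨?_, ?_, ?_, ?_, ?_, ?_⟩
    · intro p q θ hp hq hne
      by_cases hθ : θ ∈ hIoc x y
      · exact pair _ _ (inL · · θ hθ) (fun q hq => h.sits (.inl ⟨hθ, hq⟩)) p q
          (fun hp hq => P.fits.before p q θ hp hq hne) hp hq hne
      · rw [outL _ _ _ hθ] at hp hq
        exact P.fits.before p q θ hp hq hne
    · intro p q θ hp hq hne
      by_cases hθ : θ ∈ hIco x y
      · exact pair _ _ (inR · · θ hθ) (fun q hq => h.sits (.inr ⟨hθ, hq⟩)) p q
          (fun hp hq => P.fits.after p q θ hp hq hne) hp hq hne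
      · rw [outR _ _ _ hθ] at hp hq
        exact P.fits.after p q θ hp hq hne
    · intro p q θ hp hqL hqR hin
      by_cases hθ : θ ∈ hIoc x y ∨ θ ∈ hIco x y
      · obtain ⟨u, v, huv, hall⟩ := sw θ hθ
        have hp' : (p.φ₁ = r.φ₁ ∧ p.φ₂ = r.φ₂) ∨ (p.φ₁ = r.φ₂ ∧ p.φ₂ = r.φ₁) := by
          by_cases hL : ML p.φ₁ p.φ₂ θ
          · have e := (hall _ _).1 ⟨hL, fun hR => hp (iff_of_true hL hR)⟩
            exact huv.imp (fun h => ⟨e.1.trans h.1, e.2.trans h.2⟩)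
              fun h => ⟨e.1.trans h.1, e.2.trans h.2⟩
          · have e := (hall _ _).2 ⟨hL, by_contra fun hR => hp (iff_of_false hL hR)⟩
            exact huv.symm.imp (fun h => ⟨e.1.trans h.2, e.2.trans h.1⟩)
              fun h => ⟨e.1.trans h.2, e.2.trans h.1⟩
        by_cases eq : q.φ₁ = r.φ₂ ∧ q.φ₂ = r.φ₁
        · rcases hp' with ep | ep
          · exact hin.not_touch (Rect.touch_swap (eq.1.trans ep.2.symm) (eq.2.trans ep.1.symm))
          · apply hp
            rw [ep.1, ep.2, ← eq.1, ← eq.2]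
            exact iff_of_true hqL hqR
        · have hs := sit q θ (hθ.imp (fun h => ⟨h, hqL⟩) fun h => ⟨h, hqR⟩) eq
          rcases hp' with ep | ep
          · exact Rect.not_inner_of_sits hs ((Rect.laminar_congr (q' := q) ep.1 ep.2 rfl rfl).2.1 hin)
          · exact Rect.not_inner_of_sits (Rect.sits_swap hs ep.1 ep.2) hin
      · push Not at hθ
        rw [outL _ _ _ hθ.1, outR _ _ _ hθ.2] at hp
        rw [outL _ _ _ hθ.1] at hqL
        rw [outR _ _ _ hθ.2] at hqR
        exact P.fits.thru p q θ hp hqL hqR hin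
    · intro p q θ h1 h2 h3 h4 hin
      by_cases hθ : θ ∈ hIoc x y ∨ θ ∈ hIco x y
      · obtain ⟨u, v, huv, hall⟩ := sw θ hθ
        have e1 := (hall _ _).1 ⟨h1, h2⟩
        have e2 := (hall _ _).1 ⟨h3, h4⟩
        have := (Rect.laminar_congr (r' := q) (q' := q) (e1.1.trans e2.1.symm) (e1.2.trans e2.2.symm) rfl rfl).2.1 hin
        exact this.not_inner this
      · push Not at hθ
        rw [outL _ _ _ hθ.1] at h1 h3
        rw [outR _ _ _ hθ.2] at h2 h4
        exact P.fits.both_end p q θ h1 h2 h3 h4 hin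
    · intro p q θ h1 h2 h3 h4 hin
      by_cases hθ : θ ∈ hIoc x y ∨ θ ∈ hIco x y
      · obtain ⟨u, v, huv, hall⟩ := sw θ hθ
        have e1 := (hall _ _).2 ⟨h2, h1⟩
        have e2 := (hall _ _).2 ⟨h4, h3⟩
        have := (Rect.laminar_congr (r' := q) (q' := q) (e1.1.trans e2.1.symm) (e1.2.trans e2.2.symm) rfl rfl).2.1 hin
        exact this.not_inner this
      · push Not at hθ
        rw [outL _ _ _ hθ.1] at h2 h4
        rw [outR _ _ _ hθ.2] at h1 h3
        exact P.fits.both_start p q θ h1 h2 h3 h4 hin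
    · intro p q θ h1 h2 h3 h4
      by_cases hθ : θ ∈ hIoc x y ∨ θ ∈ hIco x y
      · obtain ⟨u, v, huv, hall⟩ := sw θ hθ
        have e1 := (hall _ _).1 ⟨h1, h2⟩
        have e2 := (hall _ _).2 ⟨h4, h3⟩
        exact Rect.touch_swap (e2.1.trans e1.2.symm) (e2.2.trans e1.1.symm)
      · push Not at hθ
        rw [outL _ _ _ hθ.1] at h1 h4
        rw [outR _ _ _ hθ.2] at h2 h3
        exact P.fits.end_start p q θ h1 h2 h3 h4
  have hΨ : ∀ a b θ, s(a, b) ∈ movieOf P θ ↔ ML a b θ ∨ ML b a θ := by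
    intro a b θ
    rw [mem_movieOf_iff_act]
    by_cases hθ : θ ∈ hIoc x y
    · rw [inL _ _ _ hθ, inL _ _ _ hθ]
      have := onL θ hθ
      grind
    · rw [outL _ _ _ hθ, outL _ _ _ hθ]
  have hΦ : ∀ a b θ, s(a, b) ∈ movieAfter P θ ↔ MR a b θ ∨ MR b a θ := by
    intro a b θ
    rw [mem_movieAfter_iff_act]
    by_cases hθ : θ ∈ hIco x y
    · rw [inR _ _ _ hθ, inR _ _ _ hθ]
      have := onR θ hθ
      grind
    · rw [outR _ _ _ hθ, outR _ _ _ hθ]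
  obtain ⟨P', hP', hL, hR⟩ := hfam.exists_diagram hfit hΨ hΦ (encard_le P).1 (encard_le P).2
  exact ⟨P', hP', onL, onR, hL, hR⟩

end Diagram.Toggleable

namespace Diagram.IsToggle
variable {P P' P₁ : Diagram} {a b x y : S1}

lemma symm (h : P.IsToggle P' a b x y) (hab : a ≠ b) : P'.IsToggle P b a x y where
  onL θ hθ := (h.left _ _ _).2 (.inr ⟨rfl, rfl, hθ⟩)
  onR θ hθ := (h.right _ _ _).2 (.inr ⟨rfl, rfl, hθ⟩)
  left c d θ := by
    rw [h.left]
    have h1 := h.onL θ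
    have h2 := fun hθ => (h.onL θ hθ).not_swap
    by_cases hθ : θ ∈ hIoc x y
    · have h1 := h.onL θ hθ
      have h2 := h1.not_swap
      by_cases e1 : c = a ∧ d = b
      · rw [e1.1, e1.2]; simp [hθ, h1]
      · by_cases e2 : c = b ∧ d = a
        · rw [e2.1, e2.2]; simp [hθ, h2, hab, hab.symm]
        · tauto
    · tauto
  right c d θ := by
    rw [h.right]
    by_cases hθ : θ ∈ hIco x y
    · have h1 := h.onR θ hθ
      have h2 := h1.not_swap
      by_cases e1 : c = a ∧ d = b
      · rw [e1.1, e1.2]; simp [hθ, h1]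
      · by_cases e2 : c = b ∧ d = a
        · rw [e2.1, e2.2]; simp [hθ, h2, hab, hab.symm]
        · tauto
    · tauto

lemma trans {x₁ y₁ x₂ y₂ : S1} (h : P.IsToggle P' a b x y) (h₁ : P.IsToggle P₁ a b x₁ y₁)
    (hL : ∀ θ, (θ ∈ hIoc x y ↔ θ ∈ hIoc x₁ y₁ ∨ θ ∈ hIoc x₂ y₂) ∧ ¬ (θ ∈ hIoc x₁ y₁ ∧ θ ∈ hIoc x₂ y₂))
    (hR : ∀ θ, (θ ∈ hIco x y ↔ θ ∈ hIco x₁ y₁ ∨ θ ∈ hIco x₂ y₂) ∧ ¬ (θ ∈ hIco x₁ y₁ ∧ θ ∈ hIco x₂ y₂)) :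
    P₁.IsToggle P' a b x₂ y₂ where
  onL θ hθ := (h₁.left _ _ _).2 (.inl ⟨h.onL _ ((hL θ).1.2 (.inr hθ)), fun e => (hL θ).2 ⟨e.2.2, hθ⟩⟩)
  onR θ hθ := (h₁.right _ _ _).2 (.inl ⟨h.onR _ ((hR θ).1.2 (.inr hθ)), fun e => (hR θ).2 ⟨e.2.2, hθ⟩⟩)
  left c d θ := by
    have h1 := hL θ
    rw [h.left, h₁.left]
    by_cases i1 : θ ∈ hIoc x₁ y₁
    · have i2 : _ ∉ _ := fun e => h1.2 ⟨i1, e⟩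
      simp only [h1.1, i1, i2, and_true, and_false, or_false, not_false_eq_true]
    · by_cases i2 : θ ∈ hIoc x₂ y₂ <;>
        simp only [h1.1, i1, i2, and_true, and_false, or_false, false_or, not_false_eq_true]
  right c d θ := by
    have h1 := hR θ
    rw [h.right, h₁.right]
    by_cases i1 : θ ∈ hIco x₁ y₁
    · have i2 : _ ∉ _ := fun e => h1.2 ⟨i1, e⟩
      simp only [h1.1, i1, i2, and_true, and_false, or_false, not_false_eq_true]
    · by_cases i2 : θ ∈ hIco x₂ y₂ <;>
        simp only [h1.1, i1, i2, and_true, and_false, or_false, false_or, not_false_eq_true]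

lemma not_occupied (h : P.IsToggle P' a b x y) {θ : S1} (hθ : θ ∈ cIoo x y)
    (ho : ¬ P.OccupiedMeridian θ) : ¬ P'.OccupiedMeridian θ := by
  rw [not_occupied_iff_act] at ho ⊢
  intro c d
  have h1 : θ ∈ hIoc x y := .inl hθ
  have h2 : θ ∈ hIco x y := .inr hθ
  rw [h.left, h.right, ho]
  simp only [h1, h2]

lemma not_occupied_outside (h : P.IsToggle P' a b x y) {θ : S1} (hθ : θ ∉ hIoc x y)
    (hθ' : θ ∉ hIco x y) (ho : ¬ P.OccupiedMeridian θ) : ¬ P'.OccupiedMeridian θ := by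
  rw [not_occupied_iff_act] at ho ⊢
  intro c d
  rw [h.left, h.right, ho]
  simp only [hθ, hθ']

lemma movieOf_eq (h : P.IsToggle P' a b x y) : movieOf P' = movieOf P := by
  funext θ
  ext c
  induction c with | _ c d => ?_
  rw [mem_movieOf_iff_act, mem_movieOf_iff_act, h.left, h.left]
  by_cases hθ : θ ∈ hIoc x y
  · have := h.onL θ hθ
    grind
  · tauto

lemma isSpell_on (h : P.IsToggle P' a b x y) (hxy : x ≠ y) (hab : a ≠ b)
    (h1 : ¬ P.ActL b a x) (h2 : ¬ P.ActR b a y) :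
    IsSpell P'.ActL P'.ActR ⟨x, y, b, a, hxy, hab.symm⟩ where
  start := fun e => ((h.left _ _ _).1 e).elim (fun e => h1 e.1) fun e => left_not_mem_hIoc x y hxy e.2.2
  finish := fun e => ((h.right _ _ _).1 e).elim (fun e => h2 e.1) fun e => right_not_mem_hIco x y hxy e.2.2
  left _ hθ := (h.left _ _ _).2 (.inr ⟨rfl, rfl, hθ⟩)
  right _ hθ := (h.right _ _ _).2 (.inr ⟨rfl, rfl, hθ⟩)

lemma isSpell_rest (h : P.IsToggle P' a b x y) {r n : Rect} (hr : r ∈ P.rects)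
    (e1 : r.φ₁ = a) (e2 : r.φ₂ = b) (e3 : n.φ₁ = a) (e4 : n.φ₂ = b)
    (h1 : n.θ₁ = r.θ₁ ∨ n.θ₁ ∈ hIoc x y) (h2 : n.θ₂ = r.θ₂ ∨ n.θ₂ ∈ hIco x y)
    (hL : ∀ θ, n.L θ → r.L θ ∧ θ ∉ hIoc x y) (hR : ∀ θ, n.R θ → r.R θ ∧ θ ∉ hIco x y) :
    IsSpell P'.ActL P'.ActR n := by
  have hab : a ≠ b := e1 ▸ e2 ▸ r.hφ
  have hs := isSpell hr
  refine ⟨fun e => ?_, fun e => ?_, fun θ hθ => ?_, fun θ hθ => ?_⟩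
  · rw [e3, e4, h.left] at e
    rcases e with e | e
    · rcases h1 with h1 | h1
      · have := hs.start
        rw [e1, e2, ← h1] at this
        exact this e.1
      · exact e.2 ⟨rfl, rfl, h1⟩
    · exact hab e.1
  · rw [e3, e4, h.right] at e
    rcases e with e | e
    · rcases h2 with h2 | h2
      · have := hs.finish
        rw [e1, e2, ← h2] at this
        exact this e.1
      · exact e.2 ⟨rfl, rfl, h2⟩
    · exact hab e.1
  · rw [e3, e4, h.left]
    exact .inl ⟨⟨r, hr, e1, e2, (hL θ hθ).1⟩, fun e => (hL θ hθ).2 e.2.2⟩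
  · rw [e3, e4, h.right]
    exact .inl ⟨⟨r, hr, e1, e2, (hR θ hθ).1⟩, fun e => (hR θ hθ).2 e.2.2⟩

lemma mem_rects_iff (h : P.IsToggle P' a b x y) {r : Rect} (hr : r ∈ P.rects) (e1 : r.φ₁ = a)
    (e2 : r.φ₂ = b) (hrL : ∀ θ ∈ hIoc x y, r.L θ) (hxy : x ≠ y)
    (hsw : ∀ q ∈ P.rects, q.φ₁ = b → q.φ₂ = a → q.θ₁ ∉ hIoc x y ∧ q.θ₂ ∉ hIco x y)
    {N : Set Rect} (hN : ∀ n ∈ N, IsSpell P'.ActL P'.ActR n)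
    (hN₁ : ∀ θ, r.L θ → θ ∉ hIoc x y → ∃ n ∈ N, n.φ₁ = a ∧ n.φ₂ = b ∧ n.L θ)
    (hN₂ : ∃ n ∈ N, n.φ₁ = b ∧ n.φ₂ = a ∧ n.θ₁ = x ∧ n.θ₂ = y) (q : Rect) :
    q ∈ P'.rects ↔ (q ∈ P.rects ∧ q ≠ r) ∨ q ∈ N := by
  have hab : a ≠ b := e1 ▸ e2 ▸ r.hφ
  have keep : ∀ q ∈ P.rects, q ≠ r → q ∈ P'.rects := by
    intro q hq hne
    have hs := isSpell hq
    refine Diagram.mem_rects_iff.2 ⟨fun e => ?_, fun e => ?_, fun θ hθ => ?_, fun θ hθ => ?_⟩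
    · rcases (h.left _ _ _).1 e with e | e
      · exact hs.start e.1
      · exact (hsw q hq e.1 e.2.1).1 e.2.2
    · rcases (h.right _ _ _).1 e with e | e
      · exact hs.finish e.1
      · exact (hsw q hq e.1 e.2.1).2 e.2.2
    · exact (h.left _ _ _).2 (.inl ⟨hs.left θ hθ, fun e => hne (P.pairwiseCompatible.eq_of_L hq hr hθ
        (hrL θ e.2.2) (.inl rfl) (.inl (e.1.trans e1.symm)))⟩)
    · refine (h.right _ _ _).2 (.inl ⟨hs.right θ hθ, fun e => hne ?_⟩)
      obtain ⟨r', hr', e3, e4, e5⟩ := h.onR θ e.2.2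
      have hqr := P.pairwiseCompatible.eq_of_R hq hr' hθ e5 (.inl rfl) (.inl (e.1.trans e3.symm))
      obtain ⟨r'', hr'', e6, e7, e8⟩ := h.onL y (right_mem_hIoc x y)
      subst hqr
      obtain ⟨t, ht, ht'⟩ := ((q.eventually_right θ).and ((IsTame.interval hxy).right θ)).exists
      exact P.pairwiseCompatible.eq_of_L hq hr (ht.1.2 hθ) (hrL _ (ht'.1.2 e.2.2)) (.inl rfl)
        (.inl (e.1.trans e1.symm))
  have uniq : ∀ p ∈ P'.rects, ∀ q ∈ P'.rects, ∀ θ, p.L θ → q.L θ → p.φ₁ = q.φ₁ → p = q :=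
    fun p hp q hq θ h1 h2 e => P'.pairwiseCompatible.eq_of_L hp hq h1 h2 (.inl rfl) (.inl e)
  constructor
  · intro hq
    rcases (h.left _ _ _).1 ((isSpell hq).left _ q.L_right) with ⟨⟨p, hp, f1, f2, f3⟩, e⟩ | e
    · by_cases hpr : p = r
      · subst hpr
        obtain ⟨n, hn, g1, g2, g3⟩ := hN₁ _ f3 fun e' => e ⟨f1.symm.trans e1, f2.symm.trans e2, e'⟩
        rw [uniq q hq n (Diagram.mem_rects_iff.2 (hN n hn)) _ q.L_right g3 (f1.symm.trans (e1.trans g1.symm))]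
        exact .inr hn
      · rw [uniq q hq p (keep p hp hpr) _ q.L_right f3 f1.symm]
        exact .inl ⟨hp, hpr⟩
    · obtain ⟨n, hn, g1, g2, rfl, rfl⟩ := hN₂
      rw [uniq q hq n (Diagram.mem_rects_iff.2 (hN n hn)) _ q.L_right e.2.2 (e.1.trans g1.symm)]
      exact .inr hn
  · rintro (hq | hq)
    · exact keep q hq.1 hq.2
    · exact Diagram.mem_rects_iff.2 (hN q hq)

end Diagram.IsToggle

namespace Diagram.IsToggle
variable {P P' : Diagram} {a b x y : S1}

lemma bubbleCreation (h : P.IsToggle P' a b x y) (hxy : x ≠ y)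
    (hocc : ∀ θ ∈ cIcc x y, ¬ P.OccupiedMeridian θ)
    (hout : ∀ q ∈ P.rects, q.L y → ¬ cIcc a b ⊆ cIoo q.φ₁ q.φ₂) : BubbleCreation P P' := by
  obtain ⟨r, hr, rfl, rfl, hry⟩ := h.onL y (right_mem_hIoc x y)
  have occ : ∀ q ∈ P.rects, q.θ₁ ∉ cIcc x y ∧ q.θ₂ ∉ cIcc x y := fun q hq =>
    ⟨fun hm => hocc _ hm (P.occupiedMeridian_iff.2 ⟨q, hq, .inl rfl⟩),
      fun hm => hocc _ hm (P.occupiedMeridian_iff.2 ⟨q, hq, .inr rfl⟩)⟩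
  have hsub : cIcc x y ⊆ cIoo r.θ₁ r.θ₂ := cIcc_subset_cIoo r.hθ hxy
    ⟨y, r.mem_cIcc_iff_L_or_R.2 (.inl hry), right_mem_cIcc _ _⟩ (occ r hr).1 (occ r hr).2
  have hx := hsub (left_mem_cIcc _ _)
  have hy := hsub (right_mem_cIcc _ _)
  have ho := (occ r hr).1
  rw [mem_cIcc_iff' r.θ₁ hxy, arc_self] at ho
  have hx' := mem_cIoo_iff.1 hx
  have hy' := mem_cIoo_iff.1 hy
  have hne : ℓ r.θ₁ x ≠ ℓ r.θ₁ y := fun e => hxy (arc_inj.1 e)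
  have n1 : r.θ₁ ≠ x := fun e => left_not_mem_cIoo r.θ₁ r.θ₂ (e ▸ hx)
  have n2 : y ≠ r.θ₂ := fun e => right_not_mem_cIoo r.θ₁ r.θ₂ (e ▸ hy)
  have hlt : ℓ r.θ₁ x < ℓ r.θ₁ y := by grind
  have sw : ∀ z ∈ cIcc x y, ¬ P.ActL r.φ₂ r.φ₁ z ∧ ¬ P.ActR r.φ₂ r.φ₁ z := by
    intro z hz
    have hz' := (r.L_and_R).2 (hsub hz)
    exact ⟨fun e => (ActL.not_swap ⟨r, hr, rfl, rfl, hz'.1⟩) e,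
      fun e => (ActR.not_swap ⟨r, hr, rfl, rfl, hz'.2⟩) e⟩
  refine ⟨r, x, y, hr, hx, hy, hocc, fun q hq hsubq => ?_, ⟨r.θ₁, x, r.φ₁, r.φ₂, n1, r.hφ⟩,
    ⟨x, y, r.φ₂, r.φ₁, hxy, r.hφ.symm⟩, ⟨y, r.θ₂, r.φ₁, r.φ₂, n2, r.hφ⟩, ⟨rfl, rfl, rfl, rfl⟩,
    ⟨rfl, rfl, rfl, rfl⟩, ⟨rfl, rfl, rfl, rfl⟩, ?_⟩
  · have hq1 : y ∈ cIoo q.θ₁ q.θ₂ :=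
      (hsubq (show (y, r.φ₁) ∈ _ from ⟨right_mem_cIcc _ _, left_mem_cIcc _ _⟩)).1
    exact hout q hq (q.L_and_R.2 hq1).1 fun φ hφ =>
      (hsubq (show (y, φ) ∈ _ from ⟨right_mem_cIcc _ _, hφ⟩)).2
  have hnn := fun θ => arc_nonneg r.θ₁ θ
  have key := h.mem_rects_iff hr rfl rfl (fun θ hθ => by
      unfold Rect.L
      rw [mem_hIoc_iff' r.θ₁ hxy] at hθ
      rw [mem_hIoc_iff r.hθ]
      grind) hxy (fun q hq _ _ => ⟨fun e => (occ q hq).1 ?_, fun e => (occ q hq).2 ?_⟩)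
    (N := {⟨r.θ₁, x, r.φ₁, r.φ₂, n1, r.hφ⟩, ⟨x, y, r.φ₂, r.φ₁, hxy, r.hφ.symm⟩,
      ⟨y, r.θ₂, r.φ₁, r.φ₂, n2, r.hφ⟩}) ?_ ?_ ⟨_, .inr (.inl rfl), rfl, rfl, rfl, rfl⟩
  · ext q
    rw [Finset.mem_coe, key]
    have hrN : ∀ n ∈ ({⟨r.θ₁, x, r.φ₁, r.φ₂, n1, r.hφ⟩, ⟨x, y, r.φ₂, r.φ₁, hxy, r.hφ.symm⟩,
      ⟨y, r.θ₂, r.φ₁, r.φ₂, n2, r.hφ⟩} : Set Rect), n ≠ r := by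
      rintro n (rfl | rfl | rfl) e
      · exact right_not_mem_cIoo r.θ₁ x (by rw [← e] at hx; exact hx)
      · exact r.hφ (congrArg Rect.φ₂ e)
      · exact n2 (by rw [← e] at hy; exact absurd hy (left_not_mem_cIoo _ _))
    constructor
    · rintro (⟨h1, h2⟩ | h1)
      · exact ⟨.inl h1, h2⟩
      · exact ⟨.inr h1, hrN q h1⟩
    · rintro ⟨h1 | h1, h2⟩
      · exact .inl ⟨h1, h2⟩
      · exact .inr h1
  · exact (mem_cIcc_iff_or hxy).2 (by rcases e with e | e <;> simp [e])
  · exact (mem_cIcc_iff_or hxy).2 (by rcases e with e | e <;> simp [e])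
  · rintro n (rfl | rfl | rfl)
    · refine h.isSpell_rest hr rfl rfl rfl rfl (.inl rfl) (.inr (left_mem_hIco _ _)) (fun θ hθ => ?_)
        fun θ hθ => ?_
      · unfold Rect.L at *
        rw [mem_hIoc_iff' r.θ₁ hxy, mem_hIoc_iff r.hθ]
        rw [mem_hIoc_iff n1] at hθ
        grind
      · unfold Rect.R at *
        rw [mem_hIco_iff' r.θ₁ hxy, mem_hIco_iff r.hθ]
        rw [mem_hIco_iff n1] at hθ
        grind
    · exact h.isSpell_on hxy r.hφ (sw x (left_mem_cIcc _ _)).1 (sw y (right_mem_cIcc _ _)).2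
    · refine h.isSpell_rest hr rfl rfl rfl rfl (.inr (right_mem_hIoc _ _)) (.inl rfl) (fun θ hθ => ?_)
        fun θ hθ => ?_
      · unfold Rect.L at *
        rw [mem_hIoc_iff' r.θ₁ hxy, mem_hIoc_iff r.hθ]
        rw [mem_hIoc_iff' r.θ₁ n2] at hθ
        grind
      · unfold Rect.R at *
        rw [mem_hIco_iff' r.θ₁ hxy, mem_hIco_iff r.hθ]
        rw [mem_hIco_iff' r.θ₁ n2] at hθ
        grind
  · intro θ hθ hθ'
    by_cases hc : ℓ r.θ₁ θ ≤ ℓ r.θ₁ x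
    · refine ⟨_, .inl rfl, rfl, rfl, ?_⟩
      unfold Rect.L at *
      rw [mem_hIoc_iff r.hθ] at hθ
      rw [mem_hIoc_iff n1]
      exact ⟨hθ.1, hc⟩
    · refine ⟨_, .inr (.inr rfl), rfl, rfl, ?_⟩
      unfold Rect.L at *
      rw [mem_hIoc_iff r.hθ] at hθ
      rw [mem_hIoc_iff' r.θ₁ hxy] at hθ'
      rw [mem_hIoc_iff' r.θ₁ n2]
      grind

end Diagram.IsToggle

namespace Diagram.IsToggle
variable {P P' : Diagram} {a b x y : S1} {ε : ℝ}

lemma halfWrinkle_start (h : P.IsToggle P' a b x (x + (ε : S1))) (hε : 0 < ε) (h4 : 4 * ε < 1)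
    (hw : ∀ t ∈ Set.Icc (-(2 * ε)) (2 * ε), P.OccupiedMeridian (x + (t : S1)) → t = 0)
    (hst : ¬ P.ActL a b x)
    (solo : ∀ q ∈ P.rects, x = q.θ₁ ∨ x = q.θ₂ → q.φ₁ = a ∧ q.φ₂ = b) : HalfWrinkleCreation P P' := by
  set y := x + (ε : S1) with hy
  have hℓ : ℓ x y = ε := arc_add hε.le (by linarith)
  have hxy : x ≠ y := fun e => by rw [← e, arc_self] at hℓ; linarith
  obtain ⟨r, hr, rfl, rfl, hrx⟩ := h.onR x (left_mem_hIco _ _)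
  have hrL : ¬ r.L x := fun e => hst ⟨r, hr, rfl, rfl, e⟩
  have hrθ : x = r.θ₁ := r.start_iff.1 ⟨hrL, hrx⟩
  have ends : ∀ q ∈ P.rects, x = q.θ₁ ∨ x = q.θ₂ → q = r := by
    intro q hq e
    have e' := solo q hq e
    rcases e with e | e
    · exact P.pairwiseCompatible.eq_of_R hq hr (e ▸ q.R_left) hrx (.inl rfl) (.inl e'.1)
    · exact absurd ⟨q, hq, e'.1, e'.2, e ▸ q.L_right⟩ hst
  have occ : ∀ q ∈ P.rects, ∀ z, z = q.θ₁ ∨ z = q.θ₂ → ℓ x z ≤ 2 * ε → x = z := by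
    intro q hq z hz hle
    have := hw (ℓ x z) ⟨by linarith [arc_nonneg x z], hle⟩
      (by rw [add_arc]; exact P.occupiedMeridian_iff.2 ⟨q, hq, hz⟩)
    exact (arc_eq_zero.1 this).symm
  have noL : ∀ q ∈ P.rects, q.L x → ∀ φ, q.HasEnd φ → ¬ r.HasEnd φ := by
    intro q hq hL φ h1 h2
    by_cases hR : q.R x
    · exact hrL (P.pairwiseCompatible.eq_of_R hq hr hR hrx h1 h2 ▸ hL)
    · exact hrL (ends q hq (.inr (q.end_iff.1 ⟨hL, hR⟩)) ▸ hL)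
  have free : ∀ φ, r.HasEnd φ → (x, φ) ∈ P.boundary := fun φ hφ => by
    refine P.pairwiseCompatible.mem_freeVertices.2 fun e => ?_
    obtain ⟨q, hq, h1, h2⟩ := e.2 ⟨r, hr, hrx, hφ⟩
    exact noL q hq h1 φ h2 hφ
  have hr2 : 2 * ε < ℓ x r.θ₂ := by
    by_contra! hle
    exact r.hθ (hrθ ▸ occ r hr _ (.inr rfl) hle)
  have n2 : y ≠ r.θ₂ := fun e => by rw [← e, hℓ] at hr2; linarith
  have hnn := fun θ => arc_nonneg x θ
  have key := h.mem_rects_iff hr rfl rfl (fun θ hθ => by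
      unfold Rect.L
      rw [mem_hIoc_iff hxy] at hθ
      rw [← hrθ, mem_hIoc_iff (hrθ ▸ r.hθ)]
      exact ⟨hθ.1, by linarith [hθ.2]⟩) hxy (fun q hq e1 e2 => ⟨fun e => ?_, fun e => ?_⟩)
    (N := {⟨x, y, r.φ₂, r.φ₁, hxy, r.hφ.symm⟩, ⟨y, r.θ₂, r.φ₁, r.φ₂, n2, r.hφ⟩}) ?_ ?_
    ⟨_, .inl rfl, rfl, rfl, rfl, rfl⟩
  · have hs1 : ∀ q ∈ P.rects, HasSideIn q x r.φ₁ r.φ₂ ↔ q = r := fun q hq =>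
      ⟨fun e => ends q hq (e.1.imp Eq.symm Eq.symm), by rintro rfl; exact ⟨.inl hrθ.symm, subset_rfl⟩⟩
    have hs2 : ∀ q ∈ P.rects, ¬ HasSideIn q x r.φ₂ r.φ₁ := fun q hq e => by
      have := ends q hq (e.1.imp Eq.symm Eq.symm)
      exact not_cIcc_subset_swap r.hφ (this ▸ e.2)
    refine ⟨x, r.φ₁, r.φ₂, ⟨free _ (.inl rfl), ⟨r, hr, .inl (by rw [hrθ])⟩, free _ (.inr rfl),
      ⟨r, hr, .inl (by rw [hrθ])⟩, ε, hε, h4, OrderIso.refl _, x + ((-ε : ℝ) : S1),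
      x + ((0 : ℝ) : S1), x + (ε : S1), hw, rfl, rfl, rfl, fun q => ?_⟩,
      Diagram.boundary_eq h.movieOf_eq.symm, ?_⟩
    · rw [key, ← hy, AddCircle.coe_zero, add_zero, Set.mem_insert_iff,
        Set.mem_singleton_iff, Rect.eq_iff, Rect.eq_iff]
      have := r.hθ
      have := (hs1 r hr).2 rfl
      unfold SideMoved
      grind
    · rintro q hq ⟨θ, φ⟩ hv rfl
      have hv' := Rect.mem_vertices.1 hv
      have := ends q hq hv'.1
      subst this
      rcases hv'.2 with e | e <;> simp [e]
  · rw [mem_hIoc_iff hxy] at e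
    have := occ q hq _ (.inl rfl) (by linarith [e.2])
    rw [← this, arc_self] at e
    linarith [e.1]
  · rw [mem_hIco_iff hxy] at e
    have := ends q hq (.inr (occ q hq _ (.inr rfl) (by linarith)))
    rw [this] at e1
    exact r.hφ e1
  · rintro n (rfl | rfl)
    · refine h.isSpell_on hxy r.hφ ?_ ?_
      · rintro ⟨q, hq, e1, e2, e3⟩
        exact noL q hq e3 _ (.inl rfl) (.inr e1)
      · refine fun e => (ActR.not_swap ⟨r, hr, rfl, rfl, ?_⟩) e
        unfold Rect.R
        rw [← hrθ, mem_hIco_iff (hrθ ▸ r.hθ)]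
        linarith
    · refine h.isSpell_rest hr rfl rfl rfl rfl (.inr (right_mem_hIoc _ _)) (.inl rfl)
        (fun θ hθ => ?_) fun θ hθ => ?_
      · unfold Rect.L at *
        rw [mem_hIoc_iff hxy, ← hrθ, mem_hIoc_iff (hrθ ▸ r.hθ)]
        rw [mem_hIoc_iff' x n2] at hθ
        grind
      · unfold Rect.R at *
        rw [mem_hIco_iff hxy, ← hrθ, mem_hIco_iff (hrθ ▸ r.hθ)]
        rw [mem_hIco_iff' x n2] at hθ
        grind
  · intro θ hθ hθ'
    refine ⟨_, .inr rfl, rfl, rfl, ?_⟩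
    unfold Rect.L at *
    rw [← hrθ, mem_hIoc_iff (hrθ ▸ r.hθ)] at hθ
    rw [mem_hIoc_iff hxy] at hθ'
    rw [mem_hIoc_iff' x n2]
    grind

lemma halfWrinkle_finish (h : P.IsToggle P' a b (y - (ε : S1)) y) (hε : 0 < ε) (h4 : 4 * ε < 1)
    (hw : ∀ t ∈ Set.Icc (-(2 * ε)) (2 * ε), P.OccupiedMeridian (y + (t : S1)) → t = 0)
    (hst : ¬ P.ActR a b y)
    (solo : ∀ q ∈ P.rects, y = q.θ₁ ∨ y = q.θ₂ → q.φ₁ = a ∧ q.φ₂ = b) : HalfWrinkleCreation P P' := by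
  set x := y - (ε : S1) with hx
  have hyx : y = x + (ε : S1) := by rw [hx, sub_add_cancel]
  have hℓ : ℓ x y = ε := by rw [hyx]; exact arc_add hε.le (by linarith)
  have hxy : x ≠ y := fun e => by rw [← e, arc_self] at hℓ; linarith
  obtain ⟨r, hr, rfl, rfl, hrx⟩ := h.onL y (right_mem_hIoc _ _)
  have hrR : ¬ r.R y := fun e => hst ⟨r, hr, rfl, rfl, e⟩
  have hrθ : y = r.θ₂ := r.end_iff.1 ⟨hrx, hrR⟩
  have ends : ∀ q ∈ P.rects, y = q.θ₁ ∨ y = q.θ₂ → q = r := by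
    intro q hq e
    have e' := solo q hq e
    rcases e with e | e
    · exact absurd ⟨q, hq, e'.1, e'.2, e ▸ q.R_left⟩ hst
    · exact P.pairwiseCompatible.eq_of_L hq hr (e ▸ q.L_right) hrx (.inl rfl) (.inl e'.1)
  have occ : ∀ q ∈ P.rects, ∀ z, z = q.θ₁ ∨ z = q.θ₂ → ℓ x z ≤ 2 * ε → y = z := by
    intro q hq z hz hle
    have := hw (ℓ x z - ε) ⟨by linarith [arc_nonneg x z], by linarith⟩
      (by
        rw [AddCircle.coe_sub, hyx, add_assoc, add_sub_cancel, add_arc]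
        exact P.occupiedMeridian_iff.2 ⟨q, hq, hz⟩)
    exact arc_inj.1 (hℓ.trans (sub_eq_zero.1 this).symm)
  have noR : ∀ q ∈ P.rects, q.R y → ∀ φ, q.HasEnd φ → ¬ r.HasEnd φ := by
    intro q hq hR φ h1 h2
    by_cases hL : q.L y
    · exact hrR (P.pairwiseCompatible.eq_of_L hq hr hL hrx h1 h2 ▸ hR)
    · exact hrR (ends q hq (.inl (q.start_iff.1 ⟨hL, hR⟩)) ▸ hR)
  have free : ∀ φ, r.HasEnd φ → (y, φ) ∈ P.boundary := fun φ hφ => by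
    refine P.pairwiseCompatible.mem_freeVertices.2 fun e => ?_
    obtain ⟨q, hq, h1, h2⟩ := e.1 ⟨r, hr, hrx, hφ⟩
    exact noR q hq h1 φ h2 hφ
  have hr2 : 2 * ε < ℓ x r.θ₁ := by
    by_contra! hle
    exact r.hθ (hrθ ▸ (occ r hr _ (.inl rfl) hle).symm)
  have n2 : r.θ₁ ≠ x := fun e => by rw [e, arc_self] at hr2; linarith
  have n3 : r.θ₁ ≠ y := hrθ ▸ r.hθ
  have hnn := fun θ => arc_nonneg x θ
  have h0 := arc_self x
  have key := h.mem_rects_iff hr rfl rfl (fun θ hθ => by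
      unfold Rect.L
      rw [mem_hIoc_iff hxy] at hθ
      rw [← hrθ, mem_hIoc_iff' x n3]
      grind) hxy (fun q hq e1 e2 => ⟨fun e => ?_, fun e => ?_⟩)
    (N := {⟨x, y, r.φ₂, r.φ₁, hxy, r.hφ.symm⟩, ⟨r.θ₁, x, r.φ₁, r.φ₂, n2, r.hφ⟩}) ?_ ?_
    ⟨_, .inl rfl, rfl, rfl, rfl, rfl⟩
  · have hs1 : ∀ q ∈ P.rects, HasSideIn q y r.φ₁ r.φ₂ ↔ q = r := fun q hq =>
      ⟨fun e => ends q hq (e.1.imp Eq.symm Eq.symm), by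
        rintro rfl; exact ⟨.inr hrθ.symm, subset_rfl⟩⟩
    have hs2 : ∀ q ∈ P.rects, ¬ HasSideIn q y r.φ₂ r.φ₁ := fun q hq e => by
      have := ends q hq (e.1.imp Eq.symm Eq.symm)
      exact not_cIcc_subset_swap r.hφ (this ▸ e.2)
    refine ⟨y, r.φ₂, r.φ₁, ⟨free _ (.inr rfl), ⟨r, hr, .inr (by rw [hrθ]; rfl)⟩, free _ (.inl rfl),
      ⟨r, hr, .inr (by rw [hrθ]; rfl)⟩, ε, hε, h4, OrderIso.refl _, y + ((-ε : ℝ) : S1),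
      y + ((0 : ℝ) : S1), y + (ε : S1), hw, rfl, rfl, rfl, fun q => ?_⟩,
      Diagram.boundary_eq h.movieOf_eq.symm, ?_⟩
    · rw [key, AddCircle.coe_neg, ← sub_eq_add_neg, ← hx, AddCircle.coe_zero, add_zero, Set.mem_insert_iff,
        Set.mem_singleton_iff, Rect.eq_iff, Rect.eq_iff]
      have := r.hθ
      have := (hs1 r hr).2 rfl
      unfold SideMoved
      grind
    · rintro q hq ⟨θ, φ⟩ hv rfl
      have hv' := Rect.mem_vertices.1 hv
      have := ends q hq hv'.1
      subst this
      rcases hv'.2 with e | e <;> simp [e]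
  · rw [mem_hIoc_iff hxy] at e
    have := ends q hq (.inl (occ q hq _ (.inl rfl) (by linarith [e.2])))
    rw [this] at e1
    exact r.hφ e1
  · rw [mem_hIco_iff hxy] at e
    have := occ q hq _ (.inr rfl) (by linarith)
    rw [← this] at e
    linarith
  · rintro n (rfl | rfl)
    · refine h.isSpell_on hxy r.hφ ?_ ?_
      · refine fun e => (ActL.not_swap ⟨r, hr, rfl, rfl, ?_⟩) e
        unfold Rect.L
        rw [← hrθ, mem_hIoc_iff' x n3]
        grind
      · rintro ⟨q, hq, e1, e2, e3⟩
        exact noR q hq e3 _ (.inl rfl) (.inr e1)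
    · refine h.isSpell_rest hr rfl rfl rfl rfl (.inl rfl) (.inr (left_mem_hIco _ _))
        (fun θ hθ => ?_) fun θ hθ => ?_
      · unfold Rect.L at *
        rw [mem_hIoc_iff hxy, ← hrθ, mem_hIoc_iff' x n3]
        rw [mem_hIoc_iff' x n2] at hθ
        grind
      · unfold Rect.R at *
        rw [mem_hIco_iff hxy, ← hrθ, mem_hIco_iff' x n3]
        rw [mem_hIco_iff' x n2] at hθ
        grind
  · intro θ hθ hθ'
    refine ⟨_, .inr rfl, rfl, rfl, ?_⟩
    unfold Rect.L at *
    rw [← hrθ, mem_hIoc_iff' x n3] at hθ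
    rw [mem_hIoc_iff hxy] at hθ'
    rw [mem_hIoc_iff' x n2]
    grind

end Diagram.IsToggle

namespace Diagram

/-- `Q` is obtained from `P` by a finite sequence of moves. -/
def Reach (P Q : Diagram) : Prop := Nonempty (MoveSequence P Q)

lemma Reach.refl (P : Diagram) : P.Reach P := ⟨.nil P⟩

lemma Reach.trans {P Q R : Diagram} (h : P.Reach Q) (h' : Q.Reach R) : P.Reach R := by
  obtain ⟨s⟩ := h'
  induction s with
  | nil => exact h
  | snoc _ hm ih => obtain ⟨t⟩ := ih; exact ⟨.snoc t hm⟩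

lemma Reach.of_move {P Q : Diagram} (h : VerticalMove P Q) : P.Reach Q := ⟨.snoc (.nil P) h⟩

lemma _root_.RectMovie.VerticalMove.symm {P Q : Diagram} (h : VerticalMove P Q) : VerticalMove Q P := by
  rcases h with h | h | h | h
  · exact .inr (.inl h)
  · exact .inl h
  · exact .inr (.inr (.inr h))
  · exact .inr (.inr (.inl h))

lemma Reach.symm {P Q : Diagram} (h : P.Reach Q) : Q.Reach P := by
  obtain ⟨s⟩ := h
  induction s with
  | nil => exact Reach.refl _
  | snoc _ hm ih => exact (Reach.of_move hm.symm).trans ih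

lemma eventually_window (P : Diagram) (y : S1) : ∀ᶠ ε : ℝ in 𝓝[>] 0,
    ∀ t ∈ Set.Icc (-(2 * ε)) (2 * ε), P.OccupiedMeridian (y + (t : S1)) → t = 0 := by
  have h := eventually_not_mem_of_finite P.finite_occupied y
  obtain ⟨δ, hδ, hall⟩ := mem_nhdsGT_iff_exists_Ioo_subset.1 (h.1.and h.2)
  have hδ' : 0 < δ := hδ
  filter_upwards [eventually_small (half_pos hδ')] with ε hε t ht hocc
  by_contra hne
  rcases lt_or_gt_of_ne hne with h0 | h0
  · refine (hall ⟨neg_pos.2 h0, by linarith [ht.1, hε.2]⟩).2 ?_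
    rw [AddCircle.coe_neg, sub_neg_eq_add]
    exact hocc
  · exact (hall ⟨h0, by linarith [ht.2, hε.2]⟩).1 hocc

end Diagram

lemma split_hIoc {x y z : S1} (hz : z ∈ cIoo x y) (θ : S1) :
    ((θ ∈ hIoc x y ↔ θ ∈ hIoc x z ∨ θ ∈ hIoc z y) ∧ ¬ (θ ∈ hIoc x z ∧ θ ∈ hIoc z y)) ∧
    ((θ ∈ hIco x y ↔ θ ∈ hIco x z ∨ θ ∈ hIco z y) ∧ ¬ (θ ∈ hIco x z ∧ θ ∈ hIco z y)) := by
  have h1 : x ≠ z := by rintro rfl; exact left_not_mem_cIoo _ _ hz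
  have h2 : z ≠ y := by rintro rfl; exact right_not_mem_cIoo _ _ hz
  rw [mem_cIoo_iff] at hz
  have h3 : x ≠ y := by rintro rfl; rw [arc_self] at hz; linarith
  rw [mem_hIoc_iff h3, mem_hIoc_iff h1, mem_hIoc_iff' x h2, mem_hIco_iff h3, mem_hIco_iff h1,
    mem_hIco_iff' x h2]
  have := arc_nonneg x θ
  grind

lemma split_cIoo {x y z : S1} (hz : z ∈ cIoo x y) :
    cIoo x z ⊆ cIoo x y ∧ cIoo z y ⊆ cIoo x y := by
  rw [mem_cIoo_iff] at hz
  constructor <;> intro θ hθ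
  · rw [mem_cIoo_iff] at *
    exact ⟨hθ.1, hθ.2.trans hz.2⟩
  · rw [mem_cIoo_iff] at *
    rw [← mem_cIoo_iff, mem_cIoo_iff' x] at hθ
    grind

namespace Diagram.Toggleable
variable {P P' : Diagram} {r : Rect} {x y z : S1}

lemma not_swapL (h : P.Toggleable r x y) {θ : S1} (hθ : r.L θ) : ¬ P.ActL r.φ₂ r.φ₁ θ :=
  fun e => (ActL.not_swap ⟨r, h.mem, rfl, rfl, hθ⟩) e

lemma head (h : P.Toggleable r x y) (hz : z ∈ cIoo x y) : P.Toggleable r x z where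
  mem := h.mem
  ne := by rintro rfl; exact left_not_mem_cIoo _ _ hz
  left θ hθ := h.left θ ((split_hIoc hz θ).1.1.2 (.inl hθ))
  right θ hθ := h.right θ ((split_hIoc hz θ).2.1.2 (.inl hθ))
  outerL q hq θ hθ := h.outerL q hq θ ((split_hIoc hz θ).1.1.2 (.inl hθ))
  outerR q hq θ hθ := h.outerR q hq θ ((split_hIoc hz θ).2.1.2 (.inl hθ))
  start := h.start
  finish q hq e := absurd (P.occupiedMeridian_iff.2 ⟨q, hq, e⟩) (h.inner z hz)
  inner θ hθ := h.inner θ ((split_cIoo hz).1 hθ)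
  never := ⟨y, fun e => (split_hIoc hz y).1.2 ⟨e, right_mem_hIoc _ _⟩,
    h.not_swapL (h.left y (right_mem_hIoc _ _))⟩

lemma tail (h : P.Toggleable r x y) (hz : z ∈ cIoo x y) : P.Toggleable r z y where
  mem := h.mem
  ne := by rintro rfl; exact right_not_mem_cIoo _ _ hz
  left θ hθ := h.left θ ((split_hIoc hz θ).1.1.2 (.inr hθ))
  right θ hθ := h.right θ ((split_hIoc hz θ).2.1.2 (.inr hθ))
  outerL q hq θ hθ := h.outerL q hq θ ((split_hIoc hz θ).1.1.2 (.inr hθ))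
  outerR q hq θ hθ := h.outerR q hq θ ((split_hIoc hz θ).2.1.2 (.inr hθ))
  start q hq e := absurd (P.occupiedMeridian_iff.2 ⟨q, hq, e⟩) (h.inner z hz)
  finish := h.finish
  inner θ hθ := h.inner θ ((split_cIoo hz).2 hθ)
  never := ⟨z, fun e => (split_hIoc hz z).1.2 ⟨right_mem_hIoc _ _, e⟩,
    h.not_swapL (h.left z (.inl hz))⟩

lemma not_subset (h : P.Toggleable r x y) (hP' : P.IsToggle P' r.φ₁ r.φ₂ x y) {θ : S1}
    (hθ : θ ∈ hIoc x y) : ∀ q ∈ P'.rects, q.L θ → ¬ cIcc r.φ₂ r.φ₁ ⊆ cIoo q.φ₁ q.φ₂ := by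
  intro q hq hL hs
  by_cases e : q.φ₁ = r.φ₂ ∧ q.φ₂ = r.φ₁
  · rw [e.1, e.2] at hs
    exact left_not_mem_cIoo _ _ (hs (left_mem_cIcc _ _))
  · have := ((hP'.left _ _ _).1 ⟨q, hq, rfl, rfl, hL⟩).resolve_right fun e' => e ⟨e'.1, e'.2.1⟩
    exact Rect.not_inner_of_sits (Rect.sits_swap (c := r.swap)
      (h.sits (.inl ⟨hθ, this.1⟩) fun e' => this.2 ⟨e'.1, e'.2, hθ⟩) rfl rfl) hs

lemma step_right (h : P.Toggleable r x y) (hP' : P.IsToggle P' r.φ₁ r.φ₂ x y) :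
    ∃ y' P₂, P.Toggleable r x y' ∧ P.IsToggle P₂ r.φ₁ r.φ₂ x y' ∧ P₂.Reach P' ∧
      ¬ P.OccupiedMeridian y' := by
  by_cases ho : P.OccupiedMeridian y
  swap
  · exact ⟨y, P', h, hP', Reach.refl _, ho⟩
  have hne := h.ne
  obtain ⟨ε, hw, e1, e2⟩ := ((P'.eventually_window y).and ((eventually_small (arc_pos.2 hne.symm)).and
    (eventually_small (show (0:ℝ) < 1 / 4 by norm_num)))).exists
  set z := y - (ε : S1) with hz
  have hyz : y = z + (ε : S1) := by rw [hz, sub_add_cancel]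
  have hzx : ℓ x z = ℓ x y - ε := by
    have h1 := add_arc x y
    have : z = x + ((ℓ x y - ε : ℝ) : S1) := by
      rw [AddCircle.coe_sub, ← add_sub_assoc, h1]
    rw [this, arc_add (by linarith [e1.2]) (by linarith [arc_lt_one x y, e1.1])]
  have hz' : z ∈ cIoo x y := by
    rw [mem_cIoo_iff, hzx]; constructor <;> linarith [e1.1, e1.2]
  have h2 := h.head hz'
  obtain ⟨P₂, -, hP₂⟩ := h2.exists_toggle
  have ht := (hP'.trans hP₂ (fun θ => (split_hIoc hz' θ).1) fun θ => (split_hIoc hz' θ).2).symm r.hφ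
  refine ⟨z, P₂, h2, hP₂, ?_, h.inner z hz'⟩
  obtain ⟨q, hq, hqy⟩ := P.occupiedMeridian_iff.1 ho
  have hry := (h.finish q hq hqy).1
  have hnR : ¬ P.ActR r.φ₁ r.φ₂ y := hry ▸ (isSpell h.mem).finish
  have y2 := right_not_mem_hIco x y hne
  have hsw : ∀ c d, ¬ (P'.ActL c d y ↔ P'.ActR c d y) → c = r.φ₂ ∧ d = r.φ₁ := by
    intro c d hs
    by_contra hB
    rw [hP'.left, hP'.right] at hs
    simp only [y2, right_mem_hIoc, and_true, and_false, not_false_eq_true, or_false, hB] at hs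
    by_cases hA : c = r.φ₁ ∧ d = r.φ₂
    · rw [hA.1, hA.2] at hs; simp [hnR] at hs
    · exact (h.eq_of_switch (fun q hq e => (h.finish q hq e).2) (fun e => hs (by simpa [hA] using e))).elim hA hB
  by_cases hC : P.ActR r.φ₂ r.φ₁ y
  · refine (Reach.of_move (.inl (ht.bubbleCreation (h.tail hz').ne ?_ ?_))).symm
    · intro θ hθ
      rcases (mem_cIcc_iff_or (h.tail hz').ne).1 hθ with rfl | rfl | hθ
      · exact hP'.not_occupied hz' (h.inner _ hz')
      · rw [not_occupied_iff_act]
        intro c d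
        by_contra hs
        have e := hsw c d hs
        apply hs
        rw [e.1, e.2, hP'.left, hP'.right]
        exact iff_of_true (.inr ⟨rfl, rfl, right_mem_hIoc _ _⟩) (.inl ⟨hC, fun e => y2 e.2.2⟩)
      · have := (split_cIoo hz').2 hθ
        exact hP'.not_occupied this (h.inner _ this)
    · exact h.not_subset hP' (right_mem_hIoc _ _)
  · refine (Reach.of_move (.inr (.inr (.inl (ht.halfWrinkle_finish e1.1 (by linarith [e2.2]) hw ?_ ?_))))).symm
    · rw [hP'.right]
      rintro (e | e)
      · exact hC e.1
      · exact y2 e.2.2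
    · intro q hq e
      refine hsw _ _ fun hs => ?_
      rcases e with rfl | rfl
      · exact (isSpell hq).start (hs.2 ((isSpell hq).right _ q.R_left))
      · exact (isSpell hq).finish (hs.1 ((isSpell hq).left _ q.L_right))

lemma step_left (h : P.Toggleable r x y) (hP' : P.IsToggle P' r.φ₁ r.φ₂ x y) :
    ∃ x' P₂, P.Toggleable r x' y ∧ P.IsToggle P₂ r.φ₁ r.φ₂ x' y ∧ P₂.Reach P' ∧
      ¬ P.OccupiedMeridian x' := by
  by_cases ho : P.OccupiedMeridian x
  swap
  · exact ⟨x, P', h, hP', Reach.refl _, ho⟩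
  have hne := h.ne
  obtain ⟨ε, hw, e1, e2⟩ := ((P'.eventually_window x).and ((eventually_small (arc_pos.2 hne.symm)).and
    (eventually_small (show (0:ℝ) < 1 / 4 by norm_num)))).exists
  set z := x + (ε : S1) with hz
  have hzx : ℓ x z = ε := arc_add e1.1.le (by linarith [e2.2])
  have hz' : z ∈ cIoo x y := by
    rw [mem_cIoo_iff, hzx]; exact e1
  have h2 := h.tail hz'
  obtain ⟨P₂, -, hP₂⟩ := h2.exists_toggle
  have ht := (hP'.trans hP₂ (fun θ => (split_hIoc hz' θ).1.imp (fun h => h.trans or_comm)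
    fun h e => h e.symm) fun θ => (split_hIoc hz' θ).2.imp (fun h => h.trans or_comm)
    fun h e => h e.symm).symm r.hφ
  refine ⟨z, P₂, h2, hP₂, ?_, h.inner z hz'⟩
  obtain ⟨q, hq, hqx⟩ := P.occupiedMeridian_iff.1 ho
  have hrx := (h.start q hq hqx).1
  have hnL : ¬ P.ActL r.φ₁ r.φ₂ x := hrx ▸ (isSpell h.mem).start
  have x1 := left_not_mem_hIoc x y hne
  have hsw : ∀ c d, ¬ (P'.ActL c d x ↔ P'.ActR c d x) → c = r.φ₂ ∧ d = r.φ₁ := by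
    intro c d hs
    by_contra hB
    rw [hP'.left, hP'.right] at hs
    simp only [x1, left_mem_hIco, and_true, and_false, not_false_eq_true, or_false, hB] at hs
    by_cases hA : c = r.φ₁ ∧ d = r.φ₂
    · rw [hA.1, hA.2] at hs; simp [hnL] at hs
    · exact (h.eq_of_switch (fun q hq e => (h.start q hq e).2) (fun e => hs (by simpa [hA] using e))).elim hA hB
  by_cases hC : P.ActL r.φ₂ r.φ₁ x
  · refine (Reach.of_move (.inl (ht.bubbleCreation (h.head hz').ne ?_ ?_))).symm
    · intro θ hθ
      rcases (mem_cIcc_iff_or (h.head hz').ne).1 hθ with rfl | rfl | hθ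
      · rw [not_occupied_iff_act]
        intro c d
        by_contra hs
        have e := hsw c d hs
        apply hs
        rw [e.1, e.2, hP'.left, hP'.right]
        exact iff_of_true (.inl ⟨hC, fun e => x1 e.2.2⟩) (.inr ⟨rfl, rfl, left_mem_hIco _ _⟩)
      · exact hP'.not_occupied hz' (h.inner _ hz')
      · have := (split_cIoo hz').1 hθ
        exact hP'.not_occupied this (h.inner _ this)
    · exact h.not_subset hP' (.inl hz')
  · refine (Reach.of_move (.inr (.inr (.inl (ht.halfWrinkle_start e1.1 (by linarith [e2.2]) hw ?_ ?_))))).symm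
    · rw [hP'.left]
      rintro (e | e)
      · exact hC e.1
      · exact x1 e.2.2
    · intro q hq e
      refine hsw _ _ fun hs => ?_
      rcases e with rfl | rfl
      · exact (isSpell hq).start (hs.2 ((isSpell hq).right _ q.R_left))
      · exact (isSpell hq).finish (hs.1 ((isSpell hq).left _ q.L_right))

lemma reach (h : P.Toggleable r x y) (hP' : P.IsToggle P' r.φ₁ r.φ₂ x y) : P.Reach P' := by
  obtain ⟨y', P₂, h₂, t₂, r₂, o₂⟩ := h.step_right hP'
  obtain ⟨x', P₁, h₁, t₁, r₁, o₁⟩ := h₂.step_left t₂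
  refine Reach.trans (Reach.of_move (.inl (t₁.bubbleCreation h₁.ne ?_ ?_))) (r₁.trans r₂)
  · intro θ hθ
    rcases (mem_cIcc_iff_or h₁.ne).1 hθ with rfl | rfl | hθ
    · exact o₁
    · exact o₂
    · exact h₁.inner θ hθ
  · exact fun q hq hL => h₁.outerL q hq _ (right_mem_hIoc _ _) hL

end Diagram.Toggleable

lemma Rect.cross_of_inner {r q : Rect} (h : r.Compatible q) (hin : r.Inner q) {θ : S1}
    (h1 : r.L θ ∨ r.R θ) (h2 : q.L θ ∨ q.R θ) : r.Cross q := by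
  have hφ := hin r.φ₁_mem_arc
  refine (h.cross (θ := θ) (φ := r.φ₁) ⟨r.mem_cIcc_iff_L_or_R.2 h1, r.φ₁_mem_arc⟩
    ⟨q.mem_cIcc_iff_L_or_R.2 h2, cIoo_subset_cIcc _ _ hφ⟩ (.inr fun hv => ?_)).resolve_right
      fun h' => hin.not_inner h'.2
  rcases (Rect.mem_vertices.1 hv).2 with e | e
  · rw [e] at hφ; exact q.φ₁_not_mem_arcInt hφ
  · rw [e] at hφ; exact q.φ₂_not_mem_arcInt hφ

lemma Rect.Inner.not_laminar_swap {r q c : Rect} (h : r.Inner q) (h1 : c.φ₁ = r.φ₂)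
    (h2 : c.φ₂ = r.φ₁) : ¬ q.Laminar c := by
  have key : ¬ (q.Inner c ∨ q.Apart c) := fun h' =>
    Rect.not_inner_of_sits (Rect.sits_swap h' (c := r) h2.symm h1.symm) h
  rintro (h' | h' | h')
  · exact key (.inr h')
  · exact key (.inl h')
  · rcases mem_cIcc_or_swap (a := r.φ₁) (b := r.φ₂) q.φ₁ with hm | hm
    · exact left_not_mem_cIoo _ _ (h hm)
    · exact left_not_mem_cIoo _ _ (h' (by rw [Rect.arc, h1, h2]; exact hm))

namespace Diagram
variable {P K : Diagram}

lemma not_end_of_thru {k c : Rect} (hk : k ∈ P.rects) (hc : c ∈ P.rects) {z : S1}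
    (hz : z = k.θ₁ ∨ z = k.θ₂) (hL : c.L z) (hR : c.R z) (hm : k.φ₁ ∈ c.arc) : False := by
  have hne : k ≠ c := by
    rintro rfl
    rcases hz with rfl | rfl
    · exact k.not_L_left hL
    · exact k.not_R_right hR
  have hloc := (P.compatible k hk c hc hne).localAt z
  have hlam : k.Laminar c := by
    rcases hz with rfl | rfl
    · exact hloc.after k.R_left hR
    · exact hloc.before k.L_right hL
  rcases hlam with h | h | h
  · exact disjoint_left.1 h k.φ₁_mem_arc hm
  · exact hloc.left_thru hz hL hR h
  · exact left_not_mem_cIoo _ _ (h hm)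

lemma endpoint_cases (hm : movieOf P = movieOf K) {q : Rect} (hq : q ∈ P.rects) {z : S1}
    (hz : z = q.θ₁ ∨ z = q.θ₂) :
    (∃ q' ∈ P.rects, (z = q'.θ₁ ∨ z = q'.θ₂) ∧ q'.φ₁ = q.φ₂ ∧ q'.φ₂ = q.φ₁) ∨
    ∃ k ∈ K.rects, (z = k.θ₁ ∨ z = k.θ₂) ∧
      ((k.φ₁ = q.φ₁ ∧ k.φ₂ = q.φ₂) ∨ (k.φ₁ = q.φ₂ ∧ k.φ₂ = q.φ₁)) := by
  rcases hz with rfl | rfl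
  · have hA : s(q.φ₁, q.φ₂) ∈ movieAfter K q.θ₁ := by
      rw [← movieAfter_eq hm]; exact mem_movieAfter.2 ⟨q, hq, q.R_left, rfl⟩
    obtain ⟨k, hk, h1, h2⟩ := mem_movieAfter.1 hA
    have h2' := Sym2.eq_iff.1 h2
    by_cases hL : k.L q.θ₁
    · left
      have : s(q.φ₁, q.φ₂) ∈ movieOf P q.θ₁ := by rw [hm]; exact mem_movieOf.2 ⟨k, hk, hL, h2⟩
      rcases mem_movieOf_iff_act.1 this with h | ⟨q', hq', e1, e2, e3⟩
      · exact absurd h (isSpell hq).start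
      · refine ⟨q', hq', .inr (q'.end_iff.1 ⟨e3, fun hR => ?_⟩), e1, e2⟩
        exact (ActR.not_swap ⟨q, hq, rfl, rfl, q.R_left⟩) ⟨q', hq', e1, e2, hR⟩
    · exact .inr ⟨k, hk, .inl (k.start_iff.1 ⟨hL, h1⟩), h2'⟩
  · have hA : s(q.φ₁, q.φ₂) ∈ movieOf K q.θ₂ := by
      rw [← hm]; exact mem_movieOf.2 ⟨q, hq, q.L_right, rfl⟩
    obtain ⟨k, hk, h1, h2⟩ := mem_movieOf.1 hA
    have h2' := Sym2.eq_iff.1 h2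
    by_cases hR : k.R q.θ₂
    · left
      have : s(q.φ₁, q.φ₂) ∈ movieAfter P q.θ₂ := by
        rw [movieAfter_eq hm]; exact mem_movieAfter.2 ⟨k, hk, hR, h2⟩
      rcases mem_movieAfter_iff_act.1 this with h | ⟨q', hq', e1, e2, e3⟩
      · exact absurd h (isSpell hq).finish
      · refine ⟨q', hq', .inl (q'.start_iff.1 ⟨fun hL => ?_, e3⟩), e1, e2⟩
        exact (ActL.not_swap ⟨q, hq, rfl, rfl, q.L_right⟩) ⟨q', hq', e1, e2, hL⟩
    · exact .inr ⟨k, hk, .inr (k.end_iff.1 ⟨h1, hR⟩), h2'⟩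

lemma act_swap (hm : movieOf P = movieOf K) {a b θ : S1} (h : P.ActL a b θ) (hK : ¬ K.ActL a b θ) :
    K.ActL b a θ := by
  have : s(a, b) ∈ movieOf K θ := by rw [← hm]; exact mem_movieOf_iff_act.2 (.inl h)
  exact (mem_movieOf_iff_act.1 this).resolve_left hK

lemma actR_swap (hm : movieOf P = movieOf K) {a b θ : S1} (h : P.ActR a b θ)
    (hK : ¬ K.ActR a b θ) : K.ActR b a θ := by
  have : s(a, b) ∈ movieAfter K θ := by
    rw [← movieAfter_eq hm]; exact mem_movieAfter_iff_act.2 (.inl h)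
  exact (mem_movieAfter_iff_act.1 this).resolve_left hK

lemma not_end_of_keep (hm : movieOf P = movieOf K) {r q : Rect} (hr : r ∈ P.rects)
    {o : S1} (ho : o ∈ r.arcInt) {z : S1} (hL : r.L z) (hR : r.R z)
    (hK : ∀ k ∈ K.rects, (z = k.θ₁ ∨ z = k.θ₂) → k.φ₁ ∈ cIoo r.φ₂ r.φ₁ → False)
    (hout : ∀ q ∈ P.rects, (z = q.θ₁ ∨ z = q.θ₂) → ¬ r.Inner q)
    (hq : q ∈ P.rects) (hz : z = q.θ₁ ∨ z = q.θ₂) : False := by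
  have apart : ∀ q ∈ P.rects, (z = q.θ₁ ∨ z = q.θ₂) → q.Apart r := by
    intro q hq hz
    have hne : q ≠ r := by
      rintro rfl
      rcases hz with rfl | rfl
      · exact q.not_L_left hL
      · exact q.not_R_right hR
    have hloc := (P.compatible q hq r hr hne).localAt z
    have hlam : q.Laminar r := by
      rcases hz with e | e
      · exact hloc.after (e ▸ q.R_left) hR
      · exact hloc.before (e ▸ q.L_right) hL
    rcases hlam with h | h | h
    · exact h
    · exact absurd h (hloc.left_thru hz hL hR)
    · exact absurd h (hout q hq hz)
  have ho' : o ∈ r.arc := cIoo_subset_cIcc _ _ ho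
  have a1 := apart q hq hz
  rcases endpoint_cases hm hq hz with ⟨q', hq', hz', e1, e2⟩ | ⟨k, hk, hz', e⟩
  · have a2 := apart q' hq' hz'
    rcases mem_cIcc_or_swap (a := q.φ₁) (b := q.φ₂) o with h | h
    · exact disjoint_left.1 a1 h ho'
    · exact disjoint_left.1 a2 (by rw [Rect.arc, e1, e2]; exact h) ho'
  · refine hK k hk hz' (not_mem_cIcc_iff.1 fun hm' => ?_)
    rcases e with e | e
    · exact disjoint_left.1 a1 q.φ₁_mem_arc (e.1 ▸ hm')
    · exact disjoint_left.1 a1 q.φ₂_mem_arc (e.1 ▸ hm')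

end Diagram

namespace Diagram
variable {P K : Diagram}

lemma weakly_disjoint {q r : Rect} (hq : q ∈ P.rects) (hr : r ∈ P.rects) (hne : q ≠ r) {z : S1}
    (hzq : z = q.θ₁ ∨ z = q.θ₂) (hzr : z = r.θ₁ ∨ z = r.θ₂) {φ : S1} (h1 : φ ∈ q.arc)
    (h2 : φ ∈ r.arc) : φ = r.φ₁ ∨ φ = r.φ₂ := by
  have hloc := (P.compatible q hq r hr hne).localAt z
  rcases hzq with e | e <;> rcases hzr with e' | e'
  · exact absurd h2 (disjoint_left.1 (hloc.both_start e e') h1)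
  · exact (hloc.start_end e e' φ h1 h2).2
  · exact (hloc.end_start e e' φ h1 h2).2
  · exact absurd h2 (disjoint_left.1 (hloc.both_end e e') h1)

lemma eq_or_swap_of_end (hm : movieOf P = movieOf K) {r q : Rect} (hr : r ∈ P.rects) {o : S1}
    (ho : o ∈ r.arcInt) {z : S1} (hzr : z = r.θ₁ ∨ z = r.θ₂)
    (hc : (∃ c ∈ P.rects, (z = c.θ₁ ∨ z = c.θ₂) ∧ c.φ₁ = r.φ₂ ∧ c.φ₂ = r.φ₁) ∨
      ∃ c ∈ K.rects, (z = c.θ₁ ∨ z = c.θ₂) ∧ c.φ₁ = r.φ₂ ∧ c.φ₂ = r.φ₁)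
    (hq : q ∈ P.rects) (hz : z = q.θ₁ ∨ z = q.θ₂) :
    (q.φ₁ = r.φ₁ ∧ q.φ₂ = r.φ₂) ∨ (q.φ₁ = r.φ₂ ∧ q.φ₂ = r.φ₁) := by
  by_contra hcon
  have hqr : q ≠ r := by rintro rfl; exact hcon (.inl ⟨rfl, rfl⟩)
  have done : (∀ φ, q.HasEnd φ → φ ∈ cIcc r.φ₂ r.φ₁ → φ = r.φ₁ ∨ φ = r.φ₂) → False := by
    intro h
    have all : ∀ φ, q.HasEnd φ → φ = r.φ₁ ∨ φ = r.φ₂ := fun φ hφ => by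
      rcases mem_cIcc_or_swap (a := r.φ₁) (b := r.φ₂) φ with h' | h'
      · exact weakly_disjoint hq hr hqr hz hzr hφ.mem_arc h'
      · exact h φ hφ h'
    have h1 := all _ (.inl rfl)
    have h2 := all _ (.inr rfl)
    have := q.hφ
    rcases h1 with h1 | h1 <;> rcases h2 with h2 | h2
    · exact this (h1.trans h2.symm)
    · exact hcon (.inl ⟨h1, h2⟩)
    · exact hcon (.inr ⟨h1, h2⟩)
    · exact this (h1.trans h2.symm)
  rcases hc with ⟨c, hc, hzc, e1, e2⟩ | ⟨c, hc, hzc, e1, e2⟩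
  · have hqc : q ≠ c := by rintro rfl; exact hcon (.inr ⟨e1, e2⟩)
    refine done fun φ hφ h => ?_
    have := weakly_disjoint hq hc hqc hz hzc hφ.mem_arc (by rw [Rect.arc, e1, e2]; exact h)
    rw [e1, e2] at this
    exact this.symm
  · rcases endpoint_cases hm hq hz with ⟨q', hq', hz', f1, f2⟩ | ⟨k, hk, hz', f⟩
    · have hqr' : q' ≠ r := by rintro rfl; exact hcon (.inr ⟨f2.symm, f1.symm⟩)
      have ho' : o ∈ r.arc := cIoo_subset_cIcc _ _ ho
      have : o = r.φ₁ ∨ o = r.φ₂ := by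
        rcases mem_cIcc_or_swap (a := q.φ₁) (b := q.φ₂) o with h | h
        · exact weakly_disjoint hq hr hqr hz hzr h ho'
        · exact weakly_disjoint hq' hr hqr' hz' hzr (by rw [Rect.arc, f1, f2]; exact h) ho'
      rcases this with rfl | rfl
      · exact r.φ₁_not_mem_arcInt ho
      · exact r.φ₂_not_mem_arcInt ho
    · have hkc : k ≠ c := by
        rintro rfl
        rcases f with f | f
        · exact hcon (.inr ⟨f.1.symm.trans e1, f.2.symm.trans e2⟩)
        · exact hcon (.inl ⟨f.2.symm.trans e2, f.1.symm.trans e1⟩)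
      refine done fun φ hφ h => ?_
      have hkφ : k.HasEnd φ := by
        rcases f with f | f
        · rw [Rect.HasEnd, f.1, f.2]; exact hφ
        · rw [Rect.HasEnd, f.1, f.2]; exact hφ.symm
      have := weakly_disjoint hk hc hkc hz' hzc hkφ.mem_arc (by rw [Rect.arc, e1, e2]; exact h)
      rw [e1, e2] at this
      exact this.symm

lemma right_of_left {q : Rect} (h : ∀ θ, q.L θ → K.ActL q.φ₁ q.φ₂ θ) {θ : S1} (hθ : q.R θ) :
    K.ActR q.φ₁ q.φ₂ θ := by
  obtain ⟨t, h1, h2⟩ := ((q.eventually_right θ).and ((K.tame q.φ₁ q.φ₂).right θ)).exists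
  exact h2.1.1 (h _ (h1.1.2 hθ))

lemma exists_toggleable (hm : movieOf P = movieOf K) {r : Rect} (hr : r ∈ P.rects) {o : S1}
    (ho : o ∈ r.arcInt) (hbad : ∃ θ, r.L θ ∧ ¬ K.ActL r.φ₁ r.φ₂ θ)
    (hmin : ∀ q ∈ P.rects, r.Cross q → ∀ θ, q.L θ → K.ActL q.φ₁ q.φ₂ θ)
    (hcom : (∀ θ, s(r.φ₁, r.φ₂) ∈ movieOf P θ) → ∃ θ, P.ActL r.φ₁ r.φ₂ θ ∧ K.ActL r.φ₁ r.φ₂ θ) :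
    ∃ x y, P.Toggleable r x y ∧ (∀ θ ∈ hIoc x y, ¬ K.ActL r.φ₁ r.φ₂ θ) ∧ ¬ K.ActR r.φ₁ r.φ₂ x ∧
      (P.OccupiedMeridian x ∨ K.OccupiedMeridian x) ∧
      (P.OccupiedMeridian y ∨ K.OccupiedMeridian y) := by
  have htame : IsTame (fun θ => r.L θ ∧ ¬ K.ActL r.φ₁ r.φ₂ θ) fun θ => r.R θ ∧ ¬ K.ActR r.φ₁ r.φ₂ θ :=
    IsTame.and ⟨r.eventually_right, r.eventually_left⟩ (K.tame _ _).not
  obtain ⟨θ₀, h0⟩ := hbad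
  obtain ⟨x, y, hxy, -, hx, hx', hy, hy', hin⟩ := htame.exists_interval h0
    ⟨r.θ₁, fun h => r.not_L_left h.1⟩
  have inL : ∀ θ ∈ hIoc x y, r.L θ ∧ ¬ K.ActL r.φ₁ r.φ₂ θ := by
    rintro θ (h | rfl)
    · exact (hin θ h).1
    · exact hy
  have inR : ∀ θ ∈ hIco x y, r.R θ ∧ ¬ K.ActR r.φ₁ r.φ₂ θ := by
    rintro θ (rfl | h)
    · exact hx'
    · exact (hin θ h).2
  have actL : ∀ {θ}, r.L θ → P.ActL r.φ₁ r.φ₂ θ := fun h => ⟨r, hr, rfl, rfl, h⟩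
  have actR : ∀ {θ}, r.R θ → P.ActR r.φ₁ r.φ₂ θ := fun h => ⟨r, hr, rfl, rfl, h⟩
  have KL : ∀ θ ∈ hIoc x y, K.ActL r.φ₂ r.φ₁ θ := fun θ hθ =>
    act_swap hm (actL (inL θ hθ).1) (inL θ hθ).2
  have KR : ∀ θ ∈ hIco x y, K.ActR r.φ₂ r.φ₁ θ := fun θ hθ =>
    actR_swap hm (actR (inR θ hθ).1) (inR θ hθ).2
  have cross : ∀ q ∈ P.rects, ∀ θ, (r.L θ ∨ r.R θ) → (q.L θ ∨ q.R θ) → r.Inner q →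
      ∀ θ, q.L θ → K.ActL q.φ₁ q.φ₂ θ := by
    intro q hq θ h1 h2 hi
    refine hmin q hq (Rect.cross_of_inner (P.compatible r hr q hq ?_) hi h1 h2)
    rintro rfl
    exact hi.not_inner hi
  have outerL : ∀ q ∈ P.rects, ∀ θ ∈ hIoc x y, q.L θ → ¬ r.Inner q := by
    intro q hq θ hθ h hi
    have h1 := cross q hq θ (.inl (inL θ hθ).1) (.inl h) hi θ h
    refine hi.not_laminar_swap (c := r.swap) rfl rfl (K.fits.before q r.swap θ h1 (KL θ hθ) ?_)
    intro e
    have hi' := (Rect.laminar_congr (r' := r) (q' := r.swap) rfl rfl e.1 e.2).2.1 hi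
    exact left_not_mem_cIoo _ _ (hi' r.φ₂_mem_arc)
  have outerR : ∀ q ∈ P.rects, ∀ θ ∈ hIco x y, q.R θ → ¬ r.Inner q := by
    intro q hq θ hθ h hi
    have h1 := right_of_left (cross q hq θ (.inr (inR θ hθ).1) (.inr h) hi) h
    refine hi.not_laminar_swap (c := r.swap) rfl rfl (K.fits.after q r.swap θ h1 (KR θ hθ) ?_)
    intro e
    have hi' := (Rect.laminar_congr (r' := r) (q' := r.swap) rfl rfl e.1 e.2).2.1 hi
    exact left_not_mem_cIoo _ _ (hi' r.φ₂_mem_arc)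
  have inner : ∀ θ ∈ cIoo x y, ¬ P.OccupiedMeridian θ := by
    intro z hz hocc
    obtain ⟨q, hq, hzq⟩ := P.occupiedMeridian_iff.1 hocc
    refine not_end_of_keep hm hr ho (hin z hz).1.1 (hin z hz).2.1 (fun k hk hzk hφ => ?_)
      (fun q hq hzq => ?_) hq hzq
    · obtain ⟨c, hc, e1, e2, e3⟩ := KL z (.inl hz)
      obtain ⟨c', hc', e1', e2', e3'⟩ := KR z (.inr hz)
      have := eq_of_LR hc hc' (e1.trans e1'.symm) (e2.trans e2'.symm) e3 e3'
      subst this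
      exact not_end_of_thru hk hc hzk e3 e3' (by rw [Rect.arc, e1, e2]; exact cIoo_subset_cIcc _ _ hφ)
    · rcases hzq with rfl | rfl
      · exact outerR q hq _ (.inr hz) q.R_left
      · exact outerL q hq _ (.inl hz) q.L_right
  have noK : ∀ c ∈ K.rects, c.φ₁ = r.φ₂ → c.φ₂ = r.φ₁ → ∀ z, (z = c.θ₁ ∨ z = c.θ₂) →
      ∀ k ∈ K.rects, (z = k.θ₁ ∨ z = k.θ₂) → k.φ₁ ∈ cIoo r.φ₂ r.φ₁ → False := by
    intro c hc e1 e2 z hzc k hk hzk hφ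
    have hkc : k ≠ c := by rintro rfl; rw [e1] at hφ; exact left_not_mem_cIoo _ _ hφ
    have := weakly_disjoint hk hc hkc hzk hzc k.φ₁_mem_arc
      (by rw [Rect.arc, e1, e2]; exact cIoo_subset_cIcc _ _ hφ)
    rw [e1, e2] at this
    rcases this with e | e <;> rw [e] at hφ
    · exact left_not_mem_cIoo _ _ hφ
    · exact right_not_mem_cIoo _ _ hφ
  have startK : ∀ c ∈ K.rects, c.φ₁ = r.φ₂ → c.φ₂ = r.φ₁ → c.R x → K.ActL r.φ₁ r.φ₂ x → x = c.θ₁ :=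
    fun c hc e1 e2 h h' => c.start_iff.1 ⟨fun hL => (ActL.not_swap h') ⟨c, hc, e1, e2, hL⟩, h⟩
  have finishK : ∀ c ∈ K.rects, c.φ₁ = r.φ₂ → c.φ₂ = r.φ₁ → c.L y → K.ActR r.φ₁ r.φ₂ y → y = c.θ₂ :=
    fun c hc e1 e2 h h' => c.end_iff.1 ⟨h, fun hR => (ActR.not_swap h') ⟨c, hc, e1, e2, hR⟩⟩
  refine ⟨x, y, ⟨hr, hxy, fun θ hθ => (inL θ hθ).1, fun θ hθ => (inR θ hθ).1, outerL, outerR, ?_, ?_,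
    inner, ?_⟩, fun θ hθ => (inL θ hθ).2, hx'.2, ?_, ?_⟩
  · intro q hq hzq
    obtain ⟨c, hc, e1, e2, e3⟩ := KR x (left_mem_hIco _ _)
    by_cases hrL : r.L x
    · exfalso
      have hKL : K.ActL r.φ₁ r.φ₂ x := by_contra fun h => hx ⟨hrL, h⟩
      have hxc := startK c hc e1 e2 e3 hKL
      refine not_end_of_keep hm hr ho hrL hx'.1 (noK c hc e1 e2 x (.inl hxc)) (fun q hq hzq hi => ?_)
        hq hzq
      rcases hzq with rfl | rfl
      · exact outerR q hq _ (left_mem_hIco _ _) q.R_left hi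
      · have h1 := cross q hq _ (.inl hrL) (.inl q.L_right) hi _ q.L_right
        have hr' : ¬ K.ActR r.φ₁ r.φ₂ q.θ₂ := hx'.2
        by_cases h2 : K.ActR q.φ₁ q.φ₂ q.θ₂
        · exact K.fits.thru r q _ (fun e => hr' (e.1 hKL)) h1 h2 hi
        · exact K.fits.both_end r q _ hKL hr' h1 h2 hi
    · have hxr := r.start_iff.1 ⟨hrL, hx'.1⟩
      refine ⟨hxr.symm, eq_or_swap_of_end hm hr ho (.inl hxr) ?_ hq hzq⟩
      by_cases hcL : c.L x
      · left
        have : s(r.φ₁, r.φ₂) ∈ movieOf P x := by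
          rw [hm, ← e1, ← e2, Sym2.eq_swap]; exact mem_movieOf.2 ⟨c, hc, hcL, rfl⟩
        rcases mem_movieOf_iff_act.1 this with h | ⟨c', hc', f1, f2, f3⟩
        · exact absurd h (hxr ▸ (isSpell hr).start)
        · exact ⟨c', hc', .inr (c'.end_iff.1 ⟨f3, fun hR =>
            (ActR.not_swap (actR hx'.1)) ⟨c', hc', f1, f2, hR⟩⟩), f1, f2⟩
      · exact .inr ⟨c, hc, .inl (c.start_iff.1 ⟨hcL, e3⟩), e1, e2⟩
  · intro q hq hzq
    obtain ⟨c, hc, e1, e2, e3⟩ := KL y (right_mem_hIoc _ _)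
    by_cases hrR : r.R y
    · exfalso
      have hKR : K.ActR r.φ₁ r.φ₂ y := by_contra fun h => hy' ⟨hrR, h⟩
      have hyc := finishK c hc e1 e2 e3 hKR
      refine not_end_of_keep hm hr ho hy.1 hrR (noK c hc e1 e2 y (.inr hyc)) (fun q hq hzq hi => ?_)
        hq hzq
      rcases hzq with rfl | rfl
      · have h1 := right_of_left (cross q hq _ (.inr hrR) (.inr q.R_left) hi) q.R_left
        have hr' : ¬ K.ActL r.φ₁ r.φ₂ q.θ₁ := hy.2
        by_cases h2 : K.ActL q.φ₁ q.φ₂ q.θ₁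
        · exact K.fits.thru r q _ (fun e => hr' (e.2 hKR)) h2 h1 hi
        · exact K.fits.both_start r q _ hKR hr' h1 h2 hi
      · exact outerL q hq _ (right_mem_hIoc _ _) q.L_right hi
    · have hyr := r.end_iff.1 ⟨hy.1, hrR⟩
      refine ⟨hyr.symm, eq_or_swap_of_end hm hr ho (.inr hyr) ?_ hq hzq⟩
      by_cases hcR : c.R y
      · left
        have : s(r.φ₁, r.φ₂) ∈ movieAfter P y := by
          rw [movieAfter_eq hm, ← e1, ← e2, Sym2.eq_swap]; exact mem_movieAfter.2 ⟨c, hc, hcR, rfl⟩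
        rcases mem_movieAfter_iff_act.1 this with h | ⟨c', hc', f1, f2, f3⟩
        · exact absurd h (hyr ▸ (isSpell hr).finish)
        · exact ⟨c', hc', .inl (c'.start_iff.1 ⟨fun hL =>
            (ActL.not_swap (actL hy.1)) ⟨c', hc', f1, f2, hL⟩, f3⟩), f1, f2⟩
      · exact .inr ⟨c, hc, .inr (c.end_iff.1 ⟨e3, hcR⟩), e1, e2⟩
  · by_cases hall : ∀ θ, s(r.φ₁, r.φ₂) ∈ movieOf P θ
    · obtain ⟨θ, h1, h2⟩ := hcom hall
      exact ⟨θ, fun h => (inL θ h).2 h2, h1.not_swap⟩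
    · push Not at hall
      obtain ⟨θ, hθ⟩ := hall
      exact ⟨θ, fun h => hθ (mem_movieOf_iff_act.2 (.inl (actL (inL θ h).1))),
        fun h => hθ (mem_movieOf_iff_act.2 (.inr h))⟩
  · by_cases hrL : r.L x
    · right
      have hKL : K.ActL r.φ₁ r.φ₂ x := by_contra fun h => hx ⟨hrL, h⟩
      obtain ⟨c, hc, e1, e2, e3⟩ := KR x (left_mem_hIco _ _)
      exact K.occupiedMeridian_iff.2 ⟨c, hc, .inl (startK c hc e1 e2 e3 hKL)⟩
    · exact .inl (P.occupiedMeridian_iff.2 ⟨r, hr, .inl (r.start_iff.1 ⟨hrL, hx'.1⟩)⟩)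
  · by_cases hrR : r.R y
    · right
      have hKR : K.ActR r.φ₁ r.φ₂ y := by_contra fun h => hy' ⟨hrR, h⟩
      obtain ⟨c, hc, e1, e2, e3⟩ := KL y (right_mem_hIoc _ _)
      exact K.occupiedMeridian_iff.2 ⟨c, hc, .inr (finishK c hc e1 e2 e3 hKR)⟩
    · exact .inl (P.occupiedMeridian_iff.2 ⟨r, hr, .inr (r.end_iff.1 ⟨hy.1, hrR⟩)⟩)

end Diagram

namespace Diagram
variable {P Q K : Diagram}

lemma reach_inter_aux (K : Diagram) (o : S1) (X : Set S1) (hX : X.Finite)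
    (hKX : ∀ θ, K.OccupiedMeridian θ → θ ∈ X) (n : ℕ) : ∀ P : Diagram, movieOf P = movieOf K →
    (∀ θ, P.OccupiedMeridian θ → θ ∈ X) →
    (∀ a b, o ∈ cIoo a b → (∀ θ, s(a, b) ∈ movieOf P θ) → ∃ θ, P.ActL a b θ ∧ K.ActL a b θ) →
    {p : S1 × S1 × S1 | p.1 ∈ X ∧ o ∈ cIoo p.2.1 p.2.2 ∧ P.ActR p.2.1 p.2.2 p.1 ∧
      ¬ K.ActR p.2.1 p.2.2 p.1}.ncard = n →
    ∃ P', P.Reach P' ∧ movieOf P' = movieOf P ∧ ∀ a b θ, o ∈ cIoo a b →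
      (P'.ActL a b θ ↔ P.ActL a b θ ∧ K.ActL a b θ) := by
  classical
  induction n using Nat.strong_induction_on with | _ n ih => ?_
  intro P hm hPX hcom hn
  by_cases hbad : ∃ r ∈ P.rects, o ∈ r.arcInt ∧ ∃ θ, r.L θ ∧ ¬ K.ActL r.φ₁ r.φ₂ θ
  swap
  · push Not at hbad
    refine ⟨P, Reach.refl P, rfl, fun a b θ ho => ⟨fun h => ⟨h, ?_⟩, fun h => h.1⟩⟩
    obtain ⟨r, hr, rfl, rfl, h1⟩ := h
    exact hbad r hr ho θ h1
  obtain ⟨r, hr, hrmin⟩ := (P.rects.filter fun r => o ∈ r.arcInt ∧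
    ∃ θ, r.L θ ∧ ¬ K.ActL r.φ₁ r.φ₂ θ).exists_min_image (fun r => ℓ r.θ₁ r.θ₂)
    (by obtain ⟨r, hr, h⟩ := hbad; exact ⟨r, Finset.mem_filter.2 ⟨hr, h⟩⟩)
  rw [Finset.mem_filter] at hr
  obtain ⟨hr, ho, hrb⟩ := hr
  obtain ⟨x, y, ht, h1, h2, h3, h4⟩ := exists_toggleable hm hr ho hrb (fun q hq hc θ hθ => by
    by_contra hK
    have h := hrmin q (Finset.mem_filter.2 ⟨hq, hc.2 (cIoo_subset_cIcc _ _ ho), θ, hθ, hK⟩)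
    have := arc_lt_of_subset q.hθ hc.1
    linarith) (hcom _ _ ho)
  have hxX : x ∈ X := h3.elim (hPX x) (hKX x)
  have hyX : y ∈ X := h4.elim (hPX y) (hKX y)
  obtain ⟨P₁, hm₁, hP₁⟩ := ht.exists_toggle
  have ho' : o ∉ cIoo r.φ₂ r.φ₁ := not_mem_cIoo_of_mem_cIoo ho
  have nsw : ∀ a b, o ∈ cIoo a b → ¬ (a = r.φ₂ ∧ b = r.φ₁) := fun a b h e => by
    rw [e.1, e.2] at h; exact ho' h
  have hlt : {p : S1 × S1 × S1 | p.1 ∈ X ∧ o ∈ cIoo p.2.1 p.2.2 ∧ P₁.ActR p.2.1 p.2.2 p.1 ∧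
      ¬ K.ActR p.2.1 p.2.2 p.1}.ncard < n := by
    rw [← hn]
    refine Set.ncard_lt_ncard ⟨?_, fun hs => ?_⟩ ?_
    · rintro ⟨z, a, b⟩ ⟨e1, e2, e3, e4⟩
      exact ⟨e1, e2, (((hP₁.right _ _ _).1 e3).resolve_right fun e => nsw a b e2 ⟨e.1, e.2.1⟩).1, e4⟩
    · have := @hs (x, r.φ₁, r.φ₂) ⟨hxX, ho, ⟨r, hr, rfl, rfl, ht.right x (left_mem_hIco _ _)⟩, h2⟩
      rcases (hP₁.right _ _ _).1 this.2.2.1 with e | e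
      · exact e.2 ⟨rfl, rfl, left_mem_hIco _ _⟩
      · exact r.hφ e.1
    · refine (hX.prod (P.rects.image fun r => (r.φ₁, r.φ₂)).finite_toSet).subset ?_
      rintro ⟨z, a, b⟩ ⟨e1, -, ⟨q, hq, rfl, rfl, -⟩, -⟩
      exact ⟨e1, Finset.mem_coe.2 (Finset.mem_image_of_mem _ hq)⟩
  have hPX₁ : ∀ θ, P₁.OccupiedMeridian θ → θ ∈ X := by
    intro θ hθ
    by_contra hX'
    refine absurd hθ ?_
    have hP : ¬ P.OccupiedMeridian θ := fun h => hX' (hPX θ h)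
    have nx : θ ≠ x := by rintro rfl; exact hX' hxX
    have ny : θ ≠ y := by rintro rfl; exact hX' hyX
    by_cases hI : θ ∈ cIoo x y
    · exact hP₁.not_occupied hI hP
    · exact hP₁.not_occupied_outside (fun h => h.elim hI ny) (fun h => h.elim nx hI) hP
  have hcom₁ : ∀ a b, o ∈ cIoo a b → (∀ θ, s(a, b) ∈ movieOf P₁ θ) →
      ∃ θ, P₁.ActL a b θ ∧ K.ActL a b θ := by
    intro a b hab hall
    obtain ⟨θ, e1, e2⟩ := hcom a b hab (hm₁ ▸ hall)
    exact ⟨θ, (hP₁.left _ _ _).2 (.inl ⟨e1, fun e => h1 θ e.2.2 (e.1 ▸ e.2.1 ▸ e2)⟩), e2⟩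
  obtain ⟨P', hr', hm', hact⟩ := ih _ hlt P₁ (hm₁.trans hm) hPX₁ hcom₁ rfl
  refine ⟨P', (ht.reach hP₁).trans hr', hm'.trans hm₁, fun a b θ h => ?_⟩
  rw [hact a b θ h, hP₁.left]
  constructor
  · rintro ⟨h5 | h5, h6⟩
    · exact ⟨h5.1, h6⟩
    · exact absurd ⟨h5.1, h5.2.1⟩ (nsw a b h)
  · rintro ⟨h5, h6⟩
    exact ⟨.inl ⟨h5, fun e => h1 θ e.2.2 (e.1 ▸ e.2.1 ▸ h6)⟩, h6⟩

lemma reach_inter (hm : movieOf P = movieOf K) {o : S1}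
    (hcom : ∀ a b, o ∈ cIoo a b → (∀ θ, s(a, b) ∈ movieOf P θ) →
      ∃ θ, P.ActL a b θ ∧ K.ActL a b θ) :
    ∃ P', P.Reach P' ∧ movieOf P' = movieOf P ∧ ∀ a b θ, o ∈ cIoo a b →
      (P'.ActL a b θ ↔ P.ActL a b θ ∧ K.ActL a b θ) :=
  reach_inter_aux K o ({θ | P.OccupiedMeridian θ} ∪ {θ | K.OccupiedMeridian θ})
    (P.finite_occupied.union K.finite_occupied) (fun _ h => .inr h) _ P hm (fun _ h => .inl h)
    hcom rfl

lemma eq_of_act (h : ∀ a b θ, P.ActL a b θ ↔ Q.ActL a b θ) : P = Q := by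
  have hR : ∀ a b θ, P.ActR a b θ ↔ Q.ActR a b θ := by
    intro a b θ
    obtain ⟨t, h1, h2⟩ := (((P.tame a b).right θ).and ((Q.tame a b).right θ)).exists
    rw [← h1.1, ← h2.1, h]
  have : P.rects = Q.rects := by
    ext r
    rw [mem_rects_iff, mem_rects_iff]
    constructor
    · rintro ⟨h1, h2, h3, h4⟩
      exact ⟨fun e => h1 ((h _ _ _).2 e), fun e => h2 ((hR _ _ _).2 e),
        fun θ hθ => (h _ _ _).1 (h3 θ hθ), fun θ hθ => (hR _ _ _).1 (h4 θ hθ)⟩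
    · rintro ⟨h1, h2, h3, h4⟩
      exact ⟨fun e => h1 ((h _ _ _).1 e), fun e => h2 ((hR _ _ _).1 e),
        fun θ hθ => (h _ _ _).2 (h3 θ hθ), fun θ hθ => (hR _ _ _).2 (h4 θ hθ)⟩
  cases P; cases Q
  simp only at this
  subst this
  rfl

lemma eq_of_act_base (hm : movieOf P = movieOf Q) {o : S1} (ho : ∀ θ, ∀ c ∈ movieOf P θ, o ∉ c)
    (h : ∀ a b θ, o ∈ cIoo a b → (P.ActL a b θ ↔ Q.ActL a b θ)) : P = Q := by
  have key : ∀ P Q : Diagram, movieOf P = movieOf Q → (∀ θ, ∀ c ∈ movieOf P θ, o ∉ c) →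
      (∀ a b θ, o ∈ cIoo a b → (P.ActL a b θ ↔ Q.ActL a b θ)) →
      ∀ a b θ, P.ActL a b θ → Q.ActL a b θ := by
    intro P Q hm ho h a b θ hP
    have hc : s(a, b) ∈ movieOf P θ := mem_movieOf_iff_act.2 (.inl hP)
    have n1 : o ≠ a := fun e => ho θ _ hc (by rw [e]; exact Sym2.mem_mk_left _ _)
    have n2 : o ≠ b := fun e => ho θ _ hc (by rw [e]; exact Sym2.mem_mk_right _ _)
    by_cases hab : o ∈ cIcc a b
    · exact (h a b θ (((mem_cIcc_iff_or hP.ne).1 hab).resolve_left n1 |>.resolve_left n2)).1 hP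
    · have hba := not_mem_cIcc_iff.1 hab
      rw [hm] at hc
      exact (mem_movieOf_iff_act.1 hc).resolve_right fun e => hP.not_swap ((h b a θ hba).2 e)
  exact eq_of_act fun a b θ => ⟨key P Q hm ho h a b θ,
    key Q P hm.symm (hm ▸ ho) (fun a b θ e => (h a b θ e).symm) a b θ⟩

lemma reach_of_common (hm : movieOf P = movieOf K) {o : S1} (ho : ∀ θ, ∀ c ∈ movieOf P θ, o ∉ c)
    (hcom : ∀ a b, o ∈ cIoo a b → (∀ θ, s(a, b) ∈ movieOf P θ) →
      ∃ θ, P.ActL a b θ ∧ K.ActL a b θ) : P.Reach K := by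
  obtain ⟨P', h1, h2, h3⟩ := reach_inter hm hcom
  obtain ⟨K', h4, h5, h6⟩ := reach_inter (P := K) (K := P) hm.symm (o := o) (fun a b h h' => by
    obtain ⟨θ, e1, e2⟩ := hcom a b h (hm ▸ h')
    exact ⟨θ, e2, e1⟩)
  have : P' = K' := eq_of_act_base (h2.trans (hm.trans h5.symm)) (h2 ▸ ho) fun a b θ h => by
    rw [h3 a b θ h, h6 a b θ h, and_comm]
  subst this
  exact h1.trans h4.symm

lemma movieLimits (P : Diagram) : ∃ Φ, MovieLimits (movieOf P) Φ :=
  (isMovieDiagram_movieOf P).exists_limits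

lemma reach_of_movieOf_eq (hm : movieOf P = movieOf Q) : P.Reach Q := by
  classical
  obtain ⟨Φ, h⟩ := P.movieLimits
  obtain ⟨o, ho⟩ := h.exists_base
  set I : Finset ((S1 × S1) × Bool) := (h.finite_arcs.toFinset.filter fun c =>
    (∀ θ, s(c.1, c.2) ∈ movieOf P θ) ∧ o ∈ cIoo c.1 c.2) ×ˢ Finset.univ with hI
  set D : Bool → Diagram := fun i => if i then P else Q with hD
  have hDm : ∀ i, movieOf (D i) = movieOf P := by rintro (i | i) <;> simp [hD, hm]
  obtain ⟨f, hf, hinj⟩ := exists_injOn_of_infinite I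
    (fun c => {θ : S1 | (D c.2).ActL c.1.1 c.1.2 θ ∧ movieOf P θ = Φ θ}) (by
      rintro ⟨⟨a, b⟩, i⟩ hi
      obtain ⟨-, hall, -⟩ := Finset.mem_filter.1 (Finset.mem_product.1 hi).1
      obtain ⟨θ, hθ⟩ := (D i).arcFamily.never b a
      have := hall θ
      rw [← hDm i] at this
      obtain ⟨r, hr, e1, e2, -⟩ := (mem_movieOf_iff_act.1 this).resolve_right hθ
      intro hfin
      refine (infinite_cIoo r.hθ) ((hfin.union h.finite_events).subset fun z hz => ?_)
      by_cases hz' : movieOf P z = Φ z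
      · exact .inl ⟨⟨r, hr, e1, e2, .inl hz⟩, hz'⟩
      · exact .inr hz')
  set Y := I.image fun c => (f c, c.1.1, c.1.2) with hY
  have h1 : ∀ y ∈ Y, movieOf P y.1 = Φ y.1 := by
    intro y hy
    obtain ⟨c, hc, rfl⟩ := Finset.mem_image.1 hy
    exact (hf c hc).2
  have h2 : ∀ y ∈ Y, ∀ y' ∈ Y, y.1 = y'.1 → y = y' := by
    intro y hy y' hy' e
    obtain ⟨c, hc, rfl⟩ := Finset.mem_image.1 hy
    obtain ⟨c', hc', rfl⟩ := Finset.mem_image.1 hy'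
    rw [hinj hc hc' e]
  have hmemI : ∀ a b i, (∀ θ, s(a, b) ∈ movieOf P θ) → o ∈ cIoo a b → ((a, b), i) ∈ I :=
    fun a b i hall hab => Finset.mem_product.2 ⟨Finset.mem_filter.2
      ⟨h.finite_arcs.mem_toFinset.2 ⟨0, hall 0⟩, hall, hab⟩, Finset.mem_univ _⟩
  obtain ⟨K, hK, hKY⟩ := h.exists_diagram (isPreconnected_ends P) ho Y h1 h2
    (fun a b hall hab => ⟨f ((a, b), true), Finset.mem_image.2 ⟨_, hmemI a b true hall hab, rfl⟩⟩)
  have key : ∀ i, (D i).Reach K := by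
    intro i
    refine reach_of_common ((hDm i).trans hK.symm) (o := o) (by rw [hDm i]; exact ho) fun a b hab hall => ?_
    rw [hDm i] at hall
    have hm := hmemI a b i hall hab
    exact ⟨f ((a, b), i), (hf _ hm).1, hKY (f ((a, b), i), a, b) (Finset.mem_image.2 ⟨_, hm, rfl⟩)
      (hall _) hab⟩
  exact (key true).trans (key false).symm

end Diagram

/-! ## Homogeneous maps and the three-sphere -/

/-- The two complex coordinates of a point of the sphere. -/
def pr (x : S3) : ℂ × ℂ := (x.1 0, x.1 1)

def nrm (v : ℂ × ℂ) : ℝ := √(‖v.1‖ ^ 2 + ‖v.2‖ ^ 2)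

lemma nrm_pos {v : ℂ × ℂ} (h : v ≠ 0) : 0 < nrm v := by
  refine Real.sqrt_pos.2 (lt_of_le_of_ne (by positivity) fun e => h ?_)
  have h1 : ‖v.1‖ = 0 := by nlinarith [sq_nonneg ‖v.1‖, sq_nonneg ‖v.2‖]
  have h2 : ‖v.2‖ = 0 := by nlinarith [sq_nonneg ‖v.1‖, sq_nonneg ‖v.2‖]
  exact Prod.ext (norm_eq_zero.1 h1) (norm_eq_zero.1 h2)

lemma pr_norm (x : S3) : ‖x.1 0‖ ^ 2 + ‖x.1 1‖ ^ 2 = 1 := by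
  have h := x.2
  rw [mem_sphere_zero_iff_norm, EuclideanSpace.norm_eq, Fin.sum_univ_two, Real.sqrt_eq_one] at h
  exact h

lemma nrm_pr (x : S3) : nrm (pr x) = 1 := by
  rw [nrm, pr, pr_norm, Real.sqrt_one]

lemma pr_ne_zero (x : S3) : pr x ≠ 0 := fun h => by
  have := nrm_pr x
  rw [h] at this
  simp [nrm] at this

lemma pr_injective : Function.Injective pr := fun x y h => by
  refine Subtype.ext (PiLp.ext fun i => ?_)
  fin_cases i
  · exact (Prod.ext_iff.1 h).1
  · exact (Prod.ext_iff.1 h).2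

lemma continuous_pr : Continuous pr := by unfold pr; fun_prop

lemma nrm_smul {t : ℝ} (ht : 0 ≤ t) (v : ℂ × ℂ) : nrm (t • v) = t * nrm v := by
  unfold nrm
  rw [Prod.smul_fst, Prod.smul_snd, norm_smul, norm_smul, Real.norm_of_nonneg ht,
    show (t * ‖v.1‖) ^ 2 + (t * ‖v.2‖) ^ 2 = t ^ 2 * (‖v.1‖ ^ 2 + ‖v.2‖ ^ 2) by ring,
    Real.sqrt_mul (sq_nonneg t), Real.sqrt_sq ht]

lemma continuous_nrm : Continuous nrm := by unfold nrm; fun_prop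

open Classical in
/-- The point of the sphere on the ray of a non-zero vector. -/
def proj (v : ℂ × ℂ) : S3 :=
  if h : v = 0 then ⟨EuclideanSpace.single 0 1, by simp⟩ else
    ⟨WithLp.toLp 2 ![(nrm v)⁻¹ • v.1, (nrm v)⁻¹ • v.2], by
      have h1 := nrm_smul (inv_nonneg.2 (nrm_pos h).le) v
      rw [inv_mul_cancel₀ (nrm_pos h).ne'] at h1
      rw [mem_sphere_zero_iff_norm, EuclideanSpace.norm_eq, Fin.sum_univ_two]
      exact h1⟩

lemma pr_proj {v : ℂ × ℂ} (h : v ≠ 0) : pr (proj v) = (nrm v)⁻¹ • v := by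
  rw [proj, dif_neg h]; rfl

lemma pr_proj_exists {v : ℂ × ℂ} (h : v ≠ 0) : ∃ t : ℝ, 0 < t ∧ pr (proj v) = t • v :=
  ⟨_, inv_pos.2 (nrm_pos h), pr_proj h⟩

lemma proj_pr (x : S3) : proj (pr x) = x :=
  pr_injective (by rw [pr_proj (pr_ne_zero x), nrm_pr, inv_one, one_smul])

lemma proj_smul {t : ℝ} (ht : 0 < t) (v : ℂ × ℂ) : proj (t • v) = proj v := by
  by_cases h : v = 0
  · rw [h, smul_zero]
  · have h' : t • v ≠ 0 := smul_ne_zero ht.ne' h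
    refine pr_injective ?_
    rw [pr_proj h, pr_proj h', nrm_smul ht.le, smul_smul, mul_inv, mul_right_comm,
      inv_mul_cancel₀ ht.ne', one_mul]

lemma eq_smul_of_proj_eq {v w : ℂ × ℂ} (hv : v ≠ 0) (hw : w ≠ 0) (h : proj v = proj w) :
    ∃ t : ℝ, 0 < t ∧ v = t • w := by
  have := congrArg pr h
  rw [pr_proj hv, pr_proj hw] at this
  refine ⟨nrm v * (nrm w)⁻¹, mul_pos (nrm_pos hv) (inv_pos.2 (nrm_pos hw)), ?_⟩
  rw [mul_smul, ← this, smul_smul, mul_inv_cancel₀ (nrm_pos hv).ne', one_smul]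

lemma continuousOn_proj : ContinuousOn proj {v | v ≠ 0} := by
  rw [Topology.IsInducing.subtypeVal.continuousOn_iff]
  have : ContinuousOn (fun v : ℂ × ℂ => (WithLp.toLp 2 ![(nrm v)⁻¹ • v.1, (nrm v)⁻¹ • v.2] :
      EuclideanSpace ℂ (Fin 2))) {v | v ≠ 0} := by
    refine (PiLp.continuous_toLp 2 _).comp_continuousOn (continuousOn_pi.2 fun i => ?_)
    have h1 : ContinuousOn (fun v : ℂ × ℂ => (nrm v)⁻¹) {v | v ≠ 0} :=
      continuous_nrm.continuousOn.inv₀ fun v hv => (nrm_pos hv).ne'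
    fin_cases i
    · exact h1.smul continuous_fst.continuousOn
    · exact h1.smul continuous_snd.continuousOn
  refine this.congr fun v hv => ?_
  simp only [Function.comp, proj, dif_neg hv]

lemma continuous_proj {α : Type*} [TopologicalSpace α] {f : α → ℂ × ℂ} (hf : Continuous f)
    (h : ∀ x, f x ≠ 0) : Continuous fun x => proj (f x) :=
  continuousOn_proj.comp_continuous hf h

lemma exists_radial {Λ : ℂ × ℂ → ℂ × ℂ} (hc : Continuous Λ) (hb : Function.Bijective Λ) (d : ℕ)
    (hd : d ≠ 0) (hh : ∀ t : ℝ, 0 < t → ∀ v, Λ (t • v) = t ^ d • Λ v) (h0 : Λ 0 = 0) :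
    ∃ h : S3 ≃ₜ S3, ∀ x, h x = proj (Λ (pr x)) := by
  have hne : ∀ v, v ≠ 0 → Λ v ≠ 0 := fun v hv e => hv (hb.1 (e.trans h0.symm))
  have hcont : Continuous fun x => proj (Λ (pr x)) :=
    continuous_proj (hc.comp continuous_pr) fun x => hne _ (pr_ne_zero x)
  have hbij : Function.Bijective fun x => proj (Λ (pr x)) := by
    constructor
    · intro x y e
      obtain ⟨s, hs, e'⟩ := eq_smul_of_proj_eq (hne _ (pr_ne_zero x)) (hne _ (pr_ne_zero y)) e
      have ht : (0 : ℝ) < s ^ ((d : ℝ)⁻¹) := Real.rpow_pos_of_pos hs _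
      rw [← Real.rpow_inv_natCast_pow hs.le hd, ← hh _ ht] at e'
      rw [← proj_pr x, hb.1 e', proj_smul ht, proj_pr]
    · intro y
      obtain ⟨v, hv⟩ := hb.2 (pr y)
      have hv0 : v ≠ 0 := by rintro rfl; exact pr_ne_zero y (hv.symm.trans h0)
      obtain ⟨t, ht, e⟩ := pr_proj_exists hv0
      refine ⟨proj v, ?_⟩
      simp only
      rw [e, hh t ht, proj_smul (pow_pos ht d), hv, proj_pr]
  exact ⟨Continuous.homeoOfEquivCompactToT2 (f := Equiv.ofBijective _ hbij) hcont, fun x => rfl⟩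

/-! ## Angles -/

lemma norm_expi (θ : S1) : ‖expi θ‖ = 1 := Circle.norm_coe _

lemma expi_injective : Function.Injective expi := fun _ _ h =>
  AddCircle.injective_toCircle one_ne_zero (Subtype.ext h)

lemma continuous_expi : Continuous expi := by
  unfold expi; exact continuous_subtype_val.comp AddCircle.continuous_toCircle

/-- The angle of a complex number. -/
def ang (w : ℂ) : S1 := ((w.arg / (2 * Real.pi) : ℝ) : S1)

lemma eq_norm_mul_expi (w : ℂ) : w = ‖w‖ * expi (ang w) := by
  have : expi (ang w) = Complex.exp (w.arg * Complex.I) := by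
    rw [expi, ang, AddCircle.toCircle_apply_mk, Circle.coe_exp]
    congr 2
    have := Real.pi_ne_zero
    push_cast
    field_simp
  rw [this, Complex.norm_mul_exp_arg_mul_I]

lemma expi_ang {w : ℂ} (h : w ≠ 0) : expi (ang w) = (‖w‖ : ℂ)⁻¹ * w := by
  conv_rhs => rw [eq_norm_mul_expi w]
  have : (‖w‖ : ℂ) ≠ 0 := by simpa using h
  rw [norm_mul, norm_expi, mul_one, Complex.norm_real, norm_norm, inv_mul_cancel_left₀ this]

lemma ang_mul_expi {t : ℝ} (ht : 0 < t) (θ : S1) : ang (t * expi θ) = θ := by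
  have h0 : (t : ℂ) * expi θ ≠ 0 := mul_ne_zero (by exact_mod_cast ht.ne') (by
    rw [← norm_pos_iff, norm_expi]; exact one_pos)
  refine expi_injective ?_
  rw [expi_ang h0, norm_mul, norm_expi, mul_one, Complex.norm_real, Real.norm_of_nonneg ht.le,
    inv_mul_cancel_left₀ (by exact_mod_cast ht.ne')]

lemma ang_smul {t : ℝ} (ht : 0 < t) {w : ℂ} (h : w ≠ 0) : ang (t • w) = ang w := by
  conv_lhs => rw [eq_norm_mul_expi w]
  rw [Complex.real_smul, ← mul_assoc, ← Complex.ofReal_mul, ang_mul_expi (by positivity)]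

lemma continuousOn_ang : ContinuousOn ang {w | w ≠ 0} := by
  have hi : Topology.IsInducing expi :=
    (continuous_expi.isClosedEmbedding expi_injective).isInducing
  rw [hi.continuousOn_iff]
  refine ContinuousOn.congr (f := fun w : ℂ => (‖w‖ : ℂ)⁻¹ * w) ?_ fun w hw => expi_ang hw
  refine ContinuousOn.mul (ContinuousOn.inv₀ (by fun_prop) ?_) continuousOn_id
  intro w hw
  simpa using hw

lemma mem_page {x : S3} {θ : S1} : x ∈ page θ ↔ x.1 1 = 0 ∨ ang (x.1 1) = θ := by
  change x.1 1 = (‖x.1 1‖ : ℂ) * expi θ ↔ _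
  constructor
  · intro h
    by_cases h0 : x.1 1 = 0
    · exact .inl h0
    · right
      rw [h, ang_mul_expi (norm_pos_iff.2 h0)]
  · rintro (h | rfl)
    · simp [h]
    · exact eq_norm_mul_expi _

/-! ## Radial homeomorphisms -/

/-- A homogeneous self-homeomorphism of `ℂ × ℂ`. -/
structure IsRad (Λ : ℂ × ℂ → ℂ × ℂ) : Prop where
  cont : Continuous Λ
  bij : Function.Bijective Λ
  hom : ∃ d : ℕ, d ≠ 0 ∧ ∀ t : ℝ, 0 < t → ∀ v, Λ (t • v) = t ^ d • Λ v

/-- A set invariant under multiplication by positive numbers. -/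
def IsCone {E : Type*} [SMul ℝ E] (S : Set E) : Prop := ∀ t : ℝ, 0 < t → ∀ v : E, v ∈ S → t • v ∈ S

lemma IsCone.smul_mem_iff {E : Type*} [AddCommGroup E] [Module ℝ E] {S : Set E} (hS : IsCone S)
    {t : ℝ} (ht : 0 < t) {v : E} : t • v ∈ S ↔ v ∈ S := by
  refine ⟨fun h => ?_, hS t ht v⟩
  have := hS t⁻¹ (inv_pos.2 ht) _ h
  rwa [smul_smul, inv_mul_cancel₀ ht.ne', one_smul] at this

namespace IsRad

lemma map_zero {Λ : ℂ × ℂ → ℂ × ℂ} (h : IsRad Λ) : Λ 0 = 0 := by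
  obtain ⟨d, hd, hh⟩ := h.hom
  have h1 := hh 2 two_pos 0
  rw [smul_zero] at h1
  have h2 : ((2 : ℝ) ^ d - 1) • Λ 0 = 0 := by rw [sub_smul, one_smul, ← h1, sub_self]
  refine (smul_eq_zero.1 h2).resolve_left ?_
  have : (1 : ℝ) < 2 ^ d := one_lt_pow₀ (by norm_num) hd
  linarith

lemma map_ne_zero {Λ : ℂ × ℂ → ℂ × ℂ} (h : IsRad Λ) {v : ℂ × ℂ} (hv : v ≠ 0) : Λ v ≠ 0 :=
  fun e => hv (h.bij.1 (e.trans h.map_zero.symm))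

lemma comp {Λ M : ℂ × ℂ → ℂ × ℂ} (h : IsRad Λ) (h' : IsRad M) : IsRad (M ∘ Λ) := by
  obtain ⟨d, hd, hh⟩ := h.hom
  obtain ⟨d', hd', hh'⟩ := h'.hom
  refine ⟨h'.cont.comp h.cont, h'.bij.comp h.bij, d * d', mul_ne_zero hd hd', fun t ht v => ?_⟩
  simp only [Function.comp]
  rw [hh t ht, hh' _ (pow_pos ht d), pow_mul]

/-- The homeomorphism of the sphere induced by a radial homeomorphism. -/
def homeo {Λ : ℂ × ℂ → ℂ × ℂ} (h : IsRad Λ) : S3 ≃ₜ S3 :=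
  (exists_radial h.cont h.bij h.hom.choose h.hom.choose_spec.1 h.hom.choose_spec.2 h.map_zero).choose

lemma homeo_apply {Λ : ℂ × ℂ → ℂ × ℂ} (h : IsRad Λ) (x : S3) : h.homeo x = proj (Λ (pr x)) :=
  (exists_radial h.cont h.bij h.hom.choose h.hom.choose_spec.1 h.hom.choose_spec.2
    h.map_zero).choose_spec x

lemma pr_homeo {Λ : ℂ × ℂ → ℂ × ℂ} (h : IsRad Λ) (x : S3) :
    ∃ t : ℝ, 0 < t ∧ pr (h.homeo x) = t • Λ (pr x) := by
  rw [h.homeo_apply]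
  exact pr_proj_exists (h.map_ne_zero (pr_ne_zero x))

end IsRad

/-! ## Fiberwise maps -/

/-- The map of `ℂ × ℂ` that changes the real part of the first coordinate only. -/
def fib (F : ℝ → ℝ × ℂ → ℝ) (v : ℂ × ℂ) : ℂ × ℂ := (⟨F v.1.re (v.1.im, v.2), v.1.im⟩, v.2)

lemma isRad_fib {F : ℝ → ℝ × ℂ → ℝ} (hc : Continuous (Function.uncurry F))
    (hm : ∀ s, StrictMono fun y => F y s) (hb : ∀ s, ∃ M, ∀ y, |F y s - y| ≤ M)
    (hh : ∀ t : ℝ, 0 < t → ∀ y s, F (t * y) (t • s) = t * F y s) : IsRad (fib F) := by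
  refine ⟨?_, ⟨fun v w e => ?_, fun v => ?_⟩, 1, one_ne_zero, fun t ht v => ?_⟩
  · have h1 : Continuous fun v : ℂ × ℂ => F v.1.re (v.1.im, v.2) :=
      hc.comp (f := fun v : ℂ × ℂ => (v.1.re, (v.1.im, v.2))) (by fun_prop)
    have h2 : Continuous fun v : ℂ × ℂ => ((F v.1.re (v.1.im, v.2) : ℂ) + v.1.im * Complex.I, v.2) := by
      fun_prop
    refine h2.congr fun v => ?_
    rw [fib, Complex.mk_eq_add_mul_I]
  · obtain ⟨⟨y, i⟩, b⟩ := v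
    obtain ⟨⟨y', i'⟩, b'⟩ := w
    simp only [fib, Prod.mk.injEq, Complex.mk.injEq] at e
    obtain ⟨⟨e1, rfl⟩, rfl⟩ := e
    rw [(hm (i, b)).injective e1]
  · obtain ⟨⟨y, i⟩, b⟩ := v
    obtain ⟨M, hM⟩ := hb (i, b)
    have hcs : Continuous fun y => F y (i, b) :=
      hc.comp (f := fun y : ℝ => (y, (i, b))) (by fun_prop)
    have h1 : Tendsto (fun y => F y (i, b)) atTop atTop :=
      tendsto_atTop_mono (f := fun y => y + -M) (fun y => by have := abs_le.1 (hM y); linarith)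
        (tendsto_atTop_add_const_right _ _ tendsto_id)
    have h2 : Tendsto (fun y => F y (i, b)) atBot atBot :=
      tendsto_atBot_mono (f := fun y => y + M) (fun y => by have := abs_le.1 (hM y); linarith)
        (tendsto_atBot_add_const_right _ _ tendsto_id)
    obtain ⟨x, hx⟩ := hcs.surjective h1 h2 y
    refine ⟨(⟨x, i⟩, b), ?_⟩
    simp only [fib]
    rw [show F x (i, b) = y from hx]
  · have := hh t ht v.1.re (v.1.im, v.2)
    rw [Prod.smul_mk, smul_eq_mul, Complex.real_smul] at this
    refine Prod.ext (Complex.ext ?_ ?_) ?_ <;> simp [fib, this]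

/-- A positively homogeneous function. -/
def IsHom {E : Type*} [SMul ℝ E] (f : E → ℝ) : Prop := ∀ t : ℝ, 0 < t → ∀ v : E, f (t • v) = t * f v

lemma isRad_shear {f : ℝ × ℂ → ℝ} (hc : Continuous f) (hf : IsHom f) :
    IsRad (fib fun y s => y + f s) := by
  refine isRad_fib ?_ (fun s a b h => by simpa using h) (fun s => ⟨|f s|, fun y => by simp⟩)
    fun t ht y s => by rw [hf t ht]; ring
  exact continuous_fst.add (hc.comp continuous_snd)

/-- The map of the line that is identical outside the interval from `p` to `r` and takes `q` to
`q'`. -/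
def push (p q q' r y : ℝ) : ℝ := y - (q - q') * max 0 (min ((y - p) / (q - p)) ((r - y) / (r - q)))

/-- The condition under which `push` is a homeomorphism. -/
def PushOK (p q q' r : ℝ) : Prop := q = q' ∨ (p < q ∧ p < q' ∧ q < r ∧ q' < r)

lemma push_of_le {p q q' r y : ℝ} (h : PushOK p q q' r) (hy : y ≤ p) : push p q q' r y = y := by
  obtain rfl | ⟨h1, -, -, -⟩ := h
  · simp [push]
  · have : (y - p) / (q - p) ≤ 0 := div_nonpos_of_nonpos_of_nonneg (by linarith) (by linarith)
    rw [push, max_eq_left ((min_le_left _ _).trans this), mul_zero, sub_zero]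

lemma push_of_ge {p q q' r y : ℝ} (h : PushOK p q q' r) (hy : r ≤ y) : push p q q' r y = y := by
  obtain rfl | ⟨-, -, h1, -⟩ := h
  · simp [push]
  · have : (r - y) / (r - q) ≤ 0 := div_nonpos_of_nonpos_of_nonneg (by linarith) (by linarith)
    rw [push, max_eq_left ((min_le_right _ _).trans this), mul_zero, sub_zero]

lemma push_self {p q q' r : ℝ} (h : PushOK p q q' r) : push p q q' r q = q' := by
  obtain rfl | ⟨h1, -, h2, -⟩ := h
  · simp [push]
  · rw [push, div_self (by linarith), div_self (by linarith)]; norm_num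

lemma push_displacement {p q q' r : ℝ} (h : PushOK p q q' r) (y : ℝ) :
    |push p q q' r y - y| ≤ |q - q'| := by
  obtain rfl | ⟨h1, -, h2, -⟩ := h
  · simp [push]
  · have : max 0 (min ((y - p) / (q - p)) ((r - y) / (r - q))) ≤ 1 := by
      refine max_le zero_le_one ?_
      rcases le_total y q with hy | hy
      · exact (min_le_left _ _).trans ((div_le_one (by linarith)).2 (by linarith))
      · exact (min_le_right _ _).trans ((div_le_one (by linarith)).2 (by linarith))
    rw [push, sub_sub_cancel_left, abs_neg, abs_mul, abs_of_nonneg (a := max _ _) (le_max_left _ _)]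
    exact mul_le_of_le_one_right (abs_nonneg _) this

lemma push_strictMono {p q q' r : ℝ} (h : PushOK p q q' r) : StrictMono (push p q q' r) := by
  intro y z hyz
  obtain rfl | ⟨h1, h2, h3, h4⟩ := h
  · simpa [push] using hyz
  have e1 : (z - p) / (q - p) = (y - p) / (q - p) + (z - y) / (q - p) := by rw [← add_div]; ring
  have e2 : (r - y) / (r - q) = (r - z) / (r - q) + (z - y) / (r - q) := by rw [← add_div]; ring
  have d1 : 0 < (z - y) / (q - p) := div_pos (by linarith) (by linarith)
  have d2 : 0 < (z - y) / (r - q) := div_pos (by linarith) (by linarith)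
  unfold push
  rw [e1, e2]
  set A := (y - p) / (q - p)
  set B := (r - z) / (r - q)
  have b1 : max 0 (min (A + (z - y) / (q - p)) B) ≤
      max 0 (min A (B + (z - y) / (r - q))) + (z - y) / (q - p) := by grind
  have b2 : max 0 (min A (B + (z - y) / (r - q))) ≤
      max 0 (min (A + (z - y) / (q - p)) B) + (z - y) / (r - q) := by grind
  have c1 : (q - p) * ((z - y) / (q - p)) = z - y := by field_simp [(by linarith : q - p ≠ 0)]
  have c2 : (r - q) * ((z - y) / (r - q)) = z - y := by field_simp [(by linarith : r - q ≠ 0)]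
  rcases le_total q' q with hq | hq
  · have := mul_le_mul_of_nonneg_left b1 (sub_nonneg.2 hq)
    have := mul_lt_mul_of_pos_right (show q - q' < q - p by linarith) d1
    linarith
  · have := mul_le_mul_of_nonneg_left b2 (sub_nonneg.2 hq)
    have := mul_lt_mul_of_pos_right (show q' - q < r - q by linarith) d2
    linarith

lemma push_smul {t : ℝ} (ht : 0 < t) (p q q' r y : ℝ) :
    push (t * p) (t * q) (t * q') (t * r) (t * y) = t * push p q q' r y := by
  unfold push
  simp only [← mul_sub, mul_div_mul_left _ _ ht.ne']
  ring

lemma isRad_push {p q q' r : ℝ × ℂ → ℝ} (hp : Continuous p) (hq : Continuous q)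
    (hq' : Continuous q') (hr : Continuous r) (jp : IsHom p) (jq : IsHom q) (jq' : IsHom q')
    (jr : IsHom r) (h : ∀ s, PushOK (p s) (q s) (q' s) (r s)) :
    IsRad (fib fun y s => push (p s) (q s) (q' s) (r s) y) := by
  refine isRad_fib ?_ (fun s => push_strictMono (h s)) (fun s => ⟨_, push_displacement (h s)⟩)
    fun t ht y s => by rw [jp t ht, jq t ht, jq' t ht, jr t ht, push_smul ht]
  refine continuous_iff_continuousAt.2 fun ⟨y, s⟩ => ?_
  by_cases e : q s = q' s
  · have h1 : Tendsto (fun v : ℝ × (ℝ × ℂ) => |q v.2 - q' v.2|) (𝓝 (y, s)) (𝓝 0) := by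
      have : Continuous fun v : ℝ × (ℝ × ℂ) => |q v.2 - q' v.2| := by fun_prop
      have := this.tendsto (y, s)
      rwa [e, sub_self, abs_zero] at this
    have h2 := squeeze_zero_norm (f := fun v : ℝ × (ℝ × ℂ) =>
      push (p v.2) (q v.2) (q' v.2) (r v.2) v.1 - v.1) (fun v => push_displacement (h v.2) v.1) h1
    have h3 := h2.add (continuous_fst.tendsto (y, s))
    simp only [sub_add_cancel, zero_add] at h3
    have e2 : Function.uncurry (fun (y : ℝ) (s : ℝ × ℂ) => push (p s) (q s) (q' s) (r s) y) (y, s) = y := by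
      simp [push, e]
    rw [ContinuousAt, e2]
    exact h3
  · obtain ⟨h1, -, h2, -⟩ := (h s).resolve_left e
    simp only [Function.uncurry_def, push]
    have c1 : ContinuousAt (fun v : ℝ × (ℝ × ℂ) => (v.1 - p v.2) / (q v.2 - p v.2)) (y, s) :=
      ContinuousAt.div (by fun_prop) (by fun_prop) (by simp only; linarith)
    have c2 : ContinuousAt (fun v : ℝ × (ℝ × ℂ) => (r v.2 - v.1) / (r v.2 - q v.2)) (y, s) :=
      ContinuousAt.div (by fun_prop) (by fun_prop) (by simp only; linarith)
    exact continuousAt_fst.sub ((by fun_prop : ContinuousAt (fun v : ℝ × (ℝ × ℂ) => q v.2 - q' v.2)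
      (y, s)).mul (continuousAt_const.max (c1.min c2)))

/-! ## Signed bumps -/

lemma continuous_comp_arc {f : ℝ → ℝ} (hf : f 0 = f 1) (hc : Continuous f) (a : S1) :
    Continuous fun θ => f (ℓ a θ) := by
  have h := (AddCircle.liftIco_zero_continuous (p := (1 : ℝ)) hf hc.continuousOn).comp
    (continuous_id.sub (continuous_const (y := a)))
  refine h.congr fun θ => ?_
  change AddCircle.liftIco (1 : ℝ) 0 f (θ - a) = _
  rw [← coe_arc, AddCircle.liftIco_zero_coe_apply]
  exact ⟨arc_nonneg _ _, arc_lt_one _ _⟩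

/-- The function equal to `bump a b` on `[a;b]` and to `-bump b a` on `[b;a]`. -/
def sb (a b θ : S1) : ℝ :=
  if ℓ a θ ≤ ℓ a b then
    ℓ a θ * (ℓ a b - ℓ a θ) / ℓ a b
  else -((ℓ a θ - ℓ a b) * (1 - ℓ a θ) / (1 - ℓ a b))

/-- A function that decreases from `1` to `-1` on `[a;b]` and increases from `-1` to `1` on
`[b;a]`. -/
def gm (a b θ : S1) : ℝ :=
  if ℓ a θ ≤ ℓ a b then 1 - 2 * (ℓ a θ / ℓ a b)
  else 2 * ((ℓ a θ - ℓ a b) / (1 - ℓ a b)) - 1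

lemma continuous_sb (a b : S1) : Continuous (sb a b) := by
  have h1 := arc_lt_one a b
  have h0 := arc_nonneg a b
  refine continuous_comp_arc (f := fun u => if u ≤ ℓ a b then
    u * (ℓ a b - u) / ℓ a b else
    -((u - ℓ a b) * (1 - u) / (1 - ℓ a b))) ?_ ?_ a
  · simp only [if_pos h0, if_neg h1.not_ge]; simp
  · refine Continuous.if_le (by fun_prop) (by fun_prop) continuous_id continuous_const fun u hu => ?_
    simp [hu]

lemma continuous_gm {a b : S1} (hab : a ≠ b) : Continuous (gm a b) := by
  have h1 := arc_lt_one a b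
  have h0 := arc_pos.2 hab.symm
  refine continuous_comp_arc (f := fun u => if u ≤ ℓ a b then
    1 - 2 * (u / ℓ a b) else 2 * ((u - ℓ a b) / (1 - ℓ a b)) - 1) ?_ ?_ a
  · simp only [if_pos h0.le, if_neg h1.not_ge]
    rw [div_self (by linarith)]; norm_num
  · refine Continuous.if_le (by fun_prop) (by fun_prop) continuous_id continuous_const fun u hu => ?_
    rw [hu, div_self h0.ne']; norm_num

lemma sb_nonneg_iff {a b : S1} (hab : a ≠ b) {θ : S1} : 0 ≤ sb a b θ ↔ θ ∈ cIcc a b := by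
  have h1 := arc_lt_one a b
  have h0 := arc_pos.2 hab.symm
  have h2 := arc_nonneg a θ
  have h3 := arc_lt_one a θ
  rw [mem_cIcc_iff hab, sb]
  split_ifs with h
  · exact iff_of_true (div_nonneg (mul_nonneg h2 (by linarith)) h0.le) h
  · refine iff_of_false (not_le.2 (neg_neg_of_pos ?_)) h
    exact div_pos (mul_pos (by linarith) (by linarith)) (by linarith)

lemma sb_pos_iff {a b : S1} (hab : a ≠ b) {θ : S1} : 0 < sb a b θ ↔ θ ∈ cIoo a b := by
  have h1 := arc_lt_one a b
  have h0 := arc_pos.2 hab.symm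
  have h2 := arc_nonneg a θ
  have h3 := arc_lt_one a θ
  rw [mem_cIoo_iff, sb]
  split_ifs with h
  · rw [div_pos_iff_of_pos_right h0]
    constructor
    · intro h'
      exact ⟨pos_of_mul_pos_left h' (by linarith), by nlinarith⟩
    · rintro ⟨h4, h5⟩
      exact mul_pos h4 (by linarith)
  · refine iff_of_false (not_lt.2 (neg_nonpos.2 ?_)) fun h' => h h'.2.le
    exact (div_pos (mul_pos (by linarith) (by linarith)) (by linarith)).le

lemma sb_eq_bump {a b θ : S1} (hab : a ≠ b) (h : θ ∈ cIcc a b) : sb a b θ = bump a b θ := by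
  rw [mem_cIcc_iff hab] at h
  rw [sb, if_pos h, bump, arc_eq_ite a θ b, if_pos h]

lemma sb_swap {a b : S1} (hab : a ≠ b) (θ : S1) : sb b a θ = -sb a b θ := by
  have h1 := arc_lt_one a b
  have h0 := arc_pos.2 hab.symm
  have h2 := arc_nonneg a θ
  have h3 := arc_lt_one a θ
  have e1 : ℓ b a = 1 - ℓ a b := by
    rw [arc_eq_ite a b a, arc_self, if_neg (by linarith)]; ring
  have e2 := arc_eq_ite a b θ
  rw [sb, sb, e1, e2]
  have k1 : ℓ a b ≠ 0 := h0.ne'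
  have k2 : 1 - ℓ a b ≠ 0 := by linarith
  rcases lt_trichotomy (ℓ a θ) (ℓ a b) with c | c | c
  · rw [if_neg c.not_ge, if_pos c.le]
    split_ifs with c'
    · have : ℓ a θ = 0 := by linarith
      rw [this, show 0 - ℓ a b + 1 = 1 - ℓ a b by ring]; simp
    · rw [show 1 - (1 - ℓ a b) = ℓ a b by ring]; congr 2; ring
  · simp [c, h1.le]
  · rw [if_pos c.le, if_neg c.not_ge, if_pos (by linarith), neg_neg]; congr 1; ring

lemma sb_lt_of_subset {a b c d θ : S1} (hab : a ≠ b) (hcd : c ≠ d)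
    (h : cIcc a b ⊆ cIoo c d) (hθ : θ ∈ cIcc a b) : sb a b θ < sb c d θ := by
  have hθ' := cIoo_subset_cIcc _ _ (h hθ)
  have i0 : c ∉ cIcc a b := fun hc => left_not_mem_cIoo c d (h hc)
  have i1 := mem_cIoo_iff.1 (h (left_mem_cIcc a b))
  have i2 := mem_cIoo_iff.1 (h (right_mem_cIcc a b))
  have i3 := (mem_cIcc_iff' c hab).1 hθ
  rw [mem_cIcc_iff' c hab, arc_self] at i0
  have hab' : ℓ c a ≠ ℓ c b := fun e => hab (arc_inj.1 e)
  have h0 : ℓ c a < ℓ c b ∧ ℓ c a ≤ ℓ c θ ∧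
      ℓ c θ ≤ ℓ c b := by grind
  obtain ⟨k1, k2, k3⟩ := h0
  rw [sb_eq_bump hab hθ, sb_eq_bump hcd hθ', bump, bump, arc_eq_ite c a θ, if_pos k2,
    arc_eq_ite c θ b, if_pos k3, arc_eq_ite c a b, if_pos k1.le, arc_eq_ite c θ d,
    if_pos (by linarith), div_lt_div_iff₀ (by linarith) (by linarith)]
  set p := ℓ c a
  set q := ℓ c b
  set u := ℓ c θ
  set D := ℓ c d
  obtain ⟨i1, -⟩ := i1
  obtain ⟨-, i2⟩ := i2
  have e : u * (D - u) * (q - p) - (u - p) * (q - u) * D =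
    p * (D - q) * (q - p) + p * (q - u) ^ 2 + (D - q) * (u - p) ^ 2 := by ring
  have : 0 < p * (D - q) * (q - p) := mul_pos (mul_pos i1 (by linarith)) (by linarith)
  have : 0 ≤ p * (q - u) ^ 2 := mul_nonneg i1.le (sq_nonneg _)
  have : 0 ≤ (D - q) * (u - p) ^ 2 := mul_nonneg (by linarith) (sq_nonneg _)
  linarith

/-- The extension of a function on the circle to a homogeneous function on the plane. -/
def rad (f : S1 → ℝ) (w : ℂ) : ℝ := ‖w‖ * f (ang w)

lemma isHom_rad (f : S1 → ℝ) : IsHom (rad f) := fun t ht w => by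
  by_cases hw : w = 0
  · simp [rad, hw]
  · rw [rad, rad, ang_smul ht hw, norm_smul, Real.norm_of_nonneg ht.le, mul_assoc]

lemma continuous_rad {f : S1 → ℝ} (hf : Continuous f) : Continuous (rad f) := by
  refine continuous_iff_continuousAt.2 fun w => ?_
  by_cases hw : w = 0
  · subst hw
    obtain ⟨M, hM⟩ := isCompact_univ.exists_bound_of_continuousOn (f := f) hf.continuousOn
    have h1 : Tendsto (fun v : ℂ => ‖v‖ * M) (𝓝 0) (𝓝 0) := by
      have : Continuous fun v : ℂ => ‖v‖ * M := by fun_prop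
      simpa using this.tendsto 0
    have h2 := squeeze_zero_norm (f := rad f) (fun v => by
      rw [rad, norm_mul, norm_norm]
      exact mul_le_mul_of_nonneg_left (hM _ trivial) (norm_nonneg v)) h1
    rw [ContinuousAt, rad, norm_zero, zero_mul]
    exact h2
  · exact continuousAt_id.norm.mul (hf.continuousAt.comp
      (continuousOn_ang.continuousAt (isOpen_ne.mem_nhds hw)))

/-! ## Straightening of the plane -/

/-- The homogeneous map of the plane whose real part is positive exactly on the sector over
`(a;b)`. -/
def straight (a b : S1) (w : ℂ) : ℂ := ⟨rad (sb a b) w, rad (gm a b) w⟩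

lemma quad_unique {L y x t t' s s' : ℝ} (hL : 0 < L) (ht : 0 < t) (ht' : 0 < t')
    (e1 : y = t * (L * (s * (1 - s)))) (e2 : x = t * (1 - 2 * s))
    (e1' : y = t' * (L * (s' * (1 - s')))) (e2' : x = t' * (1 - 2 * s')) : t = t' ∧ s = s' := by
  have k : t = t' := by
    have h1 : L * (t * t - x * x) = 4 * y * t := by subst e2; rw [e1]; ring
    have h2 : L * (t' * t' - x * x) = 4 * y * t' := by rw [e2', e1']; ring
    by_contra hne
    have h3 : L * (t + t') = 4 * y := by
      have : (t - t') * (L * (t + t') - 4 * y) = 0 := by linear_combination h1 - h2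
      linarith [(mul_eq_zero.1 this).resolve_left (sub_ne_zero.2 hne)]
    have h4 : L * (t * t' + x * x) = 0 := by linear_combination t * h3 - h1
    nlinarith [mul_pos ht ht', sq_nonneg x, mul_pos hL (mul_pos ht ht'), mul_nonneg hL.le (mul_self_nonneg x)]
  refine ⟨k, ?_⟩
  rw [← k, e2] at e2'
  have := mul_left_cancel₀ ht.ne' e2'
  linarith

lemma quad_exists {L y x : ℝ} (hL : 0 < L) (hy : 0 ≤ y) (h : y ≠ 0 ∨ x ≠ 0) : ∃ t s : ℝ,
    0 < t ∧ 0 ≤ s ∧ s ≤ 1 ∧ y = t * (L * (s * (1 - s))) ∧ x = t * (1 - 2 * s) := by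
  set m := 2 * y / L with hm
  have hm0 : 0 ≤ m := by positivity
  set R := √(m ^ 2 + x ^ 2) with hR
  have hR2 : R ^ 2 = m ^ 2 + x ^ 2 := Real.sq_sqrt (by positivity)
  have hx : |x| ≤ R := Real.abs_le_sqrt (by nlinarith [sq_nonneg m])
  have ht : 0 < m + R := by
    rcases h with h | h
    · have : 0 < m := by rw [hm]; have := lt_of_le_of_ne hy h.symm; positivity
      have := abs_nonneg x; linarith
    · have := abs_pos.2 h; linarith
  have hx' : |x / (m + R)| ≤ 1 := by
    rw [abs_div, abs_of_pos ht]; exact (div_le_one ht).2 (by linarith)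
  obtain ⟨b1, b2⟩ := abs_le.1 hx'
  have e : m + R ≠ 0 := ht.ne'
  refine ⟨m + R, (1 - x / (m + R)) / 2, ht, by linarith, by linarith, ?_, by field_simp; ring⟩
  have : y = L * m / 2 := by rw [hm]; field_simp
  rw [this]
  field_simp
  linear_combination -hR2

lemma isHom_straight (a b : S1) {t : ℝ} (ht : 0 < t) (w : ℂ) :
    straight a b (t • w) = t • straight a b w := by
  refine Complex.ext ?_ ?_
  · simp [straight, ← isHom_rad (sb a b) t ht]
  · simp [straight, ← isHom_rad (gm a b) t ht]

lemma continuous_straight {a b : S1} (hab : a ≠ b) : Continuous (straight a b) := by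
  have h1 := continuous_rad (continuous_sb a b)
  have h2 := continuous_rad (continuous_gm hab)
  have : Continuous fun w => (rad (sb a b) w : ℂ) + rad (gm a b) w * Complex.I := by fun_prop
  exact this.congr fun w => (Complex.mk_eq_add_mul_I _ _).symm

lemma straight_zero (a b : S1) : straight a b 0 = 0 := by
  refine Complex.ext ?_ ?_ <;> simp [straight, rad]

lemma straight_cases {a b : S1} (hab : a ≠ b) {w : ℂ} (hw : w ≠ 0) : ∃ t s : ℝ, 0 < t ∧ t = ‖w‖ ∧
    ((0 ≤ (straight a b w).re ∧ ℓ a (ang w) = ℓ a b * s ∧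
      (straight a b w).re = t * (ℓ a b * (s * (1 - s))) ∧
      (straight a b w).im = t * (1 - 2 * s)) ∨
    ((straight a b w).re < 0 ∧ ℓ a (ang w) = ℓ a b + (1 - ℓ a b) * s ∧
      -(straight a b w).re = t * ((1 - ℓ a b) * (s * (1 - s))) ∧
      -(straight a b w).im = t * (1 - 2 * s))) := by
  have h1 := arc_lt_one a b
  have h0 := arc_pos.2 hab.symm
  have h2 := arc_nonneg a (ang w)
  have h3 := arc_lt_one a (ang w)
  have hn := norm_pos_iff.2 hw
  have k1 : ℓ a b ≠ 0 := h0.ne'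
  have k2 : 1 - ℓ a b ≠ 0 := by linarith
  by_cases c : ℓ a (ang w) ≤ ℓ a b
  · refine ⟨‖w‖, ℓ a (ang w) / ℓ a b, hn, rfl, .inl ⟨?_, ?_, ?_, ?_⟩⟩
    · exact mul_nonneg hn.le ((sb_nonneg_iff hab).2 ((mem_cIcc_iff hab).2 c))
    · field_simp
    · simp only [straight, rad, sb, if_pos c]; field_simp
    · simp only [straight, rad, gm, if_pos c]
  · refine ⟨‖w‖, (ℓ a (ang w) - ℓ a b) / (1 - ℓ a b), hn, rfl,
      .inr ⟨?_, ?_, ?_, ?_⟩⟩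
    · refine mul_neg_of_pos_of_neg hn (not_le.1 fun h => c ?_)
      exact (mem_cIcc_iff hab).1 ((sb_nonneg_iff hab).1 h)
    · field_simp; ring
    · simp only [straight, rad, sb, if_neg c]; field_simp; ring
    · simp only [straight, rad, gm, if_neg c]; ring

lemma eq_of_norm_arc {a : S1} {v w : ℂ} (h1 : ‖v‖ = ‖w‖)
    (h2 : ℓ a (ang v) = ℓ a (ang w)) : v = w := by
  rw [eq_norm_mul_expi v, eq_norm_mul_expi w, h1, arc_inj.1 h2]

lemma exists_straight {a : S1} {t u : ℝ} (ht : 0 < t) (h0 : 0 ≤ u) (h1 : u < 1) :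
    ∃ w : ℂ, ‖w‖ = t ∧ ℓ a (ang w) = u := by
  refine ⟨t * expi (a + (u : S1)), ?_, ?_⟩
  · rw [norm_mul, norm_expi, mul_one, Complex.norm_real, Real.norm_of_nonneg ht.le]
  · rw [ang_mul_expi ht, arc_add h0 h1]

lemma straight_ne_zero {a b : S1} (hab : a ≠ b) {w : ℂ} (hw : w ≠ 0) : straight a b w ≠ 0 := by
  intro e
  have h1 := arc_lt_one a b
  have h0 := arc_pos.2 hab.symm
  obtain ⟨t, s, ht, -, ⟨-, -, e1, e2⟩ | ⟨h, -⟩⟩ := straight_cases hab hw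
  · rw [e, Complex.zero_re] at e1
    rw [e, Complex.zero_im] at e2
    have e3 := (mul_eq_zero.1 e2.symm).resolve_left ht.ne'
    have e4 : s = 1 / 2 := by linarith
    rw [e4] at e1
    have : 0 < t * (ℓ a b * (1 / 2 * (1 - 1 / 2))) := by norm_num; positivity
    linarith
  · rw [e, Complex.zero_re] at h; exact h.false

lemma bijective_straight {a b : S1} (hab : a ≠ b) : Function.Bijective (straight a b) := by
  have h1 := arc_lt_one a b
  have h0 := arc_pos.2 hab.symm
  constructor
  · intro v w e
    by_cases hv : v = 0
    · by_contra hw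
      refine straight_ne_zero hab (w := w) (fun h => hw (hv.trans h.symm)) ?_
      rw [← e, hv, straight_zero]
    by_cases hw : w = 0
    · exact absurd (by rw [e, hw, straight_zero]) (straight_ne_zero hab hv)
    obtain ⟨t, s, ht, tv, hc⟩ := straight_cases hab hv
    obtain ⟨t', s', ht', tw, hc'⟩ := straight_cases hab hw
    rw [e] at hc
    rcases hc with ⟨p, u, e1, e2⟩ | ⟨p, u, e1, e2⟩ <;> rcases hc' with ⟨p', u', e1', e2'⟩ | ⟨p', u', e1', e2'⟩
    · obtain ⟨rfl, rfl⟩ := quad_unique h0 ht ht' e1 e2 e1' e2'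
      exact eq_of_norm_arc (tv.symm.trans tw) (u.trans u'.symm)
    · linarith
    · linarith
    · obtain ⟨rfl, rfl⟩ := quad_unique (sub_pos.2 h1) ht ht' e1 e2 e1' e2'
      exact eq_of_norm_arc (tv.symm.trans tw) (u.trans u'.symm)
  · intro c
    by_cases hc : c = 0
    · exact ⟨0, by rw [hc, straight_zero]⟩
    have hc' : c.re ≠ 0 ∨ c.im ≠ 0 := by
      by_contra! h
      exact hc (Complex.ext h.1 h.2)
    rcases le_or_gt 0 c.re with h | h
    · obtain ⟨t, s, ht, hs0, hs1, e1, e2⟩ := quad_exists h0 h hc'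
      have hu : ℓ a b * s ≤ ℓ a b := mul_le_of_le_one_right h0.le hs1
      obtain ⟨w, hw, hu'⟩ := exists_straight (a := a) ht (mul_nonneg h0.le hs0)
        (hu.trans_lt h1)
      refine ⟨w, Complex.ext ?_ ?_⟩
      · simp only [straight, rad, sb, hu', if_pos hu, hw, e1]; field_simp
      · simp only [straight, rad, gm, hu', if_pos hu, hw, e2]; field_simp
    · obtain ⟨t, s, ht, hs0, hs1, e1, e2⟩ := quad_exists (sub_pos.2 h1) (neg_nonneg.2 h.le)
        (x := -c.im) (by simpa using hc')
      have hs : 0 < s := by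
        refine lt_of_le_of_ne hs0 fun hs => ?_
        rw [← hs] at e1; linarith
      have hs' : s < 1 := by
        refine lt_of_le_of_ne hs1 fun hs => ?_
        rw [hs] at e1; linarith
      have k2 : 1 - ℓ a b ≠ 0 := by linarith
      obtain ⟨w, hw, hu'⟩ := exists_straight (a := a)
        (u := ℓ a b + (1 - ℓ a b) * s) ht (by nlinarith) (by nlinarith)
      have hu : ¬ ℓ a b + (1 - ℓ a b) * s ≤ ℓ a b := by
        have := mul_pos (sub_pos.2 h1) hs; linarith
      refine ⟨w, Complex.ext ?_ ?_⟩
      · simp only [straight, rad, sb, hu', if_neg hu, hw]; rw [← neg_neg c.re, e1]; field_simp; ring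
      · simp only [straight, rad, gm, hu', if_neg hu, hw]; rw [← neg_neg c.im, e2]; field_simp; ring

/-! ## Tiles in homogeneous coordinates -/

/-- The radial map after which the equations of tiles are homogeneous of degree one. -/
def sq (v : ℂ × ℂ) : ℂ × ℂ := (‖v.1‖ • v.1, ‖v.2‖ • v.2)

lemma bijective_norm_smul : Function.Bijective fun w : ℂ => ‖w‖ • w := by
  constructor
  · intro v w e
    simp only at e
    have h1 : ‖v‖ = ‖w‖ := by
      have := congrArg norm e
      rw [norm_smul, norm_smul, norm_norm, norm_norm] at this
      exact (mul_self_inj (norm_nonneg _) (norm_nonneg _)).1 this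
    by_cases hv : v = 0
    · rw [hv] at h1 ⊢
      exact (norm_eq_zero.1 (by rw [← h1, norm_zero])).symm
    · rw [h1] at e
      exact smul_right_injective ℂ (by rw [← h1]; exact norm_ne_zero_iff.2 hv) e
  · intro w
    by_cases hw : w = 0
    · exact ⟨0, by simp [hw]⟩
    · have h : 0 < √‖w‖ := Real.sqrt_pos.2 (norm_pos_iff.2 hw)
      refine ⟨(√‖w‖)⁻¹ • w, ?_⟩
      simp only
      rw [norm_smul, norm_inv, Real.norm_of_nonneg h.le, smul_smul]
      have : (√‖w‖)⁻¹ * ‖w‖ * (√‖w‖)⁻¹ = 1 := by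
        have := Real.mul_self_sqrt (norm_nonneg w)
        field_simp
        nlinarith
      rw [this, one_smul]

lemma isRad_sq : IsRad sq := by
  refine ⟨by unfold sq; fun_prop, bijective_norm_smul.prodMap bijective_norm_smul, 2, two_ne_zero,
    fun t ht v => ?_⟩
  have key : ∀ w : ℂ, ‖t • w‖ • t • w = t ^ 2 • ‖w‖ • w := fun w => by
    rw [norm_smul, Real.norm_of_nonneg ht.le, smul_smul, smul_smul]; ring_nf
  exact Prod.ext (key v.1) (key v.2)

lemma rad_norm_smul (f : S1 → ℝ) (w : ℂ) : rad f (‖w‖ • w) = ‖w‖ ^ 2 * f (ang w) := by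
  by_cases hw : w = 0
  · simp [rad, hw]
  · rw [isHom_rad f _ (norm_pos_iff.2 hw), rad]; ring

namespace Rect

/-- The defining function of the horizontal side. -/
def X (r : Rect) : ℂ → ℝ := rad (sb r.θ₁ r.θ₂)

/-- The defining function of the vertical side. -/
def Y (r : Rect) : ℂ → ℝ := rad (sb r.φ₁ r.φ₂)

/-- The cone over the tile. -/
def cone (r : Rect) : Set (ℂ × ℂ) := {v | 0 ≤ r.X v.2 ∧ r.Y v.1 = r.X v.2}

lemma isHom_X (r : Rect) : IsHom r.X := isHom_rad _
lemma continuous_X (r : Rect) : Continuous r.X := continuous_rad (continuous_sb _ _)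
lemma continuous_Y (r : Rect) : Continuous r.Y := continuous_rad (continuous_sb _ _)

lemma X_pos_iff (r : Rect) {w : ℂ} : 0 < r.X w ↔ w ≠ 0 ∧ ang w ∈ cIoo r.θ₁ r.θ₂ := by
  by_cases h : w = 0
  · simp [X, rad, h]
  · rw [X, rad, mul_pos_iff_of_pos_left (norm_pos_iff.2 h), sb_pos_iff r.hθ]; simp [h]

lemma isClosed_cone (r : Rect) : IsClosed r.cone :=
  (isClosed_le continuous_const (r.continuous_X.comp continuous_snd)).inter
    (isClosed_eq (r.continuous_Y.comp continuous_fst) (r.continuous_X.comp continuous_snd))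

lemma mem_tile_iff (r : Rect) (x : S3) : x ∈ tile r ↔ sq (pr x) ∈ r.cone := by
  change _ ↔ 0 ≤ rad _ (‖x.1 1‖ • x.1 1) ∧ rad _ (‖x.1 0‖ • x.1 0) = rad _ (‖x.1 1‖ • x.1 1)
  simp only [rad_norm_smul]
  constructor
  · rintro ⟨θ, hθ, φ, hφ, h1, h2, h3⟩
    have e1 : ‖x.1 1‖ ^ 2 * sb r.θ₁ r.θ₂ (ang (x.1 1)) = ‖x.1 1‖ ^ 2 * sb r.θ₁ r.θ₂ θ := by
      by_cases h : x.1 1 = 0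
      · simp [h]
      · rw [h1] at h ⊢
        rw [ang_mul_expi (norm_pos_iff.2 fun h' => h (by simp [h'])), ← h1]
    have e2 : ‖x.1 0‖ ^ 2 * sb r.φ₁ r.φ₂ (ang (x.1 0)) = ‖x.1 0‖ ^ 2 * sb r.φ₁ r.φ₂ φ := by
      by_cases h : x.1 0 = 0
      · simp [h]
      · rw [h2] at h ⊢
        rw [ang_mul_expi (norm_pos_iff.2 fun h' => h (by simp [h'])), ← h2]
    rw [e1, e2, sb_eq_bump r.hθ hθ, sb_eq_bump r.hφ hφ]
    refine ⟨mul_nonneg (sq_nonneg _) ?_, h3.symm⟩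
    rw [← sb_eq_bump r.hθ hθ]
    exact (sb_nonneg_iff r.hθ).2 hθ
  · rintro ⟨h1, h2⟩
    have key : ∀ (w : ℂ) {a b : S1}, a ≠ b → 0 ≤ ‖w‖ ^ 2 * sb a b (ang w) → ∃ θ ∈ cIcc a b,
        w = (‖w‖ : ℂ) * expi θ ∧ ‖w‖ ^ 2 * sb a b (ang w) = ‖w‖ ^ 2 * bump a b θ := by
      intro w a b hab h
      by_cases hw : w = 0
      · exact ⟨a, left_mem_cIcc _ _, by simp [hw], by simp [hw]⟩
      · have := (sb_nonneg_iff hab).1 (nonneg_of_mul_nonneg_right h (by positivity))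
        exact ⟨_, this, eq_norm_mul_expi w, by rw [sb_eq_bump hab this]⟩
    obtain ⟨θ, hθ, e1, e2⟩ := key _ r.hθ h1
    obtain ⟨φ, hφ, e3, e4⟩ := key _ r.hφ (h2 ▸ h1)
    exact ⟨θ, hθ, φ, hφ, e1, e3, by rw [← e2, ← e4, h2]⟩

end Rect

lemma isClosed_tile (r : Rect) : IsClosed (tile r) := by
  have : tile r = (fun x => sq (pr x)) ⁻¹' r.cone := Set.ext r.mem_tile_iff
  rw [this]
  exact r.isClosed_cone.preimage (isRad_sq.cont.comp continuous_pr)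

/-! ## Splitting a rectangle -/

/-- The positive part of the signed bump. -/
def pb (a b θ : S1) : ℝ := max 0 (sb a b θ)

lemma pb_of_mem {a b θ : S1} (hab : a ≠ b) (h : θ ∈ cIcc a b) : pb a b θ = sb a b θ :=
  max_eq_right ((sb_nonneg_iff hab).2 h)

lemma pb_of_not_mem {a b θ : S1} (h : θ ∉ cIoo a b) : pb a b θ = 0 := by
  refine max_eq_left ?_
  by_cases hab : a = b
  · subst hab
    have h1 := arc_nonneg a θ
    have h2 := arc_lt_one a θ
    rw [sb, arc_self, div_zero, sub_zero, sub_zero, div_one]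
    split_ifs
    · exact le_rfl
    · exact neg_nonpos.2 (mul_nonneg h1 (by linarith))
  · exact not_lt.1 fun h' => h ((sb_pos_iff hab).1 h')

/-- The function that describes the surface into which the tile of `[θ₁;θ₂] × [φ₁;φ₂]` turns. -/
def splitBump (r : Rect) (x y θ : S1) : ℝ := pb r.θ₁ x θ + pb y r.θ₂ θ - pb x y θ

lemma continuous_splitBump (r : Rect) (x y : S1) : Continuous (splitBump r x y) := by
  have := continuous_sb r.θ₁ x
  have := continuous_sb y r.θ₂
  have := continuous_sb x y
  unfold splitBump pb
  fun_prop

namespace IsSplit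

variable {P Q : Diagram} {r : Rect} {x y : S1}

lemma hxy (h : IsSplit P Q r x y) : x ≠ y := fun e => by
  have := h.lt; rw [e] at this; exact this.false

lemma order (h : IsSplit P Q r x y) : ℓ r.θ₁ r.θ₁ = 0 ∧ 0 ≤ ℓ r.θ₁ x ∧ ℓ r.θ₁ x < ℓ r.θ₁ y ∧
    ℓ r.θ₁ y ≤ ℓ r.θ₁ r.θ₂ := ⟨arc_self _, arc_nonneg _ _, h.lt, h.le⟩

lemma bump_mid (h : IsSplit P Q r x y) {θ : S1} (hθ : θ ∈ cIcc x y) :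
    θ ∈ cIcc r.θ₁ r.θ₂ ∧ splitBump r x y θ = -sb x y θ := by
  have := h.order
  rw [splitBump, pb_of_mem h.hxy hθ]
  rw [mem_cIcc_iff' r.θ₁ h.hxy] at hθ
  rw [pb_of_not_mem (a := r.θ₁), pb_of_not_mem (a := y), mem_cIcc_iff' r.θ₁ r.hθ]
  · exact ⟨by grind, by ring⟩
  all_goals rw [mem_cIoo_iff' r.θ₁]; grind

lemma bump_left (h : IsSplit P Q r x y) (hx : r.θ₁ ≠ x) {θ : S1} (hθ : θ ∈ cIcc r.θ₁ x) :
    θ ∈ cIcc r.θ₁ r.θ₂ ∧ splitBump r x y θ = sb r.θ₁ x θ := by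
  have := h.order
  rw [splitBump, pb_of_mem hx hθ]
  rw [mem_cIcc_iff' r.θ₁ hx] at hθ
  rw [pb_of_not_mem (a := x), pb_of_not_mem (a := y), mem_cIcc_iff' r.θ₁ r.hθ]
  · exact ⟨by grind, by ring⟩
  all_goals rw [mem_cIoo_iff' r.θ₁]; grind

lemma bump_right (h : IsSplit P Q r x y) (hy : y ≠ r.θ₂) {θ : S1} (hθ : θ ∈ cIcc y r.θ₂) :
    θ ∈ cIcc r.θ₁ r.θ₂ ∧ splitBump r x y θ = sb y r.θ₂ θ := by
  have := h.order
  rw [splitBump, pb_of_mem hy hθ]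
  rw [mem_cIcc_iff' r.θ₁ hy] at hθ
  rw [pb_of_not_mem (a := x), pb_of_not_mem (a := r.θ₁), mem_cIcc_iff' r.θ₁ r.hθ]
  · exact ⟨by grind, by ring⟩
  all_goals rw [mem_cIoo_iff' r.θ₁]; grind

lemma arc_cases (h : IsSplit P Q r x y) {θ : S1} (hθ : θ ∈ cIcc r.θ₁ r.θ₂) :
    θ ∈ cIcc x y ∨ (r.θ₁ ≠ x ∧ θ ∈ cIcc r.θ₁ x) ∨ (y ≠ r.θ₂ ∧ θ ∈ cIcc y r.θ₂) := by
  have h1 := h.order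
  have h3 := arc_nonneg r.θ₁ θ
  rw [mem_cIcc_iff' r.θ₁ r.hθ] at hθ
  by_cases c1 : ℓ r.θ₁ θ < ℓ r.θ₁ x
  · have hx : r.θ₁ ≠ x := by grind
    refine .inr (.inl ⟨hx, ?_⟩)
    rw [mem_cIcc_iff' r.θ₁ hx]; grind
  by_cases c2 : ℓ r.θ₁ θ ≤ ℓ r.θ₁ y
  · left
    rw [mem_cIcc_iff' r.θ₁ h.hxy]; grind
  · have hy : y ≠ r.θ₂ := by grind
    refine .inr (.inr ⟨hy, ?_⟩)
    rw [mem_cIcc_iff' r.θ₁ hy]; grind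

lemma mem_of_bump_nonpos (h : IsSplit P Q r x y) {θ : S1} (hθ : θ ∈ cIoo r.θ₁ r.θ₂)
    (hb : splitBump r x y θ ≤ 0) : θ ∈ cIcc x y := by
  have key : ∀ {a b : S1}, a ≠ b → θ ∈ cIcc a b → splitBump r x y θ = sb a b θ → θ = a ∨ θ = b :=
    fun hab h1 h2 => ((mem_cIcc_iff_or hab).1 h1).imp_right
      (Or.resolve_right · fun h3 => hb.not_gt (h2 ▸ (sb_pos_iff hab).2 h3))
  rcases h.arc_cases (cIoo_subset_cIcc _ _ hθ) with h1 | ⟨h1, h2⟩ | ⟨h1, h2⟩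
  · exact h1
  · rcases key h1 h2 (h.bump_left h1 h2).2 with e | e
    · rw [e] at hθ; exact absurd hθ (left_not_mem_cIoo _ _)
    · rw [e]; exact left_mem_cIcc _ _
  · rcases key h1 h2 (h.bump_right h1 h2).2 with e | e
    · rw [e]; exact right_mem_cIcc _ _
    · rw [e] at hθ; exact absurd hθ (right_not_mem_cIoo _ _)

lemma splitBump_lt (h : IsSplit P Q r x y) {θ : S1} (hθ : θ ∈ cIoo r.θ₁ r.θ₂) :
    splitBump r x y θ < sb r.θ₁ r.θ₂ θ := by
  have h1 := h.lt
  have h2 := h.le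
  have h3 := arc_nonneg r.θ₁ x
  have hu := mem_cIoo_iff.1 hθ
  have hθ' := cIoo_subset_cIcc _ _ hθ
  rcases h.arc_cases hθ' with h1 | ⟨hx, h4⟩ | ⟨hy, h4⟩
  · rw [(h.bump_mid h1).2]
    exact (neg_nonpos.2 ((sb_nonneg_iff h.hxy).2 h1)).trans_lt ((sb_pos_iff r.hθ).2 hθ)
  · have h5 := arc_pos.2 hx.symm
    rw [(h.bump_left hx h4).2, sb, sb, if_pos ((mem_cIcc_iff hx).1 h4), if_pos hu.2.le,
      div_lt_div_iff₀ h5 (by linarith)]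
    have : 0 < ℓ r.θ₁ θ * (ℓ r.θ₁ θ * (ℓ r.θ₁ r.θ₂ - ℓ r.θ₁ x)) :=
      mul_pos hu.1 (mul_pos hu.1 (by linarith))
    linarith
  · have e := (h.bump_right hy h4).2
    rw [mem_cIcc_iff' r.θ₁ hy] at h4
    have h5 : ℓ r.θ₁ y ≤ ℓ r.θ₁ θ := by grind
    have h6 : ℓ r.θ₁ y ≠ ℓ r.θ₁ r.θ₂ := fun e => hy (arc_inj.1 e)
    have h7 : θ ∈ cIcc y r.θ₂ := by rw [mem_cIcc_iff' r.θ₁ hy]; exact .inl ⟨h5, hu.2.le⟩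
    have h8 := lt_of_le_of_ne h2 h6
    rw [e, sb_eq_bump hy h7, sb_eq_bump r.hθ hθ', bump, bump, arc_eq_ite r.θ₁ y θ, if_pos h5,
      arc_eq_ite r.θ₁ θ r.θ₂, if_pos hu.2.le, arc_eq_ite r.θ₁ y r.θ₂, if_pos h2,
      div_lt_div_iff₀ (by linarith) (by linarith)]
    have : 0 < (ℓ r.θ₁ r.θ₂ - ℓ r.θ₁ θ) * ((ℓ r.θ₁ r.θ₂ - ℓ r.θ₁ θ) *
      ℓ r.θ₁ y) := mul_pos (by linarith) (mul_pos (by linarith) (by linarith))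
    linarith

lemma splitBump_eq_zero (h : IsSplit P Q r x y) {θ : S1} (hθ : θ ∉ cIoo r.θ₁ r.θ₂) :
    splitBump r x y θ = 0 := by
  have h1 := h.order
  have h4 := arc_nonneg r.θ₁ θ
  unfold splitBump
  rw [mem_cIoo_iff' r.θ₁] at hθ
  rw [pb_of_not_mem, pb_of_not_mem, pb_of_not_mem]
  · ring
  all_goals rw [mem_cIoo_iff' r.θ₁]; grind

lemma parts_cone (h : IsSplit P Q r x y) (v : ℂ × ℂ) : (∃ q, IsPart r x y q ∧ v ∈ q.cone) ↔
    0 ≤ r.X v.2 ∧ r.Y v.1 = rad (splitBump r x y) v.2 := by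
  obtain ⟨z, w⟩ := v
  have hY : rad (sb r.φ₂ r.φ₁) z = -r.Y z := by
    rw [Rect.Y, rad, rad, sb_swap r.hφ]; ring
  have pos : ∀ {a b : S1}, a ≠ b → w ≠ 0 → (0 ≤ rad (sb a b) w ↔ ang w ∈ cIcc a b) :=
    fun hab hw => by rw [rad, mul_nonneg_iff_of_pos_left (norm_pos_iff.2 hw), sb_nonneg_iff hab]
  have zero : w = 0 → ∀ f, rad f w = 0 := fun hw f => by simp [rad, hw]
  have of_eq : ∀ {f : S1 → ℝ} {e : ℝ}, (w ≠ 0 → ang w ∈ cIcc r.θ₁ r.θ₂ ∧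
      splitBump r x y (ang w) = e * f (ang w)) → 0 ≤ r.X w ∧ rad (splitBump r x y) w = e * rad f w := by
    intro f e hh
    by_cases hw : w = 0
    · rw [Rect.X, zero hw, zero hw, zero hw, mul_zero]; exact ⟨le_rfl, rfl⟩
    · obtain ⟨h1, h2⟩ := hh hw
      exact ⟨(pos r.hθ hw).2 h1, by rw [rad, rad, h2]; ring⟩
  simp only [Rect.cone, Set.mem_ofPred_eq]
  constructor
  · rintro ⟨q, hq, hq1, hq2⟩
    rw [Rect.X] at hq1 hq2
    have n := q.hθ
    rcases hq with ⟨e1, e2, e3, e4⟩ | ⟨e1, e2, e3, e4⟩ | ⟨e1, e2, e3, e4⟩ <;>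
      rw [e1, e2] at hq1 hq2 n <;> rw [Rect.Y, e3, e4] at hq2
    · obtain ⟨k1, k2⟩ := of_eq (f := sb x y) (e := -1) fun hw => by
        rw [neg_one_mul]; exact h.bump_mid ((pos n hw).1 hq1)
      exact ⟨k1, by rw [k2, ← hq2, hY]; ring⟩
    · obtain ⟨k1, k2⟩ := of_eq (f := sb r.θ₁ x) (e := 1) fun hw => by
        rw [one_mul]; exact h.bump_left n ((pos n hw).1 hq1)
      exact ⟨k1, by rw [k2, ← hq2, one_mul]; rfl⟩
    · obtain ⟨k1, k2⟩ := of_eq (f := sb y r.θ₂) (e := 1) fun hw => by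
        rw [one_mul]; exact h.bump_right n ((pos n hw).1 hq1)
      exact ⟨k1, by rw [k2, ← hq2, one_mul]; rfl⟩
  · rintro ⟨h1, h2⟩
    have mid : (w ≠ 0 → ang w ∈ cIcc x y) → ∃ q, IsPart r x y q ∧ 0 ≤ q.X w ∧ q.Y z = q.X w := by
      intro hm
      refine ⟨⟨x, y, r.φ₂, r.φ₁, h.hxy, r.hφ.symm⟩, .inl ⟨rfl, rfl, rfl, rfl⟩, ?_⟩
      change 0 ≤ rad (sb x y) w ∧ rad (sb r.φ₂ r.φ₁) z = rad (sb x y) w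
      rw [hY, h2]
      by_cases hw : w = 0
      · simp [zero hw]
      · refine ⟨(pos h.hxy hw).2 (hm hw), ?_⟩
        rw [rad, rad, (h.bump_mid (hm hw)).2]; ring
    by_cases hw : w = 0
    · exact mid fun h => absurd hw h
    rcases h.arc_cases ((pos r.hθ hw).1 h1) with c | ⟨n, c⟩ | ⟨n, c⟩
    · exact mid fun _ => c
    · refine ⟨⟨r.θ₁, x, r.φ₁, r.φ₂, n, r.hφ⟩, .inr (.inl ⟨rfl, rfl, rfl, rfl⟩), (pos n hw).2 c, ?_⟩
      change r.Y z = _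
      rw [h2, rad, (h.bump_left n c).2]; rfl
    · refine ⟨⟨y, r.θ₂, r.φ₁, r.φ₂, n, r.hφ⟩, .inr (.inr ⟨rfl, rfl, rfl, rfl⟩), (pos n hw).2 c, ?_⟩
      change r.Y z = _
      rw [h2, rad, (h.bump_right n c).2]; rfl

lemma mem_Q (h : IsSplit P Q r x y) {q : Rect} (hq : q ∈ P.rects) (hqr : q ≠ r) : q ∈ Q.rects :=
  (h.rects q).2 (.inl ⟨hq, hqr⟩)

lemma part_ne (h : IsSplit P Q r x y) {q : Rect} (hq : q ∈ P.rects) (hqr : q ≠ r) {n : Rect}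
    (hn : IsPart r x y n) : q ≠ n := by
  rintro rfl
  obtain ⟨f1, f2⟩ := h.free q hq hqr
  rcases hn with ⟨e1, -⟩ | ⟨-, e1, -⟩ | ⟨e1, -⟩
  · exact f1 (e1 ▸ left_mem_cIcc _ _)
  · exact f2 (e1 ▸ left_mem_cIcc _ _)
  · exact f1 (e1 ▸ right_mem_cIcc _ _)

lemma not_mem_cone (h : IsSplit P Q r x y) {q : Rect} (hq : q ∈ P.rects) (hqr : q ≠ r)
    {v : ℂ × ℂ} (h0 : 0 < r.X v.2) (h1 : rad (splitBump r x y) v.2 ≤ r.Y v.1)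
    (h2 : r.Y v.1 ≤ r.X v.2) : v ∉ q.cone := by
  obtain ⟨z, w⟩ := v
  rintro ⟨h3, h4⟩
  simp only at h0 h1 h2 h3 h4
  obtain ⟨hw, hθ⟩ := r.X_pos_iff.1 h0
  have hn := norm_pos_iff.2 hw
  obtain ⟨f1, f2⟩ := h.free q hq hqr
  set θ := ang w with hθ_def
  have hqθ : θ ∈ cIcc q.θ₁ q.θ₂ :=
    (sb_nonneg_iff q.hθ).1 (nonneg_of_mul_nonneg_right h3 hn)
  have bpos : rad (splitBump r x y) w ≤ 0 → θ ∈ cIcc x y := fun hh =>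
    h.mem_of_bump_nonpos hθ (nonpos_of_mul_nonpos_right hh hn)
  have inner : θ ∈ cIcc x y → cIcc x y ⊆ cIoo q.θ₁ q.θ₂ := fun hm =>
    cIcc_subset_cIoo q.hθ h.hxy ⟨θ, hqθ, hm⟩ f1 f2
  -- the part with the opposite vertical sides
  have part₂ : ∃ n : Rect, n ∈ Q.rects ∧ q ≠ n ∧ n.θ₁ = x ∧ n.θ₂ = y ∧ n.φ₁ = r.φ₂ ∧ n.φ₂ = r.φ₁ :=
    have hn : IsPart r x y ⟨x, y, r.φ₂, r.φ₁, h.hxy, r.hφ.symm⟩ := .inl ⟨rfl, rfl, rfl, rfl⟩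
    ⟨_, (h.rects _).2 (.inr hn), h.part_ne hq hqr hn, rfl, rfl, rfl, rfl⟩
  have cross₂ : θ ∈ cIcc x y → ∀ φ ∈ q.arc, φ ∈ cIcc r.φ₂ r.φ₁ →
      q.arc ⊆ cIoo r.φ₂ r.φ₁ := by
    intro hm φ hφ hφ'
    obtain ⟨n, hn, hne, e1, e2, e3, e4⟩ := part₂
    have hv : (θ, φ) ∉ q.vertices := fun hv => by
      rcases (Rect.mem_vertices.1 hv).1 with e | e <;> have := inner hm hm <;> rw [e] at this
      · exact left_not_mem_cIoo _ _ this
      · exact right_not_mem_cIoo _ _ this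
    rcases (Q.compatible q (h.mem_Q hq hqr) n hn hne).cross (Rect.mem_carrier.2 ⟨hqθ, hφ⟩)
      (Rect.mem_carrier.2 ⟨by rw [e1, e2]; exact hm, by rw [Rect.arc, e3, e4]; exact hφ'⟩)
      (.inl hv) with ⟨-, c⟩ | ⟨c, -⟩
    · rwa [Rect.Inner, Rect.arcInt, e3, e4] at c
    · rw [e1, e2] at c
      exact absurd (cIoo_subset_cIcc _ _ (c (left_mem_cIcc _ _))) f1
  by_cases hz : z = 0
  · have e : ∀ f, rad f z = 0 := fun f => by simp [rad, hz]
    rw [Rect.Y, e] at h1 h4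
    have hm := inner (bpos h1) (bpos h1)
    have : 0 < q.X w := mul_pos hn ((sb_pos_iff q.hθ).2 hm)
    linarith
  have hnz := norm_pos_iff.2 hz
  set φ := ang z with hφ_def
  have hqφ : φ ∈ q.arc :=
    (sb_nonneg_iff q.hφ).1 (nonneg_of_mul_nonneg_right (h3.trans h4.ge) hnz)
  by_cases hφ : φ ∈ cIoo r.φ₁ r.φ₂
  · have hφr : φ ∈ r.arc := cIoo_subset_cIcc _ _ hφ
    have hv : (θ, φ) ∉ r.vertices := fun hv => by
      rcases (Rect.mem_vertices.1 hv).2 with e | e <;> rw [e] at hφ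
      · exact left_not_mem_cIoo _ _ hφ
      · exact right_not_mem_cIoo _ _ hφ
    rcases (P.compatible r h.mem q hq hqr.symm).cross
      (Rect.mem_carrier.2 ⟨cIoo_subset_cIcc _ _ hθ, hφr⟩) (Rect.mem_carrier.2 ⟨hqθ, hqφ⟩)
      (.inl hv) with ⟨c1, c2⟩ | ⟨c1, c2⟩
    · have hlt : r.Y z < q.Y z := mul_lt_mul_of_pos_left (sb_lt_of_subset r.hφ q.hφ c2 hφr) hnz
      have side : ∀ n : Rect, IsPart r x y n → n.φ₁ = r.φ₁ → n.φ₂ = r.φ₂ → θ ∈ cIcc n.θ₁ n.θ₂ →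
          splitBump r x y θ = sb n.θ₁ n.θ₂ θ → False := by
        intro n hnp e3 e4 hm hb
        have hv : (θ, φ) ∉ n.vertices := fun hv => by
          rcases (Rect.mem_vertices.1 hv).2 with e | e <;> rw [e] at hφ
          · rw [e3] at hφ; exact left_not_mem_cIoo _ _ hφ
          · rw [e4] at hφ; exact right_not_mem_cIoo _ _ hφ
        rcases (Q.compatible n ((h.rects n).2 (.inr hnp)) q (h.mem_Q hq hqr)
          (h.part_ne hq hqr hnp).symm).cross (Rect.mem_carrier.2 ⟨hm, by rw [Rect.arc, e3, e4]; exact hφr⟩)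
          (Rect.mem_carrier.2 ⟨hqθ, hqφ⟩) (.inl hv) with ⟨d, -⟩ | ⟨-, d⟩
        · have := mul_lt_mul_of_pos_left (sb_lt_of_subset q.hθ n.hθ d hqθ) hn
          rw [← hb] at this
          change q.X w < rad (splitBump r x y) w at this
          linarith
        · rw [Rect.Inner, Rect.arcInt, e3, e4] at d
          exact left_not_mem_cIoo _ _ (d (cIoo_subset_cIcc _ _ (c2 (left_mem_cIcc _ _))))
      rcases h.arc_cases (cIoo_subset_cIcc _ _ hθ) with c | ⟨n, c⟩ | ⟨n, c⟩
      · exact left_not_mem_cIoo _ _ (cross₂ c r.φ₂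
          (cIoo_subset_cIcc _ _ (c2 (right_mem_cIcc _ _))) (left_mem_cIcc _ _)
          (cIoo_subset_cIcc _ _ (c2 (right_mem_cIcc _ _))))
      · exact side ⟨r.θ₁, x, r.φ₁, r.φ₂, n, r.hφ⟩ (.inr (.inl ⟨rfl, rfl, rfl, rfl⟩)) rfl rfl c
          (h.bump_left n c).2
      · exact side ⟨y, r.θ₂, r.φ₁, r.φ₂, n, r.hφ⟩ (.inr (.inr ⟨rfl, rfl, rfl, rfl⟩)) rfl rfl c
          (h.bump_right n c).2
    · have : q.Y z < r.Y z := mul_lt_mul_of_pos_left (sb_lt_of_subset q.hφ r.hφ c2 hqφ) hnz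
      have : r.X w < q.X w :=
        mul_lt_mul_of_pos_left (sb_lt_of_subset r.hθ q.hθ c1 (cIoo_subset_cIcc _ _ hθ)) hn
      linarith
  · have hY : r.Y z ≤ 0 := by
      refine mul_nonpos_of_nonneg_of_nonpos hnz.le (not_lt.1 fun h' => hφ ((sb_pos_iff r.hφ).1 h'))
    have hm := bpos (h1.trans hY)
    have hφ' : φ ∈ cIcc r.φ₂ r.φ₁ := by
      by_contra hc; exact hφ (not_mem_cIcc_iff.1 hc)
    have e1 : q.Y z < -r.Y z := by
      have := mul_lt_mul_of_pos_left (sb_lt_of_subset q.hφ r.hφ.symm (cross₂ hm φ hqφ hφ') hqφ) hnz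
      rw [sb_swap r.hφ, mul_neg] at this
      exact this
    have e2 : -rad (splitBump r x y) w < q.X w := by
      have := mul_lt_mul_of_pos_left (sb_lt_of_subset h.hxy q.hθ (inner hm) hm) hn
      rw [rad, ← hθ_def, (h.bump_mid hm).2, mul_neg, neg_neg]
      exact this
    linarith

end IsSplit

/-! ## Moving a tile -/

lemma isRad_straight {a b : S1} (hab : a ≠ b) : IsRad fun v => (straight a b v.1, v.2) :=
  ⟨((continuous_straight hab).comp continuous_fst).prodMk continuous_snd,
    (bijective_straight hab).prodMap Function.bijective_id, 1, one_ne_zero, fun t ht v => by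
      rw [pow_one]; exact Prod.ext (isHom_straight a b ht v.1) rfl⟩

namespace Rect

/-- Homogeneous coordinates in which the defining function of the vertical side is linear. -/
def coord (r : Rect) (v : ℂ × ℂ) : ℂ × ℂ := (straight r.φ₁ r.φ₂ (sq v).1, (sq v).2)

lemma isRad_coord (r : Rect) : IsRad r.coord := isRad_sq.comp (isRad_straight r.hφ)

lemma mem_tile_iff' (r : Rect) (x : S3) : x ∈ tile r ↔
    0 ≤ r.X (r.coord (pr x)).2 ∧ (r.coord (pr x)).1.re = r.X (r.coord (pr x)).2 := r.mem_tile_iff x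

end Rect

/-- The points between the graphs of two functions. -/
def between (f g : ℝ × ℂ → ℝ) : Set (ℂ × ℂ) :=
  {v | f (v.1.im, v.2) < v.1.re ∧ v.1.re < g (v.1.im, v.2)}

/-- The homeomorphism `c` takes the tile of `r` to the surface into which it turns, preserves every
page and is identical outside the domain between the graphs of `lo` and `hi`. -/
structure Moves (r : Rect) (x y : S1) (lo hi : ℝ × ℂ → ℝ) (c : S3 ≃ₜ S3) : Prop where
  cont : Continuous lo ∧ Continuous hi
  hom : IsHom lo ∧ IsHom hi
  bounds : ∀ s, (0 < r.X s.2 ∧ lo s < rad (splitBump r x y) s.2 ∧ r.X s.2 < hi s ∧ lo s < r.X s.2) ∨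
    (r.X s.2 ≤ 0 ∧ lo s = 0 ∧ hi s = 0)
  fix : ∀ p, r.coord (pr p) ∉ between lo hi → c p = p
  page_iff : ∀ p θ, c p ∈ page θ ↔ p ∈ page θ
  tile_iff : ∀ p, (0 ≤ r.X (r.coord (pr (c p))).2 ∧
    (r.coord (pr (c p))).1.re = rad (splitBump r x y) (r.coord (pr (c p))).2) ↔ p ∈ tile r

lemma sq_mem_page {p : S3} {θ : S1} :
    p ∈ page θ ↔ sq (pr p) ∈ {v : ℂ × ℂ | v.2 = 0 ∨ ang v.2 = θ} := by
  change _ ↔ ‖p.1 1‖ • p.1 1 = 0 ∨ ang (‖p.1 1‖ • p.1 1) = θ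
  rw [mem_page]
  by_cases h : p.1 1 = 0
  · simp [h]
  · rw [ang_smul (norm_pos_iff.2 h) h]; simp [h]

lemma isCone_page (θ : S1) : IsCone {v : ℂ × ℂ | v.2 = 0 ∨ ang v.2 = θ} := fun t ht v hv => by
  rcases hv with h | h
  · exact .inl (by rw [Prod.smul_snd, h, smul_zero])
  · by_cases h0 : v.2 = 0
    · exact .inl (by rw [Prod.smul_snd, h0, smul_zero])
    · exact .inr (by rw [Prod.smul_snd, ang_smul ht h0]; exact h)

lemma exists_conj {Λ M : ℂ × ℂ → ℂ × ℂ} (hΛ : IsRad Λ) (hM : IsRad M) :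
    ∃ c : S3 ≃ₜ S3, ∀ p, ∃ t : ℝ, 0 < t ∧ Λ (pr (c p)) = t • M (Λ (pr p)) := by
  refine ⟨hΛ.homeo.trans (hM.homeo.trans hΛ.homeo.symm), fun p => ?_⟩
  obtain ⟨d, -, hd⟩ := hM.hom
  obtain ⟨t₁, ht₁, e₁⟩ := hΛ.pr_homeo (hΛ.homeo.symm (hM.homeo (hΛ.homeo p)))
  obtain ⟨t₂, ht₂, e₂⟩ := hM.pr_homeo (hΛ.homeo p)
  obtain ⟨t₃, ht₃, e₃⟩ := hΛ.pr_homeo p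
  rw [Homeomorph.apply_symm_apply, e₂, e₃, hd _ ht₃, smul_smul] at e₁
  refine ⟨t₁⁻¹ * (t₂ * t₃ ^ d), by positivity, ?_⟩
  rw [mul_smul, e₁, smul_smul, inv_mul_cancel₀ ht₁.ne', one_smul]
  rfl

namespace IsSplit

variable {P Q : Diagram} {r : Rect} {x y : S1}

lemma rad_lt (h : IsSplit P Q r x y) {w : ℂ} (hw : 0 < r.X w) :
    rad (splitBump r x y) w < r.X w := by
  obtain ⟨h0, h1⟩ := r.X_pos_iff.1 hw
  exact mul_lt_mul_of_pos_left (h.splitBump_lt h1) (norm_pos_iff.2 h0)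

lemma rad_eq_zero (h : IsSplit P Q r x y) {w : ℂ} (hw : r.X w ≤ 0) :
    rad (splitBump r x y) w = 0 := by
  by_cases h0 : w = 0
  · simp [rad, h0]
  · rw [rad, h.splitBump_eq_zero, mul_zero]
    exact fun h1 => hw.not_gt (r.X_pos_iff.2 ⟨h0, h1⟩)

open scoped Pointwise in
lemma exists_moves (h : IsSplit P Q r x y) {U : Set S3} (hU : IsOpen U)
    (hreg : ∀ p : S3, 0 < r.X (r.coord (pr p)).2 →
      rad (splitBump r x y) (r.coord (pr p)).2 ≤ (r.coord (pr p)).1.re →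
      (r.coord (pr p)).1.re ≤ r.X (r.coord (pr p)).2 → p ∈ U) :
    ∃ lo hi c, Moves r x y lo hi c ∧ ∀ p, r.coord (pr p) ∈ between lo hi → p ∈ U := by
  have hΛ := r.isRad_coord
  set V : Set (ℂ × ℂ) := {v | v ≠ 0 ∧ 0 < r.X v.2 ∧ hΛ.homeo.symm (proj v) ∈ U} with hV
  have hcoord : ∀ p, hΛ.homeo.symm (proj (r.coord (pr p))) = p := fun p => by
    rw [← hΛ.homeo_apply, Homeomorph.symm_apply_apply]
  have hlift : ∀ v : ℂ × ℂ, v ≠ 0 → ∃ (p : S3) (t : ℝ), 0 < t ∧ r.coord (pr p) = t • v ∧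
      hΛ.homeo.symm (proj v) = p := fun v hv => by
    obtain ⟨t, ht, e⟩ := hΛ.pr_homeo (hΛ.homeo.symm (proj v))
    obtain ⟨t', ht', e'⟩ := pr_proj_exists hv
    rw [Homeomorph.apply_symm_apply, e'] at e
    refine ⟨_, t⁻¹ * t', mul_pos (inv_pos.2 ht) ht', ?_, rfl⟩
    rw [mul_smul, e, smul_smul, inv_mul_cancel₀ ht.ne', one_smul]
  have hVo : IsOpen V := by
    have h1 : IsOpen {v : ℂ × ℂ | 0 < r.X v.2} :=
      isOpen_lt continuous_const (r.continuous_X.comp continuous_snd)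
    have h2 := (hΛ.homeo.symm.continuous.comp_continuousOn continuousOn_proj).isOpen_inter_preimage
      isOpen_ne hU
    have : V = {v : ℂ × ℂ | 0 < r.X v.2} ∩ ({v | v ≠ 0} ∩ (hΛ.homeo.symm ∘ proj) ⁻¹' U) :=
      Set.ext fun v => ⟨fun ⟨b, a, c⟩ => ⟨a, b, c⟩, fun ⟨a, b, c⟩ => ⟨b, a, c⟩⟩
    rw [this]
    exact h1.inter h2
  have hVc : ∀ t : ℝ, 0 < t → t • Vᶜ = Vᶜ := by
    have key : ∀ t : ℝ, 0 < t → ∀ v, v ∈ V → t • v ∈ V := by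
      rintro t ht v ⟨a, b, c⟩
      refine ⟨smul_ne_zero ht.ne' a, ?_, by rwa [proj_smul ht]⟩
      rw [Prod.smul_snd, r.isHom_X t ht]
      exact mul_pos ht b
    intro t ht
    ext v
    rw [Set.mem_smul_set_iff_inv_smul_mem₀ ht.ne', Set.mem_compl_iff, Set.mem_compl_iff,
      (show IsCone V from key).smul_mem_iff (inv_pos.2 ht)]
  have h0V : (Vᶜ).Nonempty := ⟨0, fun hv => hv.1 rfl⟩
  -- the distance to the complement, on the graph of a function
  set D : (ℝ × ℂ → ℝ) → ℝ × ℂ → ℝ := fun f s =>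
    Metric.infDist (((f s : ℂ) + s.1 * Complex.I, s.2) : ℂ × ℂ) Vᶜ / 2 with hD
  have hDc : ∀ f, Continuous f → Continuous (D f) := fun f hf => by
    have : Continuous fun s : ℝ × ℂ => (((f s : ℂ) + s.1 * Complex.I, s.2) : ℂ × ℂ) := by fun_prop
    exact ((Metric.continuous_infDist_pt _).comp this).div_const 2
  have hDh : ∀ f, IsHom f → IsHom (D f) := fun f hf t ht s => by
    have e : (((f (t • s) : ℂ) + (t • s).1 * Complex.I, (t • s).2) : ℂ × ℂ) =
        t • ((f s : ℂ) + s.1 * Complex.I, s.2) := by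
      rw [hf t ht]
      refine Prod.ext ?_ rfl
      simp; ring
    simp only [hD]
    rw [e, ← hVc t ht, infDist_smul₀ ht.ne', hVc t ht, Real.norm_of_nonneg ht.le, mul_div_assoc]
  have hD0 : ∀ f s, 0 ≤ D f s := fun f s => div_nonneg Metric.infDist_nonneg zero_le_two
  have hDmem : ∀ f (v : ℂ × ℂ), |v.1.re - f (v.1.im, v.2)| < D f (v.1.im, v.2) → v ∈ V := by
    rintro f ⟨⟨y, i⟩, b⟩ hv
    by_contra hc
    have h1 := Metric.infDist_le_dist_of_mem
      (x := (((f (i, b) : ℂ) + i * Complex.I, b) : ℂ × ℂ)) (show (⟨y, i⟩, b) ∈ Vᶜ from hc)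
    rw [Prod.dist_eq, dist_self, max_eq_left dist_nonneg, dist_comm, Complex.dist_eq,
      Complex.mk_eq_add_mul_I, add_sub_add_right_eq_sub, ← Complex.ofReal_sub, Complex.norm_real,
      Real.norm_eq_abs] at h1
    simp only [hD] at hv
    linarith [abs_nonneg (y - f (i, b))]
  have hDpos : ∀ f s, (((f s : ℂ) + s.1 * Complex.I, s.2) : ℂ × ℂ) ∈ V → 0 < D f s := fun f s hs =>
    half_pos ((hVo.isClosed_compl.notMem_iff_infDist_pos h0V).1 (fun hc => hc hs))
  have hDzero : ∀ f s, r.X s.2 ≤ 0 → D f s = 0 := fun f s hs => by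
    simp only [hD]
    rw [Metric.infDist_zero_of_mem (show _ ∈ Vᶜ from fun hv => hs.not_gt hv.2.1), zero_div]
  have hregV : ∀ v : ℂ × ℂ, 0 < r.X v.2 → rad (splitBump r x y) v.2 ≤ v.1.re → v.1.re ≤ r.X v.2 →
      v ∈ V := by
    intro v h1 h2 h3
    have hv : v ≠ 0 := by rintro rfl; exact (r.X_pos_iff.1 h1).1 rfl
    obtain ⟨p, t, ht, e, e'⟩ := hlift v hv
    refine ⟨hv, h1, e' ▸ hreg p ?_ ?_ ?_⟩
    · rw [e, Prod.smul_snd, r.isHom_X t ht]; exact mul_pos ht h1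
    · rw [e, Prod.smul_snd, isHom_rad _ t ht, Prod.smul_fst, Complex.smul_re, smul_eq_mul]
      exact mul_le_mul_of_nonneg_left h2 ht.le
    · rw [e, Prod.smul_snd, r.isHom_X t ht, Prod.smul_fst, Complex.smul_re, smul_eq_mul]
      exact mul_le_mul_of_nonneg_left h3 ht.le
  set f₁ : ℝ × ℂ → ℝ := fun s => max 0 (r.X s.2) with hf₁
  set f₂ : ℝ × ℂ → ℝ := fun s => rad (splitBump r x y) s.2 with hf₂
  have c₁ : Continuous f₁ := continuous_const.max (r.continuous_X.comp continuous_snd)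
  have c₂ : Continuous f₂ := (continuous_rad (continuous_splitBump r x y)).comp continuous_snd
  have j₁ : IsHom f₁ := fun t ht s => by
    simp only [hf₁]; rw [Prod.smul_snd, r.isHom_X t ht, mul_max_of_nonneg _ _ ht.le, mul_zero]
  have j₂ : IsHom f₂ := fun t ht s => isHom_rad _ t ht s.2
  have hpos : ∀ s : ℝ × ℂ, 0 < r.X s.2 → f₁ s = r.X s.2 ∧ f₂ s < f₁ s ∧ 0 < D f₁ s ∧ 0 < D f₂ s := by
    intro s hs
    have e : f₁ s = r.X s.2 := max_eq_right hs.le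
    have hlt := h.rad_lt hs
    refine ⟨e, e ▸ hlt, hDpos _ _ (hregV _ hs ?_ ?_), hDpos _ _ (hregV _ hs ?_ ?_)⟩ <;> simp [e, hf₂, hlt.le]
  have hneg : ∀ s : ℝ × ℂ, r.X s.2 ≤ 0 → f₁ s = 0 ∧ f₂ s = 0 := fun s hs =>
    ⟨max_eq_left hs, h.rad_eq_zero hs⟩
  have jlo : IsHom fun s => f₂ s - D f₂ s := fun t ht s => by
    simp only; rw [j₂ t ht, hDh _ j₂ t ht]; ring
  have jhi : IsHom fun s => f₁ s + D f₁ s := fun t ht s => by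
    simp only; rw [j₁ t ht, hDh _ j₁ t ht]; ring
  have hok : ∀ s, PushOK (f₂ s - D f₂ s) (f₁ s) (f₂ s) (f₁ s + D f₁ s) := by
    intro s
    rcases lt_or_ge 0 (r.X s.2) with hs | hs
    · obtain ⟨-, h1, h2, h3⟩ := hpos s hs
      exact .inr ⟨by linarith, by linarith, by linarith, by linarith⟩
    · obtain ⟨h1, h2⟩ := hneg s hs
      exact .inl (h1.trans h2.symm)
  let ψ : ℝ × ℂ → ℝ → ℝ := fun s => push (f₂ s - D f₂ s) (f₁ s) (f₂ s) (f₁ s + D f₁ s)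
  have hrad : IsRad (fib fun y s => ψ s y) := isRad_push (c₂.sub (hDc _ c₂)) c₁ c₂ (c₁.add (hDc _ c₁))
    jlo j₁ j₂ jhi hok
  obtain ⟨c, hc⟩ := exists_conj hΛ hrad
  refine ⟨fun s => f₂ s - D f₂ s, fun s => f₁ s + D f₁ s, c, ⟨⟨c₂.sub (hDc _ c₂), c₁.add (hDc _ c₁)⟩,
    ⟨jlo, jhi⟩, fun s => ?_, fun p hp => ?_, fun p θ => ?_, fun p => ?_⟩,
    fun p hp => ?_⟩
  · rcases lt_or_ge 0 (r.X s.2) with hs | hs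
    · obtain ⟨h0, h1, h2, h3⟩ := hpos s hs
      exact .inl ⟨hs, by simp only [hf₂] at *; linarith, by linarith, by linarith⟩
    · obtain ⟨h1, h2⟩ := hneg s hs
      exact .inr ⟨hs, by rw [h2, hDzero _ _ hs, sub_zero], by rw [h1, hDzero _ _ hs, add_zero]⟩
  · obtain ⟨t, ht, e⟩ := hc p
    have hfix : ψ ((r.coord (pr p)).1.im, (r.coord (pr p)).2) (r.coord (pr p)).1.re =
        (r.coord (pr p)).1.re := by
      by_cases hle : (r.coord (pr p)).1.re ≤ f₂ ((r.coord (pr p)).1.im, (r.coord (pr p)).2) -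
          D f₂ ((r.coord (pr p)).1.im, (r.coord (pr p)).2)
      · exact push_of_le (hok _) hle
      · exact push_of_ge (hok _) (not_lt.1 fun hlt => hp ⟨not_le.1 hle, hlt⟩)
    rw [← hcoord (c p), e, proj_smul ht, show fib (fun y s => ψ s y) (r.coord (pr p)) = r.coord (pr p) from
      Prod.ext (Complex.ext hfix rfl) rfl, hcoord]
  · obtain ⟨t, ht, e⟩ := hc p
    have e2 : (sq (pr (c p))).2 = t • (sq (pr p)).2 := (Prod.ext_iff.1 e).2
    rw [sq_mem_page, sq_mem_page, ← (isCone_page θ).smul_mem_iff ht (v := sq (pr p))]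
    simp only [Set.mem_ofPred_eq, Prod.smul_snd, e2]
  · obtain ⟨t, ht, e⟩ := hc p
    rw [e, r.mem_tile_iff']
    set v := r.coord (pr p)
    have e1 : (t • fib (fun y s => ψ s y) v).2 = t • v.2 := rfl
    have e2 : (t • fib (fun y s => ψ s y) v).1.re = t * ψ (v.1.im, v.2) v.1.re := by simp [fib]
    change 0 ≤ r.X (t • v.2) ∧ (t • fib (fun y s => ψ s y) v).1.re = rad _ (t • v.2) ↔ _
    rw [e2, r.isHom_X t ht, isHom_rad _ t ht, mul_nonneg_iff_of_pos_left ht, mul_right_inj' ht.ne']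
    refine and_congr_right fun h0 => ?_
    rw [show r.X v.2 = f₁ (v.1.im, v.2) from (max_eq_right h0).symm,
      show rad _ v.2 = ψ (v.1.im, v.2) (f₁ (v.1.im, v.2)) from
        (push_self (hok (v.1.im, v.2))).symm]
    exact (push_strictMono (hok _)).injective.eq_iff
  · rw [← hcoord p]
    set v := r.coord (pr p)
    suffices v ∈ V from this.2.2
    obtain ⟨b1, b2⟩ := hp
    rcases lt_or_ge 0 (r.X v.2) with hs | hs
    · obtain ⟨h0, -⟩ := hpos (v.1.im, v.2) hs
      rcases lt_or_ge v.1.re (f₂ (v.1.im, v.2)) with h1 | h1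
      · exact hDmem f₂ v (by rw [abs_of_neg (by linarith)]; linarith)
      rcases lt_or_ge (f₁ (v.1.im, v.2)) v.1.re with h2 | h2
      · exact hDmem f₁ v (by rw [abs_of_pos (by linarith)]; linarith)
      · exact hregV v hs h1 (h2.trans h0.le)
    · obtain ⟨h1, h2⟩ := hneg (v.1.im, v.2) hs
      simp only at b1 b2
      rw [h2, hDzero _ _ hs] at b1
      rw [h1, hDzero _ _ hs] at b2
      linarith

end IsSplit

/-! ## Isotopies -/

lemma image_eq_of_mem_iff {e : S3 ≃ₜ S3} {S T : Set S3} (h : ∀ p, e p ∈ T ↔ p ∈ S) : e '' S = T := by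
  rw [e.image_eq_preimage_symm]
  ext p
  rw [Set.mem_preimage, ← h, e.apply_symm_apply]

namespace Isotopic

variable {F F' F'' : Set S3} {f g k f' g' : S3 ≃ₜ S3}

lemma iff_homotopicWith : Isotopic F F' f g ↔ ContinuousMap.HomotopicWith (f : C(S3, S3)) g
    fun q => ∃ h : S3 ≃ₜ S3, (∀ x, q x = h x) ∧ h '' F = F' :=
  ⟨fun ⟨H, h0, h1, hh⟩ => ⟨⟨⟨H, h0, h1⟩, hh⟩⟩,
    fun ⟨H⟩ => ⟨H.toContinuousMap, H.map_zero_left, H.map_one_left, H.prop'⟩⟩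

lemma refl (h : f '' F = F') : Isotopic F F' f f :=
  iff_homotopicWith.2 (.refl _ ⟨f, fun _ => rfl, h⟩)

lemma symm (h : Isotopic F F' f g) : Isotopic F F' g f :=
  iff_homotopicWith.2 (iff_homotopicWith.1 h).symm

lemma trans (h : Isotopic F F' f g) (h' : Isotopic F F' g k) : Isotopic F F' f k :=
  iff_homotopicWith.2 ((iff_homotopicWith.1 h).trans (iff_homotopicWith.1 h'))

lemma comp (h : Isotopic F F' f g) (h' : Isotopic F' F'' f' g') :
    Isotopic F F'' (f.trans f') (g.trans g') := by
  obtain ⟨H, h0, h1, hh⟩ := h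
  obtain ⟨K, k0, k1, kk⟩ := h'
  refine ⟨⟨fun p => K (p.1, H p), by fun_prop⟩, fun x => ?_, fun x => ?_, fun t => ?_⟩
  · change K (0, H (0, x)) = _; rw [h0, k0]; rfl
  · change K (1, H (1, x)) = _; rw [h1, k1]; rfl
  · obtain ⟨a, ha, ha'⟩ := hh t
    obtain ⟨b, hb, hb'⟩ := kk t
    refine ⟨a.trans b, fun x => ?_, ?_⟩
    · change K (t, H (t, x)) = _; rw [ha, hb]; rfl
    · rw [show ⇑(a.trans b) = b ∘ a from rfl, Set.image_comp, ha', hb']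

lemma inv (h : Isotopic F F' f g) : Isotopic F' F f.symm g.symm := by
  obtain ⟨H, h0, h1, hh⟩ := h
  choose e he he' using hh
  have hb : Function.Bijective fun p : unitInterval × S3 => (p.1, H p) := by
    constructor
    · rintro ⟨t, x⟩ ⟨s, y⟩ h
      simp only [Prod.mk.injEq] at h
      obtain ⟨rfl, h⟩ := h
      rw [he, he] at h
      rw [(e t).injective h]
    · rintro ⟨t, x⟩
      exact ⟨(t, (e t).symm x), by simp only; rw [he, (e t).apply_symm_apply]⟩
  let Φ : unitInterval × S3 ≃ₜ unitInterval × S3 :=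
    Continuous.homeoOfEquivCompactToT2 (f := Equiv.ofBijective _ hb) (by
      change Continuous fun p : unitInterval × S3 => (p.1, H p); fun_prop)
  have key : ∀ t x, (Φ.symm (t, x)).2 = (e t).symm x := fun t x => by
    have : Φ (t, (e t).symm x) = (t, x) := by
      change (t, H (t, (e t).symm x)) = _; rw [he, (e t).apply_symm_apply]
    rw [← this, Φ.symm_apply_apply]
  refine ⟨⟨fun p => (Φ.symm p).2, by fun_prop⟩, fun x => (key 0 x).trans ?_,
    fun x => (key 1 x).trans ?_, fun t => ⟨(e t).symm, key t, ?_⟩⟩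
  · rw [show e 0 = f from Homeomorph.ext fun x => by rw [← he, h0]]
  · rw [show e 1 = g from Homeomorph.ext fun x => by rw [← he, h1]]
  · rw [← he' t, ← Set.image_comp, Homeomorph.symm_comp_self, Set.image_id]

end Isotopic

/-! ## The Alexander trick -/

lemma continuous_of_shrinking {X : Type*} [TopologicalSpace X] [CompactSpace X] [T2Space X]
    {H : unitInterval × X → X} {C : Set (unitInterval × X)} (hC : IsClosed C)
    (hc : ∀ t x, t ≠ 0 → ContinuousAt H (t, x)) (h0 : ∀ x, H (0, x) = x)
    (hoff : ∀ t x, (t, x) ∉ C → H (t, x) = x) (hon : ∀ t x, (t, x) ∈ C → (t, H (t, x)) ∈ C)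
    (hpt : ∀ x y, ((0 : unitInterval), x) ∈ C → ((0 : unitInterval), y) ∈ C → x = y) :
    Continuous H := by
  refine continuous_iff_continuousAt.2 fun ⟨t, x⟩ => ?_
  by_cases ht : t = 0
  swap
  · exact hc t x ht
  subst ht
  rw [ContinuousAt, h0, tendsto_iff_ultrafilter]
  intro 𝒰 h𝒰
  have hx : Tendsto Prod.snd (𝒰 : Filter (unitInterval × X)) (𝓝 x) :=
    (continuous_snd.tendsto _).mono_left h𝒰
  have ht : Tendsto Prod.fst (𝒰 : Filter (unitInterval × X)) (𝓝 0) :=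
    (continuous_fst.tendsto _).mono_left h𝒰
  rcases 𝒰.mem_or_compl_mem C with h | h
  · obtain ⟨y, -, hy⟩ := isCompact_univ.ultrafilter_le_nhds (𝒰.map H) (by simp)
    have hy' : Tendsto H 𝒰 (𝓝 y) := hy
    have h1 : ((0 : unitInterval), x) ∈ C := hC.mem_of_tendsto h𝒰 h
    have h2 : ((0 : unitInterval), y) ∈ C :=
      hC.mem_of_tendsto (ht.prodMk_nhds hy') (by filter_upwards [h] with p hp using hon _ _ hp)
    rwa [hpt x y h1 h2]
  · exact hx.congr' (by filter_upwards [h] with p hp using (hoff _ _ hp).symm)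

/-- A permutation of the real coordinates. -/
def perm (v : ℂ × ℂ) : ℂ × ℂ := (⟨v.2.im, v.1.im⟩, ⟨v.2.re, v.1.re⟩)

lemma isRad_perm : IsRad perm := by
  refine ⟨?_, Function.Involutive.bijective fun v => rfl, 1, one_ne_zero, fun t ht v => ?_⟩
  · have : Continuous fun v : ℂ × ℂ =>
      ((v.2.im + v.1.im * Complex.I, v.2.re + v.1.re * Complex.I) : ℂ × ℂ) := by fun_prop
    exact this.congr fun v => by simp only [perm, Complex.mk_eq_add_mul_I]
  · refine Prod.ext (Complex.ext ?_ ?_) (Complex.ext ?_ ?_) <;> simp [perm]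

/-- The first of the real coordinates. -/
def ht (p : S3) : ℝ := (pr p).1.re

/-- The other three of the real coordinates. -/
def rest (p : S3) : ℝ × ℂ := ((pr p).1.im, (pr p).2)

lemma IsBallWithDisc.exists_coord {B d : Set S3} (h : IsBallWithDisc B d) :
    ∃ (G : S3 ≃ₜ S3) (C : Set (ℝ × ℂ)), IsCone C ∧ (∀ p, p ∈ B ↔ 0 < ht (G p)) ∧
      ∀ p, p ∈ d ↔ 0 < ht (G p) ∧ rest (G p) ∈ C := by
  obtain ⟨g, rfl, h⟩ := h
  have hG : ∀ p, ∃ t : ℝ, 0 < t ∧ pr (isRad_perm.homeo (g.symm p)) = t • perm (pr (g.symm p)) :=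
    fun p => isRad_perm.pr_homeo _
  have hB : ∀ p, p ∈ g '' stdBall ↔ 0 < ht ((g.symm.trans isRad_perm.homeo) p) := fun p => by
    obtain ⟨t, ht', e⟩ := hG p
    rw [g.image_eq_preimage_symm]
    change 0 < ((g.symm p).1 1).im ↔ 0 < (pr (isRad_perm.homeo (g.symm p))).1.re
    rw [e, Prod.smul_fst, Complex.smul_re, smul_eq_mul, mul_pos_iff_of_pos_left ht']; rfl
  rcases h with rfl | rfl
  · refine ⟨g.symm.trans isRad_perm.homeo, {s | s.2.re = 0}, fun t _ s hs => ?_, hB, fun p => ?_⟩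
    · simp [show s.2.re = 0 from hs]
    · rw [← hB]
      obtain ⟨t, ht', e⟩ := hG p
      rw [g.image_eq_preimage_symm, g.image_eq_preimage_symm]
      refine and_congr Iff.rfl ?_
      change _ ↔ (pr (isRad_perm.homeo (g.symm p))).2.re = 0
      rw [e, Prod.smul_snd, Complex.smul_re, smul_eq_mul, mul_eq_zero_iff_left ht'.ne']; rfl
  · refine ⟨g.symm.trans isRad_perm.homeo, {s | s.2.re = 0 ∧ 0 ≤ s.2.im}, fun t ht' s hs => ?_, hB,
      fun p => ?_⟩
    · simp [hs.1, mul_nonneg ht'.le hs.2]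
    · rw [← hB]
      obtain ⟨t, ht', e⟩ := hG p
      rw [g.image_eq_preimage_symm, g.image_eq_preimage_symm]
      refine and_congr Iff.rfl ?_
      change _ ↔ (pr (isRad_perm.homeo (g.symm p))).2.re = 0 ∧
        0 ≤ (pr (isRad_perm.homeo (g.symm p))).2.im
      rw [e, Prod.smul_snd, Complex.smul_re, Complex.smul_im, smul_eq_mul, smul_eq_mul,
        mul_eq_zero_iff_left ht'.ne', mul_nonneg_iff_of_pos_left ht']; rfl

lemma isHom_norm (τ : ℝ) : IsHom fun s : ℝ × ℂ => τ * ‖s‖ := fun t ht s => by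
  simp only; rw [norm_smul, Real.norm_of_nonneg ht.le]; ring

lemma isRad_shrink (τ : ℝ) : IsRad (fib fun y s => y + τ * ‖s‖) :=
  isRad_shear (by fun_prop) (isHom_norm τ)

/-- A contraction of a hemisphere towards its centre. -/
def shrink (τ : ℝ) : S3 ≃ₜ S3 := (isRad_shrink τ).homeo

lemma shrink_spec (τ : ℝ) (p : S3) : ∃ t : ℝ, 0 < t ∧
    ht (shrink τ p) = t * (ht p + τ * ‖rest p‖) ∧ rest (shrink τ p) = t • rest p := by
  obtain ⟨t, ht', e⟩ := (isRad_shrink τ).pr_homeo p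
  refine ⟨t, ht', ?_, ?_⟩
  · rw [ht, shrink, e, Prod.smul_fst, Complex.smul_re]; rfl
  · rw [rest, shrink, e, Prod.smul_fst, Complex.smul_im]; rfl

lemma shrink_shrink (τ σ : ℝ) (p : S3) : shrink τ (shrink σ p) = shrink (τ + σ) p := by
  obtain ⟨t, ht', e⟩ := (isRad_shrink σ).pr_homeo p
  obtain ⟨d, -, hd⟩ := (isRad_shrink τ).hom
  have e2 : fib (fun y s => y + τ * ‖s‖) (fib (fun y s => y + σ * ‖s‖) (pr p)) =
      fib (fun y s => y + (τ + σ) * ‖s‖) (pr p) :=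
    Prod.ext (Complex.ext (by simp only [fib]; ring) rfl) rfl
  rw [shrink, shrink, IsRad.homeo_apply, e, hd t ht', proj_smul (pow_pos ht' d), e2, shrink,
    IsRad.homeo_apply]

lemma shrink_zero (p : S3) : shrink 0 p = p := by
  have : fib (fun y s => y + 0 * ‖s‖) (pr p) = pr p := by
    refine Prod.ext (Complex.ext ?_ ?_) ?_ <;> simp [fib]
  rw [shrink, IsRad.homeo_apply, this, proj_pr]

lemma continuous_shrink : Continuous fun q : ℝ × S3 => shrink q.1 q.2 := by
  have h : Continuous fun q : ℝ × S3 => ((((pr q.2).1.re + q.1 * ‖((pr q.2).1.im, (pr q.2).2)‖ : ℝ) : ℂ) +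
      (pr q.2).1.im * Complex.I, (pr q.2).2) := by
    have := continuous_pr
    fun_prop
  refine (continuous_proj h fun q => ?_).congr fun q => ?_
  · rw [← Complex.mk_eq_add_mul_I]
    exact (isRad_shrink q.1).map_ne_zero (pr_ne_zero q.2)
  · rw [shrink, IsRad.homeo_apply, ← Complex.mk_eq_add_mul_I]; rfl

lemma continuous_ht : Continuous ht := by have := continuous_pr; unfold ht; fun_prop
lemma continuous_rest : Continuous rest := by have := continuous_pr; unfold rest; fun_prop

lemma eq_of_rest_eq_zero {p q : S3} (h1 : rest p = 0) (h2 : 0 ≤ ht p) (h3 : rest q = 0)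
    (h4 : 0 ≤ ht q) : p = q := by
  have key : ∀ p, rest p = 0 → 0 ≤ ht p → pr p = (1, 0) := by
    intro p h1 h2
    have e1 : p.1 1 = 0 := (Prod.ext_iff.1 h1).2
    have e2 : p.1 0 = (ht p : ℂ) := Complex.ext rfl (Prod.ext_iff.1 h1).1
    have := pr_norm p
    rw [e1, e2, Complex.norm_real, Real.norm_of_nonneg h2, norm_zero] at this
    have e3 : ht p = 1 := by nlinarith
    exact Prod.ext (by rw [pr, e2, e3]; simp) e1
  exact pr_injective ((key p h1 h2).trans (key q h3 h4).symm)

lemma isotopic_refl_of_ball {B F : Set S3} (hB : IsBallWithDisc B (B ∩ F)) {k : S3 ≃ₜ S3}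
    (hk : ∀ p, p ∉ B → k p = p) (hF : ∀ p, k p ∈ F ↔ p ∈ F) :
    Isotopic F F (Homeomorph.refl S3) k := by
  obtain ⟨G, C, hC, hG, hd⟩ := hB.exists_coord
  set k' : S3 ≃ₜ S3 := G.symm.trans (k.trans G) with hk'
  have hfix : ∀ p, ht p ≤ 0 → k' p = p := fun p hp => by
    have : k (G.symm p) = G.symm p := hk _ fun hm => by
      rw [hG, G.apply_symm_apply] at hm; linarith
    simp [hk', this]
  have hpos : ∀ p, 0 < ht p → 0 < ht (k' p) := fun p hp => by
    by_contra hn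
    rw [k'.injective (hfix _ (not_lt.1 hn))] at hn
    exact hn hp
  have hFC : ∀ p, 0 < ht p → (G.symm p ∈ F ↔ rest p ∈ C) := fun p hp => by
    have := hd (G.symm p)
    rw [Set.mem_inter_iff, hG, G.apply_symm_apply] at this
    simpa [hp] using this
  have hF' : ∀ p, G.symm (k' p) ∈ F ↔ G.symm p ∈ F := fun p => by
    simp only [hk', Homeomorph.trans_apply, G.symm_apply_apply]; exact hF _
  let e : ℝ → S3 ≃ₜ S3 := fun τ => (shrink (-τ)).trans (k'.trans (shrink τ))
  have he : ∀ τ p, e τ p = shrink τ (k' (shrink (-τ) p)) := fun τ p => rfl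
  have hinv : ∀ τ p, shrink τ (shrink (-τ) p) = p := fun τ p => by
    rw [shrink_shrink, add_neg_cancel, shrink_zero]
  have hout : ∀ τ p, ht (shrink (-τ) p) ≤ 0 → e τ p = p := fun τ p h => by
    rw [he, hfix _ h, hinv]
  have heF : ∀ τ, 0 ≤ τ → ∀ p, G.symm (e τ p) ∈ F ↔ G.symm p ∈ F := by
    intro τ hτ p
    rcases le_or_gt (ht (shrink (-τ) p)) 0 with h | h
    · rw [hout τ p h]
    have key : ∀ q, 0 < ht q → (G.symm (shrink τ q) ∈ F ↔ G.symm q ∈ F) := fun q hq => by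
      obtain ⟨t, ht', e1, e2⟩ := shrink_spec τ q
      rw [hFC q hq, hFC, e2, hC.smul_mem_iff ht']
      rw [e1]; positivity
    rw [he, key _ (hpos _ h), hF', ← key _ h, hinv]
  let H : unitInterval × S3 → S3 := fun q => if q.1 = 0 then q.2 else e ((1 - q.1) / q.1) q.2
  have c1 : Continuous fun q : unitInterval × S3 => (1 - (q.1 : ℝ)) * ‖rest q.2‖ :=
    (continuous_const.sub (continuous_subtype_val.comp continuous_fst)).mul
      (continuous_rest.comp continuous_snd).norm
  have c2 : Continuous fun q : unitInterval × S3 => ht q.2 := continuous_ht.comp continuous_snd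
  have hτ : ∀ t : unitInterval, 0 ≤ (1 - (t : ℝ)) / t := fun t =>
    div_nonneg (sub_nonneg.2 t.2.2) t.2.1
  have hpos' : ∀ t : unitInterval, t ≠ 0 → 0 < (t : ℝ) ∧ (t : ℝ) * ((1 - t) / t) = 1 - t := fun t h0 =>
    have h : (t : ℝ) ≠ 0 := fun h => h0 (Subtype.ext h)
    ⟨lt_of_le_of_ne t.2.1 h.symm, mul_div_cancel₀ _ h⟩
  have hH : ∀ t p, t ≠ 0 → H (t, p) = e ((1 - t) / t) p := fun t p h0 => if_neg h0
  have hcont : Continuous H := by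
    refine continuous_of_shrinking
      (C := {q | (1 - (q.1 : ℝ)) * ‖rest q.2‖ ≤ q.1 * ht q.2} ∩ {q | 0 ≤ ht q.2})
      ((isClosed_le c1 ((continuous_subtype_val.comp continuous_fst).mul c2)).inter
        (isClosed_le continuous_const c2)) ?_ (fun p => if_pos rfl) ?_ ?_ ?_
    · intro t p h0
      have h1 : ContinuousAt (fun q : unitInterval × S3 => (1 - (q.1 : ℝ)) / q.1) (t, p) :=
        ContinuousAt.div (by fun_prop) (by fun_prop) (hpos' t h0).1.ne'
      have h2 := continuous_shrink.continuousAt.comp (h1.neg.prodMk continuousAt_snd)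
      have h3 := continuous_shrink.continuousAt.comp
        (h1.prodMk (k'.continuous.continuousAt.comp h2))
      refine h3.congr ?_
      filter_upwards [(isOpen_ne.preimage continuous_fst).mem_nhds (show (t, p).1 ≠ 0 from h0)]
        with q hq
      exact (if_neg hq).symm
    · intro t p hq
      by_cases h0 : t = 0
      · exact if_pos h0
      rw [hH t p h0]
      refine hout _ _ (not_lt.1 fun hlt => hq ?_)
      obtain ⟨a, ha, e1, -⟩ := shrink_spec (-((1 - (t : ℝ)) / t)) p
      rw [e1, mul_pos_iff_of_pos_left ha] at hlt
      obtain ⟨h1, h2⟩ := hpos' t h0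
      have h3 := mul_nonneg (hτ t) (norm_nonneg (rest p))
      refine ⟨?_, show 0 ≤ ht p by linarith⟩
      change (1 - (t : ℝ)) * ‖rest p‖ ≤ t * ht p
      rw [← h2, mul_assoc]
      exact mul_le_mul_of_nonneg_left (by linarith) h1.le
    · intro t p hq
      by_cases h0 : t = 0
      · rwa [show H (t, p) = p from if_pos h0]
      obtain ⟨h2, h3⟩ := hpos' t h0
      have h4 := hτ t
      rw [hH t p h0]
      set τ := (1 - (t : ℝ)) / t
      rcases le_or_gt (ht (shrink (-τ) p)) 0 with h | h
      · rwa [hout _ p h]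
      · have h1 := hpos _ h
        rw [he]
        obtain ⟨a, ha, e1, e2⟩ := shrink_spec τ (k' (shrink (-τ) p))
        refine ⟨?_, show 0 ≤ ht _ by rw [e1]; positivity⟩
        change (1 - (t : ℝ)) * ‖rest _‖ ≤ t * ht _
        rw [e1, e2, norm_smul, Real.norm_of_nonneg ha.le, ← h3]
        have := mul_pos h2 (mul_pos ha h1)
        linarith
    · have key : ∀ p : S3, (1 - ((0 : unitInterval) : ℝ)) * ‖rest p‖ ≤ (0 : unitInterval) * ht p →
          rest p = 0 := fun p h => by simpa using h
      exact fun p q hp hq => eq_of_rest_eq_zero (key p hp.1) hp.2 (key q hq.1) hq.2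
  refine ⟨⟨fun q => G.symm (H (q.1, G q.2)), G.symm.continuous.comp (hcont.comp
    (continuous_fst.prodMk (G.continuous.comp continuous_snd)))⟩, fun p => ?_, fun p => ?_, fun t => ?_⟩
  · exact (congrArg G.symm (if_pos rfl)).trans (G.symm_apply_apply p)
  · change G.symm (H (1, G p)) = k p
    rw [hH 1 _ one_ne_zero, he]
    simp [shrink_zero, hk']
  · by_cases h0 : t = 0
    · exact ⟨Homeomorph.refl S3, fun p => (congrArg G.symm (if_pos h0)).trans (G.symm_apply_apply p),
        Set.image_id F⟩
    · refine ⟨G.trans ((e ((1 - t) / t)).trans G.symm), fun p => ?_, image_eq_of_mem_iff fun p => ?_⟩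
      · exact congrArg G.symm (hH t _ h0)
      · exact (heF _ (hτ t) (G p)).trans (by rw [G.symm_apply_apply])

/-! ## The morphisms of splittings -/

lemma mem_closure_of_add {C : Set (ℂ × ℂ)} (hC : IsCone C) (h0 : (0 : ℂ × ℂ) ∉ C) {p : S3}
    {e : ℂ × ℂ} (h : ∀ ε : ℝ, 0 < ε → pr p + ε • e ∈ C) : p ∈ closure {q | pr q ∈ C} := by
  have h1 : Tendsto (fun ε : ℝ => pr p + ε • e) (𝓝[>] 0) (𝓝 (pr p)) := by
    have : Continuous fun ε : ℝ => pr p + ε • e := by fun_prop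
    simpa using (this.tendsto 0).mono_left nhdsWithin_le_nhds
  have h2 := (continuousOn_proj.continuousAt (isOpen_ne.mem_nhds (pr_ne_zero p))).tendsto.comp h1
  rw [proj_pr] at h2
  refine mem_closure_of_tendsto h2 ?_
  filter_upwards [self_mem_nhdsWithin] with ε hε
  obtain ⟨t, ht, e'⟩ := pr_proj_exists fun h' => h0 (h' ▸ h ε hε)
  change pr (proj _) ∈ C
  rw [e']
  exact hC t ht _ (h ε hε)

lemma closure_stdDisc : closure stdDisc = {p | (p.1 1).re = 0 ∧ 0 ≤ (p.1 1).im} := by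
  refine Set.Subset.antisymm (closure_minimal (fun p hp => ⟨hp.2, hp.1.le⟩) ?_) fun p hp => ?_
  · have h : Continuous fun p : S3 => p.1 1 := by fun_prop
    exact (isClosed_eq (Complex.continuous_re.comp h) continuous_const).inter
      (isClosed_le continuous_const (Complex.continuous_im.comp h))
  · refine mem_closure_of_add (C := {v | 0 < v.2.im ∧ v.2.re = 0}) (fun t ht v hv => ?_)
      (fun h => h.1.false) (e := (0, Complex.I)) fun ε hε => ?_
    · simp [hv.2, mul_pos ht hv.1]
    · simp [pr, hp.1, add_pos_of_nonneg_of_pos hp.2 hε]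

lemma IsBallWithDisc.image {B d : Set S3} (h : IsBallWithDisc B d) (c : S3 ≃ₜ S3) :
    IsBallWithDisc (c '' B) (c '' d) := by
  obtain ⟨g, rfl, h⟩ := h
  refine ⟨g.trans c, Set.image_comp c g _, ?_⟩
  rw [show ⇑(g.trans c) = c ∘ g from rfl, Set.image_comp, Set.image_comp]
  exact h.imp (congrArg _) (congrArg _)

lemma IsBallWithDisc.of_coord {B T : Set S3} {G : S3 ≃ₜ S3}
    (h : ∀ p, (p ∈ B ↔ 0 < ((G p).1 1).im) ∧ (p ∈ T ↔ ((G p).1 1).re = 0 ∧ 0 ≤ ((G p).1 1).im)) :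
    IsBallWithDisc B (B ∩ T) ∧ closure (B ∩ T) = T := by
  have hd : G.symm '' stdDisc = B ∩ T := image_eq_of_mem_iff fun q => by
    rw [Set.mem_inter_iff, (h _).1, (h _).2, G.apply_symm_apply]
    exact ⟨fun h => ⟨h.1, h.2.1⟩, fun h => ⟨h.1, h.2, h.1.le⟩⟩
  refine ⟨⟨G.symm, image_eq_of_mem_iff fun q => ?_, .inl hd⟩, ?_⟩
  · rw [(h _).1, G.apply_symm_apply]; rfl
  · rw [← hd, ← G.symm.image_closure, closure_stdDisc]
    exact image_eq_of_mem_iff fun q => by rw [(h _).2, G.apply_symm_apply]; rfl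

lemma push_push_spec {n lo hi N y z : ℝ} (hN : N = max 0 n)
    (hb : (0 < n ∧ lo < n ∧ n < hi) ∨ (n ≤ 0 ∧ lo = 0 ∧ hi = 0))
    (hz : z = push 0 (hi - N) N (2 * (hi - N) + 2 * N)
      (push (2 * (lo - N) - 2 * N) (lo - N) (-N) 0 (y - N))) :
    (lo < y ∧ y < hi ↔ 0 < n - |z|) ∧ (0 ≤ n ∧ y = n ↔ z = 0 ∧ 0 ≤ n - |z|) := by
  rcases hb with ⟨h1, h2, h3⟩ | ⟨h1, rfl, rfl⟩
  · obtain rfl : N = n := hN.trans (max_eq_right h1.le)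
    have k1 : PushOK (2 * (lo - N) - 2 * N) (lo - N) (-N) 0 :=
      .inr ⟨by linarith, by linarith, by linarith, by linarith⟩
    have k2 : PushOK 0 (hi - N) N (2 * (hi - N) + 2 * N) :=
      .inr ⟨by linarith, by linarith, by linarith, by linarith⟩
    have hm := (push_strictMono k2).comp (push_strictMono k1)
    have i1 := hm.lt_iff_lt (a := lo - N) (b := y - N)
    have i2 := hm.lt_iff_lt (a := y - N) (b := hi - N)
    have i3 := hm.injective.eq_iff (a := y - N) (b := 0)
    simp only [Function.comp, ← hz] at i1 i2 i3
    rw [push_self k1, push_of_le k2 (by linarith)] at i1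
    rw [push_of_ge k1 (y := hi - N) (by linarith), push_self k2] at i2
    rw [push_of_ge k1 le_rfl, push_of_le k2 le_rfl] at i3
    rw [sub_pos, abs_lt, i1, i2, i3]
    refine ⟨by simp, fun h => ⟨sub_eq_zero.2 h.2, ?_⟩, fun h => ⟨h1.le, sub_eq_zero.1 h.1⟩⟩
    rw [i3.2 (sub_eq_zero.2 h.2), abs_zero]; linarith
  · obtain rfl : N = 0 := hN.trans (max_eq_left h1)
    have : z = y := by rw [hz]; simp [push]
    subst this
    refine ⟨⟨fun h => by linarith [h.1, h.2], fun h => by linarith [abs_nonneg z]⟩, fun h => ?_, fun h => ?_⟩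
    · obtain rfl : n = 0 := le_antisymm h1 h.1
      simp [h.2]
    · obtain ⟨rfl, h⟩ := h
      rw [abs_zero, sub_zero] at h
      exact ⟨h, le_antisymm h h1⟩

lemma isRad_swap : IsRad Prod.swap :=
  ⟨continuous_swap, Prod.swap_bijective, 1, one_ne_zero, fun t _ v => by rw [pow_one]; rfl⟩

namespace Moves

variable {P Q : Diagram} {r : Rect} {x y : S1} {lo hi : ℝ × ℂ → ℝ} {c : S3 ≃ₜ S3}

/-- The domain in which the surface is modified. -/
def zone (r : Rect) (lo hi : ℝ × ℂ → ℝ) : Set S3 := {p | r.coord (pr p) ∈ between lo hi}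

lemma X_pos (h : Moves r x y lo hi c) {p : S3} (hp : p ∈ zone r lo hi) :
    0 < r.X (r.coord (pr p)).2 := by
  rcases h.bounds ((r.coord (pr p)).1.im, (r.coord (pr p)).2) with hb | ⟨-, h1, h2⟩
  · exact hb.1
  · have := hp.1.trans hp.2
    rw [h1, h2] at this
    exact this.false.elim

lemma zone_iff (h : Moves r x y lo hi c) (p : S3) : c p ∈ zone r lo hi ↔ p ∈ zone r lo hi := by
  by_cases hp : p ∈ zone r lo hi
  · refine iff_of_true (by_contra fun hc => hc ?_) hp
    rwa [c.injective (h.fix _ hc)]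
  · rw [h.fix p hp]

lemma exists_coord (h : Moves r x y lo hi c) : ∃ G : S3 ≃ₜ S3, ∀ p,
    (p ∈ zone r lo hi ↔ 0 < ((G p).1 1).im) ∧
    (p ∈ tile r ↔ ((G p).1 1).re = 0 ∧ 0 ≤ ((G p).1 1).im) := by
  set N : ℝ × ℂ → ℝ := fun s => max 0 (r.X s.2) with hN
  have cN : Continuous N := continuous_const.max (r.continuous_X.comp continuous_snd)
  have jN : IsHom N := fun t ht s => by
    simp only [hN]; rw [Prod.smul_snd, r.isHom_X t ht, mul_max_of_nonneg _ _ ht.le, mul_zero]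
  obtain ⟨cl, ch⟩ := h.cont
  obtain ⟨jl, jh⟩ := h.hom
  have bN : ∀ s, (0 < N s ∧ lo s < N s ∧ N s < hi s) ∨ (N s = 0 ∧ lo s = 0 ∧ hi s = 0) := fun s => by
    rcases h.bounds s with ⟨h1, -, h3, h4⟩ | ⟨h1, h2⟩
    · rw [show N s = r.X s.2 from max_eq_right h1.le]; exact .inl ⟨h1, h4, h3⟩
    · exact .inr ⟨max_eq_left h1, h2⟩
  have r1 := isRad_shear (f := fun s => -N s) cN.neg fun t ht s => by simp only; rw [jN t ht]; ring
  have r2 := isRad_push (p := fun s => 2 * (lo s - N s) - 2 * N s) (q := fun s => lo s - N s)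
    (q' := fun s => -N s) (r := fun _ => 0) (by fun_prop) (by fun_prop) cN.neg continuous_const
    (fun t ht s => by simp only; rw [jN t ht, jl t ht]; ring)
    (fun t ht s => by simp only; rw [jN t ht, jl t ht]; ring)
    (fun t ht s => by simp only; rw [jN t ht]; ring) (fun t ht s => by simp) fun s => by
      rcases bN s with ⟨h1, h2, h3⟩ | ⟨h1, h2, h3⟩
      · exact .inr ⟨by linarith, by linarith, by linarith, by linarith⟩
      · exact .inl (by rw [h1, h2]; simp)
  have r3 := isRad_push (p := fun _ => 0) (q := fun s => hi s - N s)
    (q' := N) (r := fun s => 2 * (hi s - N s) + 2 * N s) continuous_const (by fun_prop) cN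
    (by fun_prop) (fun t ht s => by simp) (fun t ht s => by simp only; rw [jN t ht, jh t ht]; ring) jN
    (fun t ht s => by simp only; rw [jN t ht, jh t ht]; ring) fun s => by
      rcases bN s with ⟨h1, h2, h3⟩ | ⟨h1, h2, h3⟩
      · exact .inr ⟨by linarith, by linarith, by linarith, by linarith⟩
      · exact .inl (by rw [h1, h3]; simp)
  have r4 := isRad_shear (f := fun s : ℝ × ℂ => -|s.2.re|) (by fun_prop) fun t ht s => by
    simp [abs_mul, abs_of_pos ht]
  have hR := ((((((r.isRad_coord).comp r1).comp r2).comp r3).comp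
    (isRad_swap.comp (isRad_straight r.hθ))).comp r4).comp isRad_perm
  refine ⟨hR.homeo, fun p => ?_⟩
  obtain ⟨t, ht, e⟩ := hR.pr_homeo p
  set v := r.coord (pr p) with hv
  set s : ℝ × ℂ := (v.1.im, v.2)
  set z : ℝ := push 0 (hi s - N s) (N s) (2 * (hi s - N s) + 2 * N s)
      (push (2 * (lo s - N s) - 2 * N s) (lo s - N s) (-N s) 0 (v.1.re + -N s)) with hz
  have e1 : ((hR.homeo p).1 1).re = t * z := by
    rw [show (hR.homeo p).1 1 = _ from (Prod.ext_iff.1 e).2, Prod.smul_snd, Complex.smul_re]; rfl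
  have e2 : ((hR.homeo p).1 1).im = t * (r.X v.2 - |z|) := by
    rw [show (hR.homeo p).1 1 = _ from (Prod.ext_iff.1 e).2, Prod.smul_snd, Complex.smul_im]; rfl
  rw [e1, e2, mul_eq_zero_iff_left ht.ne', mul_pos_iff_of_pos_left ht, mul_nonneg_iff_of_pos_left ht,
    r.mem_tile_iff']
  exact push_push_spec (N := N s) rfl ((h.bounds s).imp (fun h => ⟨h.1, h.2.2.2, h.2.2.1⟩) id) hz

end Moves

namespace IsSplit

variable {P Q : Diagram} {r : Rect} {x y : S1} {lo hi : ℝ × ℂ → ℝ} {c : S3 ≃ₜ S3}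

/-- The set of points of the other tiles. -/
def others (P : Diagram) (r : Rect) : Set S3 := ⋃ q ∈ {q | q ∈ P.rects ∧ q ≠ r}, tile q

lemma isClosed_others : IsClosed (others P r) :=
  (P.rects.finite_toSet.subset fun _ h => h.1).isClosed_biUnion fun q _ => isClosed_tile q

lemma mem_others {p : S3} : p ∈ others P r ↔ ∃ q ∈ P.rects, q ≠ r ∧ p ∈ tile q := by
  simp [others, and_assoc]

lemma not_mem_others (h : IsSplit P Q r x y) (p : S3) (h0 : 0 < r.X (r.coord (pr p)).2)
    (h1 : rad (splitBump r x y) (r.coord (pr p)).2 ≤ (r.coord (pr p)).1.re)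
    (h2 : (r.coord (pr p)).1.re ≤ r.X (r.coord (pr p)).2) : p ∉ others P r := by
  rw [mem_others]
  rintro ⟨q, hq, hqr, hp⟩
  exact h.not_mem_cone (v := sq (pr p)) hq hqr h0 h1 h2 ((q.mem_tile_iff p).1 hp)

lemma part_ne_self (h : IsSplit P Q r x y) : ¬ IsPart r x y r := by
  have h1 := h.lt
  rintro (⟨-, -, e, -⟩ | ⟨-, e, -⟩ | ⟨e, -⟩)
  · exact r.hφ e
  · rw [← e] at h1; exact h1.not_ge h.le
  · rw [← e, arc_self] at h1; exact h1.not_ge (arc_nonneg _ _)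

lemma mem_parts (h : IsSplit P Q r x y) (p : S3) : (∃ q, IsPart r x y q ∧ p ∈ tile q) ↔
    0 ≤ r.X (r.coord (pr p)).2 ∧ (r.coord (pr p)).1.re = rad (splitBump r x y) (r.coord (pr p)).2 := by
  simp only [Rect.mem_tile_iff]
  exact h.parts_cone (sq (pr p))

lemma mem_added (h : IsSplit P Q r x y) (p : S3) :
    p ∈ ⋃ q ∈ (Q.rects : Set Rect) \ (P.rects : Set Rect), tile q ↔
    0 ≤ r.X (r.coord (pr p)).2 ∧ (r.coord (pr p)).1.re = rad (splitBump r x y) (r.coord (pr p)).2 := by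
  have key : ∀ q, q ∈ (Q.rects : Set Rect) \ (P.rects : Set Rect) ↔ IsPart r x y q := fun q => by
    simp only [Set.mem_sdiff, Finset.mem_coe, h.rects]
    exact ⟨fun ⟨h1, h2⟩ => h1.resolve_left fun h3 => h2 h3.1, fun hq => ⟨.inr hq, fun hP =>
      h.part_ne hP (fun e => h.part_ne_self (e ▸ hq)) hq rfl⟩⟩
  simp only [mem_iUnion, key, exists_prop, h.mem_parts]

lemma iUnion_removed (h : IsSplit P Q r x y) :
    ⋃ q ∈ (P.rects : Set Rect) \ (Q.rects : Set Rect), tile q = tile r := by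
  have key : ∀ q, q ∈ (P.rects : Set Rect) \ (Q.rects : Set Rect) ↔ q = r := fun q => by
    simp only [Set.mem_sdiff, Finset.mem_coe, h.rects]
    refine ⟨fun ⟨h1, h2⟩ => by_contra fun h3 => h2 (.inl ⟨h1, h3⟩), ?_⟩
    rintro rfl
    exact ⟨h.mem, fun h2 => h.part_ne_self (h2.resolve_left fun h => h.2 rfl)⟩
  simp [key]

lemma surface_left (h : IsSplit P Q r x y) : P.surface = others P r ∪ tile r := by
  ext p
  simp only [Diagram.surface, Set.mem_union, mem_others, mem_iUnion, exists_prop]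
  refine ⟨fun ⟨q, h1, h2⟩ => ?_, ?_⟩
  · by_cases e : q = r
    · exact .inr (e ▸ h2)
    · exact .inl ⟨q, h1, e, h2⟩
  · rintro (⟨q, h1, -, h2⟩ | h1)
    · exact ⟨q, h1, h2⟩
    · exact ⟨r, h.mem, h1⟩

lemma mem_surface_right (h : IsSplit P Q r x y) (p : S3) : p ∈ Q.surface ↔ p ∈ others P r ∨
    (0 ≤ r.X (r.coord (pr p)).2 ∧
      (r.coord (pr p)).1.re = rad (splitBump r x y) (r.coord (pr p)).2) := by
  rw [← h.mem_parts, mem_others]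
  simp only [Diagram.surface, mem_iUnion, exists_prop, h.rects, or_and_right, exists_or, and_assoc]

lemma surface_right (h : IsSplit P Q r x y) (hm : Moves r x y lo hi c) :
    Q.surface = others P r ∪ c '' tile r := by
  ext p
  rw [h.mem_surface_right, Set.mem_union, ← c.apply_symm_apply p, hm.tile_iff,
    c.injective.mem_set_image]

lemma mem_others_iff (hU : Disjoint (Moves.zone r lo hi) (others P r)) (hm : Moves r x y lo hi c)
    (p : S3) : c p ∈ others P r ↔ p ∈ others P r := by
  by_cases hp : p ∈ Moves.zone r lo hi
  · exact iff_of_false (disjoint_left.1 hU ((hm.zone_iff p).2 hp)) (disjoint_left.1 hU hp)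
  · rw [hm.fix p hp]

lemma image_surface (h : IsSplit P Q r x y) (hm : Moves r x y lo hi c)
    (hU : Disjoint (Moves.zone r lo hi) (others P r)) : c '' P.surface = Q.surface := by
  rw [h.surface_left, h.surface_right hm, Set.image_union, image_eq_of_mem_iff (mem_others_iff hU hm)]

lemma halfWrinkleHomeo (h : IsSplit P Q r x y) (hm : Moves r x y lo hi c)
    (hU : Disjoint (Moves.zone r lo hi) (others P r)) : HalfWrinkleHomeo P Q c := by
  obtain ⟨G, hG⟩ := hm.exists_coord
  obtain ⟨hb, hcl⟩ := IsBallWithDisc.of_coord hG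
  have hZ : c '' Moves.zone r lo hi = Moves.zone r lo hi := image_eq_of_mem_iff hm.zone_iff
  have e1 : Moves.zone r lo hi ∩ P.surface = Moves.zone r lo hi ∩ tile r := by
    rw [h.surface_left, Set.inter_union_distrib_left, hU.inter_eq, Set.empty_union]
  have e2 : Moves.zone r lo hi ∩ Q.surface = c '' (Moves.zone r lo hi ∩ tile r) := by
    rw [h.surface_right hm, Set.inter_union_distrib_left, hU.inter_eq, Set.empty_union,
      Set.image_inter c.injective, hZ]
  refine ⟨h.image_surface hm hU, Moves.zone r lo hi, ?_, ?_, ?_, ?_, ⟨r.θ₁, ?_⟩, hm.fix⟩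
  · rwa [e1]
  · rw [e2]; have := hb.image c; rwa [hZ] at this
  · rw [e1, hcl, h.iUnion_removed]
  · rw [e2, ← c.image_closure, hcl]
    exact image_eq_of_mem_iff fun p => by rw [h.mem_added, hm.tile_iff]
  · refine disjoint_left.2 fun p hp hp' => ?_
    obtain ⟨h1, h2⟩ := r.X_pos_iff.1 (hm.X_pos hp)
    rcases sq_mem_page.1 hp' with h3 | h3
    · exact h1 h3
    · exact left_not_mem_cIoo _ _ (h3 ▸ h2)

lemma exists_canonical (h : IsSplit P Q r x y) {U : Set S3} (hUo : IsOpen U)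
    (hU : ∀ p : S3, 0 < r.X (r.coord (pr p)).2 →
      rad (splitBump r x y) (r.coord (pr p)).2 ≤ (r.coord (pr p)).1.re →
      (r.coord (pr p)).1.re ≤ r.X (r.coord (pr p)).2 → p ∈ U) :
    ∃ c : S3 ≃ₜ S3, HalfWrinkleHomeo P Q c ∧ (∀ θ, c '' page θ = page θ) ∧ (∀ p, p ∉ U → c p = p) ∧
      ∀ p, r.X (r.coord (pr p)).2 ≤ 0 → c p = p := by
  obtain ⟨lo, hi, c, hm, hz⟩ := h.exists_moves (hUo.inter isClosed_others.isOpen_compl)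
    fun p h1 h2 h3 => ⟨hU p h1 h2 h3, h.not_mem_others p h1 h2 h3⟩
  exact ⟨c, h.halfWrinkleHomeo hm (disjoint_left.2 fun p hp => (hz p hp).2),
    fun θ => image_eq_of_mem_iff fun p => hm.page_iff p θ,
    fun p hp => hm.fix p fun hp' => hp (hz p hp').1,
    fun p hp => hm.fix p fun hp' => (hm.X_pos hp').not_ge hp⟩

end IsSplit

lemma mem_iff_of_image {e : S3 ≃ₜ S3} {S T : Set S3} (h : e '' S = T) (p : S3) : e p ∈ T ↔ p ∈ S := by
  rw [← h, e.injective.mem_set_image]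

namespace IsCanonicalMorphism

variable {F F' F'' : Set S3} {f g : S3 ≃ₜ S3}

lemma trans (h : IsCanonicalMorphism F F' f) (h' : IsCanonicalMorphism F' F'' g) :
    IsCanonicalMorphism F F'' (f.trans g) := by
  obtain ⟨c, c1, c2, c3, c4⟩ := h
  obtain ⟨d, d1, d2, d3, d4⟩ := h'
  refine ⟨c.trans d, ?_, fun p hp => ?_, fun θ => ?_, c4.comp d4⟩
  · rw [← d1, ← c1, ← Set.image_comp]; rfl
  · rw [Homeomorph.trans_apply, c2 p hp, d2 p hp]
  · rw [show ⇑(c.trans d) = d ∘ c from rfl, Set.image_comp, c3, d3]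

lemma symm (h : IsCanonicalMorphism F F' f) : IsCanonicalMorphism F' F f.symm := by
  obtain ⟨c, c1, c2, c3, c4⟩ := h
  refine ⟨c.symm, image_eq_of_mem_iff fun p => ?_, fun p hp => ?_, fun θ => image_eq_of_mem_iff fun p => ?_,
    c4.inv⟩
  · rw [← mem_iff_of_image c1, c.apply_symm_apply]
  · rw [c.symm_apply_eq, c2 p hp]
  · rw [← mem_iff_of_image (c3 θ), c.apply_symm_apply]

end IsCanonicalMorphism

lemma X_nonpos_of_mem_page {r : Rect} {p : S3} {θ : S1} (hθ : θ ∉ cIoo r.θ₁ r.θ₂)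
    (hp : p ∈ page θ) : r.X (r.coord (pr p)).2 ≤ 0 := by
  by_contra! hc
  obtain ⟨h1, h2⟩ := r.X_pos_iff.1 hc
  exact (sq_mem_page.1 hp).elim h1 fun h3 => hθ (h3 ▸ h2)

lemma binding_subset_page (θ : S1) : binding ⊆ page θ := fun _ hp => mem_page.2 (.inl hp)

namespace IsSplit

variable {P Q : Diagram} {r : Rect} {x y : S1} {f : S3 ≃ₜ S3}

lemma mem_ball (h : IsSplit P Q r x y) {B : Set S3} {G : S3 ≃ₜ S3}
    (hG : ∀ p, p ∈ B ↔ 0 < ht (G p)) (him : f '' P.surface = Q.surface)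
    (hT : tile r ⊆ closure B)
    {θ : S1} (hθ : Disjoint B (page θ)) (hfix : ∀ p, p ∉ B → f p = p) (p : S3)
    (h1 : 0 < r.X (r.coord (pr p)).2)
    (h2 : rad (splitBump r x y) (r.coord (pr p)).2 ≤ (r.coord (pr p)).1.re)
    (h3 : (r.coord (pr p)).1.re ≤ r.X (r.coord (pr p)).2) : p ∈ B := by
  set X : S3 → ℝ := fun p => r.X (r.coord (pr p)).2 with hX
  set Y : S3 → ℝ := fun p => (r.coord (pr p)).1.re
  set S : S3 → ℝ := fun p => rad (splitBump r x y) (r.coord (pr p)).2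
  have cc : Continuous fun p => r.coord (pr p) := r.isRad_coord.cont.comp continuous_pr
  have cX : Continuous X := r.continuous_X.comp (continuous_snd.comp cc)
  have cY : Continuous Y := Complex.continuous_re.comp (continuous_fst.comp cc)
  have cS : Continuous S := (continuous_rad (continuous_splitBump r x y)).comp (continuous_snd.comp cc)
  have tl : ∀ p, p ∈ tile r ↔ 0 ≤ X p ∧ Y p = X p := r.mem_tile_iff'
  have top : ∀ p, 0 < X p → Y p = X p → p ∈ B := fun p hp e => by
    by_contra hB
    have h4 := (mem_iff_of_image him p).2 (h.surface_left ▸ .inr ((tl p).2 ⟨hp.le, e⟩))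
    rw [hfix p hB, h.mem_surface_right] at h4
    have h5 : S p < X p := h.rad_lt hp
    rcases h4 with h4 | h4
    · exact h.not_mem_others p hp (h5.le.trans e.ge) e.le h4
    · exact h5.ne (h4.2.symm.trans e)
  have bot : ∀ p, 0 < X p → Y p = S p → p ∈ B := fun p hp e => by
    by_contra hB
    have h4 := (h.mem_surface_right p).2 (.inr ⟨hp.le, e⟩)
    rw [← hfix p hB, mem_iff_of_image him, h.surface_left] at h4
    have h5 : S p < X p := h.rad_lt hp
    rcases h4 with h4 | h4
    · exact h.not_mem_others p hp e.ge (e.trans_le h5.le) h4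
    · exact h5.ne (e.symm.trans ((tl p).1 h4).2)
  rcases h2.eq_or_lt with h2 | h2
  · exact bot p h1 h2.symm
  rcases h3.eq_or_lt with h3 | h3
  · exact top p h1 h3
  let W : Set S3 := {p | 0 < X p ∧ S p < Y p ∧ Y p < X p}
  have hWo : IsOpen W := (isOpen_lt continuous_const cX).inter ((isOpen_lt cS cY).inter (isOpen_lt cY cX))
  have hWc : closure W ⊆ {p | 0 ≤ X p ∧ S p ≤ Y p ∧ Y p ≤ X p} :=
    closure_minimal (fun p hp => ⟨hp.1.le, hp.2.1.le, hp.2.2.le⟩)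
      ((isClosed_le continuous_const cX).inter ((isClosed_le cS cY).inter (isClosed_le cY cX)))
  have hfr : frontier W ⊆ closure B := by
    intro p hp
    rw [hWo.frontier_eq] at hp
    obtain ⟨a1, a2, a3⟩ := hWc hp.1
    rcases a1.eq_or_lt with a1 | a1
    · have : S p = 0 := h.rad_eq_zero a1.ge
      exact hT ((tl p).2 ⟨a1.le, by linarith⟩)
    · rcases a2.eq_or_lt with a2 | a2
      · exact subset_closure (bot p a1 a2.symm)
      · refine subset_closure (top p a1 (a3.eq_or_lt.resolve_right fun a3 => hp.2 ⟨a1, a2, a3⟩))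
  -- the exterior of the ball
  let E : Set S3 := {p | ht (G p) < 0}
  have hEB : Disjoint E (closure B) := by
    have hEo : IsOpen E := isOpen_lt (continuous_ht.comp G.continuous) continuous_const
    exact (disjoint_left.2 fun p hp hB => ((hG p).1 hB).not_gt hp).closure_right hEo
  have hEc : ∀ p, p ∉ B → p ∈ closure E := fun p hp => by
    have e : G.symm '' {q | pr q ∈ {v : ℂ × ℂ | v.1.re < 0}} = E :=
      image_eq_of_mem_iff fun q => by
        change ht (G (G.symm q)) < 0 ↔ _; rw [G.apply_symm_apply]; rfl
    rw [← e, ← G.symm.image_closure]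
    refine ⟨G p, mem_closure_of_add (fun t ht v hv => ?_) (fun h => lt_irrefl (0 : ℝ) h) (e := (-1, 0))
      fun ε hε => ?_, G.symm_apply_apply p⟩
    · change (t • v.1).re < 0
      rw [Complex.smul_re]
      exact mul_neg_of_pos_of_neg ht hv
    · have : ht (G p) ≤ 0 := not_lt.1 fun h => hp ((hG p).2 h)
      change ((pr (G p)).1 + ε • (-1 : ℂ)).re < 0
      simp only [Complex.add_re, Complex.smul_re, Complex.neg_re, Complex.one_re, smul_eq_mul]
      change ht (G p) + _ < 0
      linarith
  have hEp : IsPreconnected E := by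
    have h1 : Convex ℝ {v : ℂ × ℂ | v.1.re < 0} :=
      convex_halfSpace_lt ((Complex.reLm ∘ₗ LinearMap.fst ℝ ℂ ℂ).isLinear) 0
    have h2 := h1.isPreconnected.image (fun v => G.symm (proj v))
      (G.symm.continuous.comp_continuousOn (continuousOn_proj.mono fun v hv e => by
        rw [e] at hv; exact lt_irrefl (0 : ℝ) hv))
    convert h2 using 1
    ext p
    constructor
    · exact fun hp => ⟨pr (G p), hp, by simp only; rw [proj_pr, G.symm_apply_apply]⟩
    · rintro ⟨v, hv, rfl⟩
      obtain ⟨t, ht', e⟩ := pr_proj_exists (v := v) fun e => by rw [e] at hv; exact lt_irrefl (0 : ℝ) hv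
      change ht (G (G.symm (proj v))) < 0
      rw [G.apply_symm_apply, ht, e, Prod.smul_fst, Complex.smul_re]
      exact mul_neg_of_pos_of_neg ht' hv
  by_contra hB
  obtain ⟨q, hqW, hqE⟩ := mem_closure_iff.1 (hEc p hB) W hWo ⟨h1, h2, h3⟩
  have hsub : E ⊆ W := hEp.subset_of_closure_inter_subset hWo ⟨q, hqE, hqW⟩ fun a ha => by
    by_contra hns
    exact disjoint_left.1 hEB ha.2 (hfr (hWo.frontier_eq ▸ ⟨ha.1, hns⟩))
  obtain ⟨φ, hφ⟩ := cIoo_nonempty r.hφ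
  have hz : ((1 : ℝ) * expi φ, 0) ≠ (0 : ℂ × ℂ) := fun e => by
    have := congrArg (fun v : ℂ × ℂ => ‖v.1‖) e
    simp [norm_expi] at this
  obtain ⟨t, ht', e⟩ := pr_proj_exists hz
  set b := proj ((1 : ℝ) * expi φ, 0)
  have hb : b.1 1 = 0 := by
    rw [show b.1 1 = _ from (Prod.ext_iff.1 e).2]; simp
  have hb0 : b.1 0 = t • ((1 : ℝ) * expi φ) := (Prod.ext_iff.1 e).1
  obtain ⟨a1, a2, a3⟩ := hWc (closure_mono hsub (hEc b (Set.disjoint_right.1 hθ (binding_subset_page θ hb))))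
  have k1 : X b = 0 := by
    change rad _ (‖b.1 1‖ • b.1 1) = 0
    rw [rad_norm_smul, hb]; simp
  have k2 : 0 < Y b := by
    change 0 < rad _ (‖b.1 0‖ • b.1 0)
    have h0 : b.1 0 ≠ 0 := fun h0 => pr_ne_zero b (Prod.ext h0 hb)
    rw [rad_norm_smul]
    refine mul_pos (by positivity) ((sb_pos_iff r.hφ).2 ?_)
    rw [hb0, ang_smul ht' (fun h => h0 (by rw [hb0, h, smul_zero])), ang_mul_expi one_pos]
    exact hφ
  linarith

lemma isCanonicalMorphism (h : IsSplit P Q r x y) (hf : HalfWrinkleHomeo P Q f) :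
    IsCanonicalMorphism P.surface Q.surface f := by
  obtain ⟨him, B, hBP, -, hcP, -, ⟨θ, hθ⟩, hfix⟩ := hf
  obtain ⟨G, -, -, hG, -⟩ := hBP.exists_coord
  rw [h.iUnion_removed] at hcP
  have hBo : IsOpen B := by
    rw [show B = {p | 0 < ht (G p)} from Set.ext hG]
    exact isOpen_lt continuous_const (continuous_ht.comp G.continuous)
  obtain ⟨c, hc, hpage, hcB, hcX⟩ := h.exists_canonical hBo (h.mem_ball hG him
    (hcP ▸ closure_mono Set.inter_subset_left) hθ hfix)
  refine ⟨c, hc.1, fun p hp => hcX p ?_, hpage, Isotopic.symm ?_⟩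
  · exact X_nonpos_of_mem_page (left_not_mem_cIoo _ _) (binding_subset_page _ hp)
  · have h1 := isotopic_refl_of_ball hBP (k := f.trans c.symm) (fun p hp => by
      rw [Homeomorph.trans_apply, hfix p hp, c.symm_apply_eq, hcB p hp]) fun p => by
        rw [← mem_iff_of_image hc.1, Homeomorph.trans_apply, c.apply_symm_apply, mem_iff_of_image him]
    have h2 := h1.comp (Isotopic.refl hc.1)
    rwa [show (f.trans c.symm).trans c = f from Homeomorph.ext fun p => c.apply_symm_apply _] at h2

end IsSplit

lemma BubbleHomeo.isCanonicalMorphism {P Q : Diagram} {f : S3 ≃ₜ S3} (h : BubbleHomeo P Q f) :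
    IsCanonicalMorphism P.surface Q.surface f := by
  obtain ⟨r, -, -, -, him, hpage, hfix⟩ := h
  exact ⟨f, him, fun p hp => hfix r.θ₁ (left_not_mem_cIoo _ _) p (binding_subset_page _ hp), hpage,
    Isotopic.refl him⟩

lemma BubbleCreation.exists_bubbleHomeo {P Q : Diagram} (h : BubbleCreation P Q) :
    ∃ f, BubbleHomeo P Q f := by
  obtain ⟨r, x, y, h⟩ := h
  obtain ⟨c, hc, hpage, -, hX⟩ := h.isSplit.exists_canonical isOpen_univ fun _ _ _ _ => trivial
  exact ⟨c, r, x, y, h, hc.1, hpage, fun θ hθ p hp => hX p (X_nonpos_of_mem_page hθ hp)⟩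

lemma MoveHomeo.isCanonicalMorphism {P Q : Diagram} {f : S3 ≃ₜ S3} (h : MoveHomeo P Q f) :
    IsCanonicalMorphism P.surface Q.surface f := by
  rcases h with h | h | ⟨h, h'⟩ | ⟨h, h'⟩
  · exact h.isCanonicalMorphism
  · exact h.isCanonicalMorphism.symm
  · obtain ⟨r, x, y, h⟩ := h.exists_isSplit
    exact h.isCanonicalMorphism h'
  · obtain ⟨r, x, y, h⟩ := h.exists_isSplit
    exact (h.isCanonicalMorphism h').symm

lemma VerticalMove.exists_moveHomeo {P Q : Diagram} (h : VerticalMove P Q) :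
    ∃ f, MoveHomeo P Q f := by
  have wr : ∀ {P Q : Diagram}, HalfWrinkleCreation P Q → ∃ f, HalfWrinkleHomeo P Q f := fun h => by
    obtain ⟨r, x, y, h⟩ := h.exists_isSplit
    obtain ⟨c, hc, -⟩ := h.exists_canonical isOpen_univ fun _ _ _ _ => trivial
    exact ⟨c, hc⟩
  rcases h with h | h | h | h
  · exact h.exists_bubbleHomeo.imp fun f hf => .inl hf
  · obtain ⟨f, hf⟩ := h.exists_bubbleHomeo
    exact ⟨f.symm, .inr (.inl hf)⟩
  · exact (wr h).imp fun f hf => .inr (.inr (.inl ⟨h, hf⟩))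
  · obtain ⟨f, hf⟩ := wr h
    exact ⟨f.symm, .inr (.inr (.inr ⟨h, hf⟩))⟩

lemma MoveSequence.isCanonicalMorphism {P Q : Diagram} (s : MoveSequence P Q) (f : S3 ≃ₜ S3)
    (h : s.Induces f) : IsCanonicalMorphism P.surface Q.surface f := by
  induction s generalizing f with
  | nil =>
    rw [Induces] at h
    exact ⟨Homeomorph.refl S3, Set.image_id _, fun _ _ => rfl, fun _ => Set.image_id _, h.symm⟩
  | snoc s _ ih =>
    rw [Induces] at h
    obtain ⟨g, k, h1, h2, h3⟩ := h
    obtain ⟨c, c1, c2, c3, c4⟩ := (ih g h1).trans h2.isCanonicalMorphism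
    exact ⟨c, c1, c2, c3, h3.symm.trans c4⟩

lemma MoveSequence.exists_induces {P Q : Diagram} (s : MoveSequence P Q) :
    ∃ f : S3 ≃ₜ S3, s.Induces f := by
  induction s with
  | nil =>
    refine ⟨Homeomorph.refl S3, ?_⟩
    rw [Induces]
    exact Isotopic.refl (Set.image_id _)
  | snoc s h ih =>
    obtain ⟨g, hg⟩ := ih
    obtain ⟨k, hk⟩ := h.exists_moveHomeo
    obtain ⟨c, c1, -, -, c2⟩ := (s.isCanonicalMorphism g hg).trans hk.isCanonicalMorphism
    refine ⟨c, ?_⟩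
    rw [Induces]
    exact ⟨g, k, hg, hk, c2⟩

end
end RectMovie

theorem mainTheorem3 :
    (∀ P : RectMovie.Diagram, RectMovie.IsMovieDiagram (RectMovie.movieOf P)) ∧
    (∀ Ψ : RectMovie.S1 → Finset (Sym2 RectMovie.S1), RectMovie.IsMovieDiagram Ψ →
      ((∃ P : RectMovie.Diagram, Ψ = RectMovie.movieOf P) ↔
        ∀ φ : RectMovie.S1, IsPreconnected {θ : RectMovie.S1 | ∃ c ∈ Ψ θ, φ ∈ c})) ∧
    (∀ P Q : RectMovie.Diagram,
      RectMovie.movieOf P = RectMovie.movieOf Q ↔ Nonempty (RectMovie.MoveSequence P Q)) ∧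
    (∀ (P Q : RectMovie.Diagram) (s : RectMovie.MoveSequence P Q),
      (∃ f : RectMovie.S3 ≃ₜ RectMovie.S3, s.Induces f) ∧
      ∀ f : RectMovie.S3 ≃ₜ RectMovie.S3, s.Induces f →
        RectMovie.IsCanonicalMorphism P.surface Q.surface f) := by
  refine ⟨RectMovie.isMovieDiagram_movieOf, fun Ψ h => RectMovie.isMovieDiagram_eq_movieOf_iff h,
    fun P Q => ⟨?_, fun ⟨s⟩ => s.movieOf_eq⟩, ?_⟩
  · exact RectMovie.Diagram.reach_of_movieOf_eq
  · exact fun P Q s => ⟨s.exists_induces, s.isCanonicalMorphism⟩
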